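/- **Setting.** Let $\Gamma^A$ (parities $\epsilon_A$) be coordinates of a superdomain with a non-degenerate antisymplectic bi-vector $E^{AB}$ (odd, graded skew-symmetric, satisfying the graded Jacobi identity), antibracket $(F,G)=(F\overleftarrow{\partial}_A)E^{AB}(\overrightarrow{\partial}_BG)$, and a measure density $\rho(\Gamma)$. Set $\Delta_\rho=\frac{(-1)^{\epsilon_A}}{2\rho}\overrightarrow{\partial}_A\,\rho E^{AB}\overrightarrow{\partial}_B$. Add the first-level variables $\lambda^{\alpha_0},\lambda^*_{\alpha_0}$ ($\alpha_0=1,\dots,N_0$) and $c^{\alpha_1},c^*_{\alpha_1},\bar c_{\alpha_1},\bar c^{*\alpha_1},\pi_{\alpha_1},\pi^{*\alpha_1}$ ($\alpha_1=1,\dots,N_1$), where $\lambda^{\alpha_0},\pi_{\alpha_1},c^{\alpha_1},\bar c_{\alpha_1}$ have parities $\epsilon_{\alpha_0},\epsilon_{\alpha_1},\epsilon_{\alpha_1}+1,\epsilon_{\alpha_1}+1$ and antifields have the opposite parity of their fields. Let $\Gamma_{\rm ext}=\{\Gamma^A;\pi_{\alpha_1},\pi^{*\alpha_1}\}$, with antibracket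 $(\cdot,\cdot)_{\rm ext}$ extended by $(\pi_{\alpha},\pi^{*\beta})_{\rm ext}=\delta_\alpha^\beta=-(\pi^{*\beta},\pi_{\alpha})_{\rm ext}$, and $$\Delta_{[1]}=\Delta_\rho+(-1)^{\epsilon_{\alpha_1}}\partial_{\pi_{\alpha_1}}\partial_{\pi^{*\alpha_1}}+(-1)^{\epsilon_{\alpha_0}}\partial_{\lambda^{\alpha_0}}\partial_{\lambda^*_{\alpha_0}}+(-1)^{\epsilon_{\alpha_1}+1}\big(\partial_{c^{\alpha_1}}\partial_{c^*_{\alpha_1}}+\partial_{\bar c_{\alpha_1}}\partial_{\bar c^{*\alpha_1}}\big).$$ Let $X$ be an even action, smooth in all variables and in the parameter $\hbar$ near $\hbar=0$ and near the locus where all variables outside $\Gamma_{\rm ext}$ vanish ($\Gamma_{\rm ext}$ ranging over an open set $U$), such that 1. $X$ has Planck number $1$, where $\hbar,\lambda,\lambda^*,c,c^*,\bar c,\bar c^*$ have Planck numbers $1,1,-1,2,-2,-1,1$ and $\Gamma_{\rm ext}$ has Planck number $0$; 2. the Quantum Master Equation $\Delta_{[1]}\exp(\frac{i}{\hbar}X)=0$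 holds for $\hbar\neq0$; 3. at every stationary configuration of $X|_{\hbar=0}$ over $U$ where all variables outside $\Gamma_{\rm ext}$ vanish, the Hessian of $X|_{\hbar=0}$ in the variables that remain when $\lambda^*,c^*,\bar c^*$ are put to zero ($\Gamma_{\rm ext},\lambda,c,\bar c$) has rank $2(N_0+N_1)$. Define functions of $\Gamma_{\rm ext}$ by $$X=\mathcal G_{\alpha_0}\lambda^{\alpha_0}-\mathcal G_{\alpha_1}\bar c^{*\alpha_1}+i\hbar\,\mathcal H+\bar c_{\alpha_1}\Delta^{\alpha_1}{}_{\beta_1}c^{\beta_1}+\cdots,$$ the dots denoting all other monomials in $\lambda,\lambda^*,c,c^*,\bar c,\bar c^*,\hbar$. Let $\mathcal F^{\alpha_0}(\Gamma_{\rm ext})$ be functions of parity $\epsilon_{\alpha_0}+1$ such that $\bar\Gamma_{\rm ext}=\{\mathcal F^{\alpha_0};\mathcal G_{\alpha_0}\}$ is a coordinate system on $U$, and let $\mathcal J={\rm sdet}(\partial\bar\Gamma_{\rm ext}/\partial\Gamma_{\rm ext})$. **Theorem.** On some open neighbourhood $V\subseteq U$ of the constraint surface $\{\mathcal G_{\alpha_0}=0,\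 \mathcal G_{\alpha_1}=0\}\subseteq U$ the matrices $(\mathcal F^{\alpha_0},\mathcal G_{\beta_0})_{\rm ext}$ and $\Delta^{\alpha_1}{}_{\beta_1}$ are invertible, and for some smooth even branch on $V$ of the logarithm of the square root $$\mathcal H=c-\ln\sqrt{\frac{\mathcal J\;{\rm sdet}(\mathcal F^{\alpha_0},\mathcal G_{\beta_0})_{\rm ext}}{\rho\;{\rm sdet}(\Delta^{\alpha_1}{}_{\beta_1})^2}}+\mathcal O(\mathcal G),$$ where $c$ is an integration constant (locally constant on $V$; a single constant if the constraint surface is connected, for suitable $V$) and $\mathcal O(\mathcal G)$ denotes $\sum_{\alpha_0}\mathcal G_{\alpha_0}K^{\alpha_0}$ with functions $K^{\alpha_0}$ smooth on $V$. -/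

import Mathlib

open scoped ContDiff Topology

noncomputable section

/-! ### Superfunctions

A system of super-coordinates is a finite index type `I` with a Grassmann parity `p : I → ZMod 2`.
The even coordinates range over a real vector space (the body); the odd coordinates generate a
Grassmann algebra over `ℂ`.  A superfunction is a Grassmann-algebra valued function on the body;
values outside the open domain under consideration are never used. -/

/-- Even coordinates. -/
abbrev EvenIdx {I : Type*} (p : I → ZMod 2) := {i : I // p i = 0}

/-- Odd coordinates. -/
abbrev OddIdx {I : Type*} (p : I → ZMod 2) := {i : I // ¬ p i = 0}

/-- Values of the even coordinates. -/
abbrev Body {I : Type*} (p : I → ZMod 2) := EvenIdx p → ℝ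

/-- The Grassmann algebra generated by the odd coordinates. -/
abbrev Gr {I : Type*} (p : I → ZMod 2) := ExteriorAlgebra ℂ (OddIdx p → ℂ)

/-- Superfunctions, with the pointwise ring structure. -/
abbrev SFun {I : Type*} (p : I → ZMod 2) := Body p → Gr p

instance Gr.finite {I : Type*} [Fintype I] (p : I → ZMod 2) : Module.Finite ℂ (Gr p) := by
  classical
  let _ : LinearOrder (OddIdx p) :=
    LinearOrder.lift' (Fintype.equivFin (OddIdx p)) (Fintype.equivFin (OddIdx p)).injective
  exact Module.Finite.of_basis (Module.Basis.ExteriorAlgebra (Pi.basisFun ℂ (OddIdx p)))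

/-- The sign `(-1)^k`. -/
def sgn (k : ZMod 2) : ℂ := if k = 0 then 1 else -1

/-- The complex number obtained by putting all odd generators to zero. -/
def body {I : Type*} {p : I → ZMod 2} (a : Gr p) : ℂ := ExteriorAlgebra.algebraMapInv a

/-- `a` is homogeneous of Grassmann parity `k`. -/
def HasParity {I : Type*} {p : I → ZMod 2} (k : ZMod 2) (a : Gr p) : Prop :=
  a ∈ CliffordAlgebra.evenOdd (0 : QuadraticForm ℂ (OddIdx p → ℂ)) k

/-- All components of the Grassmann-valued function `g` are `C^∞` on `s`. -/
def SmoothOn {I : Type*} {p : I → ZMod 2} {V : Type*} [NormedAddCommGroup V] [NormedSpace ℝ V]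
    (g : V → Gr p) (s : Set V) : Prop :=
  ∀ φ : Module.Dual ℂ (Gr p), ContDiffOn ℝ ∞ (fun z => φ (g z)) s

/-- Componentwise derivative of a Grassmann-valued function at `z` in the direction `v`. -/
def gderiv {I : Type*} [Fintype I] {p : I → ZMod 2} {V : Type*} [NormedAddCommGroup V]
    [NormedSpace ℝ V] (g : V → Gr p) (z v : V) : Gr p :=
  ∑ k, fderiv ℝ (fun y => (Module.finBasis ℂ (Gr p)).repr (g y) k) z v •
    Module.finBasis ℂ (Gr p) k

open Classical in
/-- Left partial derivative `∂/∂Γ^i` (acting from the left). -/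
def lD {I : Type*} [Fintype I] {p : I → ZMod 2} (i : I) (f : SFun p) : SFun p := fun x =>
  if h : p i = 0 then gderiv f x (Pi.single ⟨i, h⟩ 1)
  else CliffordAlgebra.contractLeft (Q := (0 : QuadraticForm ℂ (OddIdx p → ℂ)))
    (LinearMap.proj (⟨i, h⟩ : OddIdx p)) (f x)

open Classical in
/-- Right partial derivative (acting from the right). -/
def rD {I : Type*} [Fintype I] {p : I → ZMod 2} (i : I) (f : SFun p) : SFun p := fun x =>
  if h : p i = 0 then gderiv f x (Pi.single ⟨i, h⟩ 1)
  else CliffordAlgebra.contractRight (Q := (0 : QuadraticForm ℂ (OddIdx p → ℂ))) (f x)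
    (LinearMap.proj (⟨i, h⟩ : OddIdx p))

open Classical in
/-- The coordinate `Γ^i` as a superfunction. -/
def coordFn {I : Type*} {p : I → ZMod 2} (i : I) : SFun p := fun x =>
  if h : p i = 0 then algebraMap ℂ (Gr p) ((x ⟨i, h⟩ : ℝ) : ℂ)
  else ExteriorAlgebra.ι ℂ (Pi.single (⟨i, h⟩ : OddIdx p) (1 : ℂ))

/-- Exponential in the Grassmann algebra: ordinary exponential of the body times the (finite)
exponential series of the nilpotent rest. -/
def sexp {I : Type*} [Fintype I] {p : I → ZMod 2} (a : Gr p) : Gr p :=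
  Complex.exp (body a) • ∑ k ∈ Finset.range (Fintype.card (OddIdx p) + 1),
    ((k.factorial : ℂ)⁻¹) • (a - algebraMap ℂ (Gr p) (body a)) ^ k

/-! ### Change of the set of coordinates -/

section embed

variable {I J : Type*} {p : I → ZMod 2} {q : J → ZMod 2}

/-- Action of a parity-preserving map of coordinates on even coordinates. -/
def evenMap (e : I → J) (he : ∀ i, q (e i) = p i) (i : EvenIdx p) : EvenIdx q :=
  ⟨e i.1, (he i.1).trans i.2⟩

/-- Action of a parity-preserving map of coordinates on odd coordinates. -/
def oddMap (e : I → J) (he : ∀ i, q (e i) = p i) (i : OddIdx p) : OddIdx q :=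
  ⟨e i.1, fun h => i.2 ((he i.1).symm.trans h)⟩

/-- Forget the even coordinates outside the image of `e`. -/
def projBody (e : I → J) (he : ∀ i, q (e i) = p i) (x : Body q) : Body p :=
  fun i => x (evenMap e he i)

/-- Put the even coordinates outside the image of `e` to zero. -/
def inclBody (e : I → J) (he : ∀ i, q (e i) = p i) (u : Body p) : Body q :=
  Function.extend (evenMap e he) u 0

/-- A superfunction of the coordinates `I`, viewed as a superfunction of the coordinates `J`. -/
def pull (e : I → J) (he : ∀ i, q (e i) = p i) (f : SFun p) : SFun q := fun x =>
  ExteriorAlgebra.map (Function.ExtendByZero.linearMap ℂ (oddMap e he)) (f (projBody e he x))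

/-- Restriction of a superfunction: all coordinates outside the image of `e` are put to zero. -/
def restr (e : I → J) (he : ∀ i, q (e i) = p i) (f : SFun q) : SFun p := fun u =>
  ExteriorAlgebra.map (LinearMap.funLeft ℂ ℂ (oddMap e he)) (f (inclBody e he u))

end embed

/-! ### Superdeterminant -/

open Classical in
/-- Determinant by the Leibniz formula; it is used only for matrices with pairwise commuting
entries, where the order of the factors is irrelevant. -/
def ndet {n R : Type*} [Fintype n] [Ring R] (M : Matrix n n R) : R :=
  ∑ τ : Equiv.Perm n, ((Equiv.Perm.sign τ : ℤ) : R) *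
    ((Finset.univ : Finset n).toList.map fun i => M (τ i) i).prod

open Classical in
/-- Superdeterminant (Berezinian) `det (A - B D⁻¹ C) / det D` of a supermatrix whose rows and
columns are graded by `p`; `A`, `D` are the even-even and odd-odd blocks. -/
def sdet {n R : Type*} [Fintype n] [Ring R] (p : n → ZMod 2) (M : Matrix n n R) : R :=
  let A : Matrix (EvenIdx p) (EvenIdx p) R := M.submatrix Subtype.val Subtype.val
  let B : Matrix (EvenIdx p) (OddIdx p) R := M.submatrix Subtype.val Subtype.val
  let C : Matrix (OddIdx p) (EvenIdx p) R := M.submatrix Subtype.val Subtype.val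
  let D : Matrix (OddIdx p) (OddIdx p) R := M.submatrix Subtype.val Subtype.val
  ndet (A - B * Ring.inverse D * C) * Ring.inverse (ndet D)

/-! ### Antisymplectic geometry -/

/-- The antibracket `(f,g) = (f ∂←_A) E^{AB} (∂→_B g)`. -/
def antibracket {I : Type*} [Fintype I] {p : I → ZMod 2} (E : I → I → SFun p) (f g : SFun p) :
    SFun p := fun x => ∑ A, ∑ B, rD A f x * E A B x * lD B g x

open Classical in
/-- `E` is a non-degenerate antisymplectic bi-vector on the open set `U`: an odd, graded
skew-symmetric, invertible matrix of superfunctions whose antibracket satisfies the graded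
Jacobi identity. -/
structure IsAntisymplectic {I : Type*} [Fintype I] {p : I → ZMod 2} (E : I → I → SFun p)
    (U : Set (Body p)) : Prop where
  smooth : ∀ A B, SmoothOn (E A B) U
  parity : ∀ A B, ∀ x ∈ U, HasParity (p A + p B + 1) (E A B x)
  skew : ∀ A B, ∀ x ∈ U, E B A x = -(sgn ((p A + 1) * (p B + 1)) • E A B x)
  jacobi : ∀ (a b c : ZMod 2) (f g h : SFun p),
    SmoothOn f U → SmoothOn g U → SmoothOn h U →
    (∀ x ∈ U, HasParity a (f x) ∧ HasParity b (g x) ∧ HasParity c (h x)) → ∀ x ∈ U,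
      sgn ((a + 1) * (c + 1)) • antibracket E f (antibracket E g h) x
        + sgn ((b + 1) * (a + 1)) • antibracket E g (antibracket E h f) x
        + sgn ((c + 1) * (b + 1)) • antibracket E h (antibracket E f g) x = 0
  nondegenerate : ∀ x ∈ U, IsUnit (Matrix.of fun A B => E A B x : Matrix I I (Gr p))

/-- `ρ` is a measure density on `U`: even, smooth and nowhere vanishing. -/
structure IsDensity {I : Type*} {p : I → ZMod 2} [Fintype I] (ρ : SFun p) (U : Set (Body p)) :
    Prop where
  smooth : SmoothOn ρ U
  parity : ∀ x ∈ U, HasParity 0 (ρ x)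
  ne_zero : ∀ x ∈ U, body (ρ x) ≠ 0

/-- Jacobian matrix `f^i ∂←_j`, the functions `f` being labelled by the coordinates through `σ`. -/
def jacobian {I K : Type*} [Fintype I] {p : I → ZMod 2} (σ : K ≃ I) (f : K → SFun p)
    (x : Body p) : Matrix I I (Gr p) :=
  Matrix.of fun i j => rD j (f (σ.symm i)) x

open Classical in
/-- The superfunctions `f` (labelled through `σ`) form a coordinate system on `U`: they are smooth
of the right parity, the even ones have real body, the underlying map of bodies is injective and
the Jacobian matrix is invertible. -/
structure IsCoordSystem {I K : Type*} [Fintype I] {p : I → ZMod 2} (σ : K ≃ I) (f : K → SFun p)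
    (U : Set (Body p)) : Prop where
  smooth : ∀ a, SmoothOn (f a) U
  parity : ∀ a, ∀ x ∈ U, HasParity (p (σ a)) (f a x)
  real : ∀ a, ∀ x ∈ U, (body (f a x)).im = 0
  injOn : Set.InjOn (fun x a => body (f a x)) U
  jacobian_isUnit : ∀ x ∈ U, IsUnit (jacobian σ f x)

/-! ### The variables of the first-stage theory -/

/-- The extended variables `Γ_ext = {Γ^A; π_{α₁}, π^{*α₁}}`. -/
inductive ExtVar (ι κ₁ : Type*)
  | gam : ι → ExtVar ι κ₁
  | pi : κ₁ → ExtVar ι κ₁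
  | piS : κ₁ → ExtVar ι κ₁
  deriving DecidableEq, Fintype

/-- All variables `Γ_[1]`: the extended ones, the Lagrange multipliers `λ^{α₀}`, the ghosts
`c^{α₁}`, the antighosts `c̄_{α₁}`, and their antifields (suffix `S`). -/
inductive FullVar (ι κ₀ κ₁ : Type*)
  | ext : ExtVar ι κ₁ → FullVar ι κ₀ κ₁
  | lam : κ₀ → FullVar ι κ₀ κ₁
  | lamS : κ₀ → FullVar ι κ₀ κ₁
  | gh : κ₁ → FullVar ι κ₀ κ₁
  | ghS : κ₁ → FullVar ι κ₀ κ₁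
  | agh : κ₁ → FullVar ι κ₀ κ₁
  | aghS : κ₁ → FullVar ι κ₀ κ₁
  deriving DecidableEq, Fintype

section firststage

variable {ι κ₀ κ₁ : Type*} (p : ι → ZMod 2) (ε₀ : κ₀ → ZMod 2) (ε₁ : κ₁ → ZMod 2)

/-- Parities of the extended variables. -/
def extParity : ExtVar ι κ₁ → ZMod 2
  | .gam a => p a
  | .pi α => ε₁ α
  | .piS α => ε₁ α + 1

/-- Parities of all variables. -/
def fullParity : FullVar ι κ₀ κ₁ → ZMod 2
  | .ext v => extParity p ε₁ v
  | .lam α => ε₀ α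
  | .lamS α => ε₀ α + 1
  | .gh α => ε₁ α + 1
  | .ghS α => ε₁ α
  | .agh α => ε₁ α + 1
  | .aghS α => ε₁ α

/-- Planck numbers. -/
def planckNumber : FullVar ι κ₀ κ₁ → ℂ
  | .ext _ => 0
  | .lam _ => 1
  | .lamS _ => -1
  | .gh _ => 2
  | .ghS _ => -2
  | .agh _ => -1
  | .aghS _ => 1

/-- The variables that are left when `λ*`, `c*`, `c̄*` are put to zero. -/
def isField : FullVar ι κ₀ κ₁ → Bool
  | .ext _ => true
  | .lam _ => true
  | .gh _ => true
  | .agh _ => true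
  | _ => false

/-- `Γ_ext → Γ` on bodies. -/
def bodyOfExt : Body (extParity p ε₁) → Body p := projBody ExtVar.gam fun _ => rfl

/-- Functions of `Γ` as functions of `Γ_ext`. -/
def toExt : SFun p → SFun (extParity p ε₁) := pull ExtVar.gam fun _ => rfl

/-- Functions of `Γ` as functions of `Γ_[1]`. -/
def toFull : SFun p → SFun (fullParity p ε₀ ε₁) := pull (fun a => .ext (.gam a)) fun _ => rfl

/-- The point of the body of `Γ_[1]` over `u` where all variables of `Γ_[1]` outside `Γ_ext`
vanish. -/
def slice : Body (extParity p ε₁) → Body (fullParity p ε₀ ε₁) := inclBody FullVar.ext fun _ => rfl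

/-- Put all variables outside `Γ_ext` to zero. -/
def onSlice : SFun (fullParity p ε₀ ε₁) → SFun (extParity p ε₁) := restr FullVar.ext fun _ => rfl

variable [Fintype ι] [Fintype κ₀] [Fintype κ₁]

open Classical in
/-- The extended antisymplectic matrix: `E` on `Γ`, and `(π_α, π^{*β}) = δ = -(π^{*β}, π_α)`. -/
def Eext (E : ι → ι → SFun p) : ExtVar ι κ₁ → ExtVar ι κ₁ → SFun (extParity p ε₁)
  | .gam a, .gam b => toExt p ε₁ (E a b)
  | .pi α, .piS β => if α = β then 1 else 0
  | .piS α, .pi β => if α = β then -1 else 0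
  | _, _ => 0

/-- The odd Laplacian `Δ_[1]`:  `Δ_ρ = (-1)^{ε_A} (2ρ)⁻¹ ∂_A ρ E^{AB} ∂_B` in the `Γ` variables,
plus `(-1)^{ε(φ)} ∂_φ ∂_{φ*}` summed over `φ = π, λ, c, c̄`. -/
def oddLaplacian (E : ι → ι → SFun p) (ρ : SFun p) (f : SFun (fullParity p ε₀ ε₁)) :
    SFun (fullParity p ε₀ ε₁) := fun x =>
  (∑ A, ∑ B, (sgn (p A) / 2) • (Ring.inverse (toFull p ε₀ ε₁ ρ x) *
      lD (.ext (.gam A)) (fun y => toFull p ε₀ ε₁ ρ y * toFull p ε₀ ε₁ (E A B) y *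
        lD (.ext (.gam B)) f y) x))
    + (∑ α, sgn (ε₁ α) • lD (.ext (.pi α)) (lD (.ext (.piS α)) f) x)
    + (∑ α, sgn (ε₀ α) • lD (.lam α) (lD (.lamS α) f) x)
    + (∑ α, sgn (ε₁ α + 1) • lD (.gh α) (lD (.ghS α) f) x)
    + (∑ α, sgn (ε₁ α + 1) • lD (.agh α) (lD (.aghS α) f) x)

/-- Quantum Master Equation `Δ_[1] exp(i X / ħ) = 0` on `W`; the pairs in `W` are `(ħ, x)`. -/
def QuantumMasterEquation (E : ι → ι → SFun p) (ρ : SFun p)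
    (X : ℝ → SFun (fullParity p ε₀ ε₁)) (W : Set (ℝ × Body (fullParity p ε₀ ε₁))) : Prop :=
  ∀ z ∈ W, z.1 ≠ 0 →
    oddLaplacian p ε₀ ε₁ E ρ (fun y => sexp ((Complex.I / (z.1 : ℂ)) • X z.1 y)) z.2 = 0

/-- `X` has total Planck number `1`, the Planck number of `ħ` being `1`. -/
def PlanckNumberOne (X : ℝ → SFun (fullParity p ε₀ ε₁))
    (W : Set (ℝ × Body (fullParity p ε₀ ε₁))) : Prop :=
  ∀ z ∈ W, (∑ v, planckNumber v • (coordFn v z.2 * lD v (X z.1) z.2))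
    + (z.1 : ℂ) • gderiv (fun t : ℝ => X t z.2) z.1 1 = X z.1 z.2

/-- `𝓖_{α₀}(Γ_ext)`, the coefficient of `λ^{α₀}` in `X` (written to its left). -/
def constraintG (X : ℝ → SFun (fullParity p ε₀ ε₁)) (α : κ₀) : SFun (extParity p ε₁) :=
  onSlice p ε₀ ε₁ (rD (.lam α) (X 0))

/-- `𝓖_{α₁}(Γ_ext)`, the coefficient of `-c̄^{*α₁}` in `X` (written to its left). -/
def constraintG₁ (X : ℝ → SFun (fullParity p ε₀ ε₁)) (α : κ₁) : SFun (extParity p ε₁) :=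
  onSlice p ε₀ ε₁ (-rD (.aghS α) (X 0))

/-- `Δ^{α₁}_{β₁}(Γ_ext)`, the coefficient in the term `c̄_{α₁} Δ^{α₁}_{β₁} c^{β₁}` of `X`. -/
def fpMatrix (X : ℝ → SFun (fullParity p ε₀ ε₁)) (u : Body (extParity p ε₁)) :
    Matrix κ₁ κ₁ (Gr (extParity p ε₁)) :=
  Matrix.of fun α β => onSlice p ε₀ ε₁ (lD (.agh α) (rD (.gh β) (X 0))) u

/-- `𝓗(Γ_ext)`, the coefficient of `iħ` in `X`. -/
def oneLoop (X : ℝ → SFun (fullParity p ε₀ ε₁)) : SFun (extParity p ε₁) :=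
  onSlice p ε₀ ε₁ fun x => (1 / Complex.I) • gderiv (fun t : ℝ => X t x) 0 1

/-- `u` is a stationary configuration of (the classical part of) `X`. -/
def IsStationaryConf (X : ℝ → SFun (fullParity p ε₀ ε₁)) (u : Body (extParity p ε₁)) : Prop :=
  ∀ v, body (lD v (X 0) (slice p ε₀ ε₁ u)) = 0

/-- The field-field block of the Hessian of (the classical part of) `X` at `u`. -/
def fieldHessian (X : ℝ → SFun (fullParity p ε₀ ε₁)) (u : Body (extParity p ε₁)) :
    Matrix {v : FullVar ι κ₀ κ₁ // isField v = true} {v : FullVar ι κ₀ κ₁ // isField v = true} ℂ :=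
  Matrix.of fun v w => body (lD v.1 (rD w.1 (X 0)) (slice p ε₀ ε₁ u))

/-- A gauge-fixing action for a first-stage theory in its non-minimal form, over an open set `U`
of `Γ_ext`: an even action, smooth in all variables and in `ħ` near `λ = λ* = c = … = 0`, `ħ = 0`,
obeying Planck number conservation, the Quantum Master Equation and the rank condition. -/
structure IsGaugeFixingAction (E : ι → ι → SFun p) (ρ : SFun p)
    (X : ℝ → SFun (fullParity p ε₀ ε₁)) (W : Set (ℝ × Body (fullParity p ε₀ ε₁)))
    (U : Set (Body (extParity p ε₁))) : Prop where
  isOpen : IsOpen W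
  slice_mem : ∀ u ∈ U, ((0 : ℝ), slice p ε₀ ε₁ u) ∈ W
  smooth : SmoothOn (fun z : ℝ × Body (fullParity p ε₀ ε₁) => X z.1 z.2) W
  even : ∀ z ∈ W, HasParity 0 (X z.1 z.2)
  planck : PlanckNumberOne p ε₀ ε₁ X W
  master : QuantumMasterEquation p ε₀ ε₁ E ρ X W
  rank : ∀ u ∈ U, IsStationaryConf p ε₀ ε₁ X u →
    (fieldHessian p ε₀ ε₁ X u).rank = 2 * (Fintype.card κ₀ + Fintype.card κ₁)

/-- The functions `{𝓕^{α₀}; 𝓖_{α₀}}`. -/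
def newCoords (X : ℝ → SFun (fullParity p ε₀ ε₁)) (F : κ₀ → SFun (extParity p ε₁)) :
    κ₀ ⊕ κ₀ → SFun (extParity p ε₁) :=
  Sum.elim F (constraintG p ε₀ ε₁ X)

/-- The matrix `(𝓕^{α₀}, 𝓖_{β₀})_ext`. -/
def bracketMatrix (E : ι → ι → SFun p) (X : ℝ → SFun (fullParity p ε₀ ε₁))
    (F : κ₀ → SFun (extParity p ε₁)) (u : Body (extParity p ε₁)) :
    Matrix κ₀ κ₀ (Gr (extParity p ε₁)) :=
  Matrix.of fun α β => antibracket (Eext p ε₁ E) (F α) (constraintG p ε₀ ε₁ X β) u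

/-- The expression `𝓙 · sdet(𝓕,𝓖)_ext / (ρ · sdet(Δ)²)` under the square root. -/
def radicand (E : ι → ι → SFun p) (ρ : SFun p) (X : ℝ → SFun (fullParity p ε₀ ε₁))
    (F : κ₀ → SFun (extParity p ε₁)) (σ : κ₀ ⊕ κ₀ ≃ ExtVar ι κ₁) : SFun (extParity p ε₁) :=
  fun u =>
    sdet (extParity p ε₁) (jacobian σ (newCoords p ε₀ ε₁ X F) u)
      * sdet ε₀ (bracketMatrix p ε₀ ε₁ E X F u)
      * Ring.inverse (toExt p ε₁ ρ u * sdet ε₁ (fpMatrix p ε₀ ε₁ X u) ^ 2)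

/-- The constraint surface: points of `U` where the bodies of all `𝓖_{A₀}` vanish. -/
def onShell (X : ℝ → SFun (fullParity p ε₀ ε₁)) (U : Set (Body (extParity p ε₁))) :
    Set (Body (extParity p ε₁)) :=
  {u ∈ U | (∀ α, body (constraintG p ε₀ ε₁ X α u) = 0) ∧
    ∀ α, body (constraintG₁ p ε₀ ε₁ X α u) = 0}

end firststage

end

noncomputable section

set_option linter.unusedSectionVars false
set_option linter.unusedVariables false
set_option linter.unusedSimpArgs false

open TopologicalSpace (Opens)

/-! ### Signs -/

/-! Write G_a for the constraints 𝓖_{α₀}, G₁ for the secondary constraints 𝓖_{α₁}, (G) for the ideal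
generated by the G_a alone, and D_a = (·, G_a). The proof studies R = 𝓙 sdet(𝓕,G) e^{2𝓗} / (ρ
sdet(Δ)²), the radicand times e^{2𝓗}, and shows that its derivatives along the surface G = 0 lie in
(G). A logarithm h of R is then a locally constant function plus an element of (G), and ℓ = h/2 - 𝓗
is the logarithm of the square root that the theorem asks for.

Input from the master equation. For ħ ≠ 0 the quantum master equation becomes (X,X) = iħ · 2Δ_[1]X
(`lap2_exp`, `master_of_lap2`), and continuity carries this to ħ = 0. Planck number conservation is
a selection rule (`s_eq_zero`): where all variables outside Γ_ext and ħ vanish, only functions of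
Planck number 0 survive. Hence few terms remain in the lowest Taylor coefficients: the reducibility
relation G₁Δ = GZ (`reducibility`), the algebra (G_b,G_a) = GU + G₁W up to sign
(`constraint_algebra`), D_aΔ = WZ + ΔV + YΔ modulo (G), up to signs (`ghost_matrix_der`), and, at
first order in ħ, D_a(2𝓗) as a divergence plus D_a ln ρ minus 2(str U - str V - str Y) modulo (G)
(`one_loop_der`).

Cancellation. The derivative of ln sdet M is str(M⁻¹ dM) (`sdet_der`). For the Jacobian along D_a
this is the difference of the divergences of the field in the new and in the old coordinates
(`IsCoords.sTr_jacobian`). For (𝓕,G) the Jacobi identity gives str U minus the 𝓕-part of the new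
divergence (`sTr_bracket`), while the G-part of that divergence is again str U
(`sum_newD_constraints`). So 𝓙 sdet(𝓕,G) contributes 2 str U minus the old divergence. Eliminating
G₁ by reducibility replaces U by U + ZΔ⁻¹W, and the extra 2 str(ZΔ⁻¹W) is what the square of sdet(Δ)
removes (`first_stage_logDer`). Everything cancels, so D_a R lies in (G) (`radicand_hamG`); as (𝓕,G)
is invertible, so does ∂R/∂𝓕 (`radicand_newD`).

Invertibility. On the constraint surface the Planck numbers leave in the Hessian only the blocks
Γ_ext–λ and c̄–c, and the rank condition forces the second to be invertible (`isUnit_block_of_rank`,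
`ghost_isUnit`). The matrix of all brackets of the new coordinates is congruent to the
antisymplectic matrix and its G–G block vanishes there, so its 𝓕–G block is invertible
(`bracket_isUnit`).

Integration. In the body coordinates given by (𝓕,G), balls around points of the surface are stable
under putting G to zero, which yields a neighbourhood with a retraction along which the body of R is
locally constant, together with Hadamard's lemma (`exists_neighbourhood`). Nilpotent parts are
handled by a finite iteration for the logarithm (`exists_log`) and by a descent with the odd Euler
field (`mem_gIdeal_of_newD`). -/

lemma zmod2_cases (a : ZMod 2) : a = 0 ∨ a = 1 := by revert a; decide

@[simp] lemma sgn_zero : sgn 0 = 1 := by simp [sgn]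
@[simp] lemma sgn_one : sgn 1 = -1 := by simp [sgn]

lemma sgn_add (a b : ZMod 2) : sgn (a + b) = sgn a * sgn b := by
  rcases zmod2_cases a with rfl | rfl <;> rcases zmod2_cases b with rfl | rfl <;>
    simp [sgn, CharTwo.add_self_eq_zero]

lemma sgn_mul_self (a : ZMod 2) : sgn a * sgn a = 1 := by
  rcases zmod2_cases a with rfl | rfl <;> simp

lemma sgn_ne_zero (a : ZMod 2) : sgn a ≠ 0 := by
  rcases zmod2_cases a with rfl | rfl <;> simp

lemma neg_eq_sgn_smul {M : Type*} [AddCommGroup M] [Module ℂ M] (x : M) : -x = sgn 1 • x := by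
  simp

lemma sgn_smul_smul {M : Type*} [AddCommGroup M] [Module ℂ M] (a b : ZMod 2) (x : M) :
    sgn a • sgn b • x = sgn (a + b) • x := by rw [smul_smul, sgn_add]

/-- Every sign in the file is carried as `sgn` of a polynomial in parities. Once the factors are in
the same order, a sign comparison is thereby an identity of polynomial functions on `ZMod 2`, which
`decide` checks on all values. -/
lemma sgn_smul_congr {M : Type*} [AddCommGroup M] [Module ℂ M] {a b : ZMod 2} {x y : M}
    (h : a = b) (hx : x = y) : sgn a • x = sgn b • y := by rw [h, hx]

lemma sgn_smul_eq_iff {M : Type*} [AddCommGroup M] [Module ℂ M] {a : ZMod 2} {x y : M} :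
    sgn a • x = y ↔ x = sgn a • y := by
  constructor
  · rintro rfl; rw [smul_smul, sgn_mul_self, one_smul]
  · rintro rfl; rw [smul_smul, sgn_mul_self, one_smul]

/-! ### Supercommutative algebras and right derivations -/

/-- A `ℤ/2`-graded supercommutative algebra. -/
structure IsSuperAlg {A : Type*} [Ring A] [Algebra ℂ A] (P : ZMod 2 → Submodule ℂ A) : Prop where
  one_mem : (1 : A) ∈ P 0
  mul_mem : ∀ {i j x y}, x ∈ P i → y ∈ P j → x * y ∈ P (i + j)
  comm : ∀ {i j x y}, x ∈ P i → y ∈ P j → x * y = sgn (i * j) • (y * x)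
  decomp : ∀ x, ∃ a ∈ P 0, ∃ b ∈ P 1, x = a + b
  disj : ∀ x, x ∈ P 0 → x ∈ P 1 → x = 0

/-- A derivation of parity `r` acting from the right. -/
structure IsRDer {A : Type*} [Ring A] [Algebra ℂ A] (P : ZMod 2 → Submodule ℂ A) (r : ZMod 2)
    (D : A →ₗ[ℂ] A) : Prop where
  mem : ∀ {i x}, x ∈ P i → D x ∈ P (i + r)
  leib : ∀ {j} (x y), y ∈ P j → D (x * y) = x * D y + sgn (r * j) • (D x * y)

section superalg

variable {A : Type*} [Ring A] [Algebra ℂ A] {P : ZMod 2 → Submodule ℂ A}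

lemma mem_parity_congr {i j : ZMod 2} {x : A} (h : x ∈ P i) (hij : i = j) : x ∈ P j := hij ▸ h

lemma IsSuperAlg.even_comm (hP : IsSuperAlg P) {x : A} (hx : x ∈ P 0) (y : A) :
    x * y = y * x := by
  obtain ⟨a, ha, b, hb, rfl⟩ := hP.decomp y
  rw [mul_add, add_mul, hP.comm hx ha, hP.comm hx hb]; simp

lemma IsSuperAlg.comm3 (hP : IsSuperAlg P) {i j k : ZMod 2} {x y z : A} (hx : x ∈ P i)
    (hy : y ∈ P j) (hz : z ∈ P k) :
    x * y * z = sgn (i * j + i * k + j * k) • (z * y * x) := by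
  rw [hP.comm hx hy, smul_mul_assoc, mul_assoc, hP.comm hx hz, mul_smul_comm, ← mul_assoc,
    hP.comm hy hz, smul_mul_assoc, sgn_smul_smul, sgn_smul_smul, add_assoc]

lemma IsRDer.map_one {r : ZMod 2} {D : A →ₗ[ℂ] A} (hP : IsSuperAlg P) (hD : IsRDer P r D) :
    D 1 = 0 := by
  have := hD.leib 1 1 hP.one_mem
  simpa using this

lemma IsRDer.leib_even {r : ZMod 2} {D : A →ₗ[ℂ] A} (hD : IsRDer P r D) (x : A) {y : A}
    (hy : y ∈ P 0) : D (x * y) = x * D y + D x * y := by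
  simpa using hD.leib x y hy

lemma IsRDer.map_inv {r : ZMod 2} {D : A →ₗ[ℂ] A} (hP : IsSuperAlg P) (hD : IsRDer P r D)
    {x y : A} (hx : x ∈ P 0) (hy : y ∈ P 0) (hxy : x * y = 1) : D y = -(y * (y * D x)) := by
  have h := hD.leib_even x hy
  rw [hxy, hD.map_one hP] at h
  have h2 := congrArg (y * ·) h
  simp only [mul_zero, mul_add, ← mul_assoc] at h2
  rw [hP.even_comm hy x, hxy, one_mul] at h2
  rw [eq_neg_iff_add_eq_zero, h2, mul_assoc, hP.even_comm hy (D x)]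

/-- Split the inverse as a + b with b odd: x b = 1 - x a is both odd and even, hence zero, and
cancelling the unit x gives b = 0. -/
lemma IsSuperAlg.even_inv (hP : IsSuperAlg P) {x : A} (hx : x ∈ P 0) (hu : IsUnit x) :
    ∃ y ∈ P 0, x * y = 1 ∧ y * x = 1 := by
  obtain ⟨⟨x, y, hxy, hyx⟩, rfl⟩ := hu
  obtain ⟨a, ha, b, hb, rfl⟩ := hP.decomp y
  simp only at hx hxy hyx ⊢
  have h1 : x * a ∈ P 0 := by simpa using hP.mul_mem hx ha
  have h2 : x * b ∈ P 1 := by simpa using hP.mul_mem hx hb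
  have h3 : x * b = 0 := hP.disj _ (by
    have : x * b = 1 - x * a := by rw [← hxy]; noncomm_ring
    rw [this]; exact (P 0).sub_mem hP.one_mem h1) h2
  have h4 : b = 0 := by
    have := congrArg ((a + b) * ·) h3
    simpa [← mul_assoc, hyx] using this
  subst h4
  exact ⟨a, ha, by simpa using hxy, by simpa using hyx⟩

/-! ### Supermatrices -/

/-- Supermatrices of parity `k`. -/
def IsSM (P : ZMod 2 → Submodule ℂ A) {m n : Type*} (p : m → ZMod 2) (q : n → ZMod 2)
    (k : ZMod 2) (M : Matrix m n A) : Prop := ∀ i j, M i j ∈ P (p i + q j + k)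

/-- The twisted entrywise action of a right derivation. -/
def twD {m n : Type*} (r : ZMod 2) (q : n → ZMod 2) (D : A →ₗ[ℂ] A) (M : Matrix m n A) :
    Matrix m n A := Matrix.of fun i j => sgn (q j * r) • D (M i j)

/-- Supertrace of a supermatrix of parity `r`. -/
def sTr {n : Type*} [Fintype n] (p : n → ZMod 2) (r : ZMod 2) (M : Matrix n n A) : A :=
  ∑ i, sgn (p i * (1 + r)) • M i i

variable {m n l : Type*} {p : m → ZMod 2} {q : n → ZMod 2} {s : l → ZMod 2}

lemma IsSM.mul [Fintype n] (hP : IsSuperAlg P) {x y : ZMod 2} {M : Matrix m n A}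
    {N : Matrix n l A} (hM : IsSM P p q x M) (hN : IsSM P q s y N) :
    IsSM P p s (x + y) (M * N) := by
  intro i k
  rw [Matrix.mul_apply]
  refine Submodule.sum_mem _ fun j _ => ?_
  refine mem_parity_congr (hP.mul_mem (hM i j) (hN j k)) ?_
  generalize p i = a; generalize q j = b; generalize s k = c
  clear hM hN; decide +revert

lemma IsSM.mul₀ [Fintype n] (hP : IsSuperAlg P) {x : ZMod 2} {M : Matrix m n A}
    {N : Matrix n l A} (hM : IsSM P p q 0 M) (hN : IsSM P q s x N) :
    IsSM P p s x (M * N) := by simpa using hM.mul hP hN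

lemma IsSM.twD {r : ZMod 2} {D : A →ₗ[ℂ] A} (hD : IsRDer P r D) {M : Matrix m n A}
    (hM : IsSM P p q 0 M) : IsSM P p q r (twD r q D M) := fun i j =>
  (P _).smul_mem _ (mem_parity_congr (hD.mem (hM i j)) (by simp))

lemma IsSM.one [DecidableEq m] (hP : IsSuperAlg P) : IsSM P p p 0 (1 : Matrix m m A) := by
  intro i j
  by_cases h : i = j
  · subst h; simpa [CharTwo.add_self_eq_zero] using hP.one_mem
  · rw [Matrix.one_apply_ne h]; exact zero_mem _

/-- The column sign in `twD` is chosen for this rule. Moving D past the entry N j k costs `sgn (r *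
(q j + s k))`, which is exactly the quotient of the column signs of the product and of M. -/
lemma twD_mul [Fintype n] {r : ZMod 2} {D : A →ₗ[ℂ] A} (hD : IsRDer P r D) (M : Matrix m n A)
    {N : Matrix n l A} (hN : IsSM P q s 0 N) :
    twD r s D (M * N) = M * twD r s D N + twD r q D M * N := by
  ext i k
  simp only [twD, Matrix.add_apply, Matrix.mul_apply, Matrix.of_apply, map_sum, Finset.smul_sum,
    ← Finset.sum_add_distrib]
  refine Finset.sum_congr rfl fun j _ => ?_
  rw [hD.leib _ _ (hN j k), smul_add, mul_smul_comm, smul_mul_assoc, sgn_smul_smul]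
  congr 1
  refine sgn_smul_congr ?_ rfl
  generalize q j = b; generalize s k = c
  clear hD; decide +revert

lemma twD_one [DecidableEq m] {r : ZMod 2} {D : A →ₗ[ℂ] A} (hP : IsSuperAlg P)
    (hD : IsRDer P r D) : twD r p D (1 : Matrix m m A) = 0 := by
  ext i j
  simp only [twD, Matrix.of_apply, Matrix.zero_apply]
  by_cases h : i = j
  · subst h; simp [hD.map_one hP]
  · simp [Matrix.one_apply_ne h]

/-- Interchanging the entries M i j and N j i produces a sign in which the index-dependent part is
compensated by the weights of the two supertraces; only `sgn (x * y)` is left. -/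
lemma sTr_mul_comm [Fintype m] [Fintype n] (hP : IsSuperAlg P) {x y : ZMod 2} {M : Matrix m n A}
    {N : Matrix n m A} (hM : IsSM P p q x M) (hN : IsSM P q p y N) :
    sTr p (x + y) (M * N) = sgn (x * y) • sTr q (x + y) (N * M) := by
  simp only [sTr, Matrix.mul_apply, Finset.smul_sum]
  rw [Finset.sum_comm]
  refine Finset.sum_congr rfl fun j _ => Finset.sum_congr rfl fun i _ => ?_
  rw [hP.comm (hM i j) (hN j i), sgn_smul_smul, sgn_smul_smul]
  refine sgn_smul_congr ?_ rfl
  generalize p i = a; generalize q j = b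
  clear hM hN; decide +revert

lemma sTr_mul_comm₀ [Fintype m] [Fintype n] (hP : IsSuperAlg P) {x : ZMod 2} {M : Matrix m n A}
    {N : Matrix n m A} (hM : IsSM P p q 0 M) (hN : IsSM P q p x N) :
    sTr p x (M * N) = sTr q x (N * M) := by
  simpa using sTr_mul_comm hP hM hN

lemma sTr_add [Fintype m] (r : ZMod 2) (M N : Matrix m m A) :
    sTr p r (M + N) = sTr p r M + sTr p r N := by
  simp [sTr, Finset.sum_add_distrib]

lemma sTr_sub [Fintype m] (r : ZMod 2) (M N : Matrix m m A) :
    sTr p r (M - N) = sTr p r M - sTr p r N := by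
  simp [sTr, Finset.sum_sub_distrib, smul_sub]

lemma sTr_smul [Fintype m] (r : ZMod 2) (c : ℂ) (M : Matrix m m A) :
    sTr p r (c • M) = c • sTr p r M := by
  simp only [sTr, Finset.smul_sum, Matrix.smul_apply]
  exact Finset.sum_congr rfl fun i _ => smul_comm _ _ _

/-- An inverse of an even supermatrix is an even supermatrix. -/
lemma IsSM.inv [Fintype m] [DecidableEq m] (hP : IsSuperAlg P) {M N : Matrix m m A}
    (hM : IsSM P p p 0 M) (hMN : M * N = 1) (hNM : N * M = 1) : IsSM P p p 0 N := by
  have hdec : ∀ (x : A) (k : ZMod 2), ∃ a ∈ P k, ∃ b ∈ P (k + 1), x = a + b := by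
    intro x k
    obtain ⟨a, ha, b, hb, h⟩ := hP.decomp x
    rcases zmod2_cases k with rfl | rfl
    · exact ⟨a, ha, b, by simpa using hb, h⟩
    · exact ⟨b, hb, a, by simpa [CharTwo.add_self_eq_zero] using ha, by rw [h, add_comm]⟩
  have hdisj : ∀ (x : A) (k : ZMod 2), x ∈ P k → x ∈ P (k + 1) → x = 0 := by
    intro x k h1 h2
    rcases zmod2_cases k with rfl | rfl
    · exact hP.disj x h1 (by simpa using h2)
    · exact hP.disj x (by simpa [CharTwo.add_self_eq_zero] using h2) h1
  choose a ha b hb hab using fun i j => hdec (N i j) (p i + p j)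
  have ha' : IsSM P p p 0 (Matrix.of a) := fun i j => by simpa using ha i j
  have hb' : IsSM P p p 1 (Matrix.of b) := fun i j => by simpa using hb i j
  have hN : N = Matrix.of a + Matrix.of b := by ext i j; exact hab i j
  have h1 := ha'.mul₀ hP hM
  -- The parity-violating part b of the inverse satisfies M b = 1 - M a. The two sides have opposite
  -- parities entry by entry, so both vanish.
  have h0 : M * Matrix.of b = 0 := by
    ext i j
    refine hdisj _ (p i + p j) ?_ (by simpa using (hM.mul₀ hP hb') i j)
    have : M * Matrix.of b = 1 - M * Matrix.of a := by
      rw [← hMN, hN, mul_add]; abel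
    rw [this]
    exact Submodule.sub_mem _ (by simpa using IsSM.one hP i j)
      (by simpa using hM.mul₀ hP ha' i j)
  have h2 : Matrix.of b = 0 := by
    have := congrArg (N * ·) h0
    simpa [← mul_assoc, hNM] using this
  rw [hN, h2, add_zero]; exact ha'

/-- The logarithmic derivative of the superdeterminant: `str (M⁻¹ δM)`. -/
lemma sTr_logDer_mul [Fintype m] [DecidableEq m] (hP : IsSuperAlg P) {r : ZMod 2}
    {D : A →ₗ[ℂ] A} (hD : IsRDer P r D) {M M' N N' : Matrix m m A}
    (hM : IsSM P p p 0 M) (hM' : IsSM P p p 0 M') (hN : IsSM P p p 0 N) (hN' : IsSM P p p 0 N')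
    (h1 : M' * M = 1) (h2 : N * N' = 1) :
    sTr p r (N' * M' * twD r p D (M * N)) =
      sTr p r (M' * twD r p D M) + sTr p r (N' * twD r p D N) := by
  rw [twD_mul hD M hN, mul_add, sTr_add]
  have e1 : N' * M' * (M * twD r p D N) = N' * twD r p D N := by
    rw [mul_assoc, ← mul_assoc M', h1, one_mul]
  -- Cyclicity moves N' to the far right, where it cancels N; no sign appears because N' is even.
  have e2 : sTr p r (N' * M' * (twD r p D M * N)) = sTr p r (M' * twD r p D M) := by
    rw [mul_assoc, sTr_mul_comm₀ hP hN' ((hM'.mul₀ hP (hM.twD hD)).mul hP hN |> fun h => by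
      simpa [mul_assoc] using h), ← mul_assoc, mul_assoc, h2, mul_one]
  rw [e1, e2, add_comm]


/-! ### Derivative of the superdeterminant -/

/-- Bridge between the Leibniz formula over a noncommutative ring and the usual determinant, for
matrices whose entries come from a commutative ring. -/
lemma ndet_map {R : Type*} [CommRing R] [Fintype m] [inst : DecidableEq m] (φ : R →+* A)
    (S : Matrix m m R) : ndet (S.map φ) = φ S.det := by
  have : inst = fun a b => Classical.propDecidable (a = b) := Subsingleton.elim _ _
  subst this
  simp only [ndet, Matrix.det_apply, map_sum]
  refine Finset.sum_congr rfl fun τ _ => ?_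
  rw [Units.smul_def, zsmul_eq_mul, map_mul, map_intCast, ← Finset.prod_map_toList, map_list_prod,
    List.map_map]
  rfl

lemma ndet_map_ringHom {R S : Type*} [Ring R] [Ring S] [Fintype m] (φ : R →+* S)
    (M : Matrix m m R) : ndet (M.map φ) = φ (ndet M) := by
  simp only [ndet, map_sum]
  refine Finset.sum_congr rfl fun τ _ => ?_
  rw [map_mul, map_intCast, map_list_prod, List.map_map]
  rfl

lemma der_prod {R ι : Type*} [CommRing R] [DecidableEq ι] (φ : R →+* A) (d : R →+ A)
    (h : ∀ x y, d (x * y) = φ x * d y + φ y * d x) (t : Finset ι) (f : ι → R) :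
    d (∏ i ∈ t, f i) = ∑ k ∈ t, φ (∏ i ∈ t.erase k, f i) * d (f k) := by
  have h1 : d 1 = 0 := by have := h 1 1; simpa using this
  induction t using Finset.induction_on with
  | empty => simp [h1]
  | insert a t ha ih =>
    rw [Finset.prod_insert ha, h, ih, Finset.sum_insert ha, Finset.erase_insert ha, add_comm,
      Finset.mul_sum]
    congr 1
    refine Finset.sum_congr rfl fun k hk => ?_
    have hak : a ≠ k := fun e => ha (e ▸ hk)
    rw [Finset.erase_insert_of_ne hak, Finset.prod_insert (fun e => ha (Finset.mem_of_mem_erase e)),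
      map_mul, mul_assoc]

/-- Jacobi's formula. The derivation takes values in A and not in R because an odd derivation leads
out of the commutative ring of even elements. -/
lemma der_det {R : Type*} [CommRing R] [Fintype m] [DecidableEq m] (φ : R →+* A) (d : R →+ A)
    (h : ∀ x y, d (x * y) = φ x * d y + φ y * d x) (S : Matrix m m R) :
    d S.det = ∑ k, ∑ j, φ (S.adjugate k j) * d (S j k) := by
  have hz : ∀ (z : ℤ) x, d (z • x) = z • d x := fun z x => map_zsmul d z x
  have hL : d S.det = ∑ k, ∑ τ : Equiv.Perm m, (Equiv.Perm.sign τ : ℤ) •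
      (φ (∏ i ∈ Finset.univ.erase k, S (τ i) i) * d (S (τ k) k)) := by
    rw [Matrix.det_apply, map_sum, Finset.sum_comm]
    refine Finset.sum_congr rfl fun τ _ => ?_
    rw [Units.smul_def, hz, der_prod φ d h, Finset.smul_sum]
  rw [hL]
  refine Finset.sum_congr rfl fun k _ => ?_
  -- The cofactor is the part of the Leibniz sum over permutations sending k to j, with the factor
  -- of column k removed.
  have hadj : ∀ j, S.adjugate k j = ∑ τ : Equiv.Perm m, (Equiv.Perm.sign τ : ℤ) •
      (∏ i ∈ Finset.univ.erase k, S (τ i) i) * (if τ k = j then 1 else 0) := by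
    intro j
    rw [Matrix.adjugate_apply, Matrix.det_apply]
    refine Finset.sum_congr rfl fun τ _ => ?_
    rw [Units.smul_def, smul_mul_assoc]
    congr 1
    by_cases hτ : τ k = j
    · rw [if_pos hτ, mul_one, ← Finset.mul_prod_erase Finset.univ _ (Finset.mem_univ k), hτ,
        Matrix.updateRow_self, Pi.single_eq_same, one_mul]
      refine Finset.prod_congr rfl fun i hi => ?_
      rw [Matrix.updateRow_ne]
      exact fun e => (Finset.ne_of_mem_erase hi) (τ.injective (e.trans hτ.symm))
    · rw [if_neg hτ, mul_zero]
      refine Finset.prod_eq_zero (Finset.mem_univ (τ.symm j)) ?_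
      rw [Equiv.apply_symm_apply, Matrix.updateRow_self, Pi.single_eq_of_ne]
      rintro rfl
      exact hτ (τ.apply_symm_apply j)
  simp only [hadj, map_sum, Finset.sum_mul]
  rw [Finset.sum_comm]
  refine Finset.sum_congr rfl fun τ _ => ?_
  rw [Finset.sum_eq_single (τ k)]
  · simp [zsmul_eq_mul, mul_assoc]
  · intro j _ hj; simp [Ne.symm hj]
  · simp


lemma ndet_of_commRing [Fintype m] [DecidableEq m] (hP : IsSuperAlg P) {r : ZMod 2}
    {D : A →ₗ[ℂ] A} (hD : IsRDer P r D) {R : Type*} [CommRing R] (φ : R →+* A)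
    (hφ : Function.Injective φ) (hr : ∀ x, φ x ∈ P 0) (T T' : Matrix m m R) (hTT : T * T' = 1) :
    IsUnit (ndet (T.map φ)) ∧ ndet (T.map φ) ∈ P 0 ∧
      D (ndet (T.map φ)) = ndet (T.map φ) * ∑ i, ∑ j, φ (T' i j) * D (φ (T j i)) := by
  have hdet : IsUnit T.det := (Matrix.isUnit_iff_isUnit_det T).1 (IsUnit.of_mul_eq_one T' hTT)
  rw [ndet_map]
  refine ⟨hdet.map φ, hr _, ?_⟩
  have hd := der_det φ (D.toAddMonoidHom.comp φ.toAddMonoidHom)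
    (fun x y => by
      have := hD.leib_even (φ x) (hr y)
      rw [← hP.even_comm (hr y) (D (φ x)), ← map_mul] at this
      exact this) T
  have hadj : T.adjugate = T.det • T' := by
    have := congrArg (· * T') (Matrix.adjugate_mul T)
    simpa [mul_assoc, hTT] using this
  refine hd.trans ?_
  rw [Finset.mul_sum]
  refine Finset.sum_congr rfl fun i _ => ?_
  rw [Finset.mul_sum]
  refine Finset.sum_congr rfl fun j _ => ?_
  rw [hadj, Matrix.smul_apply, smul_eq_mul, map_mul, mul_assoc]
  rfl

/-- The even elements form a commutative subalgebra, closed under inversion of even supermatrices,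
so Jacobi's formula applies there. -/
lemma ndet_of_even [Fintype m] [DecidableEq m] (hP : IsSuperAlg P) {r : ZMod 2}
    {D : A →ₗ[ℂ] A} (hD : IsRDer P r D) {S S' : Matrix m m A} (hS : ∀ i j, S i j ∈ P 0)
    (h1 : S * S' = 1) (h2 : S' * S = 1) :
    IsUnit (ndet S) ∧ ndet S ∈ P 0 ∧
      D (ndet S) = ndet S * ∑ i, ∑ j, S' i j * D (S j i) := by
  let E : Subalgebra ℂ A :=
    { carrier := P 0
      mul_mem' := fun hx hy => by simpa using hP.mul_mem hx hy
      add_mem' := fun hx hy => (P 0).add_mem hx hy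
      algebraMap_mem' := fun c => by
        rw [Algebra.algebraMap_eq_smul_one]; exact (P 0).smul_mem _ hP.one_mem }
  let _ : CommRing E := { E.toRing with
    mul_comm := fun x y => Subtype.ext (hP.even_comm x.2 y.1) }
  have hsm : IsSM P (fun _ : m => (0 : ZMod 2)) (fun _ => 0) 0 S := fun i j => by simpa using hS i j
  have hS' : ∀ i j, S' i j ∈ P 0 := fun i j => by simpa using hsm.inv hP h1 h2 i j
  let φ : E →+* A :=
    { toFun := Subtype.val
      map_one' := rfl
      map_mul' := fun _ _ => rfl
      map_zero' := rfl
      map_add' := fun _ _ => rfl }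
  have hφ : Function.Injective φ := Subtype.val_injective
  let T : Matrix m m E := Matrix.of fun i j => ⟨S i j, hS i j⟩
  let T' : Matrix m m E := Matrix.of fun i j => ⟨S' i j, hS' i j⟩
  refine ndet_of_commRing hP hD φ hφ (fun x => x.2) T T' ?_
  have : (T * T').map φ = (1 : Matrix m m E).map φ := by
    rw [Matrix.map_mul, Matrix.map_one _ (map_zero φ) (map_one φ)]
    exact h1
  exact Matrix.map_injective hφ this

open Classical in
/-- The parity decomposition of an index set. -/
def parityEquiv (p : m → ZMod 2) : EvenIdx p ⊕ OddIdx p ≃ m := Equiv.sumCompl fun i => p i = 0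

lemma parityEquiv_submatrix (p : m → ZMod 2) (M : Matrix m m A) :
    M.submatrix (parityEquiv p) (parityEquiv p) = Matrix.fromBlocks
      (M.submatrix Subtype.val Subtype.val) (M.submatrix Subtype.val Subtype.val)
      (M.submatrix Subtype.val Subtype.val) (M.submatrix Subtype.val Subtype.val) := by
  ext i j
  rcases i with i | i <;> rcases j with j | j <;> rfl

lemma sTr_submatrix {n : Type*} [Fintype m] [Fintype n] (e : n ≃ m) (p : m → ZMod 2) (r : ZMod 2)
    (M : Matrix m m A) : sTr (p ∘ e) r (M.submatrix e e) = sTr p r M :=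
  e.sum_comp fun i => sgn (p i * (1 + r)) • M i i

lemma zmod2_ne {a : ZMod 2} (h : ¬ a = 0) : a = 1 := (zmod2_cases a).resolve_left h

open Classical in
/-- The derivative of the superdeterminant of an even supermatrix. -/
theorem sdet_der [Fintype m] (hP : IsSuperAlg P) {r : ZMod 2}
    {D : A →ₗ[ℂ] A} (hD : IsRDer P r D) {M M' : Matrix m m A} (hM : IsSM P p p 0 M)
    (h1 : M * M' = 1) (h2 : M' * M = 1)
    (hu : IsUnit (M.submatrix Subtype.val Subtype.val : Matrix (OddIdx p) (OddIdx p) A))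
    (hS : IsUnit ((M.submatrix Subtype.val Subtype.val : Matrix (EvenIdx p) (EvenIdx p) A)
      - (M.submatrix Subtype.val Subtype.val : Matrix (EvenIdx p) (OddIdx p) A)
      * Ring.inverse (M.submatrix Subtype.val Subtype.val : Matrix (OddIdx p) (OddIdx p) A)
      * (M.submatrix Subtype.val Subtype.val : Matrix (OddIdx p) (EvenIdx p) A))) :
    IsUnit (sdet p M) ∧ sdet p M ∈ P 0 ∧ D (sdet p M) = sdet p M * sTr p r (M' * twD r p D M) := by
  let pe : EvenIdx p → ZMod 2 := fun _ => 0
  let po : OddIdx p → ZMod 2 := fun _ => 1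
  have hpe : ∀ i : EvenIdx p, p i.1 = pe i := fun i => i.2
  have hpo : ∀ i : OddIdx p, p i.1 = po i := fun i => zmod2_ne i.2
  set a : Matrix (EvenIdx p) (EvenIdx p) A := M.submatrix Subtype.val Subtype.val with ha
  set b : Matrix (EvenIdx p) (OddIdx p) A := M.submatrix Subtype.val Subtype.val with hb
  set c : Matrix (OddIdx p) (EvenIdx p) A := M.submatrix Subtype.val Subtype.val with hc
  set d : Matrix (OddIdx p) (OddIdx p) A := M.submatrix Subtype.val Subtype.val with hd
  obtain ⟨d', hd1, hd2, hinv⟩ : ∃ d', d * d' = 1 ∧ d' * d = 1 ∧ Ring.inverse d = d' :=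
    ⟨_, Ring.mul_inverse_cancel _ hu, Ring.inverse_mul_cancel _ hu, rfl⟩
  rw [hinv] at hS
  set S := a - b * d' * c with hSdef
  obtain ⟨S', hS1, hS2⟩ : ∃ S', S * S' = 1 ∧ S' * S = 1 :=
    ⟨_, Ring.mul_inverse_cancel _ hS, Ring.inverse_mul_cancel _ hS⟩
  have hsd : sdet p M = ndet S * Ring.inverse (ndet d) := by
    simp only [sdet, ← ha, ← hb, ← hc, ← hd, hinv, hSdef]
  have sma : IsSM P pe pe 0 a := fun i j => by
    have := hM i.1 j.1
    rwa [hpe i, hpe j] at this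
  have smb : IsSM P pe po 0 b := fun i j => by
    have := hM i.1 j.1
    rwa [hpe i, hpo j] at this
  have smc : IsSM P po pe 0 c := fun i j => by
    have := hM i.1 j.1
    rwa [hpo i, hpe j] at this
  have smd : IsSM P po po 0 d := fun i j => by
    have := hM i.1 j.1
    rwa [hpo i, hpo j] at this
  have smd' : IsSM P po po 0 d' := smd.inv hP hd1 hd2
  have smS : IsSM P pe pe 0 S := fun i j =>
    Submodule.sub_mem _ (sma i j) (((smb.mul₀ hP smd').mul₀ hP smc) i j)
  have smS' : IsSM P pe pe 0 S' := smS.inv hP hS1 hS2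
  obtain ⟨uS, eS, dS⟩ := ndet_of_even hP hD (fun i j => by simpa [pe] using smS i j) hS1 hS2
  obtain ⟨ud, ed, dd⟩ := ndet_of_even hP hD (fun i j => by
    simpa [po, CharTwo.add_self_eq_zero] using smd i j) hd1 hd2
  obtain ⟨y, hy, hy1, hy2⟩ := hP.even_inv ed ud
  have hry : Ring.inverse (ndet d) = y := by
    rw [← one_mul (Ring.inverse _), ← hy2, mul_assoc, Ring.mul_inverse_cancel _ ud, mul_one]
  rw [hsd, hry]
  refine ⟨uS.mul ⟨⟨y, ndet d, hy2, hy1⟩, rfl⟩, by simpa using hP.mul_mem eS hy, ?_⟩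
  rw [hD.leib_even _ hy, hD.map_inv hP ed hy hy1, dS, dd]
  -- transport to block form
  let e := parityEquiv p
  let pp : EvenIdx p ⊕ OddIdx p → ZMod 2 := Sum.elim pe po
  have hpp : p ∘ e = pp := by
    ext i; rcases i with i | i
    · exact hpe i
    · exact hpo i
  -- Block factorisation M = L T R with L, R unipotent and T = diag(S, d), S the Schur complement.
  -- Since str(M⁻¹ dM) is additive over the factors, and triangular factors with unit diagonal
  -- contribute nothing, only T matters.
  let L : Matrix (EvenIdx p ⊕ OddIdx p) (EvenIdx p ⊕ OddIdx p) A := Matrix.fromBlocks 1 (b * d') 0 1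
  let L' : Matrix (EvenIdx p ⊕ OddIdx p) (EvenIdx p ⊕ OddIdx p) A :=
    Matrix.fromBlocks 1 (-(b * d')) 0 1
  let T : Matrix (EvenIdx p ⊕ OddIdx p) (EvenIdx p ⊕ OddIdx p) A := Matrix.fromBlocks S 0 0 d
  let T' : Matrix (EvenIdx p ⊕ OddIdx p) (EvenIdx p ⊕ OddIdx p) A := Matrix.fromBlocks S' 0 0 d'
  let R : Matrix (EvenIdx p ⊕ OddIdx p) (EvenIdx p ⊕ OddIdx p) A := Matrix.fromBlocks 1 0 (d' * c) 1
  let R' : Matrix (EvenIdx p ⊕ OddIdx p) (EvenIdx p ⊕ OddIdx p) A :=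
    Matrix.fromBlocks 1 0 (-(d' * c)) 1
  have hblk : ∀ {w x y z}, IsSM P pe pe 0 w → IsSM P pe po 0 x → IsSM P po pe 0 y →
      IsSM P po po 0 z → IsSM P pp pp 0 (Matrix.fromBlocks w x y z) := by
    intro w x y z hw hx hy hz i j
    rcases i with i | i <;> rcases j with j | j
    exacts [hw i j, hx i j, hy i j, hz i j]
  have hneg : ∀ {m n : Type _} {p : m → ZMod 2} {q : n → ZMod 2} {N : Matrix m n A},
      IsSM P p q 0 N → IsSM P p q 0 (-N) := fun h i j => Submodule.neg_mem _ (h i j)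
  have h00 : ∀ {m n : Type _} {p : m → ZMod 2} {q : n → ZMod 2},
      IsSM P p q 0 (0 : Matrix m n A) := fun i j => zero_mem _
  have smL : IsSM P pp pp 0 L := hblk (IsSM.one hP) (smb.mul₀ hP smd') h00 (IsSM.one hP)
  have smL' : IsSM P pp pp 0 L' := hblk (IsSM.one hP) (hneg (smb.mul₀ hP smd')) h00 (IsSM.one hP)
  have smT : IsSM P pp pp 0 T := hblk smS h00 h00 smd
  have smT' : IsSM P pp pp 0 T' := hblk smS' h00 h00 smd'
  have smR : IsSM P pp pp 0 R := hblk (IsSM.one hP) h00 (smd'.mul₀ hP smc) (IsSM.one hP)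
  have smR' : IsSM P pp pp 0 R' := hblk (IsSM.one hP) h00 (hneg (smd'.mul₀ hP smc)) (IsSM.one hP)
  have hLL : L * L' = 1 := by simp [L, L', Matrix.fromBlocks_multiply, ← Matrix.fromBlocks_one]
  have hLL' : L' * L = 1 := by simp [L, L', Matrix.fromBlocks_multiply, ← Matrix.fromBlocks_one]
  have hTT : T * T' = 1 := by
    simp [T, T', Matrix.fromBlocks_multiply, hS1, hd1]
  have hTT' : T' * T = 1 := by
    simp [T, T', Matrix.fromBlocks_multiply, hS2, hd2]
  have hRR : R * R' = 1 := by simp [R, R', Matrix.fromBlocks_multiply]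
  have hRR' : R' * R = 1 := by simp [R, R', Matrix.fromBlocks_multiply]
  have hfac : M.submatrix e e = L * T * R := by
    rw [parityEquiv_submatrix]
    simp only [← ha, ← hb, ← hc, ← hd, L, T, R, Matrix.fromBlocks_multiply]
    congr 1
    · have : b * d' * d * (d' * c) = b * d' * c := by
        rw [Matrix.mul_assoc b d' d, hd2, Matrix.mul_one, Matrix.mul_assoc]
      simp [this, hSdef]
    · simp [Matrix.mul_assoc, hd2]
    · simp [← Matrix.mul_assoc, hd1]
    · simp
  have hinv' : M'.submatrix e e = R' * (T' * L') := by
    have e1 : M'.submatrix e e * M.submatrix e e = 1 := by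
      rw [Matrix.submatrix_mul_equiv, h2, Matrix.submatrix_one_equiv]
    have e2 : (L * T * R) * (R' * (T' * L')) = 1 := by
      rw [mul_assoc, ← mul_assoc R, hRR, one_mul, mul_assoc, ← mul_assoc T, hTT, one_mul, hLL]
    rw [← one_mul (R' * (T' * L')), ← e1, mul_assoc, hfac, e2, mul_one]
  have htr : sTr p r (M' * twD r p D M) =
      sTr pp r (R' * (T' * L') * twD r pp D (L * T * R)) := by
    rw [← sTr_submatrix e, hpp, ← Matrix.submatrix_mul_equiv _ _ _ e _, hinv', ← hfac]
    congr 2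
    ext i j
    simp only [twD, Matrix.of_apply, Matrix.submatrix_apply, ← hpp, Function.comp]
  have e3 := sTr_logDer_mul hP hD (smL.mul₀ hP smT) (smT'.mul₀ hP smL') smR smR'
    (by rw [mul_assoc, ← mul_assoc L', hLL', one_mul, hTT']) hRR
  have e4 := sTr_logDer_mul hP hD smL smL' smT smT' hLL' hTT
  have hD0 : D 0 = 0 := map_zero D
  have e5 : sTr pp r (L' * twD r pp D L) = 0 := by
    have : twD r pp D L = Matrix.fromBlocks 0 (twD r po D (b * d')) 0 0 := by
      ext i j
      rcases i with i | i <;> rcases j with j | j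
      · exact congrFun (congrFun (twD_one (p := pe) hP hD) i) j
      · rfl
      · simp [twD, L]
      · exact congrFun (congrFun (twD_one (p := po) hP hD) i) j
    rw [this]
    simp [L', Matrix.fromBlocks_multiply, sTr]
  have e6 : sTr pp r (R' * twD r pp D R) = 0 := by
    have : twD r pp D R = Matrix.fromBlocks 0 0 (twD r pe D (d' * c)) 0 := by
      ext i j
      rcases i with i | i <;> rcases j with j | j
      · exact congrFun (congrFun (twD_one (p := pe) hP hD) i) j
      · simp [twD, R]
      · rfl
      · exact congrFun (congrFun (twD_one (p := po) hP hD) i) j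
    rw [this]
    simp [R', Matrix.fromBlocks_multiply, sTr]
  have e7 : sTr pp r (T' * twD r pp D T) =
      (∑ i, ∑ j, S' i j * D (S j i)) - ∑ i, ∑ j, d' i j * D (d j i) := by
    have : twD r pp D T = Matrix.fromBlocks (twD r pe D S) 0 0 (twD r po D d) := by
      ext i j
      rcases i with i | i <;> rcases j with j | j
      · rfl
      · simp [twD, T]
      · simp [twD, T]
      · rfl
    rw [this]
    -- The weight of the odd rows in the supertrace times the column twist is -1 for either parity
    -- of D; this is why ndet d stands in the denominator.
    have hs : sgn (1 + r) * sgn r = -1 := by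
      rw [sgn_add, mul_assoc, sgn_mul_self]; simp
    simp [T', sTr, Matrix.mul_apply, pp, pe, po, twD,
      ← Finset.smul_sum, smul_smul, hs, sub_eq_add_neg]
  rw [htr, e3, e4, e5, e6, e7, zero_add, add_zero]
  generalize (∑ i, ∑ j, S' i j * D (S j i)) = t
  generalize (∑ i, ∑ j, d' i j * D (d j i)) = t'
  rw [← mul_assoc y (ndet d), hy2, one_mul, mul_assoc (ndet S) t, ← hP.even_comm hy t, mul_sub,
    mul_assoc (ndet S) y, mul_assoc (ndet S) y, mul_neg]
  abel

end superalg

/-! ### Vector fields acting from the right -/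

section vectorfields

variable {A : Type*} [Ring A] [Algebra ℂ A] {P : ZMod 2 → Submodule ℂ A}
  {I : Type*} [Fintype I] {p : I → ZMod 2} {d : I → A →ₗ[ℂ] A}

/-- A family of supercommuting right partial derivatives. -/
structure IsPartials (P : ZMod 2 → Submodule ℂ A) (p : I → ZMod 2) (d : I → A →ₗ[ℂ] A) :
    Prop where
  der : ∀ i, IsRDer P (p i) (d i)
  comm : ∀ i j x, d i (d j x) = sgn (p i * p j) • d j (d i x)

/-- The vector field with components `R`, acting from the right. -/
def vf (d : I → A →ₗ[ℂ] A) (R : I → A) : A →ₗ[ℂ] A :=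
  ∑ i, (LinearMap.mulRight ℂ (R i)).comp (d i)

lemma vf_apply (R : I → A) (x : A) : vf d R x = ∑ i, d i x * R i := by
  simp [vf, LinearMap.sum_apply]

lemma IsRDer.vf (hP : IsSuperAlg P) (hd : IsPartials P p d) {r : ZMod 2} {R : I → A}
    (hR : ∀ i, R i ∈ P (p i + r)) : IsRDer P r (vf d R) where
  mem := by
    intro k x hx
    rw [vf_apply]
    refine Submodule.sum_mem _ fun i _ => ?_
    refine mem_parity_congr (hP.mul_mem ((hd.der i).mem hx) (hR i)) ?_
    generalize p i = b; clear hR hx; decide +revert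
  leib := by
    intro j x y hy
    simp only [vf_apply, Finset.mul_sum, Finset.sum_mul, Finset.smul_sum, ← Finset.sum_add_distrib]
    refine Finset.sum_congr rfl fun i _ => ?_
    rw [(hd.der i).leib x y hy, add_mul, mul_assoc x, smul_mul_assoc, mul_assoc (d i x) y,
      mul_assoc (d i x) (R i), hP.comm hy (hR i), mul_smul_comm, sgn_smul_smul]
    congr 1
    refine sgn_smul_congr ?_ rfl
    generalize p i = b; clear hR hy; decide +revert

/-- The partial derivatives supercommute, so passing one of them through a vector field only
differentiates the components of the field. -/
lemma d_vf (hP : IsSuperAlg P) (hd : IsPartials P p d) {r : ZMod 2} {R : I → A}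
    (hR : ∀ i, R i ∈ P (p i + r)) (j : I) (x : A) :
    d j (vf d R x) = sgn (p j * r) • vf d R (d j x) + ∑ i, d i x * d j (R i) := by
  simp only [vf_apply, map_sum, Finset.smul_sum, ← Finset.sum_add_distrib]
  refine Finset.sum_congr rfl fun i _ => ?_
  rw [(hd.der j).leib _ _ (hR i), hd.comm j i, smul_mul_assoc, sgn_smul_smul, add_comm]
  congr 1
  refine sgn_smul_congr ?_ rfl
  generalize p i = a; generalize p j = b; clear hR; decide +revert

/-- Second derivatives of x cancel in the graded commutator, which is therefore again a vector
field. -/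
lemma vf_commutator (hP : IsSuperAlg P) (hd : IsPartials P p d) {r s : ZMod 2} {R S : I → A}
    (hR : ∀ i, R i ∈ P (p i + r)) (hS : ∀ i, S i ∈ P (p i + s)) (x : A) :
    vf d R (vf d S x) - sgn (r * s) • vf d S (vf d R x) =
      vf d (fun i => vf d R (S i) - sgn (r * s) • vf d S (R i)) x := by
  have h1 : vf d R (vf d S x) = ∑ i, (d i x * vf d R (S i) +
      sgn (r * (p i + s)) • (vf d R (d i x) * S i)) := by
    rw [vf_apply S, map_sum]
    exact Finset.sum_congr rfl fun i _ => (IsRDer.vf hP hd hR).leib _ _ (hS i)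
  have h2 : vf d S (vf d R x) = ∑ i, (sgn (p i * r) • (vf d R (d i x) * S i) ) +
      ∑ i, d i x * vf d S (R i) := by
    rw [vf_apply S (vf d R x)]
    simp only [d_vf hP hd hR, add_mul, Finset.sum_add_distrib, smul_mul_assoc]
    congr 1
    simp only [Finset.sum_mul, vf_apply, Finset.mul_sum, mul_assoc]
    rw [Finset.sum_comm]
  rw [h1, h2, vf_apply]
  simp only [mul_sub, Finset.sum_sub_distrib, Finset.sum_add_distrib, smul_add, Finset.smul_sum,
    mul_smul_comm, sgn_smul_smul]
  have hsg : ∀ a r s : ZMod 2, r * (a + s) = r * s + a * r := by decide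
  have : ∀ i, r * (p i + s) = r * s + p i * r := fun i => hsg _ _ _
  simp only [this]
  abel

/-! ### Hamiltonian vector fields and the Jacobi identity -/

variable {E : I → I → A}

/-- The vector field `f ↦ (f, g)`, for `g` of parity `r + 1`. -/
def ham (p : I → ZMod 2) (d : I → A →ₗ[ℂ] A) (E : I → I → A) (r : ZMod 2) (g : A) : I → A :=
  fun i => ∑ j, sgn (p j * r) • (E i j * d j g)

/-- An odd graded skew-symmetric bi-vector satisfying the graded Jacobi identity. -/
structure IsOddPoisson (P : ZMod 2 → Submodule ℂ A) (p : I → ZMod 2) (d : I → A →ₗ[ℂ] A)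
    (E : I → I → A) : Prop where
  mem : ∀ i j, E i j ∈ P (p i + p j + 1)
  skew : ∀ i j, E j i = -(sgn ((p i + 1) * (p j + 1)) • E i j)
  jac : ∀ a b c,
    sgn ((p a + 1) * (p c + 1)) • ∑ k, sgn (p k * (p b + p c)) • (E a k * d k (E b c))
    + sgn ((p b + 1) * (p a + 1)) • ∑ k, sgn (p k * (p c + p a)) • (E b k * d k (E c a))
    + sgn ((p c + 1) * (p b + 1)) • ∑ k, sgn (p k * (p a + p b)) • (E c k * d k (E a b)) = 0

lemma ham_mem (hP : IsSuperAlg P) (hd : IsPartials P p d) (hE : IsOddPoisson P p d E)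
    {r : ZMod 2} {g : A} (hg : g ∈ P (r + 1)) (i : I) : ham p d E r g i ∈ P (p i + r) := by
  refine Submodule.sum_mem _ fun j _ => Submodule.smul_mem _ _ ?_
  refine mem_parity_congr (hP.mul_mem (hE.mem i j) ((hd.der j).mem hg)) ?_
  generalize p i = a; generalize p j = b; clear hg; decide +revert

/-- The commutator of Hamiltonian fields is the Hamiltonian field of the bracket, read off in
components. Both sides are expanded into sums over three indices: terms with second derivatives of g
or h match one by one, and terms with a derivative of E are matched by the Jacobi identity for E. -/
lemma ham_jacobi (hP : IsSuperAlg P) (hd : IsPartials P p d) (hE : IsOddPoisson P p d E)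
    {r s : ZMod 2} {g h : A} (hg : g ∈ P (r + 1)) (hh : h ∈ P (s + 1)) (a : I) :
    vf d (ham p d E s h) (ham p d E r g a) - sgn (s * r) • vf d (ham p d E r g) (ham p d E s h a) =
      ham p d E (r + s) (vf d (ham p d E s h) g) a := by
  have hEd : ∀ i j k, d k (E i j) ∈ P (p i + p j + 1 + p k) := fun i j k =>
    (hd.der k).mem (hE.mem i j)
  have key : ∀ (r s : ZMod 2) (g h : A), g ∈ P (r + 1) → h ∈ P (s + 1) →
      vf d (ham p d E s h) (ham p d E r g a) =
      (∑ k, ∑ x, ∑ y, sgn (p x * r + p y * s) • (E a x * d k (d x g) * (E k y * d y h))) +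
      ∑ k, ∑ x, ∑ y, sgn (p x * r + p y * s + p k * (p x + r + 1)) •
          (d k (E a x) * d x g * (E k y * d y h)) := by
    intro r s g h hg hh
    rw [vf_apply, ← Finset.sum_add_distrib]
    refine Finset.sum_congr rfl fun k _ => ?_
    simp only [ham, map_sum, map_smul]
    rw [Finset.sum_mul_sum, ← Finset.sum_add_distrib]
    refine Finset.sum_congr rfl fun x _ => ?_
    rw [← Finset.sum_add_distrib]
    refine Finset.sum_congr rfl fun y _ => ?_
    rw [(hd.der k).leib _ _ ((hd.der x).mem hg), smul_mul_smul_comm, ← sgn_add, add_mul, smul_add,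
      smul_mul_assoc, sgn_smul_smul]
    congr 1
    refine sgn_smul_congr ?_ rfl
    generalize p x = x; generalize p y = y; generalize p k = k; clear hg hh; ring
  have keyR : ham p d E (r + s) (vf d (ham p d E s h) g) a =
      (∑ k, ∑ x, ∑ y, sgn (p k * (r + s) + p y * s) • (E a k * (d x g * (E x y * d k (d y h)))))
      + (∑ k, ∑ x, ∑ y, sgn (p k * (r + s) + p y * s + p k * (s + 1 + p y)) •
          (E a k * (d x g * (d k (E x y) * d y h))))
      + ∑ k, ∑ x, ∑ y, sgn (p k * (r + s) + p y * s + p k * (p x + s)) •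
          (E a k * (d k (d x g) * (E x y * d y h))) := by
    simp only [← Finset.sum_add_distrib]
    rw [ham]
    refine Finset.sum_congr rfl fun k _ => ?_
    rw [vf_apply, map_sum, Finset.mul_sum, Finset.smul_sum]
    refine Finset.sum_congr rfl fun x _ => ?_
    simp only [ham]
    rw [Finset.mul_sum, map_sum, Finset.mul_sum, Finset.smul_sum]
    refine Finset.sum_congr rfl fun y _ => ?_
    rw [mul_smul_comm, map_smul, mul_smul_comm, sgn_smul_smul, (hd.der k).leib (d x g) _
      (hP.mul_mem (hE.mem x y) ((hd.der y).mem hh)), (hd.der k).leib (E x y) _ ((hd.der y).mem hh)]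
    simp only [mul_add, smul_add, mul_smul_comm, sgn_smul_smul]
    congr 1
    · refine sgn_smul_congr ?_ rfl
      clear hg hh
      generalize p x = x; generalize p y = y; generalize p k = k
      have hsg : ∀ r s x y k : ZMod 2, k * (r + s) + y * s + k * (x + y + 1 + (s + 1 + y)) =
        k * (r + s) + y * s + k * (x + s) := by decide
      linear_combination hsg r s x y k
  -- Second derivatives of g: equal after interchanging two summation indices.
  have e1 : (∑ k, ∑ x, ∑ y, sgn (p k * (r + s) + p y * s + p k * (p x + s)) •
          (E a k * (d k (d x g) * (E x y * d y h)))) =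
      ∑ k, ∑ x, ∑ y, sgn (p x * r + p y * s) • (E a x * d k (d x g) * (E k y * d y h)) := by
    rw [Finset.sum_comm]
    refine Finset.sum_congr rfl fun k _ => Finset.sum_congr rfl fun x _ =>
      Finset.sum_congr rfl fun y _ => ?_
    rw [hd.comm x k, smul_mul_assoc, mul_smul_comm, sgn_smul_smul, mul_assoc]
    refine sgn_smul_congr ?_ rfl
    clear hg hh
    generalize p x = x; generalize p y = y; generalize p k = k
    have hsg : ∀ r s x y k : ZMod 2, x * (r + s) + y * s + x * (k + s) + x * k =
      x * r + y * s := by decide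
    exact hsg _ _ _ _ _
  -- Second derivatives of h: here three factors must be reversed and the skew symmetry of E used.
  have e2 : sgn (s * r) • (∑ k, ∑ x, ∑ y, sgn (p x * s + p y * r) •
        (E a x * d k (d x h) * (E k y * d y g))) =
      -∑ k, ∑ x, ∑ y, sgn (p k * (r + s) + p y * s) •
        (E a k * (d x g * (E x y * d k (d y h)))) := by
    rw [Finset.sum_comm, Finset.smul_sum, ← Finset.sum_neg_distrib]
    refine Finset.sum_congr rfl fun k _ => ?_
    rw [Finset.sum_comm, Finset.smul_sum, ← Finset.sum_neg_distrib]
    refine Finset.sum_congr rfl fun x _ => ?_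
    rw [Finset.smul_sum, ← Finset.sum_neg_distrib]
    refine Finset.sum_congr rfl fun y _ => ?_
    have h1 := hP.comm3 ((hd.der y).mem ((hd.der k).mem hh)) (hE.mem y x) ((hd.der x).mem hg)
    rw [hd.comm k y, mul_assoc (E a k), ← mul_assoc (d y _), h1, hE.skew x y, neg_eq_sgn_smul,
      neg_eq_sgn_smul]
    simp only [mul_smul_comm, smul_mul_assoc, sgn_smul_smul, mul_assoc]
    refine sgn_smul_congr ?_ rfl
    clear hg hh h1 key keyR e1
    generalize p x = x; generalize p y = y; generalize p k = k
    have hsg : ∀ r s x y k : ZMod 2, s * r + (k * s + x * r + ((s + 1 + k + y) * (y + x + 1) +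
      (s + 1 + k + y) * (r + 1 + x) + (y + x + 1) * (r + 1 + x) +
      (1 + (x + 1) * (y + 1)))) = 1 + (k * (r + s) + y * s + k * y) := by decide
    linear_combination hsg r s x y k
  -- First derivatives of E: each of the three sums is brought to a cyclic term of the Jacobi
  -- identity multiplied by the same d x g * d y h.
  have e3 : (∑ k, ∑ x, ∑ y, sgn (p x * r + p y * s + p k * (p x + r + 1)) •
          (d k (E a x) * d x g * (E k y * d y h))) -
      sgn (s * r) • (∑ k, ∑ x, ∑ y, sgn (p x * s + p y * r + p k * (p x + s + 1)) •
          (d k (E a x) * d x h * (E k y * d y g))) =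
      ∑ k, ∑ x, ∑ y, sgn (p k * (r + s) + p y * s + p k * (s + 1 + p y)) •
          (E a k * (d x g * (d k (E x y) * d y h))) := by
    rw [sub_eq_iff_eq_add]
    have t1 : (∑ k, ∑ x, ∑ y, sgn (p x * r + p y * s + p k * (p x + r + 1)) •
          (d k (E a x) * d x g * (E k y * d y h))) = ∑ x, ∑ y,
        sgn (1 + p x * r + p y * s + (p y + 1) + (p a + r) * (p y + 1)) •
        ((∑ k, sgn (p k * (p a + p x)) • (E y k * d k (E a x))) * (d x g * d y h)) := by
      rw [Finset.sum_comm]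
      refine Finset.sum_congr rfl fun x _ => ?_
      rw [Finset.sum_comm]
      refine Finset.sum_congr rfl fun y _ => ?_
      rw [Finset.sum_mul, Finset.smul_sum]
      refine Finset.sum_congr rfl fun k _ => ?_
      have h1 := hP.comm (hP.mul_mem (hEd a x k) ((hd.der x).mem hg)) (hE.mem y k)
      rw [hE.skew y k, neg_eq_sgn_smul, ← mul_assoc, mul_smul_comm, mul_smul_comm, h1]
      simp only [mul_smul_comm, smul_mul_assoc, sgn_smul_smul, mul_assoc]
      refine sgn_smul_congr ?_ rfl
      clear hg hh h1 key keyR e1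
      generalize p x = x; generalize p y = y; generalize p k = k; generalize p a = a
      have hsg : ∀ r s x y k a : ZMod 2, x * r + y * s + k * (x + r + 1) +
        (1 + ((y + 1) * (k + 1) + (a + x + 1 + k + (r + 1 + x)) * (y + k + 1))) =
        1 + x * r + y * s + (y + 1) + (a + r) * (y + 1) + k * (a + x) := by decide
      linear_combination hsg r s x y k a
    have t2 : (∑ k, ∑ x, ∑ y, sgn (p k * (r + s) + p y * s + p k * (s + 1 + p y)) •
          (E a k * (d x g * (d k (E x y) * d y h)))) = ∑ x, ∑ y,
        sgn (p y * s + (r + 1 + p x) * (p x + p y + 1)) •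
        ((∑ k, sgn (p k * (p x + p y)) • (E a k * d k (E x y))) * (d x g * d y h)) := by
      rw [Finset.sum_comm]
      refine Finset.sum_congr rfl fun x _ => ?_
      rw [Finset.sum_comm]
      refine Finset.sum_congr rfl fun y _ => ?_
      rw [Finset.sum_mul, Finset.smul_sum]
      refine Finset.sum_congr rfl fun k _ => ?_
      have h1 := hP.comm ((hd.der x).mem hg) (hEd x y k)
      rw [← mul_assoc (d x g), h1]
      simp only [mul_smul_comm, smul_mul_assoc, sgn_smul_smul, mul_assoc]
      refine sgn_smul_congr ?_ rfl
      clear hg hh h1 key keyR e1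
      generalize p x = x; generalize p y = y; generalize p k = k
      have hsg : ∀ r s x y k : ZMod 2, k * (r + s) + y * s + k * (s + 1 + y) +
        (r + 1 + x) * (x + y + 1 + k) =
        y * s + (r + 1 + x) * (x + y + 1) + k * (x + y) := by decide
      linear_combination hsg r s x y k
    have t3 : sgn (s * r) • (∑ k, ∑ x, ∑ y, sgn (p x * s + p y * r + p k * (p x + s + 1)) •
          (d k (E a x) * d x h * (E k y * d y g))) = ∑ x, ∑ y,
        sgn (s * r + p y * s + p x * r + (p x + 1) + (p y + 1) * (p a + 1) +
          (p a + s) * (p x + 1) + (s + 1 + p y) * (r + 1 + p x)) •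
        ((∑ k, sgn (p k * (p y + p a)) • (E x k * d k (E y a))) * (d x g * d y h)) := by
      conv_lhs => enter [2, 2, k]; rw [Finset.sum_comm]
      rw [Finset.sum_comm, Finset.smul_sum]
      refine Finset.sum_congr rfl fun x _ => ?_
      rw [Finset.sum_comm, Finset.smul_sum]
      refine Finset.sum_congr rfl fun y _ => ?_
      rw [Finset.sum_mul, Finset.smul_sum, Finset.smul_sum]
      refine Finset.sum_congr rfl fun k _ => ?_
      have h1 := hP.comm (hP.mul_mem (hEd y a k) ((hd.der y).mem hh)) (hE.mem x k)
      have h2 := hP.comm ((hd.der y).mem hh) ((hd.der x).mem hg)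
      rw [hE.skew x k, hE.skew y a, map_neg, map_smul, neg_eq_sgn_smul, neg_eq_sgn_smul (_ • E x k),
        ← mul_assoc]
      simp only [mul_smul_comm, smul_mul_assoc, sgn_smul_smul]
      rw [h1]
      simp only [mul_smul_comm, smul_mul_assoc, sgn_smul_smul, mul_assoc]
      rw [h2]
      simp only [mul_smul_comm, smul_mul_assoc, sgn_smul_smul, mul_assoc]
      refine sgn_smul_congr ?_ rfl
      clear hg hh h1 h2 key keyR e1 e2 t1 t2
      generalize p x = x; generalize p y = y; generalize p k = k; generalize p a = a
      have hsg : ∀ r s x y k a : ZMod 2, s * r + (y * s + x * r + k * (y + s + 1) +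
        (1 + (x + 1) * (k + 1) + (1 + (y + 1) * (a + 1)) +
        (y + a + 1 + k + (s + 1 + y)) * (x + k + 1) + (s + 1 + y) * (r + 1 + x))) =
        s * r + y * s + x * r + (x + 1) + (y + 1) * (a + 1) +
          (a + s) * (x + 1) + (s + 1 + y) * (r + 1 + x) + k * (y + a) := by decide
      linear_combination hsg r s x y k a
    rw [t1, t2, t3, ← Finset.sum_add_distrib]
    refine Finset.sum_congr rfl fun x _ => ?_
    rw [← Finset.sum_add_distrib]
    refine Finset.sum_congr rfl fun y _ => ?_
    have h1 := congrArg (fun z => sgn (1 + p x * r + p y * s + (p y + 1) + (p a + r) * (p y + 1) +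
      (p y + 1) * (p x + 1)) • (z * (d x g * d y h))) (hE.jac a x y)
    simp only [zero_mul, smul_zero, @add_mul A, smul_add, smul_mul_assoc, sgn_smul_smul] at h1
    generalize (∑ k, sgn (p k * (p a + p x)) • (E y k * d k (E a x))) * (d x g * d y h) = w3 at *
    generalize (∑ k, sgn (p k * (p x + p y)) • (E a k * d k (E x y))) * (d x g * d y h) = w1 at *
    generalize (∑ k, sgn (p k * (p y + p a)) • (E x k * d k (E y a))) * (d x g * d y h) = w2 at *
    clear hg hh key keyR e1 e2 t1 t2 t3
    generalize p x = x at *; generalize p y = y at *; generalize p a = a at *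
    have g1 : ∀ r s x y a : ZMod 2, 1 + x * r + y * s + (y + 1) + (a + r) * (y + 1) +
      (y + 1) * (x + 1) + (a + 1) * (y + 1) = 1 + (y * s + (r + 1 + x) * (x + y + 1)) := by decide
    have g2 : ∀ r s x y a : ZMod 2, 1 + x * r + y * s + (y + 1) + (a + r) * (y + 1) +
      (y + 1) * (x + 1) + (x + 1) * (a + 1) = 1 + (s * r + y * s + x * r + (x + 1) +
        (y + 1) * (a + 1) + (a + s) * (x + 1) + (s + 1 + y) * (r + 1 + x)) := by decide
    have g3 : ∀ r s x y a : ZMod 2, 1 + x * r + y * s + (y + 1) + (a + r) * (y + 1) +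
      (y + 1) * (x + 1) + (y + 1) * (x + 1) =
      1 + x * r + y * s + (y + 1) + (a + r) * (y + 1) := by decide
    rw [g1, g2, g3, sgn_add 1, sgn_add 1] at h1
    simp only [sgn_one, neg_mul, one_mul, neg_smul] at h1
    rw [← sub_eq_zero, ← h1]
    abel
  rw [key r s g h hg hh, key s r h g hh hg, keyR, smul_add, e1, e2, ← e3]
  abel

end vectorfields

/-! ### The ideal generated by the constraints -/

section gideal

variable {A : Type*} [Ring A] [Algebra ℂ A] {P : ZMod 2 → Submodule ℂ A}
  {κ : Type*} [Fintype κ] {ε : κ → ZMod 2} {G : κ → A}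

/-- The right ideal generated by a finite family. -/
def gIdeal (G : κ → A) : Submodule ℂ A where
  carrier := {x | ∃ k : κ → A, x = ∑ a, G a * k a}
  add_mem' := by
    rintro _ _ ⟨k, rfl⟩ ⟨l, rfl⟩
    exact ⟨k + l, by simp [mul_add, Finset.sum_add_distrib]⟩
  zero_mem' := ⟨0, by simp⟩
  smul_mem' := by
    rintro c _ ⟨k, rfl⟩
    exact ⟨c • k, by simp [Finset.smul_sum]⟩

lemma gIdeal_mul_right {x : A} (hx : x ∈ gIdeal G) (y : A) : x * y ∈ gIdeal G := by
  obtain ⟨k, rfl⟩ := hx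
  exact ⟨fun a => k a * y, by simp [Finset.sum_mul, mul_assoc]⟩

lemma gIdeal_gen [DecidableEq κ] (a : κ) : G a ∈ gIdeal G :=
  ⟨Pi.single a 1, by simp [Pi.single_apply]⟩

lemma gIdeal_gen_mul [DecidableEq κ] (a : κ) (y : A) : G a * y ∈ gIdeal G :=
  gIdeal_mul_right (gIdeal_gen a) y

/-- Homogeneous generators can be moved to the left past any homogeneous element at the cost of a
sign, so the right ideal is two-sided. -/
lemma gIdeal_mul_left [DecidableEq κ] (hP : IsSuperAlg P) (hG : ∀ a, G a ∈ P (ε a)) {x : A}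
    (hx : x ∈ gIdeal G) (y : A) : y * x ∈ gIdeal G := by
  obtain ⟨k, rfl⟩ := hx
  rw [Finset.mul_sum]
  refine Submodule.sum_mem _ fun a _ => ?_
  obtain ⟨u, hu, v, hv, rfl⟩ := hP.decomp y
  rw [← mul_assoc, add_mul, hP.comm hu (hG a), hP.comm hv (hG a), add_mul, smul_mul_assoc,
    smul_mul_assoc, mul_assoc, mul_assoc]
  exact Submodule.add_mem _ (Submodule.smul_mem _ _ (gIdeal_gen_mul a _))
    (Submodule.smul_mem _ _ (gIdeal_gen_mul a _))

lemma gIdeal_der [DecidableEq κ] (hP : IsSuperAlg P) (hG : ∀ a, G a ∈ P (ε a)) {r : ZMod 2}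
    {D : A →ₗ[ℂ] A} (hD : IsRDer P r D) (h : ∀ a, D (G a) ∈ gIdeal G) {x : A}
    (hx : x ∈ gIdeal G) : D x ∈ gIdeal G := by
  obtain ⟨k, rfl⟩ := hx
  rw [map_sum]
  refine Submodule.sum_mem _ fun a _ => ?_
  obtain ⟨u, hu, v, hv, h2⟩ := hP.decomp (k a)
  rw [h2, mul_add, map_add, hD.leib _ _ hu, hD.leib _ _ hv]
  exact Submodule.add_mem _
    (Submodule.add_mem _ (gIdeal_gen_mul a _) (Submodule.smul_mem _ _ (gIdeal_mul_right (h a) _)))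
    (Submodule.add_mem _ (gIdeal_gen_mul a _) (Submodule.smul_mem _ _ (gIdeal_mul_right (h a) _)))

end gideal

/-! ### Changes of coordinates and logarithmic derivatives of superdeterminants -/

section coordinates

variable {A : Type*} [Ring A] [Algebra ℂ A] {P : ZMod 2 → Submodule ℂ A}
  {I : Type*} [Fintype I] [DecidableEq I] {p : I → ZMod 2} {d : I → A →ₗ[ℂ] A}

/-- New coordinates `f` together with the inverse `K'` of their Jacobian matrix. -/
structure IsCoords (P : ZMod 2 → Submodule ℂ A) (p : I → ZMod 2) (d : I → A →ₗ[ℂ] A) (f : I → A)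
    (K' : Matrix I I A) : Prop where
  mem : ∀ i, f i ∈ P (p i)
  mul_inv : (Matrix.of fun i j => d j (f i)) * K' = 1
  inv_mul : K' * (Matrix.of fun i j => d j (f i)) = 1

variable {f : I → A} {K' : Matrix I I A}

/-- Partial derivatives with respect to the new coordinates. -/
def newD (d : I → A →ₗ[ℂ] A) (K' : Matrix I I A) (i : I) : A →ₗ[ℂ] A := vf d fun j => K' j i

lemma IsCoords.sm (hd : IsPartials P p d) (hf : IsCoords P p d f K') :
    IsSM P p p 0 (Matrix.of fun i j => d j (f i)) := fun i j => by
  simpa using (hd.der j).mem (hf.mem i)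

lemma IsCoords.sm_inv (hP : IsSuperAlg P) (hd : IsPartials P p d) (hf : IsCoords P p d f K') :
    IsSM P p p 0 K' := (hf.sm hd).inv hP hf.mul_inv hf.inv_mul

lemma IsCoords.newD_der (hP : IsSuperAlg P) (hd : IsPartials P p d) (hf : IsCoords P p d f K')
    (i : I) : IsRDer P (p i) (newD d K' i) :=
  IsRDer.vf hP hd fun j => by simpa using hf.sm_inv hP hd j i

lemma IsCoords.newD_apply (hf : IsCoords P p d f K') (i j : I) :
    newD d K' i (f j) = if j = i then 1 else 0 := by
  have := congrFun (congrFun hf.mul_inv j) i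
  rw [Matrix.mul_apply, Matrix.one_apply] at this
  rw [newD, vf_apply, ← this]
  rfl

lemma IsCoords.sum_newD (hf : IsCoords P p d f K') (h : A) (j : I) :
    ∑ i, newD d K' i h * d j (f i) = d j h := by
  have hk : ∀ k, ∑ i, K' k i * d j (f i) = if k = j then 1 else 0 := fun k => by
    have := congrFun (congrFun hf.inv_mul k) j
    rwa [Matrix.mul_apply, Matrix.one_apply] at this
  simp only [newD, vf_apply, Finset.sum_mul, mul_assoc]
  rw [Finset.sum_comm]
  simp only [← Finset.mul_sum, hk]
  simp

/-- The chain rule: a vector field is determined by its values on the new coordinates. -/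
lemma IsCoords.vf_expand (hf : IsCoords P p d f K') (S : I → A) (h : A) :
    vf d S h = ∑ i, newD d K' i h * vf d S (f i) := by
  simp only [vf_apply, Finset.mul_sum]
  rw [Finset.sum_comm]
  refine Finset.sum_congr rfl fun j _ => ?_
  rw [← hf.sum_newD h j, Finset.sum_mul]
  simp only [mul_assoc]

/-- The Lie derivative of the Berezinian: comparison of divergences in two coordinate systems. -/
lemma IsCoords.sTr_jacobian (hP : IsSuperAlg P) (hd : IsPartials P p d) (hf : IsCoords P p d f K')
    {r : ZMod 2} {R : I → A} (hR : ∀ i, R i ∈ P (p i + r)) :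
    sTr p r (K' * twD r p (vf d R) (Matrix.of fun i j => d j (f i))) =
      ∑ i, sgn (p i * (1 + r)) • newD d K' i (vf d R (f i)) -
        ∑ i, sgn (p i * (1 + r)) • d i (R i) := by
  set K : Matrix I I A := Matrix.of fun i j => d j (f i) with hK
  let M : Matrix I I A := Matrix.of fun i j => newD d K' j (vf d R (f i))
  let N : Matrix I I A := Matrix.of fun i j => d j (R i)
  have hRd := IsRDer.vf hP hd hR
  -- Passing d_j through the field R turns R(d_j f_i) into d_j(R f_i) minus the terms with d_j R;
  -- the chain rule rewrites the former as M K, with M the new-coordinate derivatives of R f. After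
  -- multiplication by K⁻¹, the supertraces of M and N are the two divergences.
  have h1 : twD r p (vf d R) K = M * K - K * N := by
    ext i j
    simp only [twD, Matrix.of_apply, Matrix.sub_apply, Matrix.mul_apply, hK, M, N]
    rw [hf.sum_newD, d_vf hP hd hR]
    abel
  have hM : IsSM P p p r M := fun i j =>
    mem_parity_congr ((hf.newD_der hP hd j).mem (hRd.mem (hf.mem i))) (by ring)
  have hK0 := hf.sm hd
  rw [h1, mul_sub, sTr_sub, ← mul_assoc K' K, hf.inv_mul, one_mul,
    sTr_mul_comm₀ hP (hf.sm_inv hP hd) (by simpa using hM.mul hP hK0), mul_assoc, hf.mul_inv,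
    mul_one]
  rfl

/-! ### The theory without ghosts -/

variable {κ : Type*} [Fintype κ] [DecidableEq κ] {ε : κ → ZMod 2} {F G : κ → A}
  {E : I → I → A} {σ : κ ⊕ κ ≃ I}

/-- The Hamiltonian vector field of the function `G a`. -/
def hamG (p : I → ZMod 2) (d : I → A →ₗ[ℂ] A) (E : I → I → A) (ε : κ → ZMod 2) (G : κ → A)
    (a : κ) : A →ₗ[ℂ] A := vf d (ham p d E (ε a + 1) (G a))

lemma parity_add_two (a : ZMod 2) : a + 1 + 1 = a := by revert a; decide

lemma ham_mem' (hP : IsSuperAlg P) (hd : IsPartials P p d) (hE : IsOddPoisson P p d E)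
    (hG : ∀ a, G a ∈ P (ε a)) (a : κ) (i : I) : ham p d E (ε a + 1) (G a) i ∈ P (p i + (ε a + 1)) :=
  ham_mem hP hd hE (by rw [parity_add_two]; exact hG a) i

lemma hamG_der (hP : IsSuperAlg P) (hd : IsPartials P p d) (hE : IsOddPoisson P p d E)
    (hG : ∀ a, G a ∈ P (ε a)) (a : κ) : IsRDer P (ε a + 1) (hamG p d E ε G a) :=
  IsRDer.vf hP hd (ham_mem' hP hd hE hG a)

/-- The bracket with a combination of the functions `G`, modulo the ideal generated by them. -/
lemma vf_ham_combination (hP : IsSuperAlg P) (hd : IsPartials P p d) (hE : IsOddPoisson P p d E)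
    (hG : ∀ a, G a ∈ P (ε a)) {s : ZMod 2} {u : κ → A} (hu : ∀ c, u c ∈ P (ε c + 1 + s)) (x : A) :
    vf d (ham p d E s (∑ c, G c * u c)) x - ∑ c, hamG p d E ε G c x * u c ∈ gIdeal G := by
  have h1 : ∀ i, ham p d E s (∑ c, G c * u c) i - ∑ c, ham p d E (ε c + 1) (G c) i * u c ∈
      gIdeal G := by
    intro i
    simp only [ham, map_sum, Finset.mul_sum, Finset.smul_sum, Finset.sum_mul]
    rw [Finset.sum_comm, ← Finset.sum_sub_distrib]
    refine Submodule.sum_mem _ fun c _ => ?_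
    rw [← Finset.sum_sub_distrib]
    refine Submodule.sum_mem _ fun j _ => ?_
    rw [(hd.der j).leib _ _ (hu c), mul_add, smul_add, mul_smul_comm, sgn_smul_smul,
      smul_mul_assoc, mul_assoc, add_sub_assoc]
    -- With this sign the terms in which the derivative hits G c cancel; those in which it hits u c
    -- keep G c as a factor.
    have : p j * s + p j * (ε c + 1 + s) = p j * (ε c + 1) := by
      generalize p j = a; generalize ε c = b; clear hu; decide +revert
    rw [this, sub_self, add_zero]
    exact Submodule.smul_mem _ _ (gIdeal_mul_left hP hG (gIdeal_gen_mul c _) _)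
  have h2 : vf d (ham p d E s (∑ c, G c * u c)) x - ∑ c, hamG p d E ε G c x * u c =
      ∑ i, d i x * (ham p d E s (∑ c, G c * u c) i - ∑ c, ham p d E (ε c + 1) (G c) i * u c) := by
    simp only [mul_sub, Finset.sum_sub_distrib, vf_apply, hamG, Finset.sum_mul, Finset.mul_sum,
      mul_assoc]
    congr 1
    rw [Finset.sum_comm]
  rw [h2]
  exact Submodule.sum_mem _ fun i _ => gIdeal_mul_left hP hG (h1 i) _

/-- The Jacobi identity in the form needed to differentiate a bracket (x, G c) along G a: the two
Hamiltonian fields are interchanged at the cost of the field of (G c, G a). -/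
lemma hamG_jacobi (hP : IsSuperAlg P) (hd : IsPartials P p d) (hE : IsOddPoisson P p d E)
    (hG : ∀ a, G a ∈ P (ε a)) (a c : κ) (x : A) :
    hamG p d E ε G a (hamG p d E ε G c x) =
      sgn ((ε a + 1) * (ε c + 1)) • hamG p d E ε G c (hamG p d E ε G a x) +
      vf d (ham p d E (ε c + 1 + (ε a + 1)) (hamG p d E ε G a (G c))) x := by
  have h := vf_commutator hP hd (ham_mem' hP hd hE hG a) (ham_mem' hP hd hE hG c) x
  rw [sub_eq_iff_eq_add] at h
  rw [hamG, hamG, h, add_comm]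
  congr 3
  ext i
  exact ham_jacobi hP hd hE (by rw [parity_add_two]; exact hG c)
    (by rw [parity_add_two]; exact hG a) i

variable {U : Matrix κ κ A} {a : κ} {B' : Matrix κ κ A}

/-- Differentiate B = (F, G) along G a by the Jacobi identity. In ((F, G a), G c) the chain rule in
the new coordinates gives M B with M the F-derivatives of (F, G a), since the brackets of the
constraints lie in the ideal; in (F, (G c, G a)) the relation (G, G a) = G U gives B U. The
supertrace against B⁻¹ leaves str U and the F-part of the divergence. -/
lemma sTr_bracket (hP : IsSuperAlg P) (hd : IsPartials P p d) (hE : IsOddPoisson P p d E)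
    (hf : IsCoords P p d f K') (hσF : ∀ b, p (σ (Sum.inl b)) = ε b + 1)
    (hσG : ∀ b, p (σ (Sum.inr b)) = ε b)
    (hfF : ∀ b, f (σ (Sum.inl b)) = F b) (hfG : ∀ b, f (σ (Sum.inr b)) = G b)
    (hU : IsSM P ε ε (ε a + 1) U)
    (hinv : ∀ b c, hamG p d E ε G c (G b) ∈ gIdeal G)
    (hGU : ∀ b, sgn (ε b * (ε a + 1)) • hamG p d E ε G a (G b) = ∑ c, G c * U c b)
    (hB1 : (Matrix.of fun b c => hamG p d E ε G c (F b)) * B' = 1)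
    (hB2 : B' * (Matrix.of fun b c => hamG p d E ε G c (F b)) = 1) :
    sTr ε (ε a + 1) (B' * twD (ε a + 1) ε (hamG p d E ε G a)
        (Matrix.of fun b c => hamG p d E ε G c (F b)))
      - (sTr ε (ε a + 1) U - ∑ b, sgn ((ε b + 1) * (1 + (ε a + 1))) •
          newD d K' (σ (Sum.inl b)) (hamG p d E ε G a (F b))) ∈ gIdeal G := by
  have hG : ∀ b, G b ∈ P (ε b) := fun b => by rw [← hfG, ← hσG]; exact hf.mem _
  have hF : ∀ b, F b ∈ P (ε b + 1) := fun b => by rw [← hfF, ← hσF]; exact hf.mem _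
  set B : Matrix κ κ A := Matrix.of fun b c => hamG p d E ε G c (F b) with hB
  set r := ε a + 1 with hr
  let M : Matrix κ κ A := Matrix.of fun b c => newD d K' (σ (Sum.inl c)) (hamG p d E ε G a (F b))
  have hBsm : IsSM P ε ε 0 B := fun b c =>
    mem_parity_congr ((hamG_der hP hd hE hG c).mem (hF b)) (by
      generalize ε b = x; generalize ε c = y; decide +revert)
  have hB'sm : IsSM P ε ε 0 B' := hBsm.inv hP hB1 hB2
  have hMsm : IsSM P ε ε r M := fun b c =>
    mem_parity_congr ((hf.newD_der hP hd _).mem ((hamG_der hP hd hE hG a).mem (hF b))) (by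
      rw [hσF, ← hr]
      have : ∀ x y r : ZMod 2, x + 1 + r + (y + 1) = x + y + r := by decide
      exact this _ _ _)
  -- Here e1 is the term ((F, G a), G c), and e2 is the term (F, (G c, G a)).
  have hT : ∀ b c, (twD r ε (hamG p d E ε G a) B - (sgn r • (M * B) + B * U)) b c ∈ gIdeal G := by
    intro b c
    have e1 : hamG p d E ε G c (hamG p d E ε G a (F b)) - (M * B) b c ∈ gIdeal G := by
      have : hamG p d E ε G c (hamG p d E ε G a (F b)) = (M * B) b c +
          ∑ e, newD d K' (σ (Sum.inr e)) (hamG p d E ε G a (F b)) * hamG p d E ε G c (G e) := by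
        rw [hamG, hf.vf_expand, ← σ.sum_comp, Fintype.sum_sum_type, Matrix.mul_apply]
        simp only [hfF, hfG]
        rfl
      rw [this, add_sub_cancel_left]
      exact Submodule.sum_mem _ fun e _ => gIdeal_mul_left hP hG (hinv e c) _
    have e2 : sgn (ε c * r) • vf d (ham p d E (ε c + 1 + r) (hamG p d E ε G a (G c))) (F b)
        - (B * U) b c ∈ gIdeal G := by
      have h := vf_ham_combination hP hd hE hG (s := ε c + 1 + r) (u := fun e => U e c)
        (fun e => mem_parity_congr (hU e c) (by
          have : ∀ x y r : ZMod 2, x + y + r = x + 1 + (y + 1 + r) := by decide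
          exact this _ _ _)) (F b)
      rw [← hGU c] at h
      have h3 : ∀ (c : ℂ) s g, vf d (ham p d E s (c • g)) (F b) = c • vf d (ham p d E s g) (F b) := by
        intro c s g
        simp only [vf_apply, ham, map_smul, mul_smul_comm, Finset.smul_sum, Finset.mul_sum,
          smul_comm _ c]
      rw [h3] at h
      exact h
    rw [Matrix.sub_apply, Matrix.add_apply, Matrix.smul_apply, twD, Matrix.of_apply, hB,
      Matrix.of_apply, hamG_jacobi hP hd hE hG, ← hB, smul_add, sgn_smul_smul]
    have hs : ε c * r + (ε a + 1) * (ε c + 1) = r := by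
      rw [← hr]; generalize ε c = x; clear_value r; clear hr hB hU hB1 hB2 hBsm hMsm e1 e2 hinv hGU
      have : ∀ x r : ZMod 2, x * r + r * (x + 1) = r := by decide
      exact this _ _
    rw [hs]
    have := Submodule.add_mem _ (Submodule.smul_mem _ (sgn r) e1) e2
    rw [smul_sub] at this
    convert this using 1
    abel
  have hT2 : sTr ε r (B' * (twD r ε (hamG p d E ε G a) B - (sgn r • (M * B) + B * U))) ∈
      gIdeal G := by
    refine Submodule.sum_mem _ fun b _ => Submodule.smul_mem _ _ ?_
    rw [Matrix.mul_apply]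
    exact Submodule.sum_mem _ fun c _ => gIdeal_mul_left hP hG (hT c b) _
  rw [mul_sub, mul_add, sTr_sub, sTr_add, ← mul_assoc B' B, hB2, one_mul, mul_smul_comm, sTr_smul,
    sTr_mul_comm₀ (N := M * B) hP hB'sm (by simpa using hMsm.mul hP hBsm), mul_assoc M, hB1, mul_one] at hT2
  convert hT2 using 2
  rw [sub_eq_add_neg, add_comm (sgn r • sTr ε r M)]
  congr 1
  rw [sTr, Finset.smul_sum, ← Finset.sum_neg_distrib]
  refine Finset.sum_congr rfl fun b _ => ?_
  rw [neg_eq_sgn_smul, sgn_smul_smul, sgn_smul_smul]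
  refine sgn_smul_congr ?_ rfl
  have : ∀ x r : ZMod 2, 1 + (x + 1) * (1 + r) = r + x * (1 + r) := by decide
  exact this _ _

/-- The derivative with respect to the coordinate G b of a sum of G c * U c b is U b b plus an
element of the ideal, so the G-part of the divergence is another copy of str U. -/
lemma sum_newD_constraints (hP : IsSuperAlg P) (hd : IsPartials P p d)
    (hE : IsOddPoisson P p d E) (hf : IsCoords P p d f K')
    (hσG : ∀ b, p (σ (Sum.inr b)) = ε b) (hfG : ∀ b, f (σ (Sum.inr b)) = G b)
    (hU : IsSM P ε ε (ε a + 1) U)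
    (hGU : ∀ b, sgn (ε b * (ε a + 1)) • hamG p d E ε G a (G b) = ∑ c, G c * U c b) :
    ∑ b, sgn (ε b * (1 + (ε a + 1))) • newD d K' (σ (Sum.inr b)) (hamG p d E ε G a (G b))
      - sTr ε (ε a + 1) U ∈ gIdeal G := by
  have hG : ∀ b, G b ∈ P (ε b) := fun b => by rw [← hfG, ← hσG]; exact hf.mem _
  rw [sTr, ← Finset.sum_sub_distrib]
  refine Submodule.sum_mem _ fun b _ => ?_
  have h1 : hamG p d E ε G a (G b) = sgn (ε b * (ε a + 1)) • ∑ c, G c * U c b :=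
    sgn_smul_eq_iff.1 (hGU b)
  rw [h1, map_smul, sgn_smul_smul, map_sum]
  have h2 : ∀ c, newD d K' (σ (Sum.inr b)) (G c * U c b) =
      G c * newD d K' (σ (Sum.inr b)) (U c b) +
      if c = b then sgn (ε b * (ε a + 1)) • U b b else 0 := by
    intro c
    rw [(hf.newD_der hP hd _).leib _ _ (hU c b), ← hfG c, hf.newD_apply]
    by_cases hcb : c = b
    · subst hcb
      simp only [hσG, if_true, one_mul]
      congr 1
      refine sgn_smul_congr ?_ rfl
      have : ∀ x r : ZMod 2, x * (x + x + r) = x * r := by decide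
      exact this _ _
    · have : ¬ σ (Sum.inr c) = σ (Sum.inr b) := fun h => hcb (by simpa using h)
      simp [hcb]
  simp only [h2, Finset.sum_add_distrib, Finset.sum_ite_eq', Finset.mem_univ, if_true, smul_add,
    sgn_smul_smul]
  have hs : ε b * (1 + (ε a + 1)) + ε b * (ε a + 1) + ε b * (ε a + 1) = ε b * (1 + (ε a + 1)) := by
    have : ∀ x r : ZMod 2, x * (1 + r) + x * r + x * r = x * (1 + r) := by decide
    exact this _ _
  rw [hs, add_sub_cancel_right]
  exact Submodule.smul_mem _ _ (Submodule.sum_mem _ fun c _ => gIdeal_gen_mul c _)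

/-- Logarithmic derivative of `sdet K * sdet (F, G)` along a constraint, on shell. -/
lemma sTr_jacobian_add_bracket (hP : IsSuperAlg P) (hd : IsPartials P p d)
    (hE : IsOddPoisson P p d E)
    (hf : IsCoords P p d f K') (hσF : ∀ b, p (σ (Sum.inl b)) = ε b + 1)
    (hσG : ∀ b, p (σ (Sum.inr b)) = ε b)
    (hfF : ∀ b, f (σ (Sum.inl b)) = F b) (hfG : ∀ b, f (σ (Sum.inr b)) = G b)
    (hU : IsSM P ε ε (ε a + 1) U)
    (hinv : ∀ b c, hamG p d E ε G c (G b) ∈ gIdeal G)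
    (hGU : ∀ b, sgn (ε b * (ε a + 1)) • hamG p d E ε G a (G b) = ∑ c, G c * U c b)
    (hB1 : (Matrix.of fun b c => hamG p d E ε G c (F b)) * B' = 1)
    (hB2 : B' * (Matrix.of fun b c => hamG p d E ε G c (F b)) = 1) :
    sTr p (ε a + 1) (K' * twD (ε a + 1) p (hamG p d E ε G a) (Matrix.of fun i j => d j (f i)))
      + sTr ε (ε a + 1) (B' * twD (ε a + 1) ε (hamG p d E ε G a)
        (Matrix.of fun b c => hamG p d E ε G c (F b)))
      - ((2 : ℂ) • sTr ε (ε a + 1) U -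
        ∑ i, sgn (p i * (1 + (ε a + 1))) • d i (ham p d E (ε a + 1) (G a) i)) ∈ gIdeal G := by
  have hG : ∀ b, G b ∈ P (ε b) := fun b => by rw [← hfG, ← hσG]; exact hf.mem _
  have h1 := sTr_bracket hP hd hE hf hσF hσG hfF hfG hU hinv hGU hB1 hB2
  have h2 := sum_newD_constraints hP hd hE hf hσG hfG hU hGU
  have h3 := hf.sTr_jacobian hP hd (ham_mem' hP hd hE hG a)
  have h4 : ∑ i, sgn (p i * (1 + (ε a + 1))) • newD d K' i (hamG p d E ε G a (f i)) =
      (∑ b, sgn ((ε b + 1) * (1 + (ε a + 1))) •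
          newD d K' (σ (Sum.inl b)) (hamG p d E ε G a (F b))) +
      ∑ b, sgn (ε b * (1 + (ε a + 1))) •
        newD d K' (σ (Sum.inr b)) (hamG p d E ε G a (G b)) := by
    rw [← σ.sum_comp, Fintype.sum_sum_type]
    simp only [hσF, hσG, hfF, hfG]
  rw [hamG] at h4
  rw [h4] at h3
  -- The F-part of the new divergence enters with opposite signs through the Jacobian and through
  -- the bracket and drops out; the G-part supplies the second str U.
  have h5 := Submodule.add_mem _ h1 h2
  convert h5 using 1
  rw [hamG, h3, two_smul]
  abel

/-! ### The first-stage theory -/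

variable {κ₁ : Type*} [Fintype κ₁] [DecidableEq κ₁] {ε₁ : κ₁ → ZMod 2} {G₁ : κ₁ → A}
  {Δ Δ' V Y : Matrix κ₁ κ₁ A} {Z : Matrix κ κ₁ A} {W : Matrix κ₁ κ A}

/-- By `hred` the secondary constraints are G₁ = G Z Δ⁻¹, so the constraint algebra closes on G
alone with structure functions U + Z Δ⁻¹ W. The new term appears as 2 str(Z Δ⁻¹ W), and by cyclicity
it is twice the W Z part of str(Δ⁻¹ dΔ). This fixes the power two of the ghost superdeterminant. -/
lemma first_stage_logDer (hP : IsSuperAlg P) (hd : IsPartials P p d)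
    (hE : IsOddPoisson P p d E)
    (hf : IsCoords P p d f K') (hσF : ∀ b, p (σ (Sum.inl b)) = ε b + 1)
    (hσG : ∀ b, p (σ (Sum.inr b)) = ε b)
    (hfF : ∀ b, f (σ (Sum.inl b)) = F b) (hfG : ∀ b, f (σ (Sum.inr b)) = G b)
    (hinv : ∀ b c, hamG p d E ε G c (G b) ∈ gIdeal G)
    (hB1 : (Matrix.of fun b c => hamG p d E ε G c (F b)) * B' = 1)
    (hB2 : B' * (Matrix.of fun b c => hamG p d E ε G c (F b)) = 1)
    (hΔ : IsSM P ε₁ ε₁ 0 Δ) (hΔ1 : Δ * Δ' = 1) (hΔ2 : Δ' * Δ = 1)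
    (hZ : IsSM P ε ε₁ 0 Z) (hW : IsSM P ε₁ ε (ε a + 1) W) (hU : IsSM P ε ε (ε a + 1) U)
    (hV : IsSM P ε₁ ε₁ (ε a + 1) V) (hY : IsSM P ε₁ ε₁ (ε a + 1) Y)
    (hred : ∀ β, ∑ α, G₁ α * Δ α β = ∑ b, G b * Z b β)
    (hGU : ∀ b, sgn (ε b * (ε a + 1)) • hamG p d E ε G a (G b) =
      ∑ c, G c * U c b + ∑ α, G₁ α * W α b)
    (hΔder : ∀ α β, (twD (ε a + 1) ε₁ (hamG p d E ε G a) Δ - (W * Z + Δ * V + Y * Δ)) α β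
      ∈ gIdeal G) :
    sTr p (ε a + 1) (K' * twD (ε a + 1) p (hamG p d E ε G a) (Matrix.of fun i j => d j (f i)))
      + sTr ε (ε a + 1) (B' * twD (ε a + 1) ε (hamG p d E ε G a)
        (Matrix.of fun b c => hamG p d E ε G c (F b)))
      - (2 : ℂ) • sTr ε₁ (ε a + 1) (Δ' * twD (ε a + 1) ε₁ (hamG p d E ε G a) Δ)
      - ((2 : ℂ) • (sTr ε (ε a + 1) U - sTr ε₁ (ε a + 1) V - sTr ε₁ (ε a + 1) Y) -
        ∑ i, sgn (p i * (1 + (ε a + 1))) • d i (ham p d E (ε a + 1) (G a) i)) ∈ gIdeal G := by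
  have hG : ∀ b, G b ∈ P (ε b) := fun b => by rw [← hfG, ← hσG]; exact hf.mem _
  have hΔ' : IsSM P ε₁ ε₁ 0 Δ' := hΔ.inv hP hΔ1 hΔ2
  set r := ε a + 1
  have hG1 : ∀ α, G₁ α = ∑ b, G b * (Z * Δ') b α := by
    intro α
    have h1 : ∑ β, (∑ γ, G₁ γ * Δ γ β) * Δ' β α = G₁ α := by
      simp only [Finset.sum_mul, mul_assoc]
      rw [Finset.sum_comm]
      simp only [← Finset.mul_sum, ← Matrix.mul_apply, hΔ1, Matrix.one_apply]
      simp
    rw [← h1]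
    simp only [hred, Matrix.mul_apply, Finset.sum_mul, Finset.mul_sum, mul_assoc]
    rw [Finset.sum_comm]
  have hU' : IsSM P ε ε r (U + Z * Δ' * W) := fun i j =>
    Submodule.add_mem _ (hU i j) (((hZ.mul₀ hP hΔ').mul₀ hP hW) i j)
  have hGU' : ∀ b, sgn (ε b * r) • hamG p d E ε G a (G b) =
      ∑ c, G c * (U + Z * Δ' * W) c b := by
    intro b
    rw [hGU b]
    simp only [Matrix.add_apply, mul_add, Finset.sum_add_distrib, hG1, Finset.sum_mul,
      Matrix.mul_apply (M := Z * Δ'), Finset.mul_sum, mul_assoc]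
    congr 1
    rw [Finset.sum_comm]
  have h1 := sTr_jacobian_add_bracket hP hd hE hf hσF hσG hfF hfG hU' hinv hGU' hB1 hB2
  have h2 : sTr ε₁ r (Δ' * (twD r ε₁ (hamG p d E ε G a) Δ - (W * Z + Δ * V + Y * Δ))) ∈
      gIdeal G := by
    refine Submodule.sum_mem _ fun b _ => Submodule.smul_mem _ _ ?_
    rw [Matrix.mul_apply]
    exact Submodule.sum_mem _ fun c _ => gIdeal_mul_left hP hG (hΔder c b) _
  have e1 : sTr ε₁ r (Δ' * (W * Z)) = sTr ε r (Z * Δ' * W) := by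
    rw [← Matrix.mul_assoc, Matrix.mul_assoc Z, ← sTr_mul_comm₀ hP hZ (hΔ'.mul₀ hP hW)]
  have e2 : sTr ε₁ r (Δ' * (Y * Δ)) = sTr ε₁ r Y := by
    rw [sTr_mul_comm₀ hP hΔ' (by simpa using hY.mul hP hΔ), mul_assoc, hΔ1, mul_one]
  rw [mul_sub, mul_add, mul_add, sTr_sub, sTr_add, sTr_add, e1, e2, ← mul_assoc Δ' Δ, hΔ2,
    one_mul] at h2
  have h3 := Submodule.sub_mem _ h1 (Submodule.smul_mem _ (2 : ℂ) h2)
  convert h3 using 1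
  rw [sTr_add]
  simp only [two_smul, smul_add, smul_sub]
  abel

end coordinates

/-! ### The first-stage theory in algebraic form: Planck grading and master equation -/

section fulltheory

variable {ι κ₀ κ₁ : Type*}

/-- The variables of the first-stage theory together with `ħ`. -/
abbrev HVar (ι κ₀ κ₁ : Type*) := Option (FullVar ι κ₀ κ₁)

/-- Parities, `ħ` included. -/
def hParity (p : ι → ZMod 2) (ε₀ : κ₀ → ZMod 2) (ε₁ : κ₁ → ZMod 2) : HVar ι κ₀ κ₁ → ZMod 2
  | none => 0
  | some v => fullParity p ε₀ ε₁ v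

/-- Planck numbers, `ħ` included. -/
def hPlanck : HVar ι κ₀ κ₁ → ℂ
  | none => 1
  | some v => planckNumber v

lemma sum_fullVar {M : Type*} [AddCommMonoid M] [Fintype ι] [Fintype κ₀] [Fintype κ₁]
    (f : FullVar ι κ₀ κ₁ → M) :
    ∑ v, f v = (∑ i, f (.ext i)) + (∑ a, (f (.lam a) + f (.lamS a))) +
      (∑ α, (f (.gh α) + f (.ghS α))) + ∑ α, (f (.agh α) + f (.aghS α)) := by
  let e : ExtVar ι κ₁ ⊕ (κ₀ ⊕ κ₀) ⊕ (κ₁ ⊕ κ₁) ⊕ (κ₁ ⊕ κ₁) ≃ FullVar ι κ₀ κ₁ :=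
    { toFun := Sum.elim .ext (Sum.elim (Sum.elim .lam .lamS)
        (Sum.elim (Sum.elim .gh .ghS) (Sum.elim .agh .aghS)))
      invFun := fun v => match v with
        | .ext i => .inl i
        | .lam a => .inr (.inl (.inl a))
        | .lamS a => .inr (.inl (.inr a))
        | .gh a => .inr (.inr (.inl (.inl a)))
        | .ghS a => .inr (.inr (.inl (.inr a)))
        | .agh a => .inr (.inr (.inr (.inl a)))
        | .aghS a => .inr (.inr (.inr (.inr a)))
      left_inv := by rintro (i | (a | a) | (a | a) | (a | a)) <;> rfl
      right_inv := by rintro (i | a | a | a | a | a | a) <;> rfl }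
  rw [← e.sum_comp]
  simp only [Fintype.sum_sum_type, Finset.sum_add_distrib]
  simp only [e, Equiv.coe_fn_mk, Sum.elim_inl, Sum.elim_inr, add_assoc]

variable {A : Type*} [Ring A] [Algebra ℂ A] {P : ZMod 2 → Submodule ℂ A}
  {B : Type*} [Ring B] [Algebra ℂ B] {PB : ZMod 2 → Submodule ℂ B}
  [Fintype ι] [Fintype κ₀] [Fintype κ₁] [DecidableEq κ₀] [DecidableEq κ₁]
  {p : ι → ZMod 2} {ε₀ : κ₀ → ZMod 2} {ε₁ : κ₁ → ZMod 2}

/-- Components of the odd vector field `f ↦ (f, X)` on the space of all variables. -/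
def fullQ (p : ι → ZMod 2) (ε₀ : κ₀ → ZMod 2) (ε₁ : κ₁ → ZMod 2)
    (d : HVar ι κ₀ κ₁ → B →ₗ[ℂ] B) (EB : ExtVar ι κ₁ → ExtVar ι κ₁ → B) (X : B) :
    HVar ι κ₀ κ₁ → B
  | none => 0
  | some (.ext i) => ∑ j, sgn (extParity p ε₁ j) • (EB i j * d (some (.ext j)) X)
  | some (.lam a) => sgn (ε₀ a + 1) • d (some (.lamS a)) X
  | some (.lamS a) => sgn (ε₀ a + 1) • d (some (.lam a)) X
  | some (.gh α) => sgn (ε₁ α) • d (some (.ghS α)) X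
  | some (.ghS α) => sgn (ε₁ α) • d (some (.gh α)) X
  | some (.agh α) => sgn (ε₁ α) • d (some (.aghS α)) X
  | some (.aghS α) => sgn (ε₁ α) • d (some (.agh α)) X

/-- Not one of the extended variables. -/
def IsExtra : HVar ι κ₀ κ₁ → Prop
  | some (.ext _) => False
  | _ => True

/-- The algebraic content of a first-stage gauge-fixing action obeying the quantum master
equation: `B` are the functions of all variables and `ħ`, `A` those of the extended variables,
`s : B → A` puts all other variables to zero. -/
structure IsFullTheory (P : ZMod 2 → Submodule ℂ A) (PB : ZMod 2 → Submodule ℂ B)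
    (p : ι → ZMod 2) (ε₀ : κ₀ → ZMod 2) (ε₁ : κ₁ → ZMod 2)
    (dA : ExtVar ι κ₁ → A →ₗ[ℂ] A) (d : HVar ι κ₀ κ₁ → B →ₗ[ℂ] B) (x : HVar ι κ₀ κ₁ → B)
    (s : B →ₐ[ℂ] A) (EA : ExtVar ι κ₁ → ExtVar ι κ₁ → A) (EB : ExtVar ι κ₁ → ExtVar ι κ₁ → B)
    (ρ ρ' X : B) : Prop where
  superA : IsSuperAlg P
  superB : IsSuperAlg PB
  partA : IsPartials P (extParity p ε₁) dA
  partB : IsPartials PB (hParity p ε₀ ε₁) d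
  x_mem : ∀ v, x v ∈ PB (hParity p ε₀ ε₁ v)
  d_x : ∀ u v, d u (x v) = open Classical in if u = v then 1 else 0
  s_x : ∀ v, IsExtra v → s (x v) = 0
  s_d : ∀ i b, s (d (some (.ext i)) b) = dA i (s b)
  s_mem : ∀ {k b}, b ∈ PB k → s b ∈ P k
  poisson : IsOddPoisson P (extParity p ε₁) dA EA
  EB_mem : ∀ i j, EB i j ∈ PB (extParity p ε₁ i + extParity p ε₁ j + 1)
  EB_skew : ∀ i j, EB j i = -(sgn ((extParity p ε₁ i + 1) * (extParity p ε₁ j + 1)) • EB i j)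
  s_EB : ∀ i j, s (EB i j) = EA i j
  d_EB : ∀ u i j, IsExtra u → d u (EB i j) = 0
  ρ_mem : ρ ∈ PB 0
  ρ'_mem : ρ' ∈ PB 0
  d_ρ : ∀ u, IsExtra u → d u ρ = 0
  X_mem : X ∈ PB 0
  planck : vf d (fun v => hPlanck v • x v) X = X
  master : vf d (fullQ p ε₀ ε₁ d EB X) X = Complex.I • (x none *
    ((∑ v, d (some v) (fullQ p ε₀ ε₁ d EB X (some v))) +
      ρ' * vf d (fullQ p ε₀ ε₁ d EB X) ρ))

variable {dA : ExtVar ι κ₁ → A →ₗ[ℂ] A} {d : HVar ι κ₀ κ₁ → B →ₗ[ℂ] B} {x : HVar ι κ₀ κ₁ → B}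
  {s : B →ₐ[ℂ] A} {EA : ExtVar ι κ₁ → ExtVar ι κ₁ → A} {EB : ExtVar ι κ₁ → ExtVar ι κ₁ → B}
  {ρ ρ' X : B}

/-- Functions of definite Planck number. -/
def HasPlanck (d : HVar ι κ₀ κ₁ → B →ₗ[ℂ] B) (x : HVar ι κ₀ κ₁ → B) (k : ℂ) (f : B) : Prop :=
  vf d (fun v => hPlanck v • x v) f = k • f

namespace IsFullTheory

variable (h : IsFullTheory P PB p ε₀ ε₁ dA d x s EA EB ρ ρ' X)
include h

lemma hasPlanck_X : HasPlanck d x 1 X := by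
  rw [HasPlanck, one_smul]; exact h.planck

/-- The commutator of a partial derivative with the weighted Euler field is that derivative times
its weight. -/
lemma hasPlanck_d {k : ℂ} {f : B} (hf : HasPlanck d x k f) (u : HVar ι κ₀ κ₁) :
    HasPlanck d x (k - hPlanck u) (d u f) := by
  have h1 := d_vf (r := 0) h.superB h.partB (R := fun v => hPlanck v • x v)
    (fun v => by simpa using Submodule.smul_mem _ _ (h.x_mem v)) u f
  rw [hf, map_smul] at h1
  simp only [map_smul, h.d_x] at h1
  simp at h1
  rw [HasPlanck, sub_smul, h1]
  simp

/-- The selection rule. On the slice every term of the Euler field vanishes, because either the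
coordinate is put to zero or it belongs to Γ_ext and has weight zero; hence k • s f = 0. -/
lemma s_eq_zero {k : ℂ} {f : B} (hf : HasPlanck d x k f) (hk : k ≠ 0) : s f = 0 := by
  have h1 := congrArg s hf
  rw [map_smul, vf_apply, map_sum] at h1
  have h2 : ∀ v, s (d v f * hPlanck v • x v) = 0 := by
    intro v
    rw [mul_smul_comm, map_smul, map_mul]
    by_cases hv : IsExtra v
    · rw [h.s_x v hv]; simp
    · rcases v with _ | (_ | _ | _ | _ | _ | _ | _) <;> first | exact absurd trivial hv |
        simp [hPlanck, planckNumber]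
  simp only [h2, Finset.sum_const_zero] at h1
  exact (smul_eq_zero.1 h1.symm).resolve_left hk

lemma fullQ_mem (v : HVar ι κ₀ κ₁) :
    fullQ p ε₀ ε₁ d EB X v ∈ PB (hParity p ε₀ ε₁ v + 1) := by
  have hX : ∀ v, d v X ∈ PB (hParity p ε₀ ε₁ v) := fun v => by
    simpa using (h.partB.der v).mem h.X_mem
  rcases v with _ | (i | a | a | α | α | α | α)
  · exact zero_mem _
  · refine Submodule.sum_mem _ fun j _ => Submodule.smul_mem _ _ ?_
    refine mem_parity_congr (h.superB.mul_mem (h.EB_mem i j) (hX _)) ?_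
    simp only [hParity, fullParity]
    have : ∀ a b : ZMod 2, a + b + 1 + b = a + 1 := by decide
    exact this _ _
  all_goals
    refine Submodule.smul_mem _ _ (mem_parity_congr (hX _) ?_)
    simp only [hParity, fullParity, parity_add_two]

lemma d_vfQ (u : HVar ι κ₀ κ₁) (f : B) : d u (vf d (fullQ p ε₀ ε₁ d EB X) f) =
    sgn (hParity p ε₀ ε₁ u) • vf d (fullQ p ε₀ ε₁ d EB X) (d u f) +
      ∑ v, d (some v) f * d u (fullQ p ε₀ ε₁ d EB X (some v)) := by
  rw [d_vf h.superB h.partB h.fullQ_mem, mul_one, Fintype.sum_option]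
  simp [fullQ]

/-- The antibracket is symmetric on even functions, so differentiating either entry of (X, X) gives
the same result. The restriction to extra variables ensures that EB itself is not differentiated. -/
lemma double (u : HVar ι κ₀ κ₁) (hu : IsExtra u) : d u (vf d (fullQ p ε₀ ε₁ d EB X) X) =
    (2 : ℂ) • sgn (hParity p ε₀ ε₁ u) • vf d (fullQ p ε₀ ε₁ d EB X) (d u X) := by
  have hX : ∀ v, d v X ∈ PB (hParity p ε₀ ε₁ v) := fun v => by
    simpa using (h.partB.der v).mem h.X_mem
  rw [h.d_vfQ, two_smul]
  congr 1
  have h0 : d none (d u X) * fullQ p ε₀ ε₁ d EB X none = 0 := mul_zero _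
  rw [vf_apply, Fintype.sum_option, h0, zero_add, sum_fullVar, sum_fullVar]
  simp only [smul_add, Finset.smul_sum]
  -- For a field–antifield pair the two summands are interchanged; only the reordering sign has to
  -- be checked.
  have hpair : ∀ (v w : HVar ι κ₀ κ₁) (c : ZMod 2),
      hParity p ε₀ ε₁ w = hParity p ε₀ ε₁ v + 1 →
      d v X * d u (sgn c • d w X) = sgn (hParity p ε₀ ε₁ u) • (d w (d u X) * sgn c • d v X) := by
    intro v w c hvw
    rw [map_smul, mul_smul_comm, mul_smul_comm, h.partB.comm u w, mul_smul_comm,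
      h.superB.comm (hX v) ((h.partB.der w).mem ((h.partB.der u).mem h.X_mem))]
    simp only [sgn_smul_smul]
    refine sgn_smul_congr ?_ rfl
    rw [hvw]
    have : ∀ a b c : ZMod 2, c + (b * (a + 1) + a * (0 + b + (a + 1))) = b + c := by decide
    exact this _ _ _
  congr 1
  · congr 1
    · congr 1
      -- On Γ_ext the symmetry comes from reversing three factors together with the skew symmetry of
      -- EB.
      · have e1 : ∀ i j, d (some (.ext i)) X * d u (sgn (extParity p ε₁ j) •
            (EB i j * d (some (.ext j)) X)) = sgn (hParity p ε₀ ε₁ u) •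
            (d (some (.ext j)) (d u X) * sgn (extParity p ε₁ i) •
              (EB j i * d (some (.ext i)) X)) := by
          intro i j
          have hi := hX (some (.ext i))
          have hj := (h.partB.der (some (.ext j))).mem ((h.partB.der u).mem h.X_mem)
          have hm := h.superB.comm3 hi (h.EB_mem i j) hj
          rw [map_smul, (h.partB.der u).leib _ _ (hX _), h.d_EB u i j hu, zero_mul, smul_zero,
            add_zero, h.partB.comm u, mul_smul_comm, mul_smul_comm, mul_smul_comm, ← mul_assoc, hm,
            h.EB_skew i j, mul_smul_comm, neg_eq_sgn_smul]
          simp only [smul_mul_assoc, mul_smul_comm, sgn_smul_smul, mul_assoc]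
          refine sgn_smul_congr ?_ rfl
          simp only [hParity, fullParity]
          generalize extParity p ε₁ i = a
          generalize extParity p ε₁ j = b
          have : ∀ a b u : ZMod 2, b + (u * b + (a * (a + b + 1) + a * (0 + u + b) +
            (a + b + 1) * (0 + u + b))) = u + (a + (1 + (a + 1) * (b + 1))) := by decide
          exact this _ _ _
        have e2 : ∀ i, d (some (.ext i)) X * d u (fullQ p ε₀ ε₁ d EB X (some (.ext i))) =
            ∑ j, sgn (hParity p ε₀ ε₁ u) •
            (d (some (.ext j)) (d u X) * sgn (extParity p ε₁ i) •
              (EB j i * d (some (.ext i)) X)) := by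
          intro i
          rw [fullQ, map_sum, Finset.mul_sum]
          exact Finset.sum_congr rfl fun j _ => e1 i j
        simp only [e2]
        rw [Finset.sum_comm]
        simp only [fullQ, Finset.mul_sum, Finset.smul_sum]
      · refine Finset.sum_congr rfl fun a _ => ?_
        rw [add_comm]
        exact congrArg₂ _ (hpair (some (.lamS a)) (some (.lam a)) _ (parity_add_two _).symm)
          (hpair (some (.lam a)) (some (.lamS a)) _ rfl)
    · refine Finset.sum_congr rfl fun a _ => ?_
      rw [add_comm]
      exact congrArg₂ _ (hpair (some (.ghS a)) (some (.gh a)) _ rfl)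
        (hpair (some (.gh a)) (some (.ghS a)) _ (parity_add_two _).symm)
  · refine Finset.sum_congr rfl fun a _ => ?_
    rw [add_comm]
    exact congrArg₂ _ (hpair (some (.aghS a)) (some (.agh a)) _ rfl)
      (hpair (some (.agh a)) (some (.aghS a)) _ (parity_add_two _).symm)

/-- Derivatives of the master equation are multiples of `ħ`. -/
lemma master_d (v : FullVar ι κ₀ κ₁) (hv : IsExtra (some v)) :
    ∃ y, vf d (fullQ p ε₀ ε₁ d EB X) (d (some v) X) = x none * y := by
  have h1 := h.double (some v) hv
  rw [h.master, map_smul, h.superB.even_comm (h.x_mem none), (h.partB.der _).leib _ _ (h.x_mem none),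
    h.d_x, if_neg (by simp), mul_zero, zero_add] at h1
  refine ⟨sgn (hParity p ε₀ ε₁ (some v)) • (2 : ℂ)⁻¹ • Complex.I •
    sgn (hParity p ε₀ ε₁ (some v) * hParity p ε₀ ε₁ none) • d (some v)
    ((∑ v, d (some v) (fullQ p ε₀ ε₁ d EB X (some v))) +
      ρ' * vf d (fullQ p ε₀ ε₁ d EB X) ρ), ?_⟩
  rw [h.superB.even_comm (h.x_mem none), smul_mul_assoc, smul_mul_assoc, smul_mul_assoc,
    smul_mul_assoc]
  exact sgn_smul_eq_iff.1 ((inv_smul_eq_iff₀ (two_ne_zero)).2 h1).symm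

lemma d_hbar_mul (u : FullVar ι κ₀ κ₁) (y : B) :
    ∃ z, d (some u) (x none * y) = x none * z := by
  refine ⟨d (some u) y, ?_⟩
  rw [h.superB.even_comm (h.x_mem none), (h.partB.der _).leib _ _ (h.x_mem none), h.d_x,
    if_neg (by simp), mul_zero, zero_add, h.superB.even_comm (h.x_mem none)]
  simp [hParity]

lemma s_hbar_mul (y : B) : s (x none * y) = 0 := by
  rw [map_mul, h.s_x none trivial, zero_mul]

end IsFullTheory

end fulltheory

/-! ### Identities read off from the lowest coefficients of the master equation -/

section extraction

variable {ι κ₀ κ₁ : Type*}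
  {A : Type*} [Ring A] [Algebra ℂ A] {P : ZMod 2 → Submodule ℂ A}
  {B : Type*} [Ring B] [Algebra ℂ B] {PB : ZMod 2 → Submodule ℂ B}
  [Fintype ι] [Fintype κ₀] [Fintype κ₁] [DecidableEq κ₀] [DecidableEq κ₁]
  {p : ι → ZMod 2} {ε₀ : κ₀ → ZMod 2} {ε₁ : κ₁ → ZMod 2}
  {dA : ExtVar ι κ₁ → A →ₗ[ℂ] A} {d : HVar ι κ₀ κ₁ → B →ₗ[ℂ] B} {x : HVar ι κ₀ κ₁ → B}
  {s : B →ₐ[ℂ] A} {EA : ExtVar ι κ₁ → ExtVar ι κ₁ → A} {EB : ExtVar ι κ₁ → ExtVar ι κ₁ → B}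
  {ρ ρ' X : B}

/-- The constraints `𝓖_{α₀}`. -/
def cG (d : HVar ι κ₀ κ₁ → B →ₗ[ℂ] B) (s : B →ₐ[ℂ] A) (X : B) (a : κ₀) : A :=
  s (d (some (.lam a)) X)

/-- The constraints `𝓖_{α₁}`. -/
def cG₁ (d : HVar ι κ₀ κ₁ → B →ₗ[ℂ] B) (s : B →ₐ[ℂ] A) (X : B) (α : κ₁) : A :=
  -s (d (some (.aghS α)) X)

/-- The ghost matrix. -/
def cΔ (ε₁ : κ₁ → ZMod 2) (d : HVar ι κ₀ κ₁ → B →ₗ[ℂ] B) (s : B →ₐ[ℂ] A) (X : B) :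
    Matrix κ₁ κ₁ A :=
  Matrix.of fun α β => sgn (ε₁ α + 1) • s (d (some (.gh β)) (d (some (.agh α)) X))

/-- The coefficient of the ghosts in the transformation of the Lagrange multipliers. -/
def cZ (ε₀ : κ₀ → ZMod 2) (ε₁ : κ₁ → ZMod 2) (d : HVar ι κ₀ κ₁ → B →ₗ[ℂ] B) (s : B →ₐ[ℂ] A)
    (X : B) : Matrix κ₀ κ₁ A :=
  Matrix.of fun b β => sgn (1 + ε₁ β + ε₀ b * ε₁ β) •
    s (d (some (.lamS b)) (d (some (.gh β)) X))

/-- The structure functions of the constraint algebra. -/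
def cU (ε₀ : κ₀ → ZMod 2) (d : HVar ι κ₀ κ₁ → B →ₗ[ℂ] B) (s : B →ₐ[ℂ] A)
    (X : B) (a : κ₀) : Matrix κ₀ κ₀ A :=
  Matrix.of fun c b => sgn (ε₀ b * (ε₀ a + 1) + (ε₀ a + 1) + 1 + ε₀ c * (ε₀ b + (ε₀ a + 1))) •
    s (d (some (.lamS c)) (d (some (.lam a)) (d (some (.lam b)) X)))

/-- The coefficients of the secondary constraints in the constraint algebra. -/
def cW (ε₀ : κ₀ → ZMod 2) (ε₁ : κ₁ → ZMod 2) (d : HVar ι κ₀ κ₁ → B →ₗ[ℂ] B) (s : B →ₐ[ℂ] A)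
    (X : B) (a : κ₀) : Matrix κ₁ κ₀ A :=
  Matrix.of fun α b => sgn (ε₀ b * (ε₀ a + 1) + (ε₀ a + 1) + 1 + ε₁ α * (ε₀ b + (ε₀ a + 1))) •
    s (d (some (.agh α)) (d (some (.lam a)) (d (some (.lam b)) X)))

/-- The coefficients in the transformation of the ghosts. -/
def cV (ε₀ : κ₀ → ZMod 2) (ε₁ : κ₁ → ZMod 2) (d : HVar ι κ₀ κ₁ → B →ₗ[ℂ] B) (s : B →ₐ[ℂ] A)
    (X : B) (a : κ₀) : Matrix κ₁ κ₁ A :=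
  Matrix.of fun γ β => sgn (ε₁ β * (ε₀ a + 1) + ε₁ β) •
    s (d (some (.lam a)) (d (some (.gh β)) (sgn (ε₁ γ) • d (some (.ghS γ)) X)))

/-- The coefficients in the transformation of the antighosts. -/
def cY (ε₀ : κ₀ → ZMod 2) (ε₁ : κ₁ → ZMod 2) (d : HVar ι κ₀ κ₁ → B →ₗ[ℂ] B) (s : B →ₐ[ℂ] A)
    (X : B) (a : κ₀) : Matrix κ₁ κ₁ A :=
  Matrix.of fun α γ => sgn (ε₁ α + (ε₀ a + 1 + 1) * ε₁ γ) •
    s (d (some (.lam a)) (d (some (.aghS γ)) (d (some (.agh α)) X)))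

namespace IsFullTheory

variable (h : IsFullTheory P PB p ε₀ ε₁ dA d x s EA EB ρ ρ' X)
include h

lemma kill {k : ℂ} {f : B} (hf : HasPlanck d x k f) (v : HVar ι κ₀ κ₁) (hk : k ≠ hPlanck v) :
    s (d v f) = 0 :=
  h.s_eq_zero (h.hasPlanck_d hf v) (sub_ne_zero.2 hk)

lemma dX_mem (v : HVar ι κ₀ κ₁) : d v X ∈ PB (hParity p ε₀ ε₁ v) := by
  simpa using (h.partB.der v).mem h.X_mem

lemma ddX_mem (u v : HVar ι κ₀ κ₁) :
    d u (d v X) ∈ PB (hParity p ε₀ ε₁ v + hParity p ε₀ ε₁ u) :=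
  (h.partB.der u).mem (h.dX_mem v)

lemma dddX_mem (w u v : HVar ι κ₀ κ₁) :
    d w (d u (d v X)) ∈ PB (hParity p ε₀ ε₁ v + hParity p ε₀ ε₁ u + hParity p ε₀ ε₁ w) :=
  (h.partB.der w).mem (h.ddX_mem u v)

lemma cG_mem (a : κ₀) : cG d s X a ∈ P (ε₀ a) := h.s_mem (h.dX_mem (some (.lam a)))

lemma cG₁_mem (α : κ₁) : cG₁ d s X α ∈ P (ε₁ α) :=
  Submodule.neg_mem _ (h.s_mem (h.dX_mem (some (.aghS α))))

lemma cΔ_sm : IsSM P ε₁ ε₁ 0 (cΔ ε₁ d s X) := fun α β =>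
  Submodule.smul_mem _ _ (mem_parity_congr (h.s_mem (h.ddX_mem _ _)) (by
    simp only [hParity, fullParity]
    have : ∀ a b : ZMod 2, a + 1 + (b + 1) = a + b + 0 := by decide
    exact this _ _))

lemma cZ_sm : IsSM P ε₀ ε₁ 0 (cZ ε₀ ε₁ d s X) := fun α β =>
  Submodule.smul_mem _ _ (mem_parity_congr (h.s_mem (h.ddX_mem _ _)) (by
    simp only [hParity, fullParity]
    have : ∀ a b : ZMod 2, b + 1 + (a + 1) = a + b + 0 := by decide
    exact this _ _))

lemma cU_sm (a : κ₀) : IsSM P ε₀ ε₀ (ε₀ a + 1) (cU ε₀ d s X a) := fun α β =>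
  Submodule.smul_mem _ _ (mem_parity_congr (h.s_mem (h.dddX_mem _ _ _)) (by
    simp only [hParity, fullParity]
    ring))

lemma cW_sm (a : κ₀) : IsSM P ε₁ ε₀ (ε₀ a + 1) (cW ε₀ ε₁ d s X a) := fun α β =>
  Submodule.smul_mem _ _ (mem_parity_congr (h.s_mem (h.dddX_mem _ _ _)) (by
    simp only [hParity, fullParity]
    ring))

lemma cV_sm (a : κ₀) : IsSM P ε₁ ε₁ (ε₀ a + 1) (cV ε₀ ε₁ d s X a) := fun α β =>
  Submodule.smul_mem _ _ (by
    simp only [map_smul]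
    exact Submodule.smul_mem _ _ (mem_parity_congr (h.s_mem (h.dddX_mem _ _ _)) (by
      simp only [hParity, fullParity]
      ring)))

lemma cY_sm (a : κ₀) : IsSM P ε₁ ε₁ (ε₀ a + 1) (cY ε₀ ε₁ d s X a) := fun α β =>
  Submodule.smul_mem _ _ (mem_parity_congr (h.s_mem (h.dddX_mem _ _ _)) (by
    simp only [hParity, fullParity]
    ring))

/-- On the slice only the constraints survive in the vector field `(·, X)`. -/
lemma s_vfQ (f : B) : s (vf d (fullQ p ε₀ ε₁ d EB X) f) =
    ∑ c, sgn (ε₀ c + 1) • (s (d (some (.lamS c)) f) * cG d s X c) -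
      ∑ α, sgn (ε₁ α) • (s (d (some (.agh α)) f) * cG₁ d s X α) := by
  -- As X has Planck number 1, its first derivatives survive on the slice only in the directions ħ,
  -- λ and c̄*. The field has no ħ component, so the constraints remain.
  have hk : ∀ v, hPlanck v ≠ 1 → s (d v X) = 0 := fun v hv => h.kill h.hasPlanck_X v hv.symm
  have h1 : ∀ i, s (fullQ p ε₀ ε₁ d EB X (some (.ext i))) = 0 := fun i => by
    rw [fullQ, map_sum]
    refine Finset.sum_eq_zero fun j _ => ?_
    rw [map_smul, map_mul, hk (some (.ext j)) (by simp [hPlanck, planckNumber])]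
    simp
  rw [vf_apply, map_sum, Fintype.sum_option, sum_fullVar]
  simp only [map_mul, h1, mul_zero, Finset.sum_const_zero, zero_add]
  simp only [fullQ, map_zero, mul_zero, map_smul, zero_add,
    hk (some (.lamS _)) (by norm_num [hPlanck, planckNumber]),
    hk (some (.ghS _)) (by norm_num [hPlanck, planckNumber]),
    hk (some (.gh _)) (by norm_num [hPlanck, planckNumber]),
    hk (some (.agh _)) (by norm_num [hPlanck, planckNumber]), smul_zero, add_zero,
    Finset.sum_const_zero]
  simp only [sub_eq_add_neg, ← Finset.sum_neg_distrib, cG, cG₁, mul_smul_comm, mul_neg, smul_neg,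
    neg_neg]

lemma s_vfQ_mem (hG₁ : ∀ α, cG₁ d s X α ∈ gIdeal (cG d s X)) (f : B) :
    s (vf d (fullQ p ε₀ ε₁ d EB X) f) ∈ gIdeal (cG d s X) := by
  rw [h.s_vfQ]
  exact Submodule.sub_mem _
    (Submodule.sum_mem _ fun c _ => Submodule.smul_mem _ _
      (gIdeal_mul_left h.superA h.cG_mem (gIdeal_gen c) _))
    (Submodule.sum_mem _ fun c _ => Submodule.smul_mem _ _
      (gIdeal_mul_left h.superA h.cG_mem (hG₁ c) _))

/-- The constraints are reducible. -/
lemma reducibility (β : κ₁) :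
    ∑ α, cG₁ d s X α * cΔ ε₁ d s X α β = ∑ b, cG d s X b * cZ ε₀ ε₁ d s X b β := by
  -- The coefficient of a single ghost c^β in the master equation, at ħ = 0.
  obtain ⟨y, hy⟩ := h.master_d (.gh β) trivial
  have h1 := congrArg s hy
  rw [h.s_hbar_mul, h.s_vfQ, sub_eq_zero] at h1
  have h2 := congrArg (sgn (ε₁ β) • ·) h1
  simp only [Finset.smul_sum] at h2
  rw [eq_comm]
  convert h2 using 1
  · refine Finset.sum_congr rfl fun b _ => ?_
    have := h.superA.comm (h.s_mem (h.ddX_mem (some (.lamS b)) (some (.gh β)))) (h.cG_mem b)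
    rw [this, cZ, Matrix.of_apply, mul_smul_comm, sgn_smul_smul, sgn_smul_smul]
    refine sgn_smul_congr ?_ rfl
    simp only [hParity, fullParity]
    have : ∀ a b : ZMod 2, 1 + b + a * b = b + (a + 1 + (b + 1 + (a + 1)) * a) := by decide
    linear_combination this (ε₀ b) (ε₁ β)
  · refine Finset.sum_congr rfl fun α _ => ?_
    have := h.superA.comm (h.s_mem (h.ddX_mem (some (.agh α)) (some (.gh β)))) (h.cG₁_mem α)
    rw [this, h.partB.comm (some (.agh α)), map_smul, cΔ, Matrix.of_apply, mul_smul_comm,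
      mul_smul_comm, sgn_smul_smul, sgn_smul_smul, sgn_smul_smul]
    refine sgn_smul_congr ?_ rfl
    simp only [hParity, fullParity]
    have : ∀ a b : ZMod 2, a + 1 = b + (a + ((b + 1 + (a + 1)) * a + (a + 1) * (b + 1))) := by decide
    linear_combination this (ε₁ α) (ε₁ β)

/-- Multiplying the reducibility relation by the inverse ghost matrix solves it for the secondary
constraints. -/
lemma cG₁_mem_gIdeal {Δ' : Matrix κ₁ κ₁ A} (hΔ : cΔ ε₁ d s X * Δ' = 1) (α : κ₁) :
    cG₁ d s X α ∈ gIdeal (cG d s X) := by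
  have h1 : ∑ β, (∑ γ, cG₁ d s X γ * cΔ ε₁ d s X γ β) * Δ' β α = cG₁ d s X α := by
    simp only [Finset.sum_mul, mul_assoc]
    rw [Finset.sum_comm]
    simp only [← Finset.mul_sum, ← Matrix.mul_apply, hΔ, Matrix.one_apply]
    simp
  rw [← h1]
  refine Submodule.sum_mem _ fun β _ => gIdeal_mul_right ?_ _
  rw [h.reducibility]
  exact Submodule.sum_mem _ fun b _ => gIdeal_gen_mul b _

/-- The first-order part in `λ` of the vector field is Hamiltonian on the extended variables. -/
lemma s_d_lam_fullQ_ext (a : κ₀) (i : ExtVar ι κ₁) :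
    s (d (some (.lam a)) (fullQ p ε₀ ε₁ d EB X (some (.ext i)))) =
      ham (extParity p ε₁) dA EA (ε₀ a + 1) (cG d s X a) i := by
  rw [fullQ, map_sum, map_sum, ham]
  refine Finset.sum_congr rfl fun j _ => ?_
  rw [map_smul, (h.partB.der _).leib _ _ (h.dX_mem (some (.ext j))), h.d_EB (some (.lam a)) i j trivial, zero_mul,
    smul_zero, add_zero, h.partB.comm (some (.lam a))]
  simp only [mul_smul_comm, sgn_smul_smul, map_mul, map_smul, h.s_d, h.s_EB]
  refine sgn_smul_congr ?_ rfl
  simp only [hParity, fullParity]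
  have : ∀ a b : ZMod 2, b + a * b = b * (a + 1) := by decide
  exact this _ _

/-- The λ-derivative of (f, X) falls on f or on the components of the field. In the second case `hf`
leaves only the Γ_ext components, and there the linear part of the field is the Hamiltonian field of
the constraint. -/
lemma s_d_lam_vfQ (a : κ₀) (f : B) (hf : ∀ v : FullVar ι κ₀ κ₁, hPlanck (some v) ≠ 0 →
      s (d (some v) f) = 0) :
    s (d (some (.lam a)) (vf d (fullQ p ε₀ ε₁ d EB X) f)) =
      sgn (ε₀ a) • s (vf d (fullQ p ε₀ ε₁ d EB X) (d (some (.lam a)) f)) +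
      hamG (extParity p ε₁) dA EA ε₀ (cG d s X) a (s f) := by
  rw [h.d_vfQ, map_add, map_smul]
  congr 1
  rw [map_sum, sum_fullVar, hamG, vf_apply]
  simp only [map_mul, hf (.lam _) (by norm_num [hPlanck, planckNumber]),
    hf (.lamS _) (by norm_num [hPlanck, planckNumber]),
    hf (.gh _) (by norm_num [hPlanck, planckNumber]),
    hf (.ghS _) (by norm_num [hPlanck, planckNumber]),
    hf (.agh _) (by norm_num [hPlanck, planckNumber]),
    hf (.aghS _) (by norm_num [hPlanck, planckNumber]), zero_mul, add_zero, Finset.sum_const_zero]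
  refine Finset.sum_congr rfl fun i _ => ?_
  rw [h.s_d, h.s_d_lam_fullQ_ext]

/-- The constraint algebra. -/
lemma constraint_algebra (a b : κ₀) :
    sgn (ε₀ b * (ε₀ a + 1)) • hamG (extParity p ε₁) dA EA ε₀ (cG d s X) a (cG d s X b) =
      ∑ c, cG d s X c * cU ε₀ d s X a c b + ∑ α, cG₁ d s X α * cW ε₀ ε₁ d s X a α b := by
  -- The part of the master equation quadratic in λ, at ħ = 0.
  obtain ⟨y, hy⟩ := h.master_d (.lam b) trivial
  obtain ⟨z, hz⟩ := h.d_hbar_mul (.lam a) y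
  have h1 := congrArg s (congrArg (d (some (.lam a))) hy)
  rw [hz, h.s_hbar_mul, h.s_d_lam_vfQ a _ (fun v hv => h.kill (h.hasPlanck_d h.hasPlanck_X _) _ (by
    simpa [hPlanck, planckNumber] using hv.symm)), add_comm, add_eq_zero_iff_eq_neg] at h1
  change hamG (extParity p ε₁) dA EA ε₀ (cG d s X) a (cG d s X b) = _ at h1
  rw [h1, h.s_vfQ, neg_eq_sgn_smul, sgn_smul_smul, sgn_smul_smul, smul_sub, sub_eq_add_neg]
  congr 1
  · rw [Finset.smul_sum]
    refine Finset.sum_congr rfl fun c _ => ?_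
    rw [h.superA.comm (h.s_mem (h.dddX_mem (some (.lamS c)) (some (.lam a)) (some (.lam b))))
      (h.cG_mem c), cU, Matrix.of_apply, mul_smul_comm, sgn_smul_smul, sgn_smul_smul]
    refine sgn_smul_congr ?_ rfl
    simp only [hParity, fullParity]
    have : ∀ a b c : ZMod 2, b * (a + 1) + (1 + a) + (c + 1 + (b + a + (c + 1)) * c) =
      b * (a + 1) + (a + 1) + 1 + c * (b + (a + 1)) := by decide
    linear_combination this (ε₀ a) (ε₀ b) (ε₀ c)
  · rw [Finset.smul_sum, ← Finset.sum_neg_distrib]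
    refine Finset.sum_congr rfl fun c _ => ?_
    rw [h.superA.comm (h.s_mem (h.dddX_mem (some (.agh c)) (some (.lam a)) (some (.lam b))))
      (h.cG₁_mem c), cW, Matrix.of_apply, mul_smul_comm, sgn_smul_smul, sgn_smul_smul,
      neg_eq_sgn_smul, sgn_smul_smul]
    refine sgn_smul_congr ?_ rfl
    simp only [hParity, fullParity]
    have : ∀ a b c : ZMod 2, 1 + (b * (a + 1) + (1 + a) + (c + (b + a + (c + 1)) * c)) =
      b * (a + 1) + (a + 1) + 1 + c * (b + (a + 1)) := by decide
    linear_combination this (ε₀ a) (ε₀ b) (ε₁ c)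

/-- The transformation of the ghost matrix along a constraint, on shell. -/
lemma ghost_matrix_der (hG₁ : ∀ α, cG₁ d s X α ∈ gIdeal (cG d s X)) (a : κ₀) (α β : κ₁) :
    (twD (ε₀ a + 1) ε₁ (hamG (extParity p ε₁) dA EA ε₀ (cG d s X) a) (cΔ ε₁ d s X) -
      (cW ε₀ ε₁ d s X a * cZ ε₀ ε₁ d s X + cΔ ε₁ d s X * cV ε₀ ε₁ d s X a +
        cY ε₀ ε₁ d s X a * cΔ ε₁ d s X)) α β ∈ gIdeal (cG d s X) := by
  -- The coefficient of λ c c̄ in the master equation, at ħ = 0.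
  obtain ⟨y, hy⟩ := h.master_d (.agh α) trivial
  obtain ⟨z, hz⟩ := h.d_hbar_mul (.gh β) y
  obtain ⟨w, hw⟩ := h.d_hbar_mul (.lam a) z
  have hp2 : HasPlanck d x 0 (d (some (.gh β)) (d (some (.agh α)) X)) := by
    have := h.hasPlanck_d (h.hasPlanck_d h.hasPlanck_X (some (.agh α))) (some (.gh β))
    norm_num [hPlanck, planckNumber] at this
    exact this
  have hp1 : HasPlanck d x 2 (d (some (.agh α)) X) := by
    have := h.hasPlanck_d h.hasPlanck_X (some (.agh α))
    norm_num [hPlanck, planckNumber] at this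
    exact this
  have hp3 : ∀ v : FullVar ι κ₀ κ₁, hPlanck (some v) ≠ 1 →
      s (d (some (.lam a)) (d (some v) (d (some (.agh α)) X))) = 0 := fun v hv =>
    h.kill (h.hasPlanck_d hp1 _) _ (by
      intro he
      apply hv
      have : (2 : ℂ) - 1 = 1 := by norm_num
      simp only [hPlanck, planckNumber] at he ⊢
      linear_combination -he)
  have h1 := congrArg s (congrArg (d (some (.lam a))) (congrArg (d (some (.gh β))) hy))
  rw [hz, hw, h.s_hbar_mul, h.d_vfQ, map_add, map_smul, map_add, map_smul,
    h.s_d_lam_vfQ a _ (fun v hv => h.kill hp2 _ hv.symm), map_sum, map_sum] at h1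
  have h2 : ∀ v : FullVar ι κ₀ κ₁, s (d (some (.lam a)) (d (some v) (d (some (.agh α)) X) *
      d (some (.gh β)) (fullQ p ε₀ ε₁ d EB X (some v)))) =
      s (d (some v) (d (some (.agh α)) X)) *
        s (d (some (.lam a)) (d (some (.gh β)) (fullQ p ε₀ ε₁ d EB X (some v)))) +
      sgn (ε₀ a * (fullParity p ε₀ ε₁ v + 1 + (ε₁ β + 1))) •
        (s (d (some (.lam a)) (d (some v) (d (some (.agh α)) X))) *
          s (d (some (.gh β)) (fullQ p ε₀ ε₁ d EB X (some v)))) := by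
    intro v
    rw [(h.partB.der _).leib _ _ ((h.partB.der (some (.gh β))).mem (h.fullQ_mem (some v))), map_add,
      map_smul, map_mul, map_mul]
    rfl
  -- Selection rules for the products: a first derivative of ∂X/∂c̄, which has Planck number 2,
  -- survives only along c, and after a further λ-derivative only along λ and c̄*. These three cases
  -- produce Δ V, W Z and Y Δ.
  have hk1 : ∀ v : FullVar ι κ₀ κ₁, hPlanck (some v) ≠ 2 →
      s (d (some v) (d (some (.agh α)) X)) = 0 := fun v hv => h.kill hp1 _ hv.symm
  simp only [h2, Finset.sum_add_distrib] at h1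
  rw [sum_fullVar, sum_fullVar] at h1
  simp only [hk1 (.ext _) (by norm_num [hPlanck, planckNumber]),
    hk1 (.lam _) (by norm_num [hPlanck, planckNumber]),
    hk1 (.lamS _) (by norm_num [hPlanck, planckNumber]),
    hk1 (.ghS _) (by norm_num [hPlanck, planckNumber]),
    hk1 (.agh _) (by norm_num [hPlanck, planckNumber]),
    hk1 (.aghS _) (by norm_num [hPlanck, planckNumber]),
    hp3 (.ext _) (by norm_num [hPlanck, planckNumber]),
    hp3 (.lamS _) (by norm_num [hPlanck, planckNumber]),
    hp3 (.gh _) (by norm_num [hPlanck, planckNumber]),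
    hp3 (.ghS _) (by norm_num [hPlanck, planckNumber]),
    hp3 (.agh _) (by norm_num [hPlanck, planckNumber]),
    zero_mul, add_zero, zero_add, smul_zero, Finset.sum_const_zero] at h1
  -- The term in which all three derivatives act on X before the field is applied is proportional to
  -- the constraints. It is the whole error modulo the ideal.
  have hc : (sgn (ε₁ β * (ε₀ a + 1) + (ε₁ α + 1) + (ε₁ β + 1))) • (sgn (ε₁ β + 1) •
      (sgn (ε₀ a) • s (vf d (fullQ p ε₀ ε₁ d EB X) (d (some (.lam a)) (d (some (.gh β))
        (d (some (.agh α)) X)))))) ∈ gIdeal (cG d s X) :=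
    Submodule.smul_mem _ _ (Submodule.smul_mem _ _ (Submodule.smul_mem _ _ (h.s_vfQ_mem hG₁ _)))
  have h3 := congrArg (sgn (ε₁ β * (ε₀ a + 1) + (ε₁ α + 1) + (ε₁ β + 1)) • ·) h1
  simp only [smul_zero, smul_add, Finset.smul_sum] at h3
  rw [← Submodule.neg_mem_iff]
  convert hc using 1
  rw [Matrix.sub_apply, Matrix.add_apply, Matrix.add_apply, Matrix.mul_apply, Matrix.mul_apply,
    Matrix.mul_apply, twD, Matrix.of_apply]
  have e1 : sgn (ε₁ β * (ε₀ a + 1)) • hamG (extParity p ε₁) dA EA ε₀ (cG d s X) a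
      (cΔ ε₁ d s X α β) = sgn (ε₁ β * (ε₀ a + 1) + (ε₁ α + 1) + (ε₁ β + 1)) • sgn (ε₁ β + 1) •
      hamG (extParity p ε₁) dA EA ε₀ (cG d s X) a
        (s (d (some (.gh β)) (d (some (.agh α)) X))) := by
    rw [cΔ, Matrix.of_apply, map_smul, sgn_smul_smul, sgn_smul_smul]
    refine sgn_smul_congr ?_ rfl
    have : ∀ a b c : ZMod 2, b * (a + 1) + (c + 1) = b * (a + 1) + (c + 1) + (b + 1) + (b + 1) := by
      decide
    exact this _ _ _
  have e2 : ∀ b, cW ε₀ ε₁ d s X a α b * cZ ε₀ ε₁ d s X b β =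
      -(sgn (ε₁ β * (ε₀ a + 1) + (ε₁ α + 1) + (ε₁ β + 1)) •
        sgn (ε₀ a * (ε₀ b + 1 + (ε₁ β + 1))) •
        (s (d (some (.lam a)) (d (some (.lam b)) (d (some (.agh α)) X))) *
          s (d (some (.gh β)) (sgn (ε₀ b + 1) • d (some (.lamS b)) X)))) := by
    intro b
    rw [cW, cZ, Matrix.of_apply, Matrix.of_apply, map_smul, h.partB.comm (some (.gh β)),
      h.partB.comm (some (.lam b)) (some (.agh α)), map_smul (d (some (.lam a))),
      h.partB.comm (some (.lam a)) (some (.agh α)), neg_eq_sgn_smul]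
    simp only [map_smul, smul_mul_assoc, mul_smul_comm, sgn_smul_smul]
    refine sgn_smul_congr ?_ rfl
    simp only [hParity, fullParity]
    have : ∀ a b c e : ZMod 2, 1 + e + b * e + (b * (a + 1) + (a + 1) + 1 + c * (b + (a + 1))) =
      1 + (e * (a + 1) + (c + 1) + (e + 1) + (a * (b + 1 + (e + 1)) +
        (b + 1 + (e + 1) * (b + 1) + (b * (c + 1) + a * (c + 1))))) := by decide
    linear_combination this (ε₀ a) (ε₀ b) (ε₁ α) (ε₁ β)
  have e3 : ∀ γ, cΔ ε₁ d s X α γ * cV ε₀ ε₁ d s X a γ β =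
      -(sgn (ε₁ β * (ε₀ a + 1) + (ε₁ α + 1) + (ε₁ β + 1)) •
        (s (d (some (.gh γ)) (d (some (.agh α)) X)) *
        s (d (some (.lam a)) (d (some (.gh β)) (sgn (ε₁ γ) • d (some (.ghS γ)) X))))) := by
    intro γ
    rw [cΔ, cV, Matrix.of_apply, Matrix.of_apply, neg_eq_sgn_smul]
    simp only [map_smul, smul_mul_assoc, mul_smul_comm, sgn_smul_smul]
    refine sgn_smul_congr ?_ rfl
    have : ∀ a c e f : ZMod 2, e * (a + 1) + e + (c + 1) =
      1 + (e * (a + 1) + (c + 1) + (e + 1)) := by decide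
    linear_combination this (ε₀ a) (ε₁ α) (ε₁ β) (ε₁ γ)
  have e4 : ∀ γ, cY ε₀ ε₁ d s X a α γ * cΔ ε₁ d s X γ β =
      -(sgn (ε₁ β * (ε₀ a + 1) + (ε₁ α + 1) + (ε₁ β + 1)) •
        sgn (ε₀ a * (ε₁ γ + 1 + (ε₁ β + 1))) •
        (s (d (some (.lam a)) (d (some (.aghS γ)) (d (some (.agh α)) X))) *
          s (d (some (.gh β)) (sgn (ε₁ γ) • d (some (.agh γ)) X)))) := by
    intro γ
    rw [cΔ, cY, Matrix.of_apply, Matrix.of_apply, neg_eq_sgn_smul]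
    simp only [map_smul, smul_mul_assoc, mul_smul_comm, sgn_smul_smul]
    refine sgn_smul_congr ?_ rfl
    have : ∀ a c e f : ZMod 2, f + 1 + (c + (a + 1 + 1) * f) =
      1 + (e * (a + 1) + (c + 1) + (e + 1) + (a * (f + 1 + (e + 1)) + f)) := by decide
    linear_combination this (ε₀ a) (ε₁ α) (ε₁ β) (ε₁ γ)
  simp only [e1, e2, e3, e4, Finset.sum_neg_distrib]
  simp only [hParity, fullParity, fullQ] at h3 ⊢
  rw [eq_comm, ← sub_eq_zero, ← h3]
  abel

lemma bracket_mem_gIdeal {Δ' : Matrix κ₁ κ₁ A} (hΔ : cΔ ε₁ d s X * Δ' = 1) (a b : κ₀) :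
    hamG (extParity p ε₁) dA EA ε₀ (cG d s X) a (cG d s X b) ∈ gIdeal (cG d s X) := by
  have h1 := h.constraint_algebra a b
  rw [show hamG (extParity p ε₁) dA EA ε₀ (cG d s X) a (cG d s X b) =
    sgn (ε₀ b * (ε₀ a + 1)) • sgn (ε₀ b * (ε₀ a + 1)) •
      hamG (extParity p ε₁) dA EA ε₀ (cG d s X) a (cG d s X b) by
    rw [smul_smul, sgn_mul_self, one_smul], h1]
  exact Submodule.smul_mem _ _ (Submodule.add_mem _
    (Submodule.sum_mem _ fun c _ => gIdeal_gen_mul c _)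
    (Submodule.sum_mem _ fun α _ => gIdeal_mul_right (h.cG₁_mem_gIdeal hΔ α) _))

lemma s_d_lam_pair (a : κ₀) (v w : FullVar ι κ₀ κ₁) (k : ZMod 2)
    (hvw : fullParity p ε₀ ε₁ v * fullParity p ε₀ ε₁ w = 0) :
    s (d (some (.lam a)) (d (some v) (sgn k • d (some w) X))) =
      s (d (some (.lam a)) (d (some w) (sgn k • d (some v) X))) := by
  rw [map_smul, map_smul, h.partB.comm (some v)]
  simp only [hParity, hvw, sgn_zero, one_smul, map_smul]

/-- The divergence of `(·, X)` to first order in `λ`. -/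
lemma s_d_lam_div (a : κ₀) :
    s (d (some (.lam a)) (∑ v, d (some v) (fullQ p ε₀ ε₁ d EB X (some v)))) =
      (∑ i, sgn (extParity p ε₁ i * (1 + (ε₀ a + 1))) •
        dA i (ham (extParity p ε₁) dA EA (ε₀ a + 1) (cG d s X a) i)) -
      (2 : ℂ) • (sTr ε₀ (ε₀ a + 1) (cU ε₀ d s X a) - sTr ε₁ (ε₀ a + 1) (cV ε₀ ε₁ d s X a) -
        sTr ε₁ (ε₀ a + 1) (cY ε₀ ε₁ d s X a)) := by
  have hz : ∀ b : ZMod 2, b * (b + 1) = 0 := by decide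
  have hz' : ∀ b : ZMod 2, (b + 1) * b = 0 := by decide
  have h1 : ∀ i, s (d (some (.lam a)) (d (some (.ext i)) (fullQ p ε₀ ε₁ d EB X (some (.ext i))))) =
      sgn (extParity p ε₁ i * (1 + (ε₀ a + 1))) •
        dA i (ham (extParity p ε₁) dA EA (ε₀ a + 1) (cG d s X a) i) := by
    intro i
    rw [h.partB.comm (some (.lam a)), map_smul, h.s_d, h.s_d_lam_fullQ_ext]
    refine sgn_smul_congr ?_ rfl
    simp only [hParity, fullParity]
    have : ∀ a b : ZMod 2, a * b = b * (1 + (a + 1)) := by decide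
    exact this _ _
  -- Both members of a conjugate pair contribute the same mixed second derivative of X; this is the
  -- origin of the factor 2 here and in `h3` and `h4`.
  have h2 : ∑ b, (s (d (some (.lam a)) (d (some (.lam b)) (sgn (ε₀ b + 1) • d (some (.lamS b)) X))) +
      s (d (some (.lam a)) (d (some (.lamS b)) (sgn (ε₀ b + 1) • d (some (.lam b)) X)))) =
      -((2 : ℂ) • sTr ε₀ (ε₀ a + 1) (cU ε₀ d s X a)) := by
    rw [sTr, Finset.smul_sum, ← Finset.sum_neg_distrib]
    refine Finset.sum_congr rfl fun b _ => ?_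
    rw [h.s_d_lam_pair a (.lam b) (.lamS b) _ (hz _), ← two_smul ℂ, cU, Matrix.of_apply,
      map_smul, h.partB.comm (some (.lamS b)) (some (.lam a)), ← smul_neg, neg_eq_sgn_smul]
    simp only [map_smul, sgn_smul_smul]
    rw [h.partB.comm (some (.lam a)) (some (.lamS b))]
    simp only [map_smul, sgn_smul_smul]
    congr 1
    refine sgn_smul_congr ?_ rfl
    simp only [hParity, fullParity]
    have : ∀ a b : ZMod 2, b + 1 + a * (b + 1) = 1 + (b * (1 + (a + 1)) +
      (b * (a + 1) + (a + 1) + 1 + b * (b + (a + 1))) + (b + 1) * a + a * (b + 1)) := by decide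
    linear_combination this (ε₀ a) (ε₀ b)
  have h3 : ∑ α, (s (d (some (.lam a)) (d (some (.gh α)) (sgn (ε₁ α) • d (some (.ghS α)) X))) +
      s (d (some (.lam a)) (d (some (.ghS α)) (sgn (ε₁ α) • d (some (.gh α)) X)))) =
      (2 : ℂ) • sTr ε₁ (ε₀ a + 1) (cV ε₀ ε₁ d s X a) := by
    rw [sTr, Finset.smul_sum]
    refine Finset.sum_congr rfl fun α _ => ?_
    rw [h.s_d_lam_pair a (.ghS α) (.gh α) _ (hz _), ← two_smul ℂ, cV, Matrix.of_apply]
    simp only [map_smul, sgn_smul_smul]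
    congr 1
    refine sgn_smul_congr ?_ rfl
    have : ∀ a b : ZMod 2, b = b * (1 + (a + 1)) + (b * (a + 1) + b + b) := by decide
    linear_combination this (ε₀ a) (ε₁ α)
  have h4 : ∑ α, (s (d (some (.lam a)) (d (some (.agh α)) (sgn (ε₁ α) • d (some (.aghS α)) X))) +
      s (d (some (.lam a)) (d (some (.aghS α)) (sgn (ε₁ α) • d (some (.agh α)) X)))) =
      (2 : ℂ) • sTr ε₁ (ε₀ a + 1) (cY ε₀ ε₁ d s X a) := by
    rw [sTr, Finset.smul_sum]
    refine Finset.sum_congr rfl fun α _ => ?_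
    rw [h.s_d_lam_pair a (.agh α) (.aghS α) _ (hz' _), ← two_smul ℂ, cY, Matrix.of_apply]
    simp only [map_smul, sgn_smul_smul]
    congr 1
    refine sgn_smul_congr ?_ rfl
    have : ∀ a b : ZMod 2, b = b * (1 + (a + 1)) + (b + (a + 1 + 1) * b) := by decide
    linear_combination this (ε₀ a) (ε₁ α)
  rw [map_sum, map_sum, sum_fullVar]
  simp only [h1]
  simp only [fullQ]
  rw [h2, h3, h4]
  module

/-- The transformation of the one-loop term along a constraint. -/
lemma one_loop_der (hG₁ : ∀ α, cG₁ d s X α ∈ gIdeal (cG d s X)) (a : κ₀) :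
    (2 : ℂ) • hamG (extParity p ε₁) dA EA ε₀ (cG d s X) a ((1 / Complex.I) • s (d none X)) -
      (((∑ i, sgn (extParity p ε₁ i * (1 + (ε₀ a + 1))) •
        dA i (ham (extParity p ε₁) dA EA (ε₀ a + 1) (cG d s X a) i)) -
      (2 : ℂ) • (sTr ε₀ (ε₀ a + 1) (cU ε₀ d s X a) - sTr ε₁ (ε₀ a + 1) (cV ε₀ ε₁ d s X a) -
        sTr ε₁ (ε₀ a + 1) (cY ε₀ ε₁ d s X a))) +
      s ρ' * hamG (extParity p ε₁) dA EA ε₀ (cG d s X) a (s ρ)) ∈ gIdeal (cG d s X) := by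
  have hρ0 : ∀ v : FullVar ι κ₀ κ₁, IsExtra (some v) → d (some v) ρ = 0 := fun v hv => h.d_ρ _ hv
  -- Since ρ does not depend on the extra variables, the surviving directions of the field do not
  -- see it, and the λ-derivative of ρ' drops out of the product.
  have hsY : s (vf d (fullQ p ε₀ ε₁ d EB X) ρ) = 0 := by
    rw [h.s_vfQ]
    simp [hρ0 (.lamS _) trivial, hρ0 (.agh _) trivial]
  have h1m : ∀ k : ZMod 2, k + 1 + k = 1 := by decide
  have hρm : vf d (fullQ p ε₀ ε₁ d EB X) ρ ∈ PB 1 := by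
    rw [vf_apply]
    refine Submodule.sum_mem _ fun v _ => mem_parity_congr (h.superB.mul_mem
      ((h.partB.der v).mem h.ρ_mem) (h.fullQ_mem v)) ?_
    have : ∀ k : ZMod 2, 0 + k + (k + 1) = 1 := by decide
    exact this _
  have hLm : (∑ v, d (some v) (fullQ p ε₀ ε₁ d EB X (some v))) +
      ρ' * vf d (fullQ p ε₀ ε₁ d EB X) ρ ∈ PB 1 :=
    Submodule.add_mem _ (Submodule.sum_mem _ fun v _ => mem_parity_congr
      ((h.partB.der (some v)).mem (h.fullQ_mem (some v))) (h1m _))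
      (mem_parity_congr (h.superB.mul_mem h.ρ'_mem hρm) (zero_add _))
  have hρ1 : s (d (some (.lam a)) (ρ' * vf d (fullQ p ε₀ ε₁ d EB X) ρ)) =
      s ρ' * hamG (extParity p ε₁) dA EA ε₀ (cG d s X) a (s ρ) := by
    rw [(h.partB.der _).leib _ _ hρm, map_add, map_smul, map_mul, map_mul, hsY, mul_zero, smul_zero,
      add_zero, h.s_d_lam_vfQ a _ (fun v hv => ?_), hρ0 (.lam a) trivial, map_zero, map_zero, smul_zero,
      zero_add]
    rw [hρ0 v (by rcases v with _ | _ | _ | _ | _ | _ | _ <;> trivial), map_zero]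
  -- The first order in ħ. Differentiating the master equation with respect to ħ gives twice (∂X/∂ħ,
  -- X) on the left; on the right, at ħ = 0, i times the bracket of divergence and density terms.
  -- One λ-derivative then gives the identity.
  have h1 := h.double none trivial
  rw [h.master, map_smul, (h.partB.der _).leib _ _ hLm, h.d_x, if_pos rfl, one_mul] at h1
  have h2 := congrArg s (congrArg (d (some (.lam a))) h1)
  obtain ⟨z, hz⟩ := h.d_hbar_mul (.lam a) (d none ((∑ v, d (some v) (fullQ p ε₀ ε₁ d EB X (some v))) +
      ρ' * vf d (fullQ p ε₀ ε₁ d EB X) ρ))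
  have hs0 : ∀ k : ZMod 2, sgn (hParity p ε₀ ε₁ none * k) = 1 := fun k => by
    simp [hParity, sgn]
  have hp0 : HasPlanck d x 0 (d none X) := by
    have := h.hasPlanck_d h.hasPlanck_X none
    rwa [show (1 : ℂ) - hPlanck (none : HVar ι κ₀ κ₁) = 0 by simp [hPlanck]] at this
  have hs1 : sgn (hParity p ε₀ ε₁ none) = 1 := by simp [hParity, sgn]
  rw [hs0, hs1, one_smul, one_smul] at h2
  simp only [map_smul, map_add (d (some (.lam a))) (_ * _) (_ + _), hz, map_add s, h.s_hbar_mul,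
    zero_add] at h2
  rw [h.s_d_lam_vfQ a _ (fun v hv => h.kill hp0 _ hv.symm), map_add, map_add, h.s_d_lam_div, hρ1] at h2
  have h3 := h.s_vfQ_mem hG₁ (d (some (.lam a)) (d none X))
  have h4 : (2 : ℂ) • hamG (extParity p ε₁) dA EA ε₀ (cG d s X) a ((1 / Complex.I) • s (d none X)) =
      (1 / Complex.I) • (2 : ℂ) • hamG (extParity p ε₁) dA EA ε₀ (cG d s X) a (s (d none X)) := by
    rw [map_smul, smul_comm]
  have h5 : (2 : ℂ) • hamG (extParity p ε₁) dA EA ε₀ (cG d s X) a (s (d none X)) = _ :=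
    eq_sub_of_add_eq' ((smul_add _ _ _).symm.trans h2.symm)
  rw [h4, h5, smul_sub, smul_smul, one_div, inv_mul_cancel₀ Complex.I_ne_zero, one_smul,
    sub_right_comm, sub_self, zero_sub]
  exact Submodule.neg_mem _ (Submodule.smul_mem _ _ (Submodule.smul_mem _ _ (Submodule.smul_mem _ _ h3)))

end IsFullTheory

end extraction

/-! ### Logarithmic derivatives of even invertible elements -/

section logder

variable {A : Type*} [Ring A] [Algebra ℂ A] {P : ZMod 2 → Submodule ℂ A}

/-- `x` is even, invertible and has logarithmic derivative `l`. -/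
structure HasLogDer (P : ZMod 2 → Submodule ℂ A) (D : A →ₗ[ℂ] A) (x l : A) : Prop where
  unit : IsUnit x
  even : x ∈ P 0
  eq : D x = x * l

variable {D : A →ₗ[ℂ] A} {r : ZMod 2} {x y l k : A}

lemma HasLogDer.mul (hP : IsSuperAlg P) (hD : IsRDer P r D) (hx : HasLogDer P D x l)
    (hy : HasLogDer P D y k) : HasLogDer P D (x * y) (l + k) where
  unit := hx.unit.mul hy.unit
  even := by simpa using hP.mul_mem hx.even hy.even
  eq := by
    rw [hD.leib_even _ hy.even, hx.eq, hy.eq, mul_add, mul_assoc, mul_assoc, mul_assoc,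
      hP.even_comm hy.even l, add_comm]

lemma HasLogDer.inverse (hP : IsSuperAlg P) (hD : IsRDer P r D) (hx : HasLogDer P D x l) :
    HasLogDer P D (Ring.inverse x) (-l) := by
  obtain ⟨y, hy, h1, h2⟩ := hP.even_inv hx.even hx.unit
  have : Ring.inverse x = y := by
    rw [← one_mul (Ring.inverse _), ← h2, mul_assoc, Ring.mul_inverse_cancel _ hx.unit, mul_one]
  rw [this]
  refine ⟨⟨⟨y, x, h2, h1⟩, rfl⟩, hy, ?_⟩
  rw [hD.map_inv hP hx.even hy h1, hx.eq, ← mul_assoc y x, h2, one_mul, mul_neg]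

end logder

open Classical in
/-- An invertible even supermatrix with invertible odd-odd block and Schur complement. -/
structure SdetRegular {m A : Type*} [Fintype m] [DecidableEq m] [Ring A] [Algebra ℂ A]
    (P : ZMod 2 → Submodule ℂ A) (p : m → ZMod 2) (M M' : Matrix m m A) : Prop where
  sm : IsSM P p p 0 M
  mul_inv : M * M' = 1
  inv_mul : M' * M = 1
  odd : IsUnit (M.submatrix Subtype.val Subtype.val : Matrix (OddIdx p) (OddIdx p) A)
  schur : IsUnit ((M.submatrix Subtype.val Subtype.val : Matrix (EvenIdx p) (EvenIdx p) A)
      - (M.submatrix Subtype.val Subtype.val : Matrix (EvenIdx p) (OddIdx p) A)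
      * Ring.inverse (M.submatrix Subtype.val Subtype.val : Matrix (OddIdx p) (OddIdx p) A)
      * (M.submatrix Subtype.val Subtype.val : Matrix (OddIdx p) (EvenIdx p) A))

lemma SdetRegular.hasLogDer {m A : Type*} [Fintype m] [inst : DecidableEq m] [Ring A] [Algebra ℂ A]
    {P : ZMod 2 → Submodule ℂ A} {p : m → ZMod 2} {M M' : Matrix m m A}
    (h : SdetRegular P p M M') (hP : IsSuperAlg P) {r : ZMod 2} {D : A →ₗ[ℂ] A}
    (hD : IsRDer P r D) : HasLogDer P D (sdet p M) (sTr p r (M' * twD r p D M)) := by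
  have := sdet_der hP hD h.sm (by convert h.mul_inv) (by convert h.inv_mul) (by convert h.odd)
    (by convert h.schur)
  exact ⟨this.1, this.2.1, this.2.2⟩

/-! ### Invariance of the radicand along the constraint surface -/

section conclusion

variable {ι κ₀ κ₁ : Type*}
  {A : Type*} [Ring A] [Algebra ℂ A] {P : ZMod 2 → Submodule ℂ A}
  {B : Type*} [Ring B] [Algebra ℂ B] {PB : ZMod 2 → Submodule ℂ B}
  [Fintype ι] [Fintype κ₀] [Fintype κ₁] [DecidableEq ι] [DecidableEq κ₀] [DecidableEq κ₁]
  {p : ι → ZMod 2} {ε₀ : κ₀ → ZMod 2} {ε₁ : κ₁ → ZMod 2}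
  {dA : ExtVar ι κ₁ → A →ₗ[ℂ] A} {d : HVar ι κ₀ κ₁ → B →ₗ[ℂ] B} {x : HVar ι κ₀ κ₁ → B}
  {s : B →ₐ[ℂ] A} {EA : ExtVar ι κ₁ → ExtVar ι κ₁ → A} {EB : ExtVar ι κ₁ → ExtVar ι κ₁ → B}
  {ρ ρ' X : B} {f : ExtVar ι κ₁ → A} {K' : Matrix (ExtVar ι κ₁) (ExtVar ι κ₁) A}
  {B' : Matrix κ₀ κ₀ A} {Δ' : Matrix κ₁ κ₁ A} {σ : κ₀ ⊕ κ₀ ≃ ExtVar ι κ₁} {F : κ₀ → A} {e : A}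

namespace IsFullTheory

variable (h : IsFullTheory P PB p ε₀ ε₁ dA d x s EA EB ρ ρ' X)
include h

/-- The radicand times `exp 2𝓗` is invariant along the constraints, on shell. -/
theorem radicand_hamG (hf : IsCoords P (extParity p ε₁) dA f K')
    (hσF : ∀ b, extParity p ε₁ (σ (Sum.inl b)) = ε₀ b + 1)
    (hσG : ∀ b, extParity p ε₁ (σ (Sum.inr b)) = ε₀ b)
    (hfF : ∀ b, f (σ (Sum.inl b)) = F b) (hfG : ∀ b, f (σ (Sum.inr b)) = cG d s X b)
    (hK : SdetRegular P (extParity p ε₁) (Matrix.of fun i j => dA j (f i)) K')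
    (hB : SdetRegular P ε₀
      (Matrix.of fun b c => hamG (extParity p ε₁) dA EA ε₀ (cG d s X) c (F b)) B')
    (hΔ : SdetRegular P ε₁ (cΔ ε₁ d s X) Δ')
    (hρ : s ρ * s ρ' = 1) (he : e ∈ P 0) (hu : IsUnit e)
    (hde : ∀ a, hamG (extParity p ε₁) dA EA ε₀ (cG d s X) a e =
      e * (2 : ℂ) • hamG (extParity p ε₁) dA EA ε₀ (cG d s X) a ((1 / Complex.I) • s (d none X)))
    (a : κ₀) :
    hamG (extParity p ε₁) dA EA ε₀ (cG d s X) a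
      (sdet (extParity p ε₁) (Matrix.of fun i j => dA j (f i)) *
        sdet ε₀ (Matrix.of fun b c => hamG (extParity p ε₁) dA EA ε₀ (cG d s X) c (F b)) *
        Ring.inverse (s ρ * sdet ε₁ (cΔ ε₁ d s X) ^ 2) * e) ∈ gIdeal (cG d s X) := by
  have hP := h.superA
  have hD := hamG_der (ε := ε₀) hP h.partA h.poisson h.cG_mem a
  have lK := hK.hasLogDer hP hD
  have lB := hB.hasLogDer hP hD
  have lΔ := hΔ.hasLogDer hP hD
  have hρ0 : s ρ ∈ P 0 := h.s_mem h.ρ_mem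
  have hρ0' : s ρ' ∈ P 0 := h.s_mem h.ρ'_mem
  have lρ : HasLogDer P (hamG (extParity p ε₁) dA EA ε₀ (cG d s X) a) (s ρ)
      (s ρ' * hamG (extParity p ε₁) dA EA ε₀ (cG d s X) a (s ρ)) :=
    ⟨⟨⟨s ρ, s ρ', hρ, (hP.even_comm hρ0' _).trans hρ⟩, rfl⟩, hρ0,
      by rw [← mul_assoc, hρ, one_mul]⟩
  have le : HasLogDer P (hamG (extParity p ε₁) dA EA ε₀ (cG d s X) a) e
      ((2 : ℂ) • hamG (extParity p ε₁) dA EA ε₀ (cG d s X) a ((1 / Complex.I) • s (d none X))) :=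
    ⟨hu, he, hde a⟩
  have lall := ((lK.mul hP hD lB).mul hP hD ((lρ.mul hP hD (lΔ.mul hP hD lΔ)).inverse hP hD)).mul
    hP hD le
  rw [← pow_two] at lall
  rw [lall.eq]
  refine gIdeal_mul_left hP h.cG_mem ?_ _
  have hG₁ := fun α => h.cG₁_mem_gIdeal hΔ.mul_inv α
  have h1 := first_stage_logDer (a := a) hP h.partA h.poisson hf hσF hσG hfF hfG
    (fun b c => h.bracket_mem_gIdeal hΔ.mul_inv c b) hB.mul_inv hB.inv_mul hΔ.sm hΔ.mul_inv
    hΔ.inv_mul h.cZ_sm (h.cW_sm a) (h.cU_sm a) (h.cV_sm a) (h.cY_sm a) h.reducibility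
    (h.constraint_algebra a) (h.ghost_matrix_der hG₁ a)
  have h2 := h.one_loop_der hG₁ a
  -- The main terms in `h1` and `h2`, divergence and supertraces, are opposite; the density term of
  -- `h2` is the logarithmic derivative of ρ.
  convert Submodule.add_mem _ h1 h2 using 1
  rw [two_smul ℂ (sTr ε₁ _ (Δ' * _))]
  abel

/-- On shell the radicand times `exp 2𝓗` does not depend on the coordinates `𝓕`. -/
theorem radicand_newD (hf : IsCoords P (extParity p ε₁) dA f K')
    (hfF : ∀ b, f (σ (Sum.inl b)) = F b) (hfG : ∀ b, f (σ (Sum.inr b)) = cG d s X b)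
    (hB : (Matrix.of fun b c => hamG (extParity p ε₁) dA EA ε₀ (cG d s X) c (F b)) * B' = 1)
    (hΔ : cΔ ε₁ d s X * Δ' = 1) {y : A}
    (hy : ∀ a, hamG (extParity p ε₁) dA EA ε₀ (cG d s X) a y ∈ gIdeal (cG d s X)) (b : κ₀) :
    newD dA K' (σ (Sum.inl b)) y ∈ gIdeal (cG d s X) := by
  -- In (y, G c) the chain rule gives F-derivatives times (F, G c) and G-derivatives times (G, G c).
  -- The latter lie in the ideal, and inverting the bracket matrix isolates the F-derivatives.
  have h1 : ∀ c, ∑ b, newD dA K' (σ (Sum.inl b)) y *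
      hamG (extParity p ε₁) dA EA ε₀ (cG d s X) c (F b) ∈ gIdeal (cG d s X) := by
    intro c
    have h2 := hy c
    rw [hamG, hf.vf_expand, ← σ.sum_comp, Fintype.sum_sum_type] at h2
    simp only [hfF, hfG] at h2
    rw [← hamG] at h2
    refine (Submodule.add_mem_iff_left _ (Submodule.sum_mem _ fun b _ => ?_)).1 h2
    exact gIdeal_mul_left h.superA h.cG_mem (h.bracket_mem_gIdeal hΔ c b) _
  have h2 : newD dA K' (σ (Sum.inl b)) y = ∑ c, (∑ b, newD dA K' (σ (Sum.inl b)) y *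
      hamG (extParity p ε₁) dA EA ε₀ (cG d s X) c (F b)) * B' c b := by
    simp only [Finset.sum_mul, mul_assoc]
    rw [Finset.sum_comm]
    have h3 := fun b' => congrFun (congrFun hB b') b
    simp only [Matrix.mul_apply, Matrix.of_apply, Matrix.one_apply] at h3
    simp only [← Finset.mul_sum, h3]
    simp
  rw [h2]
  exact Submodule.sum_mem _ fun c _ => gIdeal_mul_right (h1 c) _

end IsFullTheory

end conclusion

/-! ### Grassmann algebras: parity and contractions -/

section grassmann

variable {M N : Type*} [AddCommGroup M] [Module ℂ M] [AddCommGroup N] [Module ℂ N]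

/-- The even and the odd part of a Grassmann algebra. -/
abbrev gpar (M : Type*) [AddCommGroup M] [Module ℂ M] (k : ZMod 2) :
    Submodule ℂ (ExteriorAlgebra ℂ M) :=
  CliffordAlgebra.evenOdd (0 : QuadraticForm ℂ M) k

/-- For the zero quadratic form any two vectors are orthogonal, so supercommutativity is the graded
commutation rule for Clifford algebras of orthogonal vectors. -/
lemma gpar_comm {i j : ZMod 2} {x y : ExteriorAlgebra ℂ M} (hx : x ∈ gpar M i) (hy : y ∈ gpar M j) :
    x * y = sgn (i * j) • (y * x) := by
  have h := CliffordAlgebra.map_mul_map_of_isOrtho_of_mem_evenOdd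
    (QuadraticMap.Isometry.id (0 : QuadraticForm ℂ M)) (QuadraticMap.Isometry.id _)
    (fun a b => by simp [QuadraticMap.isOrtho_def]) x y hx hy
  simp only [CliffordAlgebra.map_id, AlgHom.id_apply] at h
  rw [h]
  rcases zmod2_cases i with rfl | rfl <;> rcases zmod2_cases j with rfl | rfl <;> simp [sgn]

lemma gpar_superAlg : IsSuperAlg (gpar M) where
  one_mem := SetLike.GradedOne.one_mem
  mul_mem hx hy := SetLike.GradedMul.mul_mem hx hy
  comm := gpar_comm
  decomp x := by
    have h := (CliffordAlgebra.evenOdd_isCompl (0 : QuadraticForm ℂ M)).sup_eq_top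
    have hx : x ∈ (⊤ : Submodule ℂ _) := trivial
    rw [← h, Submodule.mem_sup] at hx
    obtain ⟨a, ha, b, hb, e⟩ := hx
    exact ⟨a, ha, b, hb, e.symm⟩
  disj x h0 h1 :=
    (Submodule.disjoint_def.1 (CliffordAlgebra.evenOdd_isCompl (0 : QuadraticForm ℂ M)).disjoint)
      x h0 h1

/-- Contraction from the right. -/
def gD (d : Module.Dual ℂ M) : ExteriorAlgebra ℂ M →ₗ[ℂ] ExteriorAlgebra ℂ M :=
  (CliffordAlgebra.contractRight (Q := (0 : QuadraticForm ℂ M))).flip d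

lemma gD_mul_ι (d : Module.Dual ℂ M) (x : ExteriorAlgebra ℂ M) (v : M) :
    gD d (x * ExteriorAlgebra.ι ℂ v) = d v • x - gD d x * ExteriorAlgebra.ι ℂ v :=
  CliffordAlgebra.contractRight_mul_ι _ _ _

lemma gD_algebraMap (d : Module.Dual ℂ M) (r : ℂ) :
    gD d (algebraMap ℂ (ExteriorAlgebra ℂ M) r) = 0 :=
  CliffordAlgebra.contractRight_algebraMap _ _ _

lemma gD_ι (d : Module.Dual ℂ M) (v : M) :
    gD d (ExteriorAlgebra.ι ℂ v) = algebraMap ℂ _ (d v) :=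
  CliffordAlgebra.contractRight_ι _ _ _

lemma gD_comm (d d' : Module.Dual ℂ M) (x : ExteriorAlgebra ℂ M) :
    gD d (gD d' x) = -gD d' (gD d x) :=
  CliffordAlgebra.contractRight_comm _ _ _

lemma ι_mem_gpar (v : M) : ExteriorAlgebra.ι ℂ v ∈ gpar M 1 :=
  CliffordAlgebra.ι_mem_evenOdd_one _ _

/-- Induction for elements of a Grassmann algebra, multiplying by generators from the right. -/
lemma grassmann_induction {C : ExteriorAlgebra ℂ M → Prop} (x : ExteriorAlgebra ℂ M)
    (algebraMap : ∀ r, C (algebraMap ℂ _ r)) (add : ∀ x y, C x → C y → C (x + y))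
    (mul_ι : ∀ x v, C x → C (x * ExteriorAlgebra.ι ℂ v)) : C x :=
  CliffordAlgebra.right_induction (Q := (0 : QuadraticForm ℂ M)) algebraMap add
    (fun v x => mul_ι x v) x

/-- Induction by right multiplication with generators does not respect homogeneity, so the claim is
carried for the even and the odd component together. The same device serves several of the following
lemmas. -/
lemma gD_mem (d : Module.Dual ℂ M) {k : ZMod 2} {x : ExteriorAlgebra ℂ M} (hx : x ∈ gpar M k) :
    gD d x ∈ gpar M (k + 1) := by
  have key : ∀ x : ExteriorAlgebra ℂ M, ∃ a ∈ gpar M 0, ∃ b ∈ gpar M 1, x = a + b ∧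
      gD d a ∈ gpar M 1 ∧ gD d b ∈ gpar M 0 := by
    intro x
    induction x using grassmann_induction with
    | algebraMap r =>
      refine ⟨algebraMap ℂ _ r, ?_, 0, zero_mem _, by simp, by rw [gD_algebraMap]; exact zero_mem _,
        by simp⟩
      rw [Algebra.algebraMap_eq_smul_one]
      exact Submodule.smul_mem _ _ gpar_superAlg.one_mem
    | add x y hx hy =>
      obtain ⟨a, ha, b, hb, rfl, h1, h2⟩ := hx
      obtain ⟨a', ha', b', hb', rfl, h1', h2'⟩ := hy
      refine ⟨a + a', add_mem ha ha', b + b', add_mem hb hb', by abel, ?_, ?_⟩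
      · rw [map_add]; exact add_mem h1 h1'
      · rw [map_add]; exact add_mem h2 h2'
    | mul_ι x v hx =>
      obtain ⟨a, ha, b, hb, rfl, h1, h2⟩ := hx
      have hm : ∀ {i j : ZMod 2} {x : ExteriorAlgebra ℂ M}, x ∈ gpar M i → i + 1 = j →
          x * ExteriorAlgebra.ι ℂ v ∈ gpar M j := fun h e =>
        mem_parity_congr (gpar_superAlg.mul_mem h (ι_mem_gpar v)) e
      refine ⟨b * ExteriorAlgebra.ι ℂ v, hm hb (by decide), a * ExteriorAlgebra.ι ℂ v,
        hm ha (by decide), by rw [add_mul, add_comm], ?_, ?_⟩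
      · rw [gD_mul_ι]
        exact sub_mem (Submodule.smul_mem _ _ hb) (hm h2 (by decide))
      · rw [gD_mul_ι]
        exact sub_mem (Submodule.smul_mem _ _ ha) (hm h1 (by decide))
  obtain ⟨a, ha, b, hb, rfl, h1, h2⟩ := key x
  rcases zmod2_cases k with rfl | rfl
  · have : b ∈ gpar M 0 := by simpa using sub_mem hx ha
    rw [gpar_superAlg.disj b this hb, add_zero]
    simpa using h1
  · have : a ∈ gpar M 1 := by simpa using sub_mem hx hb
    rw [gpar_superAlg.disj a ha this, zero_add]
    exact mem_parity_congr h2 (by decide)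

lemma gD_leib (d : Module.Dual ℂ M) {j : ZMod 2} (x y : ExteriorAlgebra ℂ M) (hy : y ∈ gpar M j) :
    gD d (x * y) = x * gD d y + sgn j • (gD d x * y) := by
  have key : ∀ y : ExteriorAlgebra ℂ M, ∃ a ∈ gpar M 0, ∃ b ∈ gpar M 1, y = a + b ∧
      gD d (x * a) = x * gD d a + gD d x * a ∧ gD d (x * b) = x * gD d b - gD d x * b := by
    intro y
    induction y using grassmann_induction with
    | algebraMap r =>
      refine ⟨algebraMap ℂ _ r, ?_, 0, zero_mem _, by simp, ?_, by simp⟩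
      · rw [Algebra.algebraMap_eq_smul_one]
        exact Submodule.smul_mem _ _ gpar_superAlg.one_mem
      · rw [gD_algebraMap, mul_zero, zero_add, ← Algebra.commutes, ← Algebra.commutes,
          ← Algebra.smul_def, ← Algebra.smul_def, map_smul]
    | add y z hy hz =>
      obtain ⟨a, ha, b, hb, rfl, h1, h2⟩ := hy
      obtain ⟨a', ha', b', hb', rfl, h1', h2'⟩ := hz
      refine ⟨a + a', add_mem ha ha', b + b', add_mem hb hb', by abel, ?_, ?_⟩
      · rw [mul_add, map_add, h1, h1', map_add, mul_add, mul_add]; abel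
      · rw [mul_add, map_add, h2, h2', map_add, mul_add, mul_add]; abel
    | mul_ι y v hy =>
      obtain ⟨a, ha, b, hb, rfl, h1, h2⟩ := hy
      have hm : ∀ {i j : ZMod 2} {x : ExteriorAlgebra ℂ M}, x ∈ gpar M i → i + 1 = j →
          x * ExteriorAlgebra.ι ℂ v ∈ gpar M j := fun h e =>
        mem_parity_congr (gpar_superAlg.mul_mem h (ι_mem_gpar v)) e
      refine ⟨b * ExteriorAlgebra.ι ℂ v, hm hb (by decide), a * ExteriorAlgebra.ι ℂ v,
        hm ha (by decide), by rw [add_mul, add_comm], ?_, ?_⟩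
      · rw [← mul_assoc, gD_mul_ι, h2, gD_mul_ι, mul_sub, sub_mul, mul_smul_comm]
        simp only [mul_assoc]; abel
      · rw [← mul_assoc, gD_mul_ι, h1, gD_mul_ι, mul_sub, add_mul, mul_smul_comm]
        simp only [mul_assoc]; abel
  obtain ⟨a, ha, b, hb, rfl, h1, h2⟩ := key y
  rcases zmod2_cases j with rfl | rfl
  · have : b ∈ gpar M 0 := by simpa using sub_mem hy ha
    rw [gpar_superAlg.disj b this hb, add_zero, h1, sgn_zero, one_smul]
  · have : a ∈ gpar M 1 := by simpa using sub_mem hy hb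
    rw [gpar_superAlg.disj a ha this, zero_add, h2, sgn_one, neg_smul, one_smul, sub_eq_add_neg]

/-- Contractions from the left and from the right. -/
lemma contractLeft_eq_gD (d : Module.Dual ℂ M) {k : ZMod 2} {x : ExteriorAlgebra ℂ M}
    (hx : x ∈ gpar M k) :
    CliffordAlgebra.contractLeft (Q := (0 : QuadraticForm ℂ M)) d x = sgn (k + 1) • gD d x := by
  have hι : ∀ v : M, ∀ {j : ZMod 2} {y : ExteriorAlgebra ℂ M}, y ∈ gpar M j →
      y * ExteriorAlgebra.ι ℂ v = sgn j • (ExteriorAlgebra.ι ℂ v * y) := fun v j y hy => by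
    simpa using gpar_comm hy (ι_mem_gpar v)
  have hL : ∀ (v : M) (y : ExteriorAlgebra ℂ M),
      CliffordAlgebra.contractLeft (Q := (0 : QuadraticForm ℂ M)) d (ExteriorAlgebra.ι ℂ v * y) =
      d v • y - ExteriorAlgebra.ι ℂ v *
        CliffordAlgebra.contractLeft (Q := (0 : QuadraticForm ℂ M)) d y :=
    fun v y => CliffordAlgebra.contractLeft_ι_mul _ _ _
  have key : ∀ x : ExteriorAlgebra ℂ M, ∃ a ∈ gpar M 0, ∃ b ∈ gpar M 1, x = a + b ∧
      CliffordAlgebra.contractLeft (Q := (0 : QuadraticForm ℂ M)) d a = -gD d a ∧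
      CliffordAlgebra.contractLeft (Q := (0 : QuadraticForm ℂ M)) d b = gD d b := by
    intro x
    induction x using grassmann_induction with
    | algebraMap r =>
      refine ⟨algebraMap ℂ _ r, ?_, 0, zero_mem _, by simp, ?_, by simp⟩
      · rw [Algebra.algebraMap_eq_smul_one]
        exact Submodule.smul_mem _ _ gpar_superAlg.one_mem
      · rw [gD_algebraMap, neg_zero]
        exact CliffordAlgebra.contractLeft_algebraMap (0 : QuadraticForm ℂ M) d r
    | add x y hx hy =>
      obtain ⟨a, ha, b, hb, rfl, h1, h2⟩ := hx
      obtain ⟨a', ha', b', hb', rfl, h1', h2'⟩ := hy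
      refine ⟨a + a', add_mem ha ha', b + b', add_mem hb hb', by abel, ?_, ?_⟩
      · rw [map_add, map_add, h1, h1']; abel
      · rw [map_add, map_add, h2, h2']
    | mul_ι x v hx =>
      obtain ⟨a, ha, b, hb, rfl, h1, h2⟩ := hx
      have hm : ∀ {i j : ZMod 2} {x : ExteriorAlgebra ℂ M}, x ∈ gpar M i → i + 1 = j →
          x * ExteriorAlgebra.ι ℂ v ∈ gpar M j := fun h e =>
        mem_parity_congr (gpar_superAlg.mul_mem h (ι_mem_gpar v)) e
      refine ⟨b * ExteriorAlgebra.ι ℂ v, hm hb (by decide), a * ExteriorAlgebra.ι ℂ v,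
        hm ha (by decide), by rw [add_mul, add_comm], ?_, ?_⟩
      · rw [gD_mul_ι, hι v hb, map_smul, hL, h2, hι v (gD_mem d hb), show (1 + 1 : ZMod 2) = 0 from rfl]
        simp only [sgn_zero, sgn_one, smul_sub, one_smul, neg_smul]
        abel
      · rw [gD_mul_ι, hι v ha, map_smul, hL, h1, hι v (gD_mem d ha), show (0 + 1 : ZMod 2) = 1 from rfl]
        simp only [sgn_zero, sgn_one, smul_sub, one_smul, neg_smul, mul_neg]
  obtain ⟨a, ha, b, hb, rfl, h1, h2⟩ := key x
  rcases zmod2_cases k with rfl | rfl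
  · have : b ∈ gpar M 0 := by simpa using sub_mem hx ha
    rw [gpar_superAlg.disj b this hb, add_zero, h1, zero_add, sgn_one, neg_smul, one_smul]
  · have : a ∈ gpar M 1 := by simpa using sub_mem hx hb
    rw [gpar_superAlg.disj a ha this, zero_add, h2, show (1 + 1 : ZMod 2) = 0 from rfl, sgn_zero,
      one_smul]

lemma gD_map (f : M →ₗ[ℂ] N) (d : Module.Dual ℂ N) (x : ExteriorAlgebra ℂ M) :
    gD d (ExteriorAlgebra.map f x) = ExteriorAlgebra.map f (gD (d ∘ₗ f) x) := by
  induction x using grassmann_induction with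
  | algebraMap r => rw [AlgHom.commutes, gD_algebraMap, gD_algebraMap, map_zero]
  | add x y hx hy => simp only [map_add, hx, hy]
  | mul_ι x v hx =>
    rw [map_mul, ExteriorAlgebra.map_apply_ι, gD_mul_ι, gD_mul_ι, hx, map_sub, map_mul, map_smul,
      ExteriorAlgebra.map_apply_ι]
    rfl

lemma map_mem_gpar (f : M →ₗ[ℂ] N) {k : ZMod 2} {x : ExteriorAlgebra ℂ M} (hx : x ∈ gpar M k) :
    ExteriorAlgebra.map f x ∈ gpar N k := by
  have key : ∀ x : ExteriorAlgebra ℂ M, ∃ a ∈ gpar M 0, ∃ b ∈ gpar M 1, x = a + b ∧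
      ExteriorAlgebra.map f a ∈ gpar N 0 ∧ ExteriorAlgebra.map f b ∈ gpar N 1 := by
    intro x
    induction x using grassmann_induction with
    | algebraMap r =>
      refine ⟨algebraMap ℂ _ r, ?_, 0, zero_mem _, by simp, ?_, by simp⟩
      all_goals
        first
          | rw [AlgHom.commutes, Algebra.algebraMap_eq_smul_one]
            exact Submodule.smul_mem _ _ gpar_superAlg.one_mem
          | rw [Algebra.algebraMap_eq_smul_one]
            exact Submodule.smul_mem _ _ gpar_superAlg.one_mem
    | add x y hx hy =>
      obtain ⟨a, ha, b, hb, rfl, h1, h2⟩ := hx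
      obtain ⟨a', ha', b', hb', rfl, h1', h2'⟩ := hy
      refine ⟨a + a', add_mem ha ha', b + b', add_mem hb hb', by abel, ?_, ?_⟩
      · rw [map_add]; exact add_mem h1 h1'
      · rw [map_add]; exact add_mem h2 h2'
    | mul_ι x v hx =>
      obtain ⟨a, ha, b, hb, rfl, h1, h2⟩ := hx
      refine ⟨b * ExteriorAlgebra.ι ℂ v, mem_parity_congr (gpar_superAlg.mul_mem hb (ι_mem_gpar v))
        (by decide), a * ExteriorAlgebra.ι ℂ v, mem_parity_congr
        (gpar_superAlg.mul_mem ha (ι_mem_gpar v)) (by decide), by rw [add_mul, add_comm], ?_, ?_⟩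
      · rw [map_mul, ExteriorAlgebra.map_apply_ι]
        exact mem_parity_congr (gpar_superAlg.mul_mem h2 (ι_mem_gpar _)) (by decide)
      · rw [map_mul, ExteriorAlgebra.map_apply_ι]
        exact mem_parity_congr (gpar_superAlg.mul_mem h1 (ι_mem_gpar _)) (by decide)
  obtain ⟨a, ha, b, hb, rfl, h1, h2⟩ := key x
  rcases zmod2_cases k with rfl | rfl
  · have : b ∈ gpar M 0 := by simpa using sub_mem hx ha
    rwa [gpar_superAlg.disj b this hb, add_zero]
  · have : a ∈ gpar M 1 := by simpa using sub_mem hx hb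
    rwa [gpar_superAlg.disj a ha this, zero_add]

/-! ### The filtration by powers of the augmentation ideal -/

/-- Elements all of whose monomials have degree at least `k`. -/
def gfilt (M : Type*) [AddCommGroup M] [Module ℂ M] (k : ℕ) : Submodule ℂ (ExteriorAlgebra ℂ M) :=
  ⨆ n : ℕ, LinearMap.range (ExteriorAlgebra.ι ℂ : M →ₗ[ℂ] ExteriorAlgebra ℂ M) ^ (k + n)

lemma pow_le_gfilt {k n : ℕ} (h : k ≤ n) :
    LinearMap.range (ExteriorAlgebra.ι ℂ : M →ₗ[ℂ] ExteriorAlgebra ℂ M) ^ n ≤ gfilt M k := by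
  obtain ⟨m, rfl⟩ := Nat.exists_eq_add_of_le h
  exact le_iSup (fun n => LinearMap.range (ExteriorAlgebra.ι ℂ : M →ₗ[ℂ] _) ^ (k + n)) m

lemma gfilt_anti {k l : ℕ} (h : k ≤ l) : gfilt M l ≤ gfilt M k :=
  iSup_le fun n => pow_le_gfilt (by omega)

lemma gfilt_zero : gfilt M 0 = ⊤ := by
  rw [gfilt]
  simp only [zero_add]
  exact CliffordAlgebra.iSup_ι_range_eq_top (0 : QuadraticForm ℂ M)

lemma gfilt_mul_le (k l : ℕ) : gfilt M k * gfilt M l ≤ gfilt M (k + l) := by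
  rw [gfilt, gfilt, Submodule.iSup_mul]
  refine iSup_le fun m => ?_
  rw [Submodule.mul_iSup]
  refine iSup_le fun n => ?_
  rw [← pow_add]
  exact pow_le_gfilt (by omega)

lemma gfilt_mul {k l : ℕ} {x y : ExteriorAlgebra ℂ M} (hx : x ∈ gfilt M k) (hy : y ∈ gfilt M l) :
    x * y ∈ gfilt M (k + l) := gfilt_mul_le k l (Submodule.mul_mem_mul hx hy)

lemma gfilt_mul_left {k : ℕ} {x : ExteriorAlgebra ℂ M} (hx : x ∈ gfilt M k)
    (y : ExteriorAlgebra ℂ M) : y * x ∈ gfilt M k := by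
  simpa using gfilt_mul (show y ∈ gfilt M 0 by rw [gfilt_zero]; trivial) hx

lemma gfilt_pow {x : ExteriorAlgebra ℂ M} (hx : x ∈ gfilt M 1) (n : ℕ) : x ^ n ∈ gfilt M n := by
  induction n with
  | zero => rw [gfilt_zero]; trivial
  | succ n ih => rw [pow_succ]; exact gfilt_mul ih hx

lemma ι_mem_gfilt (v : M) : ExteriorAlgebra.ι ℂ v ∈ gfilt M 1 :=
  pow_le_gfilt (le_refl 1) (by rw [pow_one]; exact LinearMap.mem_range_self _ _)

lemma sub_algebraMap_mem_gfilt (x : ExteriorAlgebra ℂ M) :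
    x - algebraMap ℂ _ (ExteriorAlgebra.algebraMapInv x) ∈ gfilt M 1 := by
  induction x using grassmann_induction with
  | algebraMap r => simp
  | add x y hx hy =>
    rw [map_add, map_add, add_sub_add_comm]
    exact add_mem hx hy
  | mul_ι x v hx =>
    rw [map_mul]
    have : ExteriorAlgebra.algebraMapInv (ExteriorAlgebra.ι ℂ v) = 0 := by
      simp [ExteriorAlgebra.algebraMapInv]
    rw [this, mul_zero, map_zero, sub_zero]
    exact gfilt_mul_left (ι_mem_gfilt v) x

/-- An odd element squares to zero, hence so does its body, which is a complex number. -/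
lemma algebraMapInv_odd {x : ExteriorAlgebra ℂ M} (hx : x ∈ gpar M 1) :
    ExteriorAlgebra.algebraMapInv x = 0 := by
  have h := gpar_comm (x := x) (y := x) hx hx
  have h2 : x * x = 0 := by
    rw [one_mul, sgn_one, neg_smul, one_smul] at h
    have h3 : (2 : ℂ) • (x * x) = 0 := by rw [two_smul]; nth_rewrite 1 [h]; simp
    exact (smul_eq_zero.1 h3).resolve_left two_ne_zero
  have h3 := congrArg ExteriorAlgebra.algebraMapInv h2
  rw [map_mul, map_zero] at h3
  exact mul_self_eq_zero.1 h3

lemma odd_mem_gfilt {x : ExteriorAlgebra ℂ M} (hx : x ∈ gpar M 1) : x ∈ gfilt M 1 := by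
  have := sub_algebraMap_mem_gfilt x
  rwa [algebraMapInv_odd hx, map_zero, sub_zero] at this

lemma gfilt_eq_bot [Module.Finite ℂ M] {k : ℕ} (hk : Module.finrank ℂ M < k) : gfilt M k = ⊥ := by
  rw [gfilt, iSup_eq_bot]
  intro n
  have h : Module.finrank ℂ (⋀[ℂ]^(k + n) M) = 0 := by
    rw [exteriorPower.finrank_eq]
    exact Nat.choose_eq_zero_of_lt (by omega)
  exact Submodule.finrank_eq_zero.1 h

lemma gD_mem_gfilt (d : Module.Dual ℂ M) {k : ℕ} {x : ExteriorAlgebra ℂ M}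
    (hx : x ∈ gfilt M (k + 1)) : gD d x ∈ gfilt M k := by
  have key : ∀ (n : ℕ), ∀ x ∈ LinearMap.range (ExteriorAlgebra.ι ℂ : M →ₗ[ℂ] _) ^ (n + 1),
      gD d x ∈ LinearMap.range (ExteriorAlgebra.ι ℂ : M →ₗ[ℂ] ExteriorAlgebra ℂ M) ^ n := by
    intro n
    induction n with
    | zero =>
      rintro x hx
      rw [zero_add, pow_one] at hx
      obtain ⟨v, rfl⟩ := hx
      rw [gD_ι, pow_zero]
      exact Submodule.algebraMap_mem _
    | succ n ih =>
      intro x hx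
      rw [pow_succ] at hx
      induction hx using Submodule.mul_induction_on' with
      | mem_mul_mem y hy z hz =>
        obtain ⟨v, rfl⟩ := hz
        rw [gD_mul_ι, pow_succ]
        refine sub_mem (Submodule.smul_mem _ _ ?_)
          (Submodule.mul_mem_mul (ih y hy) (LinearMap.mem_range_self _ _))
        rw [← pow_succ]
        exact hy
      | add y hy z hz h1 h2 => rw [map_add]; exact add_mem h1 h2
  rw [gfilt] at hx
  refine Submodule.iSup_induction _ (motive := fun x => gD d x ∈ gfilt M k) hx ?_ ?_ ?_
  · intro n x hx
    exact pow_le_gfilt (by omega : k ≤ k + n) (key _ x (by convert hx using 2; omega))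
  · rw [map_zero]; exact zero_mem _
  · intro x y h1 h2
    rw [map_add]; exact add_mem h1 h2

section euler

variable {J : Type*} [Fintype J] [DecidableEq J]

/-- The Euler operator of a Grassmann algebra. -/
def gEuler (x : ExteriorAlgebra ℂ (J → ℂ)) : ExteriorAlgebra ℂ (J → ℂ) :=
  ∑ j, gD (LinearMap.proj j) x * ExteriorAlgebra.ι ℂ (Pi.single j (1 : ℂ))

lemma gEuler_add (x y : ExteriorAlgebra ℂ (J → ℂ)) : gEuler (x + y) = gEuler x + gEuler y := by
  simp [gEuler, add_mul, Finset.sum_add_distrib]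

lemma gEuler_ι_mul (x : ExteriorAlgebra ℂ (J → ℂ)) (v : J → ℂ) :
    gEuler (x * ExteriorAlgebra.ι ℂ v) =
      x * ExteriorAlgebra.ι ℂ v + gEuler x * ExteriorAlgebra.ι ℂ v := by
  have h1 : ∑ j, v j • ExteriorAlgebra.ι ℂ (Pi.single j (1 : ℂ) : J → ℂ) =
      ExteriorAlgebra.ι ℂ v := by
    have := (LinearMap.pi_apply_eq_sum_univ (ExteriorAlgebra.ι ℂ : (J → ℂ) →ₗ[ℂ] _) v)
    rw [this]
    refine Finset.sum_congr rfl fun j _ => ?_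
    congr 2
    ext i
    simp [Pi.single_apply, eq_comm]
  simp only [gEuler, gD_mul_ι, sub_mul, Finset.sum_sub_distrib, Finset.sum_mul]
  rw [sub_eq_add_neg, ← Finset.sum_neg_distrib]
  congr 1
  · rw [← h1, Finset.mul_sum]
    refine Finset.sum_congr rfl fun j _ => ?_
    simp
  · refine Finset.sum_congr rfl fun j _ => ?_
    have := gpar_comm (ι_mem_gpar v) (ι_mem_gpar (Pi.single j (1 : ℂ) : J → ℂ))
    rw [mul_assoc, this, mul_assoc]
    simp [sgn]

/-- The Euler operator multiplies a monomial of degree n by n, so on the k-th step of the filtration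
it acts as k up to higher degree. -/
lemma gEuler_sub_mem {k : ℕ} {x : ExteriorAlgebra ℂ (J → ℂ)} (hx : x ∈ gfilt (J → ℂ) k) :
    gEuler x - (k : ℂ) • x ∈ gfilt (J → ℂ) (k + 1) := by
  have key : ∀ (n : ℕ), ∀ x ∈ LinearMap.range (ExteriorAlgebra.ι ℂ : (J → ℂ) →ₗ[ℂ] _) ^ n,
      gEuler x = (n : ℂ) • x := by
    intro n
    induction n with
    | zero =>
      rintro x hx
      rw [pow_zero] at hx
      obtain ⟨r, rfl⟩ := Submodule.mem_one.1 hx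
      simp [gEuler, gD_algebraMap]
    | succ n ih =>
      intro x hx
      rw [pow_succ] at hx
      induction hx using Submodule.mul_induction_on' with
      | mem_mul_mem y hy z hz =>
        obtain ⟨v, rfl⟩ := hz
        rw [gEuler_ι_mul, ih y hy, smul_mul_assoc]
        push_cast
        module
      | add y hy z hz h1 h2 => rw [gEuler_add, h1, h2, smul_add]
  rw [gfilt] at hx
  refine Submodule.iSup_induction _ (motive := fun x => gEuler x - (k : ℂ) • x ∈
    gfilt (J → ℂ) (k + 1)) hx ?_ ?_ ?_
  · intro n x hx
    rw [key _ x hx]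
    rcases n with _ | n
    · simp
    · rw [← sub_smul]
      exact Submodule.smul_mem _ _ (pow_le_gfilt (by omega) hx)
  · simp [gEuler]
  · intro x y h1 h2
    rw [gEuler_add, smul_add, add_sub_add_comm]
    exact add_mem h1 h2

end euler

end grassmann

/-! ### Componentwise calculus of Grassmann-valued functions -/

section smooth

variable {I J : Type*} {p : I → ZMod 2} {q : J → ZMod 2}
  {V V' : Type*} [NormedAddCommGroup V] [NormedSpace ℝ V] [NormedAddCommGroup V'] [NormedSpace ℝ V']

section general
variable [Fintype I] [Fintype J] {g g' : V → Gr p} {s t : Set V}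

lemma gr_ext {a b : Gr p} (h : ∀ φ : Module.Dual ℂ (Gr p), φ a = φ b) : a = b :=
  (Module.finBasis ℂ (Gr p)).ext_elem fun k => h ((Module.finBasis ℂ (Gr p)).coord k)

lemma gr_expand (φ : Module.Dual ℂ (Gr p)) (a : Gr p) :
    φ a = ∑ k, (Module.finBasis ℂ (Gr p)).repr a k * φ (Module.finBasis ℂ (Gr p) k) := by
  conv_lhs => rw [← (Module.finBasis ℂ (Gr p)).sum_repr a]
  rw [map_sum]
  simp only [map_smul, smul_eq_mul]

lemma gr_expand_mul (φ : Module.Dual ℂ (Gr p)) (a b : Gr p) :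
    φ (a * b) = ∑ k, ∑ l, (Module.finBasis ℂ (Gr p)).repr a k * (Module.finBasis ℂ (Gr p)).repr b l *
      φ (Module.finBasis ℂ (Gr p) k * Module.finBasis ℂ (Gr p) l) := by
  conv_lhs => rw [← (Module.finBasis ℂ (Gr p)).sum_repr a, ← (Module.finBasis ℂ (Gr p)).sum_repr b]
  rw [Finset.sum_mul_sum, map_sum]
  simp only [map_sum, smul_mul_smul_comm, map_smul, smul_eq_mul]

lemma SmoothOn.congr (h : SmoothOn g s) (he : ∀ z ∈ s, g' z = g z) : SmoothOn g' s :=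
  fun φ => (h φ).congr fun z hz => by simp only [he z hz]

lemma SmoothOn.mono (h : SmoothOn g s) (ht : t ⊆ s) : SmoothOn g t := fun φ => (h φ).mono ht

lemma smoothOn_const (a : Gr p) : SmoothOn (fun _ : V => a) s := fun φ => contDiffOn_const

lemma SmoothOn.add (h : SmoothOn g s) (h' : SmoothOn g' s) : SmoothOn (fun z => g z + g' z) s :=
  fun φ => by simpa only [map_add] using (h φ).add (h' φ)

lemma SmoothOn.sum {K : Type*} {G : K → V → Gr p} (u : Finset K) (h : ∀ k ∈ u, SmoothOn (G k) s) :
    SmoothOn (fun z => ∑ k ∈ u, G k z) s :=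
  fun φ => by
    simp only [map_sum]
    exact ContDiffOn.sum fun k hk => h k hk φ

lemma SmoothOn.linear (h : SmoothOn g s) (L : Gr p →ₗ[ℂ] Gr q) : SmoothOn (fun z => L (g z)) s :=
  fun φ => h (φ ∘ₗ L)

lemma SmoothOn.smul {f : V → ℂ} (hf : ContDiffOn ℝ ∞ f s) (h : SmoothOn g s) :
    SmoothOn (fun z => f z • g z) s := fun φ => by
  simp only [map_smul, smul_eq_mul]
  exact hf.mul (h φ)

lemma smoothOn_algebraMap {f : V → ℂ} (hf : ContDiffOn ℝ ∞ f s) :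
    SmoothOn (fun z => algebraMap ℂ (Gr p) (f z)) s := fun φ => by
  simp only [Algebra.algebraMap_eq_smul_one, map_smul, smul_eq_mul]
  exact hf.mul contDiffOn_const

lemma SmoothOn.mul (h : SmoothOn g s) (h' : SmoothOn g' s) : SmoothOn (fun z => g z * g' z) s :=
  fun φ => by
    rw [funext fun z => gr_expand_mul φ (g z) (g' z)]
    exact ContDiffOn.sum fun k _ => ContDiffOn.sum fun l _ =>
      ((h ((Module.finBasis ℂ (Gr p)).coord k)).mul
        (h' ((Module.finBasis ℂ (Gr p)).coord l))).mul contDiffOn_const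

lemma SmoothOn.pow (h : SmoothOn g s) (n : ℕ) : SmoothOn (fun z => g z ^ n) s := by
  induction n with
  | zero => simpa using smoothOn_const (s := s) (1 : Gr p)
  | succ n ih => simpa only [pow_succ] using ih.mul h

lemma SmoothOn.comp {m : V' → V} {s' : Set V'} (h : SmoothOn g s) (hm : ContDiffOn ℝ ∞ m s')
    (hmaps : Set.MapsTo m s' s) : SmoothOn (fun z => g (m z)) s' :=
  fun φ => (h φ).comp hm hmaps

lemma SmoothOn.body (h : SmoothOn g s) : ContDiffOn ℝ ∞ (fun z => body (g z)) s :=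
  h (ExteriorAlgebra.algebraMapInv (R := ℂ) (M := OddIdx p → ℂ)).toLinearMap

/-- Componentwise differentiability of a Grassmann-valued function. -/
def GDiffAt (g : V → Gr p) (z : V) : Prop :=
  ∀ φ : Module.Dual ℂ (Gr p), DifferentiableAt ℝ (fun y => φ (g y)) z

lemma SmoothOn.gdiffAt (h : SmoothOn g s) (hs : IsOpen s) {z : V} (hz : z ∈ s) : GDiffAt g z :=
  fun φ => ((h φ).contDiffAt (hs.mem_nhds hz)).differentiableAt (by simp)

/-- Makes the derivative independent of the basis in its definition; the remaining rules follow by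
testing against linear functionals. -/
lemma gderiv_dual {z : V} (h : GDiffAt g z) (v : V) (φ : Module.Dual ℂ (Gr p)) :
    φ (gderiv g z v) = fderiv ℝ (fun y => φ (g y)) z v := by
  have h1 : (fun y => φ (g y)) = fun y => ∑ k, (Module.finBasis ℂ (Gr p)).repr (g y) k *
      φ (Module.finBasis ℂ (Gr p) k) := by
    ext y; exact gr_expand φ _
  have hd : ∀ k, DifferentiableAt ℝ (fun y => (Module.finBasis ℂ (Gr p)).repr (g y) k) z :=
    fun k => h ((Module.finBasis ℂ (Gr p)).coord k)
  rw [h1, fderiv_fun_sum fun k _ => (hd k).mul_const _, gderiv, map_sum,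
    sum_apply]
  refine Finset.sum_congr rfl fun k _ => ?_
  rw [fderiv_mul_const (hd k), map_smul]
  simp [mul_comm]

lemma gderiv_congr {z : V} (h : g =ᶠ[𝓝 z] g') (v : V) : gderiv g z v = gderiv g' z v := by
  unfold gderiv
  refine Finset.sum_congr rfl fun k _ => ?_
  congr 1
  have : (fun y => (Module.finBasis ℂ (Gr p)).repr (g y) k) =ᶠ[𝓝 z]
      fun y => (Module.finBasis ℂ (Gr p)).repr (g' y) k := h.mono fun y hy => by simp only [hy]
  rw [this.fderiv_eq]

lemma gderiv_linear {z : V} (h : GDiffAt g z) (v : V) (L : Gr p →ₗ[ℂ] Gr q) :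
    gderiv (fun y => L (g y)) z v = L (gderiv g z v) :=
  gr_ext fun φ => by
    rw [gderiv_dual (fun ψ => h (ψ ∘ₗ L))]
    exact (gderiv_dual h v (φ ∘ₗ L)).symm

lemma gderiv_add {z : V} (h : GDiffAt g z) (h' : GDiffAt g' z) (v : V) :
    gderiv (fun y => g y + g' y) z v = gderiv g z v + gderiv g' z v :=
  gr_ext fun φ => by
    rw [gderiv_dual (fun ψ => by simpa only [map_add] using (h ψ).fun_add (h' ψ)), map_add,
      gderiv_dual h, gderiv_dual h']
    simp only [map_add]
    rw [fderiv_fun_add (h φ) (h' φ)]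
    rfl

lemma GDiffAt.mul {z : V} (h : GDiffAt g z) (h' : GDiffAt g' z) :
    GDiffAt (fun y => g y * g' y) z := fun φ => by
  rw [funext fun z => gr_expand_mul φ (g z) (g' z)]
  exact DifferentiableAt.fun_sum fun k _ => DifferentiableAt.fun_sum fun l _ =>
      ((h ((Module.finBasis ℂ (Gr p)).coord k)).mul
        (h' ((Module.finBasis ℂ (Gr p)).coord l))).mul_const _

lemma gderiv_mul {z : V} (h : GDiffAt g z) (h' : GDiffAt g' z) (v : V) :
    gderiv (fun y => g y * g' y) z v = g z * gderiv g' z v + gderiv g z v * g' z :=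
  gr_ext fun φ => by
    have hd : ∀ k, DifferentiableAt ℝ (fun y => (Module.finBasis ℂ (Gr p)).repr (g y) k) z :=
      fun k => h ((Module.finBasis ℂ (Gr p)).coord k)
    have hd' : ∀ k, DifferentiableAt ℝ (fun y => (Module.finBasis ℂ (Gr p)).repr (g' y) k) z :=
      fun k => h' ((Module.finBasis ℂ (Gr p)).coord k)
    have hr : ∀ k, (Module.finBasis ℂ (Gr p)).repr (gderiv g z v) k =
        fderiv ℝ (fun y => (Module.finBasis ℂ (Gr p)).repr (g y) k) z v :=
      fun k => gderiv_dual h v ((Module.finBasis ℂ (Gr p)).coord k)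
    have hr' : ∀ k, (Module.finBasis ℂ (Gr p)).repr (gderiv g' z v) k =
        fderiv ℝ (fun y => (Module.finBasis ℂ (Gr p)).repr (g' y) k) z v :=
      fun k => gderiv_dual h' v ((Module.finBasis ℂ (Gr p)).coord k)
    rw [gderiv_dual (h.mul h'), map_add, gr_expand_mul, gr_expand_mul, ← Finset.sum_add_distrib]
    rw [funext fun y => gr_expand_mul φ (g y) (g' y)]
    have hkl : ∀ k l, DifferentiableAt ℝ (fun y => (Module.finBasis ℂ (Gr p)).repr (g y) k *
        (Module.finBasis ℂ (Gr p)).repr (g' y) l *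
        φ (Module.finBasis ℂ (Gr p) k * Module.finBasis ℂ (Gr p) l)) z := fun k l =>
      ((hd k).fun_mul (hd' l)).mul_const _
    rw [fderiv_fun_sum fun k _ => DifferentiableAt.fun_sum fun l _ => hkl k l, sum_apply]
    refine Finset.sum_congr rfl fun k _ => ?_
    rw [fderiv_fun_sum fun l _ => hkl k l, sum_apply, ← Finset.sum_add_distrib]
    refine Finset.sum_congr rfl fun l _ => ?_
    rw [fderiv_mul_const ((hd k).fun_mul (hd' l)), fderiv_fun_mul (hd k) (hd' l), hr, hr']
    simp
    ring

lemma gderiv_comp {m : V' → V} {z : V'} {m' : V' →L[ℝ] V} (h : GDiffAt g (m z))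
    (hm : HasFDerivAt m m' z) (v : V') :
    gderiv (fun y => g (m y)) z v = gderiv g (m z) (m' v) := by
  have hc : ∀ φ : Module.Dual ℂ (Gr p), HasFDerivAt (fun y => φ (g (m y)))
      ((fderiv ℝ (fun y => φ (g y)) (m z)).comp m') z := fun φ =>
    (h φ).hasFDerivAt.comp z hm
  refine gr_ext fun φ => ?_
  rw [gderiv_dual (fun ψ => (hc ψ).differentiableAt), gderiv_dual h, (hc φ).fderiv]
  rfl

lemma SmoothOn.gderiv (h : SmoothOn g s) (hs : IsOpen s) (v : V) :
    SmoothOn (fun z => gderiv g z v) s := fun φ => by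
  have h1 : ContDiffOn ℝ ∞ (fun z => fderiv ℝ (fun y => φ (g y)) z v) s :=
    ((h φ).fderiv_of_isOpen hs (by simp)).clm_apply contDiffOn_const
  exact h1.congr fun z hz => gderiv_dual (h.gdiffAt hs hz) v φ

lemma gderiv_comm (h : SmoothOn g s) (hs : IsOpen s) {z : V} (hz : z ∈ s) (v w : V) :
    gderiv (fun y => gderiv g y v) z w = gderiv (fun y => gderiv g y w) z v := by
  have key : ∀ v w : V, ∀ φ : Module.Dual ℂ (Gr p),
      φ (_root_.gderiv (fun y => _root_.gderiv g y v) z w) =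
      fderiv ℝ (fderiv ℝ (fun y => φ (g y))) z w v := by
    intro v w φ
    rw [gderiv_dual ((h.gderiv hs v).gdiffAt hs hz)]
    have h1 : (fun y => φ (_root_.gderiv g y v)) =ᶠ[𝓝 z]
        fun y => fderiv ℝ (fun y => φ (g y)) y v := by
      filter_upwards [hs.mem_nhds hz] with y hy
      exact gderiv_dual (h.gdiffAt hs hy) v φ
    have h2 : DifferentiableAt ℝ (fderiv ℝ (fun y => φ (g y))) z :=
      (((h φ).fderiv_of_isOpen (m := ∞) hs (by simp)).contDiffAt (hs.mem_nhds hz)).differentiableAt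
        (by simp)
    rw [h1.fderiv_eq, fderiv_clm_apply h2 (differentiableAt_const v)]
    simp
  refine gr_ext fun φ => ?_
  rw [key, key]
  have h3 : IsSymmSndFDerivAt ℝ (fun y => φ (g y)) z :=
    ((h φ).contDiffAt (hs.mem_nhds hz)).isSymmSndFDerivAt (by
      rw [minSmoothness_of_isRCLikeNormedField]; exact WithTop.coe_le_coe.2 (le_top : (2 : ℕ∞) ≤ ⊤))
  exact h3 w v

lemma gderiv_mem_ker {L : Gr p →ₗ[ℂ] Gr p} (h : SmoothOn g s) (hs : IsOpen s)
    (hL : ∀ z ∈ s, L (g z) = 0) {z : V} (hz : z ∈ s) (v : V) : L (gderiv g z v) = 0 := by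
  rw [← gderiv_linear (h.gdiffAt hs hz)]
  have h1 : (fun y => L (g y)) =ᶠ[𝓝 z] fun _ => 0 := by
    filter_upwards [hs.mem_nhds hz] with y hy
    exact hL y hy
  rw [gderiv_congr h1]
  simp [gderiv]

/-- A subspace is the kernel of a projection, and linear maps commute with differentiation; openness
of s makes the image under the projection vanish near z. -/
lemma gderiv_mem {S : Submodule ℂ (Gr p)} (h : SmoothOn g s) (hs : IsOpen s)
    (hL : ∀ z ∈ s, g z ∈ S) {z : V} (hz : z ∈ s) (v : V) : gderiv g z v ∈ S := by
  obtain ⟨T, hT⟩ := S.exists_isCompl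
  have hk := Submodule.ker_projection hT.symm
  rw [← hk]
  refine gderiv_mem_ker h hs (fun z hz => ?_) hz v
  have := hL z hz
  rwa [← hk] at this

end general

/-! ### Algebras of smooth superfunctions -/


variable [Fintype J]

open Classical in
/-- Extension by zero. -/
def zext {Ω : Opens V} (f : Ω → Gr q) (z : V) : Gr q := if h : z ∈ Ω then f ⟨z, h⟩ else 0

lemma zext_apply {Ω : Opens V} (f : Ω → Gr q) {z : V} (h : z ∈ Ω) : zext f z = f ⟨z, h⟩ :=
  dif_pos h

/-- Smooth superfunctions on `Ω` with Grassmann generators the odd coordinates of `q`. -/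
def SmSub (q : J → ZMod 2) (Ω : Opens V) : Subalgebra ℂ (Ω → Gr q) where
  carrier := {f | SmoothOn (zext f) Ω}
  mul_mem' h h' := (h.mul h').congr fun z hz => by simp [zext_apply _ hz]
  add_mem' h h' := (h.add h').congr fun z hz => by simp [zext_apply _ hz]
  algebraMap_mem' r := (smoothOn_const (algebraMap ℂ (Gr q) r)).congr fun z hz => by
    simp [zext_apply _ hz]

/-- Smooth superfunctions on `Ω`, as a type. -/
def SmAlg (q : J → ZMod 2) (Ω : Opens V) : Type _ := SmSub q Ω

instance (q : J → ZMod 2) (Ω : Opens V) : Ring (SmAlg q Ω) := inferInstanceAs (Ring (SmSub q Ω))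

instance (q : J → ZMod 2) (Ω : Opens V) : Algebra ℂ (SmAlg q Ω) :=
  inferInstanceAs (Algebra ℂ (SmSub q Ω))

namespace SmAlg

variable {Ω : Opens V} {Ω' : Opens V'}

/-- The underlying function, extended by zero. -/
def fn (f : SmAlg q Ω) : V → Gr q := zext f.1

lemma smooth (f : SmAlg q Ω) : SmoothOn f.fn Ω := f.2

lemma gdiffAt (f : SmAlg q Ω) {z : V} (hz : z ∈ Ω) : GDiffAt f.fn z :=
  f.smooth.gdiffAt Ω.isOpen hz

/-- Restriction of a smooth function. -/
def mk (g : V → Gr q) (hg : SmoothOn g Ω) : SmAlg q Ω :=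
  ⟨fun z => g z, hg.congr fun z hz => zext_apply _ hz⟩

lemma fn_mk {g : V → Gr q} (hg : SmoothOn g Ω) {z : V} (hz : z ∈ Ω) : (mk g hg).fn z = g z :=
  zext_apply _ hz

lemma fn_mk_nhds {g : V → Gr q} (hg : SmoothOn g Ω) {z : V} (hz : z ∈ Ω) :
    (mk g hg).fn =ᶠ[𝓝 z] g := by
  filter_upwards [Ω.isOpen.mem_nhds hz] with y hy
  exact fn_mk hg hy

@[ext] lemma ext {f g : SmAlg q Ω} (h : ∀ z ∈ Ω, f.fn z = g.fn z) : f = g :=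
  Subtype.ext (funext fun z => by
    have := h z z.2
    rwa [fn, fn, zext_apply _ z.2, zext_apply _ z.2] at this)

/-- Evaluation at a point. -/
def ev (z : V) (hz : z ∈ Ω) : SmAlg q Ω →ₐ[ℂ] Gr q :=
  (Pi.evalAlgHom ℂ (fun _ : Ω => Gr q) ⟨z, hz⟩).comp (SmSub q Ω).val

lemma ev_apply {z : V} (hz : z ∈ Ω) (f : SmAlg q Ω) : ev z hz f = f.fn z :=
  (zext_apply f.1 hz).symm

variable {z : V} (hz : z ∈ Ω)
include hz

lemma fn_add (f g : SmAlg q Ω) : (f + g).fn z = f.fn z + g.fn z := by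
  simp only [← ev_apply hz, map_add]

lemma fn_sub (f g : SmAlg q Ω) : (f - g).fn z = f.fn z - g.fn z := by
  simp only [← ev_apply hz, map_sub]

lemma fn_neg (f : SmAlg q Ω) : (-f).fn z = -f.fn z := by
  simp only [← ev_apply hz, map_neg]

lemma fn_mul (f g : SmAlg q Ω) : (f * g).fn z = f.fn z * g.fn z := by
  simp only [← ev_apply hz, map_mul]

lemma fn_pow (f : SmAlg q Ω) (n : ℕ) : (f ^ n).fn z = f.fn z ^ n := by
  simp only [← ev_apply hz, map_pow]

lemma fn_smul (c : ℂ) (f : SmAlg q Ω) : (c • f).fn z = c • f.fn z := by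
  simp only [← ev_apply hz, map_smul]

lemma fn_one : (1 : SmAlg q Ω).fn z = 1 := by simp only [← ev_apply hz, map_one]

lemma fn_zero : (0 : SmAlg q Ω).fn z = 0 := by simp only [← ev_apply hz, map_zero]

lemma fn_algebraMap (c : ℂ) : (algebraMap ℂ (SmAlg q Ω) c).fn z = algebraMap ℂ _ c := by
  rw [← ev_apply hz, AlgHom.commutes]

lemma fn_sum {K : Type*} (u : Finset K) (f : K → SmAlg q Ω) :
    (∑ k ∈ u, f k).fn z = ∑ k ∈ u, (f k).fn z := by
  simp only [← ev_apply hz, map_sum]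

omit hz

/-- Elements of given parity. -/
def par (q : J → ZMod 2) (Ω : Opens V) (k : ZMod 2) : Submodule ℂ (SmAlg q Ω) where
  carrier := {f | ∀ z ∈ Ω, f.fn z ∈ gpar (OddIdx q → ℂ) k}
  add_mem' hf hg z hz := by rw [fn_add hz]; exact add_mem (hf z hz) (hg z hz)
  zero_mem' z hz := by rw [fn_zero hz]; exact zero_mem _
  smul_mem' c f hf z hz := by rw [fn_smul hz]; exact Submodule.smul_mem _ _ (hf z hz)

lemma superAlg : IsSuperAlg (par q Ω) where
  one_mem z hz := by rw [fn_one hz]; exact gpar_superAlg.one_mem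
  mul_mem hf hg z hz := by rw [fn_mul hz]; exact gpar_superAlg.mul_mem (hf z hz) (hg z hz)
  comm hf hg := ext fun z hz => by
    rw [fn_smul hz, fn_mul hz, fn_mul hz]; exact gpar_comm (hf z hz) (hg z hz)
  decomp f := by
    have hc := CliffordAlgebra.evenOdd_isCompl (0 : QuadraticForm ℂ (OddIdx q → ℂ))
    refine ⟨mk _ (f.smooth.linear (Submodule.projection _ _ hc)), fun z hz => ?_,
      mk _ (f.smooth.linear (Submodule.projection _ _ hc.symm)), fun z hz => ?_, ext fun z hz => ?_⟩
    · rw [fn_mk _ hz]; exact Submodule.projection_apply_mem hc _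
    · rw [fn_mk _ hz]; exact Submodule.projection_apply_mem hc.symm _
    · rw [fn_add hz, fn_mk _ hz, fn_mk _ hz]
      exact (Submodule.projection_add_projection_eq_self hc _).symm
  disj f h0 h1 := ext fun z hz => by
    rw [fn_zero hz]; exact gpar_superAlg.disj _ (h0 z hz) (h1 z hz)

/-- Directional derivative. -/
def dirD (v : V) : SmAlg q Ω →ₗ[ℂ] SmAlg q Ω where
  toFun f := mk _ (f.smooth.gderiv Ω.isOpen v)
  map_add' f g := ext fun z hz => by
    rw [fn_add hz, fn_mk _ hz, fn_mk _ hz, fn_mk _ hz, ← gderiv_add (f.gdiffAt hz) (g.gdiffAt hz)]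
    refine gderiv_congr ?_ v
    filter_upwards [Ω.isOpen.mem_nhds hz] with y hy
    rw [fn_add hy]
  map_smul' c f := ext fun z hz => by
    rw [RingHom.id_apply, fn_smul hz, fn_mk _ hz, fn_mk _ hz,
      show c • gderiv f.fn z v = (c • LinearMap.id : Gr q →ₗ[ℂ] Gr q) (gderiv f.fn z v) from rfl,
      ← gderiv_linear (f.gdiffAt hz)]
    refine gderiv_congr ?_ v
    filter_upwards [Ω.isOpen.mem_nhds hz] with y hy
    rw [fn_smul hy]; rfl

lemma fn_dirD (v : V) (f : SmAlg q Ω) {z : V} (hz : z ∈ Ω) :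
    (dirD v f).fn z = gderiv f.fn z v := fn_mk _ hz

/-- Right derivative with respect to an odd generator. -/
def oddD (j : OddIdx q) : SmAlg q Ω →ₗ[ℂ] SmAlg q Ω where
  toFun f := mk _ (f.smooth.linear (gD (LinearMap.proj j)))
  map_add' f g := ext fun z hz => by
    rw [fn_add hz, fn_mk _ hz, fn_mk _ hz, fn_mk _ hz, fn_add hz, map_add]
  map_smul' c f := ext fun z hz => by
    rw [RingHom.id_apply, fn_smul hz, fn_mk _ hz, fn_mk _ hz, fn_smul hz, map_smul]

lemma fn_oddD (j : OddIdx q) (f : SmAlg q Ω) {z : V} (hz : z ∈ Ω) :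
    (oddD j f).fn z = gD (LinearMap.proj j) (f.fn z) := fn_mk _ hz

/-- Partial derivatives in even directions and with respect to odd generators. -/
def pd (w : V ⊕ OddIdx q) : SmAlg q Ω →ₗ[ℂ] SmAlg q Ω := Sum.elim dirD oddD w

/-- The parity of a partial derivative. -/
def pdPar (w : V ⊕ OddIdx q) : ZMod 2 := Sum.elim (fun _ => 0) (fun _ => 1) w

lemma pd_der (w : V ⊕ OddIdx q) : IsRDer (par q Ω) (pdPar w) (pd w) := by
  rcases w with v | j
  · refine ⟨fun {i f} hf z hz => ?_, fun {j} f g hg => ext fun z hz => ?_⟩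
    · simp only [pd, Sum.elim_inl, pdPar, fn_dirD v f hz, add_zero]
      exact gderiv_mem f.smooth Ω.isOpen hf hz v
    · simp only [pd, Sum.elim_inl, pdPar, zero_mul, sgn_zero, one_smul]
      rw [fn_dirD v _ hz, fn_add hz, fn_mul hz, fn_mul hz, fn_dirD v _ hz, fn_dirD v _ hz,
        ← gderiv_mul (f.gdiffAt hz) (g.gdiffAt hz)]
      refine gderiv_congr ?_ v
      filter_upwards [Ω.isOpen.mem_nhds hz] with y hy
      rw [fn_mul hy]
  · refine ⟨fun {i f} hf z hz => ?_, fun {k} f g hg => ext fun z hz => ?_⟩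
    · simp only [pd, Sum.elim_inr, pdPar, fn_oddD j f hz]
      exact gD_mem _ (hf z hz)
    · simp only [pd, Sum.elim_inr, pdPar, one_mul]
      rw [fn_oddD j _ hz, fn_add hz, fn_mul hz, fn_smul hz, fn_mul hz, fn_mul hz, fn_oddD j _ hz,
        fn_oddD j _ hz, gD_leib _ _ _ (hg z hz)]

lemma pd_comm (w w' : V ⊕ OddIdx q) (f : SmAlg q Ω) :
    pd w (pd w' f) = sgn (pdPar w * pdPar w') • pd w' (pd w f) := by
  have mixed : ∀ (v : V) (j : OddIdx q), pd (.inl v) (pd (.inr j) f) = pd (.inr j) (pd (.inl v) f) := by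
    intro v j
    refine ext fun z hz => ?_
    simp only [pd, Sum.elim_inl, Sum.elim_inr]
    rw [fn_dirD v _ hz, fn_oddD j _ hz, fn_dirD v _ hz, ← gderiv_linear (f.gdiffAt hz)]
    refine gderiv_congr ?_ v
    filter_upwards [Ω.isOpen.mem_nhds hz] with y hy
    rw [fn_oddD j _ hy]
  rcases w with v | j <;> rcases w' with v' | j'
  · simp only [pdPar, Sum.elim_inl, mul_zero, sgn_zero, one_smul]
    refine ext fun z hz => ?_
    simp only [pd, Sum.elim_inl]
    have h1 : ∀ v v' : V, (dirD v (dirD v' f)).fn z = gderiv (fun y => gderiv f.fn y v') z v := by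
      intro v v'
      rw [fn_dirD v _ hz]
      refine gderiv_congr ?_ v
      filter_upwards [Ω.isOpen.mem_nhds hz] with y hy
      rw [fn_dirD v' _ hy]
    rw [h1, h1]
    exact gderiv_comm f.smooth Ω.isOpen hz _ _
  · simp only [pdPar, Sum.elim_inl, zero_mul, sgn_zero, one_smul]
    exact mixed v j'
  · simp only [pdPar, Sum.elim_inl, mul_zero, sgn_zero, one_smul]
    exact (mixed v' j).symm
  · simp only [pdPar, Sum.elim_inr, mul_one, sgn_one, neg_smul, one_smul]
    refine ext fun z hz => ?_
    simp only [pd, Sum.elim_inr]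
    rw [fn_neg hz, fn_oddD j _ hz, fn_oddD j' _ hz, fn_oddD j' _ hz, fn_oddD j _ hz, gD_comm]

lemma partials {K : Type*} (τ : K → V ⊕ OddIdx q) :
    IsPartials (par q Ω) (fun k => pdPar (τ k)) (fun k => pd (τ k)) where
  der k := pd_der (τ k)
  comm k l f := pd_comm (τ k) (τ l) f

section pull

variable [Fintype I]

/-- Pull-back along an affine map of bodies and a linear map of odd generators. -/
def pullHom (L : V' →L[ℝ] V) (c : V) (Ω' : Opens V') (hm : ∀ z ∈ Ω', L z + c ∈ Ω)
    (r : (OddIdx q → ℂ) →ₗ[ℂ] (OddIdx p → ℂ)) : SmAlg q Ω →ₐ[ℂ] SmAlg p Ω' :=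
  have hs : ∀ f : SmAlg q Ω, SmoothOn (fun z => ExteriorAlgebra.map r (f.fn (L z + c)))
      (Ω' : Set V') := fun f =>
    SmoothOn.linear (g := fun z => f.fn (L z + c)) (f.smooth.comp (m := fun z => L z + c)
      (s' := (Ω' : Set V')) (L.contDiff.add contDiff_const).contDiffOn fun z hz => hm z hz)
      (ExteriorAlgebra.map r).toLinearMap
  { toFun := fun f => mk _ (hs f)
    map_one' := ext fun z hz => by rw [fn_mk _ hz, fn_one (hm z hz), map_one, fn_one hz]
    map_zero' := ext fun z hz => by rw [fn_mk _ hz, fn_zero (hm z hz), map_zero, fn_zero hz]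
    map_mul' := fun f g => ext fun z hz => by
      rw [fn_mk _ hz, fn_mul (hm z hz), map_mul, fn_mul hz, fn_mk _ hz, fn_mk _ hz]
    map_add' := fun f g => ext fun z hz => by
      rw [fn_mk _ hz, fn_add (hm z hz), map_add, fn_add hz, fn_mk _ hz, fn_mk _ hz]
    commutes' := fun a => ext fun z hz => by
      rw [fn_mk _ hz, fn_algebraMap (hm z hz), AlgHom.commutes, fn_algebraMap hz] }

variable {L : V' →L[ℝ] V} {c : V} {hm : ∀ z ∈ Ω', L z + c ∈ Ω}
  {r : (OddIdx q → ℂ) →ₗ[ℂ] (OddIdx p → ℂ)}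

lemma fn_pullHom (f : SmAlg q Ω) {z : V'} (hz : z ∈ Ω') :
    (pullHom L c Ω' hm r f).fn z = ExteriorAlgebra.map r (f.fn (L z + c)) := fn_mk _ hz

lemma pullHom_mem {k : ZMod 2} {f : SmAlg q Ω} (hf : f ∈ par q Ω k) :
    pullHom L c Ω' hm r f ∈ par p Ω' k := fun z hz => by
  rw [fn_pullHom _ hz]; exact map_mem_gpar r (hf _ (hm z hz))

lemma dirD_pullHom (v : V') (f : SmAlg q Ω) :
    dirD v (pullHom L c Ω' hm r f) = pullHom L c Ω' hm r (dirD (L v) f) := ext fun z hz => by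
  rw [fn_pullHom _ hz, fn_dirD v _ hz, fn_dirD _ _ (hm z hz)]
  have h1 : (pullHom L c Ω' hm r f).fn =ᶠ[𝓝 z]
      fun y => (ExteriorAlgebra.map r).toLinearMap (f.fn (L y + c)) := fn_mk_nhds _ hz
  have h2 : HasFDerivAt (fun y => L y + c) L z := L.hasFDerivAt.add_const c
  have h3 : GDiffAt (fun y => f.fn (L y + c)) z := fun φ =>
    DifferentiableAt.comp (f := fun y => L y + c) (g := fun y => φ (f.fn y)) z
      (f.gdiffAt (hm z hz) φ) h2.differentiableAt
  rw [gderiv_congr h1, gderiv_linear h3, gderiv_comp (m := fun y => L y + c) (f.gdiffAt (hm z hz)) h2]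
  rfl

lemma oddD_pullHom {i : OddIdx p} {j : OddIdx q} (h : LinearMap.proj i ∘ₗ r = LinearMap.proj j)
    (f : SmAlg q Ω) : oddD i (pullHom L c Ω' hm r f) = pullHom L c Ω' hm r (oddD j f) :=
  ext fun z hz => by
    rw [fn_pullHom _ hz, fn_oddD i _ hz, fn_oddD j _ (hm z hz), fn_pullHom _ hz, gD_map, h]

lemma oddD_pullHom_zero {i : OddIdx p} (h : LinearMap.proj i ∘ₗ r = 0)
    (f : SmAlg q Ω) : oddD i (pullHom L c Ω' hm r f) = 0 :=
  ext fun z hz => by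
    rw [fn_zero hz, fn_oddD i _ hz, fn_pullHom _ hz, gD_map, h, gD, map_zero, LinearMap.zero_apply, map_zero]

end pull

end SmAlg

end smooth

lemma IsRDer.map_pow {A : Type*} [Ring A] [Algebra ℂ A] {P : ZMod 2 → Submodule ℂ A}
    (hP : IsSuperAlg P) {r : ZMod 2} {D : A →ₗ[ℂ] A} (hD : IsRDer P r D) {m : A} (hm : m ∈ P 0)
    (k : ℕ) : D (m ^ (k + 1)) = ((k : ℂ) + 1) • (m ^ k * D m) := by
  induction k with
  | zero => simp
  | succ k ih =>
    rw [pow_succ, hD.leib_even _ hm, ih, smul_mul_assoc, mul_assoc, ← hP.even_comm hm (D m),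
      ← mul_assoc, ← pow_succ]
    push_cast
    module

/-! ### The exponential in a Grassmann algebra -/

section sexp

variable {I : Type*} [Fintype I] {p : I → ZMod 2}

lemma gfilt_card_eq_bot : gfilt (OddIdx p → ℂ) (Fintype.card (OddIdx p) + 1) = ⊥ :=
  gfilt_eq_bot (by rw [Module.finrank_fintype_fun_eq_card]; exact Nat.lt_succ_self _)

lemma pow_card_eq_zero {a : Gr p} (ha : a ∈ gfilt (OddIdx p → ℂ) 1) :
    a ^ (Fintype.card (OddIdx p) + 1) = 0 := by
  have := gfilt_pow ha (Fintype.card (OddIdx p) + 1)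
  rwa [gfilt_card_eq_bot, Submodule.mem_bot] at this

lemma body_nilpotent {a : Gr p} (ha : a ∈ gfilt (OddIdx p → ℂ) 1) : body a = 0 := by
  have h := congrArg (ExteriorAlgebra.algebraMapInv (R := ℂ) (M := OddIdx p → ℂ))
    (pow_card_eq_zero ha)
  rw [map_pow, map_zero] at h
  exact pow_eq_zero_iff (Nat.succ_ne_zero _) |>.1 h

lemma body_eq (a : Gr p) : body a = ExteriorAlgebra.algebraMapInv a := rfl

lemma body_algebraMap (c : ℂ) : body (algebraMap ℂ (Gr p) c) = c := by simp [body]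

lemma body_add (a b : Gr p) : body (a + b) = body a + body b := by simp [body]

lemma body_sub (a b : Gr p) : body (a - b) = body a - body b := by simp [body]

lemma body_smul (c : ℂ) (b : Gr p) : body (c • b) = c * body b := by simp [body]

lemma body_mul (a b : Gr p) : body (a * b) = body a * body b := by simp [body]

lemma body_sum {K : Type*} (u : Finset K) (f : K → Gr p) :
    body (∑ k ∈ u, f k) = ∑ k ∈ u, body (f k) := by simp [body]

lemma sexp_algebraMap (c : ℂ) : sexp (algebraMap ℂ (Gr p) c) = algebraMap ℂ _ (Complex.exp c) := by
  rw [sexp, body_algebraMap, sub_self, Finset.sum_range_succ']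
  simp [Algebra.algebraMap_eq_smul_one]

/-- The bodies are central and split off. The remainders are commuting nilpotents whose power of
exponent one more than the number of odd generators vanishes, so the truncated series are the full
nilpotent exponentials. -/
lemma sexp_add {a b : Gr p} (h : Commute a b) : sexp (a + b) = sexp a * sexp b := by
  have hs : ∀ (r : ℚ) (x : Gr p), r • x = (r : ℂ) • x := fun r x => by
    rw [← eq_ratCast (algebraMap ℚ ℂ) r, algebraMap_smul]
  set m := a - algebraMap ℂ (Gr p) (body a) with hm
  set n := b - algebraMap ℂ (Gr p) (body b) with hn
  have hm1 : m ^ (Fintype.card (OddIdx p) + 1) = 0 :=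
    pow_card_eq_zero (sub_algebraMap_mem_gfilt a)
  have hn1 : n ^ (Fintype.card (OddIdx p) + 1) = 0 :=
    pow_card_eq_zero (sub_algebraMap_mem_gfilt b)
  have hmn : a + b - algebraMap ℂ (Gr p) (body (a + b)) = m + n := by
    rw [body_add, map_add, hm, hn]; abel
  have hmn1 : (m + n) ^ (Fintype.card (OddIdx p) + 1) = 0 := by
    rw [← hmn]; exact pow_card_eq_zero (sub_algebraMap_mem_gfilt _)
  have hc : Commute m n := by
    refine Commute.sub_left (Commute.sub_right h ?_) ?_
    · exact (Algebra.commutes _ _).symm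
    · exact Algebra.commutes _ _
  have h1 := IsNilpotent.exp_add_of_commute hc ⟨_, hm1⟩ ⟨_, hn1⟩
  rw [IsNilpotent.exp_eq_sum hm1, IsNilpotent.exp_eq_sum hn1, IsNilpotent.exp_eq_sum hmn1] at h1
  simp only [hs] at h1
  push_cast at h1
  rw [sexp, sexp, sexp, hmn, h1, ← hm, ← hn, body_add, Complex.exp_add, smul_mul_smul_comm]

lemma body_sexp (a : Gr p) : body (sexp a) = Complex.exp (body a) := by
  have h : body (a - algebraMap ℂ (Gr p) (body a)) = 0 := by
    rw [body_sub, body_algebraMap, sub_self]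
  rw [sexp, body_smul, body_sum, Finset.sum_range_succ']
  have h2 : ∀ k : ℕ, body ((a - algebraMap ℂ (Gr p) (body a)) ^ (k + 1)) = 0 := fun k => by
    rw [pow_succ, body_mul, h, mul_zero]
  simp only [body_smul, h2]
  simp [body]

end sexp

/-! ### Body, filtration and invertibility of smooth superfunctions -/

section smalg


variable {J : Type*} {q : J → ZMod 2} [Fintype J]
  {V : Type*} [NormedAddCommGroup V] [NormedSpace ℝ V]

namespace SmAlg

variable {Ω : Opens V}

/-- A smooth function as a superfunction. -/
def scal (f : V → ℂ) (hf : ContDiffOn ℝ ∞ f Ω) : SmAlg q Ω := mk _ (smoothOn_algebraMap hf)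

lemma fn_scal {f : V → ℂ} (hf : ContDiffOn ℝ ∞ f Ω) {z : V} (hz : z ∈ Ω) :
    (scal f hf : SmAlg q Ω).fn z = algebraMap ℂ _ (f z) := fn_mk _ hz

lemma scal_mem {f : V → ℂ} (hf : ContDiffOn ℝ ∞ f Ω) : (scal f hf : SmAlg q Ω) ∈ par q Ω 0 :=
  fun z hz => by
    rw [fn_scal hf hz, Algebra.algebraMap_eq_smul_one]
    exact Submodule.smul_mem _ _ gpar_superAlg.one_mem

lemma smooth_body (f : SmAlg q Ω) : ContDiffOn ℝ ∞ (fun z => body (f.fn z)) Ω := f.smooth.body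

/-- The body of a superfunction. -/
def bodyPart (f : SmAlg q Ω) : SmAlg q Ω := scal _ f.smooth_body

/-- The body at a point. -/
def bodyAt (z : V) (hz : z ∈ Ω) : SmAlg q Ω →ₐ[ℂ] ℂ :=
  (ExteriorAlgebra.algebraMapInv (R := ℂ) (M := OddIdx q → ℂ)).comp (ev z hz)

lemma bodyAt_apply {z : V} (hz : z ∈ Ω) (f : SmAlg q Ω) : bodyAt z hz f = body (f.fn z) := by
  rw [← ev_apply hz]; rfl

/-- The filtration by powers of the ideal generated by the odd coordinates. -/
def filt (q : J → ZMod 2) (Ω : Opens V) (k : ℕ) : Submodule ℂ (SmAlg q Ω) where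
  carrier := {f | ∀ z ∈ Ω, f.fn z ∈ gfilt (OddIdx q → ℂ) k}
  add_mem' hf hg z hz := by rw [fn_add hz]; exact add_mem (hf z hz) (hg z hz)
  zero_mem' z hz := by rw [fn_zero hz]; exact zero_mem _
  smul_mem' c f hf z hz := by rw [fn_smul hz]; exact Submodule.smul_mem _ _ (hf z hz)

lemma filt_mul {k l : ℕ} {f g : SmAlg q Ω} (hf : f ∈ filt q Ω k) (hg : g ∈ filt q Ω l) :
    f * g ∈ filt q Ω (k + l) := fun z hz => by
  rw [fn_mul hz]; exact gfilt_mul (hf z hz) (hg z hz)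

lemma filt_anti {k l : ℕ} (h : k ≤ l) : filt q Ω l ≤ filt q Ω k :=
  fun f hf z hz => gfilt_anti h (hf z hz)

lemma filt_zero (f : SmAlg q Ω) : f ∈ filt q Ω 0 := fun z hz => by rw [gfilt_zero]; trivial

lemma filt_mul_right {k : ℕ} {f : SmAlg q Ω} (hf : f ∈ filt q Ω k) (g : SmAlg q Ω) :
    f * g ∈ filt q Ω k := by simpa using filt_mul hf (filt_zero g)

lemma filt_mul_left {k : ℕ} {f : SmAlg q Ω} (hf : f ∈ filt q Ω k) (g : SmAlg q Ω) :
    g * f ∈ filt q Ω k := by simpa using filt_mul (filt_zero g) hf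

lemma filt_card {f : SmAlg q Ω} (hf : f ∈ filt q Ω (Fintype.card (OddIdx q) + 1)) : f = 0 :=
  ext fun z hz => by
    have := hf z hz
    rw [gfilt_card_eq_bot, Submodule.mem_bot] at this
    rw [this, fn_zero hz]

lemma sub_bodyPart_mem (f : SmAlg q Ω) : f - bodyPart f ∈ filt q Ω 1 := fun z hz => by
  rw [fn_sub hz, bodyPart, fn_scal _ hz]; exact sub_algebraMap_mem_gfilt _

lemma mem_filt_one {f : SmAlg q Ω} : f ∈ filt q Ω 1 ↔ ∀ z ∈ Ω, body (f.fn z) = 0 := by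
  refine ⟨fun h z hz => body_nilpotent (h z hz), fun h z hz => ?_⟩
  have := sub_algebraMap_mem_gfilt (f.fn z)
  rwa [← body_eq, h z hz, map_zero, sub_zero] at this

lemma odd_mem_filt {f : SmAlg q Ω} (hf : f ∈ par q Ω 1) : f ∈ filt q Ω 1 :=
  fun z hz => odd_mem_gfilt (hf z hz)

lemma pd_mem_filt {k : ℕ} {f : SmAlg q Ω} (hf : f ∈ filt q Ω (k + 1)) (w : V ⊕ OddIdx q) :
    pd w f ∈ filt q Ω k := fun z hz => by
  rcases w with v | j
  · simp only [pd, Sum.elim_inl, fn_dirD v _ hz]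
    exact gfilt_anti (Nat.le_succ k) (gderiv_mem f.smooth Ω.isOpen hf hz v)
  · simp only [pd, Sum.elim_inr, fn_oddD j _ hz]
    exact gD_mem_gfilt _ (hf z hz)

lemma dirD_mem_filt {k : ℕ} {f : SmAlg q Ω} (hf : f ∈ filt q Ω k) (v : V) :
    dirD v f ∈ filt q Ω k := fun z hz => by
  rw [fn_dirD v _ hz]; exact gderiv_mem f.smooth Ω.isOpen hf hz v

/-! ### Invertible elements and matrices -/

section matrix

variable {n : Type*} [Fintype n] [DecidableEq n]

lemma matrix_pow_mem {N : Matrix n n (SmAlg q Ω)} (hN : ∀ i j, N i j ∈ filt q Ω 1) (k : ℕ) (i j : n) :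
    (N ^ k) i j ∈ filt q Ω k := by
  induction k generalizing i j with
  | zero => exact filt_zero _
  | succ k ih =>
    rw [pow_succ, Matrix.mul_apply]
    exact Submodule.sum_mem _ fun l _ => filt_mul (ih _ _) (hN _ _)

lemma matrix_isNilpotent {N : Matrix n n (SmAlg q Ω)} (hN : ∀ i j, N i j ∈ filt q Ω 1) :
    IsNilpotent N :=
  ⟨Fintype.card (OddIdx q) + 1, Matrix.ext fun i j => filt_card (matrix_pow_mem hN _ i j)⟩

/-- A matrix of superfunctions is invertible if its body is. -/
lemma matrix_isUnit {M : Matrix n n (SmAlg q Ω)}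
    (hM : ∀ z ∈ Ω, (Matrix.of fun i j => body ((M i j).fn z)).det ≠ 0) : IsUnit M := by
  let b : V → Matrix n n ℂ := fun z => Matrix.of fun i j => body ((M i j).fn z)
  have hb : ∀ i j, ContDiffOn ℝ ∞ (fun z => b z i j) Ω := fun i j => (M i j).smooth_body
  have hdet : ∀ a : V → Matrix n n ℂ, (∀ i j, ContDiffOn ℝ ∞ (fun z => a z i j) Ω) →
      ContDiffOn ℝ ∞ (fun z => (a z).det) Ω := by
    intro a ha
    simp only [Matrix.det_apply]
    exact ContDiffOn.sum fun σ _ => (contDiffOn_prod fun i _ => ha _ _).const_smul _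
  have hadj : ∀ i j, ContDiffOn ℝ ∞ (fun z => (b z)⁻¹ i j) Ω := by
    intro i j
    have h1 : ∀ z, (b z)⁻¹ i j = ((b z).det)⁻¹ * (b z).adjugate i j := fun z => by
      rw [Matrix.inv_def, Matrix.smul_apply, smul_eq_mul, Ring.inverse_eq_inv']
    simp only [h1]
    refine ((hdet b hb).inv hM).mul ?_
    simp only [Matrix.adjugate_apply]
    refine hdet _ fun k l => ?_
    by_cases hk : k = j
    · subst hk
      simp only [Matrix.updateRow_self]
      exact contDiffOn_const
    · simp only [Matrix.updateRow_ne hk]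
      exact hb k l
  let M₀ : Matrix n n (SmAlg q Ω) := Matrix.of fun i j => scal _ (hb i j)
  let M₁ : Matrix n n (SmAlg q Ω) := Matrix.of fun i j => scal _ (hadj i j)
  have hfn : ∀ z (hz : z ∈ Ω), (M₀.map (ev z hz)) = (b z).map (algebraMap ℂ (Gr q)) ∧
      (M₁.map (ev z hz)) = ((b z)⁻¹).map (algebraMap ℂ (Gr q)) := fun z hz => by
    constructor <;> ext1 i j <;> simp only [Matrix.map_apply, ev_apply, M₀, M₁, Matrix.of_apply] <;>
      exact fn_scal _ hz
  have hext : ∀ A B : Matrix n n (SmAlg q Ω), (∀ z (hz : z ∈ Ω), A.map (ev z hz) = B.map (ev z hz)) →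
      A = B := fun A B h => Matrix.ext fun i j => ext fun z hz => by
    have := congrFun (congrFun (h z hz) i) j
    simpa only [Matrix.map_apply, ev_apply] using this
  have h10 : M₁ * M₀ = 1 := hext _ _ fun z hz => by
    rw [Matrix.map_mul, (hfn z hz).1, (hfn z hz).2, ← Matrix.map_mul,
      Matrix.nonsing_inv_mul _ (isUnit_iff_ne_zero.2 (hM z hz))]
    simp
  have h01 : M₀ * M₁ = 1 := hext _ _ fun z hz => by
    rw [Matrix.map_mul, (hfn z hz).1, (hfn z hz).2, ← Matrix.map_mul,
      Matrix.mul_nonsing_inv _ (isUnit_iff_ne_zero.2 (hM z hz))]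
    simp
  -- M differs from its body matrix M₀ by entries of positive degree, so M = M₀(1 + nilpotent). The
  -- inverse M₁ of M₀ is smooth by Cramer's rule.
  have hN : IsNilpotent (M₁ * (M - M₀)) := by
    refine matrix_isNilpotent fun i j => ?_
    rw [Matrix.mul_apply]
    exact Submodule.sum_mem _ fun l _ => filt_mul_left (sub_bodyPart_mem (M l j)) _
  have h1 : M = M₀ * (1 + M₁ * (M - M₀)) := by
    rw [mul_add, ← mul_assoc, h01]; simp
  rw [h1]
  exact IsUnit.mul ⟨⟨M₀, M₁, h01, h10⟩, rfl⟩ hN.isUnit_one_add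

lemma isUnit_of_body {f : SmAlg q Ω} (hf : ∀ z ∈ Ω, body (f.fn z) ≠ 0) : IsUnit f := by
  have h := matrix_isUnit (M := (Matrix.of fun _ _ => f : Matrix Unit Unit (SmAlg q Ω)))
    (fun z hz => by simpa using hf z hz)
  obtain ⟨⟨a, b, h1, h2⟩, h3⟩ := h
  simp only at h3
  subst h3
  have e1 := congrFun (congrFun h1 ()) ()
  have e2 := congrFun (congrFun h2 ()) ()
  simp [Matrix.mul_apply] at e1 e2
  exact ⟨⟨f, b () (), e1, e2⟩, rfl⟩

/-- The body of a product of matrices at a point. -/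
lemma bodyAt_map_det {M : Matrix n n (SmAlg q Ω)} {z : V} (hz : z ∈ Ω) :
    (M.map (bodyAt z hz)) = Matrix.of fun i j => body ((M i j).fn z) := by
  ext i j
  simp [bodyAt_apply]

lemma body_det_ne_zero {M : Matrix n n (SmAlg q Ω)} (hM : IsUnit M) {z : V} (hz : z ∈ Ω) :
    (Matrix.of fun i j => body ((M i j).fn z)).det ≠ 0 := by
  rw [← bodyAt_map_det hz]
  have := hM.map (bodyAt z hz).toRingHom.mapMatrix
  exact ((Matrix.isUnit_iff_isUnit_det _).1 this).ne_zero

/-- The off-diagonal blocks of an even supermatrix have odd entries and hence zero body. The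
determinant of the body is therefore the product of those of the diagonal blocks, and the Schur
complement has the body of the even block. -/
lemma sdetRegular {ε : n → ZMod 2} {M : Matrix n n (SmAlg q Ω)} (hs : IsSM (par q Ω) ε ε 0 M)
    (hM : ∀ z ∈ Ω, (Matrix.of fun i j => body ((M i j).fn z)).det ≠ 0) :
    ∃ M', SdetRegular (par q Ω) ε M M' := by
  classical
  obtain ⟨⟨M, M', h1, h2⟩, rfl⟩ := matrix_isUnit hM
  simp only at hs hM
  have hodd : ∀ i j, ε i ≠ ε j → ∀ z ∈ Ω, body ((M i j).fn z) = 0 := by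
    intro i j hij
    refine mem_filt_one.1 (odd_mem_filt (mem_parity_congr (hs i j) ?_))
    rcases zmod2_cases (ε i) with h | h <;> rcases zmod2_cases (ε j) with h' | h' <;>
      rw [h, h'] at hij ⊢ <;> first | exact absurd rfl hij | decide
  have hne : ∀ (i : EvenIdx ε) (j : OddIdx ε), ε i.1 ≠ ε j.1 := fun i j h => j.2 (h ▸ i.2)
  have hblock : ∀ z ∈ Ω,
      (Matrix.of fun i j : EvenIdx ε => body ((M i.1 j.1).fn z)).det ≠ 0 ∧
      (Matrix.of fun i j : OddIdx ε => body ((M i.1 j.1).fn z)).det ≠ 0 := by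
    intro z hz
    have h := hM z hz
    rw [← Matrix.det_submatrix_equiv_self (parityEquiv ε)] at h
    rw [← Matrix.fromBlocks_toBlocks ((Matrix.of fun i j => body ((M i j).fn z)).submatrix
      (parityEquiv ε) (parityEquiv ε))] at h
    have h0 : ((Matrix.of fun i j => body ((M i j).fn z)).submatrix
      (parityEquiv ε) (parityEquiv ε)).toBlocks₂₁ = 0 := by
      ext i j
      exact hodd _ _ (hne j i).symm z hz
    rw [h0, Matrix.det_fromBlocks_zero₂₁] at h
    exact ⟨left_ne_zero_of_mul h, right_ne_zero_of_mul h⟩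
  refine ⟨M', hs, h1, h2, ?_, ?_⟩
  · exact matrix_isUnit fun z hz => (hblock z hz).2
  · refine matrix_isUnit fun z hz => ?_
    convert (hblock z hz).1 using 3
    ext i j
    simp only [Matrix.of_apply]
    rw [Matrix.sub_apply, fn_sub hz, body_sub, Matrix.submatrix_apply, sub_eq_self, Matrix.mul_apply, fn_sum hz, body_sum]
    refine Finset.sum_eq_zero fun k _ => ?_
    rw [fn_mul hz, body_mul]
    refine mul_eq_zero_of_right _ ?_
    exact hodd _ _ (hne j k).symm z hz

end matrix

/-! ### The exponential -/

lemma smooth_sexp (f : SmAlg q Ω) : SmoothOn (fun z => sexp (f.fn z)) (Ω : Set V) := by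
  refine SmoothOn.smul f.smooth_body.cexp (SmoothOn.sum _ fun k _ => ?_)
  have h1 : SmoothOn (fun z => (f - bodyPart f).fn z ^ k) (Ω : Set V) := (f - bodyPart f).smooth.pow k
  refine (h1.linear (((k.factorial : ℂ)⁻¹) • LinearMap.id)).congr fun z hz => ?_
  have hz' : z ∈ Ω := hz
  rw [fn_sub hz', bodyPart, fn_scal _ hz']
  rfl

/-- The exponential of a superfunction. -/
def exp (f : SmAlg q Ω) : SmAlg q Ω := mk _ f.smooth_sexp

lemma fn_exp (f : SmAlg q Ω) {z : V} (hz : z ∈ Ω) : (exp f).fn z = sexp (f.fn z) := fn_mk _ hz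

lemma isUnit_exp (f : SmAlg q Ω) : IsUnit (exp f) := isUnit_of_body fun z hz => by
  rw [fn_exp f hz, body_sexp]; exact Complex.exp_ne_zero _

lemma exp_eq (f : SmAlg q Ω) : exp f = scal _ f.smooth_body.cexp *
    ∑ k ∈ Finset.range (Fintype.card (OddIdx q) + 1), ((k.factorial : ℂ)⁻¹) • (f - bodyPart f) ^ k :=
  ext fun z hz => by
    rw [fn_exp f hz, fn_mul hz, fn_scal _ hz, fn_sum hz, sexp, ← Algebra.smul_def]
    congr 1
    refine Finset.sum_congr rfl fun k _ => ?_
    rw [fn_smul hz, fn_pow hz, fn_sub hz, bodyPart, fn_scal _ hz]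

lemma exp_mem {f : SmAlg q Ω} (hf : f ∈ par q Ω 0) : exp f ∈ par q Ω 0 := by
  have hm : f - bodyPart f ∈ par q Ω 0 := sub_mem hf (scal_mem _)
  have hp : ∀ k : ℕ, (f - bodyPart f) ^ k ∈ par q Ω 0 := fun k => by
    induction k with
    | zero => rw [pow_zero]; exact superAlg.one_mem
    | succ k ih => rw [pow_succ]; simpa using superAlg.mul_mem ih hm
  rw [exp_eq]
  simpa using superAlg.mul_mem (scal_mem f.smooth_body.cexp)
    (Submodule.sum_mem _ fun k _ => Submodule.smul_mem _ _ (hp k))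

lemma dirD_scal {f : V → ℂ} (hf : ContDiffOn ℝ ∞ f Ω) (v : V) {z : V} (hz : z ∈ Ω) :
    (dirD v (scal f hf : SmAlg q Ω)).fn z = algebraMap ℂ _ (fderiv ℝ f z v) := by
  have h1 : (scal f hf : SmAlg q Ω).fn =ᶠ[𝓝 z] fun y => algebraMap ℂ (Gr q) (f y) :=
    fn_mk_nhds _ hz
  rw [fn_dirD v _ hz, gderiv_congr h1]
  have hd : DifferentiableAt ℝ f z :=
    (hf.contDiffAt (Ω.isOpen.mem_nhds hz)).differentiableAt (by simp)
  have h2 : ∀ φ : Module.Dual ℂ (Gr q), (fun y => φ (algebraMap ℂ (Gr q) (f y))) =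
      fun y => f y * φ 1 := fun φ => by
    ext y; rw [Algebra.algebraMap_eq_smul_one, map_smul, smul_eq_mul]
  refine gr_ext fun φ => ?_
  rw [gderiv_dual (fun ψ => by rw [h2]; exact hd.mul_const _), h2, fderiv_mul_const hd,
    Algebra.algebraMap_eq_smul_one, map_smul]
  simp [mul_comm]

lemma oddD_scal {f : V → ℂ} (hf : ContDiffOn ℝ ∞ f Ω) (j : OddIdx q) :
    oddD j (scal f hf : SmAlg q Ω) = 0 :=
  ext fun z hz => by rw [fn_oddD j _ hz, fn_scal _ hz, gD_algebraMap, fn_zero hz]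

lemma pd_scal_exp {f : V → ℂ} (hf : ContDiffOn ℝ ∞ f Ω) (w : V ⊕ OddIdx q) :
    pd w (scal _ hf.cexp : SmAlg q Ω) = scal _ hf.cexp * pd w (scal f hf) := by
  rcases w with v | j
  · refine ext fun z hz => ?_
    simp only [pd, Sum.elim_inl]
    have hd : DifferentiableAt ℝ f z :=
      (hf.contDiffAt (Ω.isOpen.mem_nhds hz)).differentiableAt (by simp)
    rw [fn_mul hz, dirD_scal _ v hz, dirD_scal _ v hz, fn_scal _ hz, ← map_mul,
      (hd.hasFDerivAt.cexp).fderiv]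
    rfl
  · simp only [pd, Sum.elim_inr, oddD_scal, mul_zero]

/-- The derivative of the exponential of an even superfunction. -/
theorem pd_exp {f : SmAlg q Ω} (hf : f ∈ par q Ω 0) (w : V ⊕ OddIdx q) :
    pd w (exp f) = exp f * pd w f := by
  set m := f - bodyPart f with hm
  have hm0 : m ∈ par q Ω 0 := sub_mem hf (scal_mem _)
  have hD := pd_der (q := q) (Ω := Ω) w
  have hmem : ∀ k, m ^ k ∈ filt q Ω k := fun k => by
    induction k with
    | zero => exact filt_zero _
    | succ k ih => rw [pow_succ]; exact filt_mul ih (sub_bodyPart_mem f)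
  set n := Fintype.card (OddIdx q) with hn
  -- Differentiating the truncated series loses its top term; this term vanishes because m ^ (n + 1)
  -- = 0 and its derivative is a nonzero multiple of m ^ n times the derivative of m.
  have hmn : m ^ n * pd w m = 0 := by
    have h1 := hD.map_pow superAlg hm0 n
    rw [filt_card (hmem (n + 1)), map_zero] at h1
    refine (smul_eq_zero.1 h1.symm).resolve_left ?_
    exact_mod_cast Nat.succ_ne_zero n
  have hE : pd w (∑ k ∈ Finset.range (n + 1), ((k.factorial : ℂ)⁻¹) • m ^ k) =
      (∑ k ∈ Finset.range (n + 1), ((k.factorial : ℂ)⁻¹) • m ^ k) * pd w m := by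
    have h1 := Finset.sum_range_succ (fun k => ((k.factorial : ℂ)⁻¹) • m ^ k) n
    rw [congrArg (· * pd w m) h1]
    rw [Finset.sum_range_succ', map_add, map_sum, add_mul, smul_mul_assoc, hmn,
      smul_zero, add_zero, pow_zero, map_smul, hD.map_one superAlg, smul_zero, add_zero,
      Finset.sum_mul]
    refine Finset.sum_congr rfl fun k _ => ?_
    rw [map_smul, hD.map_pow superAlg hm0, smul_smul, smul_mul_assoc]
    congr 1
    rw [Nat.factorial_succ]
    have : ((k : ℂ) + 1) ≠ 0 := by exact_mod_cast Nat.succ_ne_zero k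
    push_cast
    field_simp
  have hEe : (∑ k ∈ Finset.range (n + 1), ((k.factorial : ℂ)⁻¹) • m ^ k) ∈ par q Ω 0 := by
    refine Submodule.sum_mem _ fun k hk => Submodule.smul_mem _ _ ?_
    clear hk
    induction k with
    | zero => rw [pow_zero]; exact superAlg.one_mem
    | succ k ih => rw [pow_succ]; simpa using superAlg.mul_mem ih hm0
  have hsplit : pd w f = pd w (bodyPart f) + pd w m := by rw [← map_add, hm, add_sub_cancel]
  rw [exp_eq, ← hm, hD.leib_even _ hEe, hE, pd_scal_exp f.smooth_body, hsplit, mul_add]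
  rw [mul_assoc, mul_assoc, ← superAlg.even_comm hEe, mul_assoc]
  exact add_comm _ _

end SmAlg

end smalg

/-! ### Coordinate directions and coordinate functions -/

section coordinates

variable {I J : Type*} {p : I → ZMod 2} {q : J → ZMod 2} [Fintype I] [Fintype J]
  {V V' : Type*} [NormedAddCommGroup V] [NormedSpace ℝ V] [NormedAddCommGroup V'] [NormedSpace ℝ V']

open Classical in
/-- The direction of the coordinate `i`. -/
def crd (q : J → ZMod 2) (i : J) : Body q ⊕ OddIdx q :=
  if h : q i = 0 then .inl (Pi.single ⟨i, h⟩ 1) else .inr ⟨i, h⟩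

lemma pdPar_crd (i : J) : SmAlg.pdPar (crd q i) = q i := by
  unfold crd
  split
  · next h => rw [h]; rfl
  · next h => rw [zmod2_ne h]; rfl

namespace SmAlg

lemma partials_crd (Ω : Opens (Body q)) : IsPartials (par q Ω) q (fun k => pd (crd q k)) := by
  have := partials (q := q) (Ω := Ω) (crd q)
  simpa only [pdPar_crd] using this

lemma fn_pd_crd {Ω : Opens (Body q)} (i : J) (f : SmAlg q Ω) {z : Body q} (hz : z ∈ Ω) :
    (pd (crd q i) f).fn z = rD i f.fn z := by
  unfold crd rD
  split
  · exact fn_dirD _ _ hz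
  · exact fn_oddD _ _ hz

lemma rD_congr {g g' : SFun q} {z : Body q} (h : g =ᶠ[𝓝 z] g') (i : J) : rD i g z = rD i g' z := by
  unfold rD
  split
  · exact gderiv_congr h _
  · rw [h.self_of_nhds]

lemma lD_congr {g g' : SFun q} {z : Body q} (h : g =ᶠ[𝓝 z] g') (i : J) : lD i g z = lD i g' z := by
  unfold lD
  split
  · exact gderiv_congr h _
  · rw [h.self_of_nhds]

/-- Left derivatives occur in the definitions, right derivatives in the algebra; on homogeneous
values they differ by a sign only. -/
lemma lD_eq {g : SFun q} {z : Body q} {k : ZMod 2} (h : HasParity k (g z)) (i : J) :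
    lD i g z = sgn (q i * (k + 1)) • rD i g z := by
  unfold lD rD
  split
  · next h0 => rw [h0, zero_mul, sgn_zero, one_smul]
  · next h0 => rw [zmod2_ne h0, one_mul]; exact contractLeft_eq_gD _ h

lemma dirD_zero {Ω : Opens V} (f : SmAlg q Ω) : dirD (0 : V) f = 0 := ext fun z hz => by
  rw [fn_dirD _ _ hz, fn_zero hz]; simp [gderiv]

lemma smooth_coordFn (i : J) (s : Set (Body q)) : SmoothOn (coordFn (p := q) i) s := by
  unfold coordFn
  split
  · next h =>
    exact smoothOn_algebraMap (f := fun x : Body q => ((x ⟨i, h⟩ : ℝ) : ℂ))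
      (Complex.ofRealCLM.contDiff.comp (contDiff_apply ℝ ℝ _)).contDiffOn
  · exact smoothOn_const _

/-- The coordinates. -/
def coord (Ω : Opens (Body q)) (i : J) : SmAlg q Ω := mk _ (smooth_coordFn i _)

lemma coord_mem (Ω : Opens (Body q)) (i : J) : coord Ω i ∈ par q Ω (q i) := fun z hz => by
  rw [coord, fn_mk _ hz]
  unfold coordFn
  split
  · next h =>
    rw [h, Algebra.algebraMap_eq_smul_one]
    exact Submodule.smul_mem _ _ gpar_superAlg.one_mem
  · next h => rw [zmod2_ne h]; exact ι_mem_gpar _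

lemma coordFn_mem (i : J) (z : Body q) : HasParity (q i) (coordFn i z) := by
  have := coord_mem (⊤ : Opens (Body q)) i z (Opens.mem_top z)
  rwa [coord, fn_mk _ (Opens.mem_top z)] at this

open Classical in
lemma rD_coordFn (i j : J) (z : Body q) : rD i (coordFn j) z = if i = j then 1 else 0 := by
  unfold rD
  split
  · next h =>
    by_cases h' : q j = 0
    · have hc : coordFn (p := q) j = fun x => algebraMap ℂ (Gr q) ((x ⟨j, h'⟩ : ℝ) : ℂ) := by
        ext x; simp [coordFn, h']
      have hd : ContDiff ℝ ∞ (fun x : Body q => ((x ⟨j, h'⟩ : ℝ) : ℂ)) :=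
        Complex.ofRealCLM.contDiff.comp (contDiff_apply ℝ ℝ _)
      have h1 := dirD_scal (q := q) (Ω := (⊤ : Opens (Body q))) hd.contDiffOn
        (Pi.single ⟨i, h⟩ 1) (z := z) (Opens.mem_top z)
      rw [fn_dirD _ _ (Opens.mem_top z)] at h1
      have h2 : (scal _ hd.contDiffOn : SmAlg q (⊤ : Opens (Body q))).fn = coordFn j := by
        ext1 x; rw [fn_scal _ (Opens.mem_top x), hc]
      rw [h2] at h1
      rw [h1]
      have h3 : HasFDerivAt (fun x : Body q => ((x ⟨j, h'⟩ : ℝ) : ℂ))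
          (Complex.ofRealCLM.comp (ContinuousLinearMap.proj (R := ℝ) (φ := fun _ : EvenIdx q => ℝ) ⟨j, h'⟩)) z :=
        (Complex.ofRealCLM.comp (ContinuousLinearMap.proj (R := ℝ) (φ := fun _ : EvenIdx q => ℝ)
          ⟨j, h'⟩)).hasFDerivAt
      rw [h3.fderiv]
      by_cases hij : i = j
      · subst hij; simp
      · simp [hij, Pi.single_apply, Ne.symm hij]
    · have hc : coordFn (p := q) j = fun x => ExteriorAlgebra.ι ℂ (Pi.single (⟨j, h'⟩ : OddIdx q) (1 : ℂ)) := by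
        ext x; simp [coordFn, h']
      have : i ≠ j := fun e => h' (e ▸ h)
      rw [hc, if_neg this]
      simp [gderiv]
  · next h =>
    change gD _ _ = _
    unfold coordFn
    split
    · next h' =>
      have : i ≠ j := fun e => h (e ▸ h')
      rw [gD_algebraMap, if_neg this]
    · next h' =>
      rw [gD_ι]
      by_cases hij : i = j
      · subst hij; simp
      · simp [hij, Pi.single_apply]

open Classical in
lemma lD_coordFn (i j : J) (z : Body q) : lD i (coordFn j) z = if i = j then 1 else 0 := by
  rw [lD_eq (coordFn_mem j z), rD_coordFn]
  split
  · next h =>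
    subst h
    have : ∀ a : ZMod 2, a * (a + 1) = 0 := by decide
    rw [this, sgn_zero, one_smul]
  · rw [smul_zero]

open Classical in
lemma pd_coord {Ω : Opens (Body q)} (i j : J) :
    pd (crd q i) (coord Ω j) = if i = j then 1 else 0 := ext fun z hz => by
  have h1 : (coord Ω j).fn =ᶠ[𝓝 z] coordFn j := fn_mk_nhds _ hz
  rw [fn_pd_crd _ _ hz, rD_congr h1, rD_coordFn]
  split
  · rw [fn_one hz]
  · rw [fn_zero hz]

end SmAlg

/-! ### Maps of coordinates -/

section maps

variable (e : I → J) (he : ∀ i, q (e i) = p i)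

/-- `projBody` as a continuous linear map. -/
def projL : Body q →L[ℝ] Body p :=
  ContinuousLinearMap.pi fun i => ContinuousLinearMap.proj (evenMap e he i)

/-- `inclBody` as a continuous linear map. -/
def inclL : Body p →L[ℝ] Body q :=
  (Function.ExtendByZero.linearMap ℝ (evenMap e he)).toContinuousLinearMap

lemma inclL_apply (u : Body p) : inclL e he u = inclBody e he u := rfl

lemma projL_apply (x : Body q) : projL e he x = projBody e he x := rfl

variable {e} (hinj : Function.Injective e)
include hinj

lemma evenMap_injective : Function.Injective (evenMap e he) := fun a b h =>
  Subtype.ext (hinj (congrArg Subtype.val h))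

lemma oddMap_injective : Function.Injective (oddMap e he) := fun a b h =>
  Subtype.ext (hinj (congrArg Subtype.val h))

/-- The image of a direction under a map of coordinates. -/
lemma crd_map (i : I) : crd q (e i) = Sum.map (inclL e he) (oddMap e he) (crd p i) := by
  classical
  unfold crd
  by_cases h : p i = 0
  · rw [dif_pos h, dif_pos ((he i).trans h), Sum.map_inl, inclL_apply]
    congr 1
    ext1 k
    rw [inclBody]
    by_cases hk : ∃ l, evenMap e he l = k
    · obtain ⟨l, rfl⟩ := hk
      rw [(evenMap_injective he hinj).extend_apply]
      have hiff : evenMap e he l = ⟨e i, (he i).trans h⟩ ↔ l = ⟨i, h⟩ := by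
        rw [Subtype.ext_iff, Subtype.ext_iff]
        exact ⟨fun h => hinj h, fun h => congrArg e h⟩
      simp only [Pi.single_apply, hiff]
    · rw [Function.extend_apply' _ _ _ hk, Pi.single_eq_of_ne]
      · rfl
      · rintro rfl
        exact hk ⟨⟨i, h⟩, rfl⟩
  · rw [dif_neg h, dif_neg (fun h' => h ((he i).symm.trans h')), Sum.map_inr]
    rfl

lemma projL_inclL (u : Body p) : projL e he (inclL e he u) = u := by
  ext i
  rw [projL_apply, inclL_apply, projBody, inclBody, (evenMap_injective he hinj).extend_apply]

lemma proj_extendByZero (i : OddIdx p) :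
    LinearMap.proj (oddMap e he i) ∘ₗ Function.ExtendByZero.linearMap ℂ (oddMap e he) =
      (LinearMap.proj i : (OddIdx p → ℂ) →ₗ[ℂ] ℂ) := by
  ext v
  simp only [LinearMap.comp_apply, LinearMap.proj_apply]
  exact (oddMap_injective he hinj).extend_apply _ _ _

omit hinj in
lemma proj_extendByZero_zero {j : OddIdx q} (hj : ∀ i, e i ≠ j.1) :
    (LinearMap.proj j : (OddIdx q → ℂ) →ₗ[ℂ] ℂ) ∘ₗ
      Function.ExtendByZero.linearMap ℂ (oddMap e he) = 0 := by
  ext v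
  simp only [LinearMap.comp_apply, LinearMap.proj_apply]
  exact Function.extend_apply' _ _ _ (by rintro ⟨i, hi⟩; exact hj i (congrArg Subtype.val hi))

omit hinj in
lemma projL_single {j : J} {w : Body q} (hj : ∀ i, e i ≠ j) (hw : crd q j = .inl w) :
    projL e he w = 0 := by
  classical
  unfold crd at hw
  split at hw
  · next h =>
    rw [← Sum.inl.inj hw]
    ext i
    rw [projL_apply, projBody, Pi.single_eq_of_ne]
    · rfl
    · intro h'; exact hj i.1 (congrArg Subtype.val h')
  · exact absurd hw (by simp)

end maps

end coordinates

/-! ### Adjoining the conjugate pairs π, π* to an odd Poisson structure -/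

section extMat

variable {ι κ₁ : Type*} {p : ι → ZMod 2} {ε₁ : κ₁ → ZMod 2}

open Classical in
/-- The extended antisymplectic matrix over an arbitrary ring. -/
def extMat {R : Type*} [Ring R] (E : ι → ι → R) : ExtVar ι κ₁ → ExtVar ι κ₁ → R
  | .gam a, .gam b => E a b
  | .pi α, .piS β => if α = β then 1 else 0
  | .piS α, .pi β => if α = β then -1 else 0
  | _, _ => 0

lemma map_extMat {R S : Type*} [Ring R] [Ring S] (f : R →+* S) (E : ι → ι → R)
    (i j : ExtVar ι κ₁) : f (extMat E i j) = extMat (fun a b => f (E a b)) i j := by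
  rcases i with a | α | α <;> rcases j with b | β | β <;> simp only [extMat, map_zero] <;>
    split <;> simp

lemma sum_extVar [Fintype ι] [Fintype κ₁] {M : Type*} [AddCommMonoid M] (f : ExtVar ι κ₁ → M) :
    ∑ v, f v = (∑ i, f (.gam i)) + ∑ α, (f (.pi α) + f (.piS α)) := by
  let e : ι ⊕ (κ₁ ⊕ κ₁) ≃ ExtVar ι κ₁ :=
    { toFun := Sum.elim .gam (Sum.elim .pi .piS)
      invFun := fun v => match v with
        | .gam i => .inl i
        | .pi a => .inr (.inl a)
        | .piS a => .inr (.inr a)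
      left_inv := by rintro (i | a | a) <;> rfl
      right_inv := by rintro (i | a | a) <;> rfl }
  rw [← e.sum_comp]
  simp only [Fintype.sum_sum_type, Finset.sum_add_distrib]
  simp only [e, Equiv.coe_fn_mk, Sum.elim_inl, Sum.elim_inr]

variable {A : Type*} [Ring A] [Algebra ℂ A] {P : ZMod 2 → Submodule ℂ A} [Fintype ι] [Fintype κ₁]
  {d : ExtVar ι κ₁ → A →ₗ[ℂ] A} {E : ι → ι → A}

lemma extMat_mem (hP : IsSuperAlg P) (hE : ∀ a b, E a b ∈ P (p a + p b + 1)) (i j : ExtVar ι κ₁) :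
    extMat E i j ∈ P (extParity p ε₁ i + extParity p ε₁ j + 1) := by
  have h2 : ∀ a : ZMod 2, a + (a + 1) + 1 = 0 := by decide
  have h3 : ∀ a : ZMod 2, a + 1 + a + 1 = 0 := by decide
  rcases i with a | α | α <;> rcases j with b | β | β <;> simp only [extMat, extParity] <;>
    first
    | exact zero_mem _
    | exact hE a b
    | split
      · next h =>
        subst h
        simp only [h2, h3]
        first | exact hP.one_mem | exact neg_mem hP.one_mem
      · exact zero_mem _

lemma extMat_skew (hE : ∀ a b, E b a = -(sgn ((p a + 1) * (p b + 1)) • E a b))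
    (i j : ExtVar ι κ₁) : extMat E j i =
      -(sgn ((extParity p ε₁ i + 1) * (extParity p ε₁ j + 1)) • extMat E i j) := by
  have h2 : ∀ a : ZMod 2, (a + 1) * (a + 1 + 1) = 0 := by decide
  have h3 : ∀ a : ZMod 2, (a + 1 + 1) * (a + 1) = 0 := by decide
  rcases i with a | α | α <;> rcases j with b | β | β <;> simp only [extMat, extParity, smul_zero, neg_zero]
  · exact hE a b
  · by_cases h : α = β
    · subst h; simp [h2]
    · simp [h, Ne.symm h]
  · by_cases h : α = β
    · subst h; simp [h3]
    · simp [h, Ne.symm h]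

lemma extMat_der (hP : IsSuperAlg P) (hd : IsPartials P (extParity p ε₁) d) (k i j : ExtVar ι κ₁)
    (h : (∃ a b, i = .gam a ∧ j = .gam b) → d k (extMat E i j) = 0) : d k (extMat E i j) = 0 := by
  have h1 := (hd.der k).map_one hP
  rcases i with a | α | α <;> rcases j with b | β | β <;> simp only [extMat, map_zero] at h ⊢ <;>
    first
    | exact h ⟨a, b, rfl, rfl⟩
    | split <;> simp [h1]

/-- The extension of an odd Poisson structure by conjugate pairs. -/
lemma extMat_poisson (hP : IsSuperAlg P) (hd : IsPartials P (extParity p ε₁) d)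
    (hE : ∀ a b, E a b ∈ P (p a + p b + 1))
    (hs : ∀ a b, E b a = -(sgn ((p a + 1) * (p b + 1)) • E a b))
    (hπ : ∀ α a b, d (.pi α) (E a b) = 0 ∧ d (.piS α) (E a b) = 0)
    (hj : ∀ a b c,
      sgn ((p a + 1) * (p c + 1)) • ∑ k, sgn (p k * (p b + p c)) • (E a k * d (.gam k) (E b c))
      + sgn ((p b + 1) * (p a + 1)) • ∑ k, sgn (p k * (p c + p a)) • (E b k * d (.gam k) (E c a))
      + sgn ((p c + 1) * (p b + 1)) • ∑ k, sgn (p k * (p a + p b)) • (E c k * d (.gam k) (E a b))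
        = 0) :
    IsOddPoisson P (extParity p ε₁) d (extMat E) where
  mem := extMat_mem hP hE
  skew := extMat_skew hs
  jac := by
    have h1 : ∀ a b c : ι, ∑ k : ExtVar ι κ₁, sgn (extParity p ε₁ k * (extParity p ε₁ (.gam b) +
        extParity p ε₁ (.gam c))) • (extMat (κ₁ := κ₁) E (.gam a) k *
        d k (extMat (κ₁ := κ₁) E (.gam b) (.gam c))) =
        ∑ k, sgn (p k * (p b + p c)) • (E a k * d (.gam k) (E b c)) := by
      intro a b c
      rw [sum_extVar]
      simp [extMat, extParity]
    -- A term with an index outside Γ vanishes: either the differentiated entry is constant, or the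
    -- π directions act on functions of Γ, or the mixed block is zero.
    have h0 : ∀ i j k : ExtVar ι κ₁, ((∃ a, i = .gam a) → (∃ b, j = .gam b) → (∃ c, k = .gam c) →
        False) → ∑ l, sgn (extParity p ε₁ l * (extParity p ε₁ j + extParity p ε₁ k)) •
          (extMat E i l * d l (extMat E j k)) = 0 := by
      intro i j k h
      refine Finset.sum_eq_zero fun l _ => ?_
      by_cases hjk : ∃ a b, j = .gam a ∧ k = .gam b
      · obtain ⟨b, c, rfl, rfl⟩ := hjk
        rcases i with a | α | α
        · exact (h ⟨a, rfl⟩ ⟨b, rfl⟩ ⟨c, rfl⟩).elim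
        all_goals
          rcases l with l | l | l
          · simp [extMat]
          · simp [extMat, (hπ l b c).1]
          · simp [extMat, (hπ l b c).2]
      · rw [extMat_der hP hd l j k (fun h => (hjk h).elim), mul_zero, smul_zero]
    intro i j k
    by_cases h : (∃ a, i = .gam a) ∧ (∃ b, j = .gam b) ∧ (∃ c, k = .gam c)
    · obtain ⟨⟨a, rfl⟩, ⟨b, rfl⟩, ⟨c, rfl⟩⟩ := h
      rw [h1, h1, h1]
      exact hj a b c
    · rw [h0 i j k fun x y z => h ⟨x, y, z⟩, h0 j k i fun x y z => h ⟨z, x, y⟩,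
        h0 k i j fun x y z => h ⟨y, z, x⟩]
      simp

end extMat

/-! ### The Jacobi identity in components -/

section poisson

variable {ι : Type*} [Fintype ι] {p : ι → ZMod 2} {E : ι → ι → SFun p} {U₀ : Opens (Body p)}

/-- The matrix of an antisymplectic structure. -/
def smMat (hE : IsAntisymplectic E U₀) (a b : ι) : SmAlg p U₀ := SmAlg.mk _ (hE.smooth a b)

/-- The component identity is the functional one applied to the coordinates, whose brackets are the
entries of E. -/
lemma smMat_poisson (hE : IsAntisymplectic E U₀) :
    IsOddPoisson (SmAlg.par p U₀) p (fun k => SmAlg.pd (crd p k)) (smMat hE) where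
  mem a b z hz := by rw [smMat, SmAlg.fn_mk _ hz]; exact hE.parity a b z hz
  skew a b := SmAlg.ext fun z hz => by
    rw [SmAlg.fn_neg hz, SmAlg.fn_smul hz, smMat, smMat, SmAlg.fn_mk _ hz, SmAlg.fn_mk _ hz]
    exact hE.skew a b z hz
  jac := by
    classical
    have h1 : ∀ b c, antibracket E (coordFn b) (coordFn c) = E b c := by
      intro b c
      ext1 x
      simp [antibracket, SmAlg.rD_coordFn, SmAlg.lD_coordFn]
    have h2 : ∀ a b c, ∀ z ∈ U₀, antibracket E (coordFn a) (E b c) z =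
        (∑ k, sgn (p k * (p b + p c)) • (smMat hE a k * SmAlg.pd (crd p k) (smMat hE b c))).fn z := by
      intro a b c z hz
      rw [SmAlg.fn_sum hz]
      simp only [antibracket, SmAlg.rD_coordFn]
      rw [Finset.sum_comm]
      refine Finset.sum_congr rfl fun k _ => ?_
      have h3 : (smMat hE b c).fn =ᶠ[𝓝 z] E b c := SmAlg.fn_mk_nhds _ hz
      rw [SmAlg.fn_smul hz, SmAlg.fn_mul hz, SmAlg.fn_pd_crd _ _ hz, SmAlg.rD_congr h3,
        SmAlg.lD_eq (hE.parity b c z hz), smMat, SmAlg.fn_mk _ hz]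
      simp only [ite_mul, one_mul, zero_mul, Finset.sum_ite_eq', Finset.mem_univ, if_true,
        mul_smul_comm, smul_ite, smul_zero]
      refine sgn_smul_congr ?_ rfl
      have : ∀ a b c : ZMod 2, a * (b + c + 1 + 1) = a * (b + c) := by decide
      exact this _ _ _
    intro a b c
    refine SmAlg.ext fun z hz => ?_
    have := hE.jacobi (p a) (p b) (p c) (coordFn a) (coordFn b) (coordFn c)
      (SmAlg.smooth_coordFn _ _) (SmAlg.smooth_coordFn _ _) (SmAlg.smooth_coordFn _ _)
      (fun x _ => ⟨SmAlg.coordFn_mem _ _, SmAlg.coordFn_mem _ _, SmAlg.coordFn_mem _ _⟩) z hz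
    rw [h1, h1, h1, h2 _ _ _ z hz, h2 _ _ _ z hz, h2 _ _ _ z hz] at this
    rw [SmAlg.fn_zero hz, SmAlg.fn_add hz, SmAlg.fn_add hz, SmAlg.fn_smul hz, SmAlg.fn_smul hz,
      SmAlg.fn_smul hz]
    exact this

end poisson

/-! ### The odd Laplacian as a divergence and the quadratic form of the master equation -/

section laplacian

variable {ι κ₀ κ₁ : Type*} [Fintype ι] [Fintype κ₀] [Fintype κ₁]
  {p : ι → ZMod 2} {ε₀ : κ₀ → ZMod 2} {ε₁ : κ₁ → ZMod 2}
  {C : Type*} [Ring C] [Algebra ℂ C] {P : ZMod 2 → Submodule ℂ C}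
  {d : HVar ι κ₀ κ₁ → C →ₗ[ℂ] C} {E : ExtVar ι κ₁ → ExtVar ι κ₁ → C} {ρ ρ' : C}

/-- Twice the odd Laplacian on even functions, expressed by the vector field `(·, f)`. -/
def lap2 (p : ι → ZMod 2) (ε₀ : κ₀ → ZMod 2) (ε₁ : κ₁ → ZMod 2)
    (d : HVar ι κ₀ κ₁ → C →ₗ[ℂ] C) (E : ExtVar ι κ₁ → ExtVar ι κ₁ → C) (ρ ρ' f : C) : C :=
  (∑ v, d (some v) (fullQ p ε₀ ε₁ d E f (some v))) + ρ' * vf d (fullQ p ε₀ ε₁ d E f) ρ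

lemma fullQ_smul (c : ℂ) (f : C) (v : HVar ι κ₀ κ₁) :
    fullQ p ε₀ ε₁ d E (c • f) v = c • fullQ p ε₀ ε₁ d E f v := by
  rcases v with _ | (_ | _ | _ | _ | _ | _ | _) <;>
    simp only [fullQ, map_smul, smul_zero, mul_smul_comm, Finset.smul_sum] <;>
    simp only [smul_comm c]

lemma lap2_smul (c : ℂ) (f : C) :
    lap2 p ε₀ ε₁ d E ρ ρ' (c • f) = c • lap2 p ε₀ ε₁ d E ρ ρ' f := by
  simp only [lap2, fullQ_smul, map_smul, vf_apply, mul_smul_comm, ← Finset.smul_sum, smul_add]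

lemma fullQ_exp (hP : IsSuperAlg P) {e S : C} (he : e ∈ P 0)
    (hd : ∀ v, d v e = e * d v S) (v : HVar ι κ₀ κ₁) :
    fullQ p ε₀ ε₁ d E e v = e * fullQ p ε₀ ε₁ d E S v := by
  rcases v with _ | (i | _ | _ | _ | _ | _ | _) <;> simp only [fullQ, hd, mul_zero, mul_smul_comm]
  rw [Finset.mul_sum]
  refine Finset.sum_congr rfl fun j _ => ?_
  rw [mul_smul_comm, ← mul_assoc, ← mul_assoc, hP.even_comm he]

/-- The odd Laplacian of an exponential. -/
lemma lap2_exp (hP : IsSuperAlg P) (hd : ∀ v, IsRDer P (fullParity p ε₀ ε₁ v) (d (some v)))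
    (hd0 : d none = 0) {e S : C} (he : e ∈ P 0) (hu : IsUnit e)
    (hde : ∀ v, d v e = e * d v S)
    (hQ : ∀ v, fullQ p ε₀ ε₁ d E S (some v) ∈ P (fullParity p ε₀ ε₁ v + 1)) :
    lap2 p ε₀ ε₁ d E ρ ρ' e = e * (lap2 p ε₀ ε₁ d E ρ ρ' S + vf d (fullQ p ε₀ ε₁ d E S) S) := by
  -- For e = exp S the field (·, e) is e (·, S); its divergence produces, besides e times the
  -- divergence of (·, S), the term in which e is differentiated, and these terms sum to e (S, S).
  have h1 : ∀ v, d (some v) (fullQ p ε₀ ε₁ d E e (some v)) =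
      e * (d (some v) (fullQ p ε₀ ε₁ d E S (some v)) + d (some v) S * fullQ p ε₀ ε₁ d E S (some v)) := by
    intro v
    have : ∀ a : ZMod 2, a * (a + 1) = 0 := by decide
    rw [fullQ_exp hP he hde, (hd v).leib _ _ (hQ v), hde, this, sgn_zero, one_smul, mul_assoc,
      mul_add]
  have h2 : vf d (fullQ p ε₀ ε₁ d E e) ρ = e * vf d (fullQ p ε₀ ε₁ d E S) ρ := by
    rw [vf_apply, vf_apply, Finset.mul_sum]
    refine Finset.sum_congr rfl fun v _ => ?_
    rw [fullQ_exp hP he hde, ← mul_assoc, ← mul_assoc, hP.even_comm he]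
  rw [lap2, lap2, h2]
  simp only [h1]
  rw [← Finset.mul_sum, Finset.sum_add_distrib, vf_apply (fullQ p ε₀ ε₁ d E S) S, Fintype.sum_option, hd0,
    LinearMap.zero_apply, zero_mul, zero_add, ← mul_assoc ρ', ← hP.even_comm he, mul_assoc e,
    ← mul_add]
  congr 1
  abel

/-- The quantum master equation, solved for the bracket. -/
lemma master_of_lap2 (hP : IsSuperAlg P) (hd : ∀ v, IsRDer P (fullParity p ε₀ ε₁ v) (d (some v)))
    (hd0 : d none = 0) {e X : C} {c : ℂ} (hc : c ≠ 0) (he : e ∈ P 0) (hu : IsUnit e)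
    (hde : ∀ v, d v e = e * d v (c • X))
    (hQ : ∀ v, fullQ p ε₀ ε₁ d E X (some v) ∈ P (fullParity p ε₀ ε₁ v + 1))
    (h : lap2 p ε₀ ε₁ d E ρ ρ' e = 0) :
    vf d (fullQ p ε₀ ε₁ d E X) X = -c⁻¹ • lap2 p ε₀ ε₁ d E ρ ρ' X := by
  rw [lap2_exp hP hd hd0 he hu hde fun v => by
    rw [fullQ_smul]; exact Submodule.smul_mem _ _ (hQ v)] at h
  have h1 := (hu.mul_right_eq_zero).1 h
  -- The bracket is quadratic and the Laplacian linear in the exponent, so one factor c can be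
  -- cancelled.
  have h2 : vf d (fullQ p ε₀ ε₁ d E (c • X)) (c • X) = c • c • vf d (fullQ p ε₀ ε₁ d E X) X := by
    simp only [vf_apply, fullQ_smul, map_smul, mul_smul_comm, smul_mul_assoc, Finset.smul_sum]
  rw [lap2_smul, h2, ← smul_add] at h1
  have h3 := (smul_eq_zero.1 h1).resolve_left hc
  rw [← eq_neg_iff_add_eq_zero] at h3
  rw [h3, smul_neg, neg_smul, neg_neg, smul_smul, inv_mul_cancel₀ hc, one_smul]

end laplacian

namespace SmAlg

/-! ### Derivatives of pull-backs -/

section pullrel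

variable {I J : Type*} {p : I → ZMod 2} {q : J → ZMod 2} [Fintype I] [Fintype J]
  {V V' : Type*} [NormedAddCommGroup V] [NormedSpace ℝ V] [NormedAddCommGroup V'] [NormedSpace ℝ V']

/-- Directions related by a pull-back. -/
def PullRel (L : V' →L[ℝ] V) (r : (OddIdx q → ℂ) →ₗ[ℂ] (OddIdx p → ℂ)) :
    V' ⊕ OddIdx p → V ⊕ OddIdx q → Prop
  | .inl v', .inl v => L v' = v
  | .inr i, .inr j => LinearMap.proj i ∘ₗ r = LinearMap.proj j
  | _, _ => False

/-- Directions along which pull-backs are constant. -/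
def PullZero (L : V' →L[ℝ] V) (r : (OddIdx q → ℂ) →ₗ[ℂ] (OddIdx p → ℂ)) : V' ⊕ OddIdx p → Prop
  | .inl v' => L v' = 0
  | .inr i => (LinearMap.proj i : (OddIdx p → ℂ) →ₗ[ℂ] ℂ) ∘ₗ r = 0

variable {Ω : Opens V} {Ω' : Opens V'} {L : V' →L[ℝ] V} {c : V} {hm : ∀ z ∈ Ω', L z + c ∈ Ω}
  {r : (OddIdx q → ℂ) →ₗ[ℂ] (OddIdx p → ℂ)}

lemma pd_pullHom {w' : V' ⊕ OddIdx p} {w : V ⊕ OddIdx q} (h : PullRel L r w' w) (f : SmAlg q Ω) :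
    pd w' (pullHom L c Ω' hm r f) = pullHom L c Ω' hm r (pd w f) := by
  rcases w' with v' | i <;> rcases w with v | j
  · subst h; exact dirD_pullHom v' f
  · exact h.elim
  · exact h.elim
  · exact oddD_pullHom h f

lemma pd_pullHom_zero {w' : V' ⊕ OddIdx p} (h : PullZero L r w') (f : SmAlg q Ω) :
    pd w' (pullHom L c Ω' hm r f) = 0 := by
  rcases w' with v' | i
  · have := dirD_pullHom (L := L) (c := c) (hm := hm) (r := r) v' f
    rw [show L v' = 0 from h, dirD_zero, map_zero] at this
    exact this
  · exact oddD_pullHom_zero h f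

variable {e : I → J} (he : ∀ i, q (e i) = p i)

lemma pullRel_proj (hinj : Function.Injective e) (i : I) :
    PullRel (projL e he) (Function.ExtendByZero.linearMap ℂ (oddMap e he)) (crd q (e i))
      (crd p i) := by
  rw [crd_map he hinj]
  cases h : crd p i with
  | inl u => exact projL_inclL he hinj u
  | inr j => exact proj_extendByZero he hinj j

lemma pullZero_proj {j : J} (hj : ∀ i, e i ≠ j) :
    PullZero (projL e he) (Function.ExtendByZero.linearMap ℂ (oddMap e he)) (crd q j) := by
  cases h : crd q j with
  | inl w => exact projL_single he hj h
  | inr k =>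
    refine proj_extendByZero_zero he fun i hi => hj i ?_
    rw [hi]
    unfold crd at h
    split at h
    · cases h
    · rw [← Sum.inr.inj h]

/-- Directions in the space with an additional parameter. -/
def paramDir (w : Body q ⊕ OddIdx q) : (ℝ × Body q) ⊕ OddIdx q := Sum.map (fun u => (0, u)) id w

lemma pullRel_snd {L : Body q →L[ℝ] V} {J' : Type*} {q' : J' → ZMod 2}
    {r : (OddIdx q' → ℂ) →ₗ[ℂ] (OddIdx q → ℂ)} {w' : Body q ⊕ OddIdx q} {w : V ⊕ OddIdx q'}
    (h : PullRel L r w' w) : PullRel (L.comp (ContinuousLinearMap.snd ℝ ℝ (Body q))) r (paramDir w') w := by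
  rcases w' with v' | i <;> rcases w with v | j <;> exact h

lemma pullZero_snd {L : Body q →L[ℝ] V} {J' : Type*} {q' : J' → ZMod 2}
    {r : (OddIdx q' → ℂ) →ₗ[ℂ] (OddIdx q → ℂ)} {w' : Body q ⊕ OddIdx q}
    (h : PullZero L r w') : PullZero (L.comp (ContinuousLinearMap.snd ℝ ℝ (Body q))) r (paramDir w') := by
  rcases w' with v' | i <;> exact h

lemma pullRel_id (w : Body q ⊕ OddIdx q) :
    PullRel (ContinuousLinearMap.id ℝ (Body q)) (LinearMap.id) w w := by
  rcases w with v | i <;> rfl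

lemma pullRel_inr (w : Body q ⊕ OddIdx q) :
    PullRel (ContinuousLinearMap.inr ℝ ℝ (Body q)) (LinearMap.id) w (paramDir w) := by
  rcases w with v | i <;> rfl

lemma pullRel_incl (hinj : Function.Injective e) (i : I) :
    PullRel ((ContinuousLinearMap.inr ℝ ℝ (Body q)).comp (inclL e he))
      (LinearMap.funLeft ℂ ℂ (oddMap e he)) (crd p i) (paramDir (crd q (e i))) := by
  rw [crd_map he hinj]
  cases h : crd p i with
  | inl u => rfl
  | inr j => rfl

lemma fn_paramDir {Ω : Opens (ℝ × Body q)} (f : SmAlg q Ω) {t : ℝ} {x : Body q} (hz : (t, x) ∈ Ω)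
    (i : J) : (pd (paramDir (crd q i)) f).fn (t, x) = rD i (fun y => f.fn (t, y)) x := by
  unfold crd rD
  split
  · simp only [paramDir, Sum.map_inl, pd, Sum.elim_inl]
    rw [fn_dirD _ _ hz, gderiv_comp (m := fun y => (t, y)) (m' := ContinuousLinearMap.inr ℝ ℝ (Body q))
      (f.gdiffAt hz) (hasFDerivAt_prodMk_right t x)]
    rfl
  · exact fn_oddD _ _ hz

end pullrel

end SmAlg

namespace SmAlg

lemma lD_fn {J : Type*} [Fintype J] {q : J → ZMod 2} {Ω : Opens (Body q)} {k : ZMod 2}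
    {g : SmAlg q Ω} (hg : g ∈ par q Ω k) {h : SFun q} {z : Body q} (hz : z ∈ Ω)
    (hh : ∀ y ∈ Ω, h y = g.fn y) (i : J) :
    lD i h z = (sgn (q i * (k + 1)) • pd (crd q i) g).fn z := by
  have h1 : h =ᶠ[𝓝 z] g.fn := by
    filter_upwards [Ω.isOpen.mem_nhds hz] with y hy
    exact hh y hy
  rw [lD_congr h1, lD_eq (hg z hz), fn_smul hz, fn_pd_crd _ _ hz]

end SmAlg

/-! ### Comparison with the coordinate expression of the odd Laplacian -/

section laplacian

variable {ι κ₀ κ₁ : Type*} [Fintype ι] [Fintype κ₀] [Fintype κ₁]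
  {p : ι → ZMod 2} {ε₀ : κ₀ → ZMod 2} {ε₁ : κ₁ → ZMod 2}

variable {C : Type*} [Ring C] [Algebra ℂ C] {P : ZMod 2 → Submodule ℂ C}
  {d : HVar ι κ₀ κ₁ → C →ₗ[ℂ] C} {EC : ι → ι → C} {ρC ρC' f : C}

lemma fullQ_ext_gam (a : ι) : fullQ p ε₀ ε₁ d (extMat EC) f (some (.ext (.gam a))) =
    ∑ b, sgn (p b) • (EC a b * d (some (.ext (.gam b))) f) := by
  simp only [fullQ]
  rw [sum_extVar]
  simp [extMat, extParity]

lemma fullQ_ext_pi (α : κ₁) : fullQ p ε₀ ε₁ d (extMat EC) f (some (.ext (.pi α))) =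
    sgn (ε₁ α + 1) • d (some (.ext (.piS α))) f := by
  classical
  simp only [fullQ]
  rw [sum_extVar]
  simp [extMat, extParity]

lemma fullQ_ext_piS (α : κ₁) : fullQ p ε₀ ε₁ d (extMat EC) f (some (.ext (.piS α))) =
    -(sgn (ε₁ α) • d (some (.ext (.pi α))) f) := by
  classical
  simp only [fullQ]
  rw [sum_extVar]
  simp [extMat, extParity]

/-- In the divergence of (·, f) each conjugate pair occurs in both orders with equal values, which
explains the overall 2. On Γ the Leibniz rule merges the plain divergence with the derivative of ρ
into ρ⁻¹ ∂(ρ ·). -/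
lemma lap2_eq (hP : IsSuperAlg P) (hD : IsPartials P (fullParity p ε₀ ε₁) fun v => d (some v))
    (hd0 : d none = 0) (hf : f ∈ P 0) (hEm : ∀ a b, EC a b ∈ P (p a + p b + 1)) (hρm : ρC ∈ P 0)
    (hρ : ρC' * ρC = 1) (hdρ : ∀ v, (∀ a, v ≠ .ext (.gam a)) → d (some v) ρC = 0) :
    lap2 p ε₀ ε₁ d (extMat EC) ρC ρC' f = (2 : ℂ) •
      ((∑ a, ∑ b, (2 : ℂ)⁻¹ • (ρC' * d (some (.ext (.gam a)))
        (ρC * (sgn (p b) • (EC a b * d (some (.ext (.gam b))) f)))))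
      + (∑ α, sgn (ε₁ α + 1) • d (some (.ext (.pi α))) (d (some (.ext (.piS α))) f))
      + (∑ α, sgn (ε₀ α + 1) • d (some (.lam α)) (d (some (.lamS α)) f))
      + (∑ α, sgn (ε₁ α + 1 + 1) • d (some (.gh α)) (d (some (.ghS α)) f))
      + (∑ α, sgn (ε₁ α + 1 + 1) • d (some (.agh α)) (d (some (.aghS α)) f))) := by
  have hdf : ∀ v, d (some v) f ∈ P (fullParity p ε₀ ε₁ v) := fun v => by
    simpa using (hD.der v).mem hf
  have pair2 : ∀ (v w : FullVar ι κ₀ κ₁) (k : ZMod 2), fullParity p ε₀ ε₁ v = k →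
      fullParity p ε₀ ε₁ w = k + 1 → ∀ l m, l = k + 1 → (m = k + 1) →
        d (some v) (sgn l • d (some w) f) + d (some w) (sgn m • d (some v) f) = (2 : ℂ) • sgn (k + 1) • d (some v) (d (some w) f) := by
    intro v w k hv hw l m hl hm
    have h1 : d (some w) (d (some v) f) = d (some v) (d (some w) f) := by
      have : ∀ k : ZMod 2, (k + 1) * k = 0 := by decide
      rw [hD.comm w v f, hv, hw, this, sgn_zero, one_smul]
    rw [map_smul, map_smul, h1, hl, hm, two_smul]
  have Qg : ∀ a, d (some (.ext (.gam a))) (fullQ p ε₀ ε₁ d (extMat EC) f (some (.ext (.gam a)))) +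
      ρC' * (d (some (.ext (.gam a))) ρC * fullQ p ε₀ ε₁ d (extMat EC) f (some (.ext (.gam a)))) =
      ∑ b, ρC' * d (some (.ext (.gam a))) (ρC * (sgn (p b) • (EC a b * d (some (.ext (.gam b))) f))) := by
    intro a
    have h1 : fullQ p ε₀ ε₁ d (extMat EC) f (some (.ext (.gam a))) ∈
        P (p a + 1) := by
      rw [fullQ_ext_gam]
      refine sum_mem fun b _ => Submodule.smul_mem _ _ ?_
      have := hP.mul_mem (hEm a b) (hdf (.ext (.gam b)))
      have e : ∀ a b : ZMod 2, a + b + 1 + b = a + 1 := by decide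
      rwa [show fullParity p ε₀ ε₁ (.ext (.gam b)) = p b from rfl, e] at this
    have h2 := (hD.der (.ext (.gam a))).leib ρC _ h1
    have e : ∀ a : ZMod 2, a * (a + 1) = 0 := by decide
    rw [show fullParity p ε₀ ε₁ (.ext (.gam a)) = p a from rfl, e, sgn_zero, one_smul] at h2
    rw [← Finset.mul_sum, ← map_sum, ← Finset.mul_sum]
    rw [← fullQ_ext_gam, h2, mul_add, ← mul_assoc ρC' ρC, hρ, one_mul]
  have hvf : vf d (fullQ p ε₀ ε₁ d (extMat EC) f) ρC =
      ∑ a, d (some (.ext (.gam a))) ρC * fullQ p ε₀ ε₁ d (extMat EC) f (some (.ext (.gam a))) := by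
    rw [vf_apply, Fintype.sum_option, sum_fullVar, sum_extVar]
    rw [hd0, LinearMap.zero_apply, zero_mul, zero_add]
    rw [Finset.sum_eq_zero (s := (Finset.univ : Finset κ₀)), Finset.sum_eq_zero (s := (Finset.univ : Finset κ₁)),
      Finset.sum_eq_zero (s := (Finset.univ : Finset κ₁)), Finset.sum_eq_zero (s := (Finset.univ : Finset κ₁))]
    · simp only [add_zero]
    all_goals
      intro α _
      rw [hdρ _ (by simp), hdρ _ (by simp), zero_mul, zero_mul, add_zero]
  rw [lap2, hvf, sum_fullVar, sum_extVar]
  simp only [smul_add, Finset.smul_sum, smul_smul (2 : ℂ) (2 : ℂ)⁻¹]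
  rw [mul_inv_cancel₀ (two_ne_zero' ℂ)]
  simp only [one_smul, ← Qg, Finset.sum_add_distrib (s := (Finset.univ : Finset ι)), ← Finset.mul_sum]
  have e1 : ∀ k : ZMod 2, k + 1 + 1 = k := by decide
  have q1 : ∀ α : κ₁, d (some (.ext (.pi α))) (fullQ p ε₀ ε₁ d (extMat EC) f (some (.ext (.pi α)))) +
      d (some (.ext (.piS α))) (fullQ p ε₀ ε₁ d (extMat EC) f (some (.ext (.piS α)))) =
      (2 : ℂ) • sgn (ε₁ α + 1) • d (some (.ext (.pi α))) (d (some (.ext (.piS α))) f) := fun α => by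
    rw [fullQ_ext_pi, fullQ_ext_piS, neg_eq_sgn_smul, sgn_smul_smul]
    exact pair2 _ _ _ rfl rfl _ _ rfl (add_comm _ _)
  have q2 : ∀ α : κ₀, d (some (.lam α)) (fullQ p ε₀ ε₁ d (extMat EC) f (some (.lam α))) +
      d (some (.lamS α)) (fullQ p ε₀ ε₁ d (extMat EC) f (some (.lamS α))) =
      (2 : ℂ) • sgn (ε₀ α + 1) • d (some (.lam α)) (d (some (.lamS α)) f) := fun α =>
    pair2 _ _ _ rfl rfl _ _ rfl rfl
  have q3 : ∀ α : κ₁, d (some (.gh α)) (fullQ p ε₀ ε₁ d (extMat EC) f (some (.gh α))) +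
      d (some (.ghS α)) (fullQ p ε₀ ε₁ d (extMat EC) f (some (.ghS α))) =
      (2 : ℂ) • sgn (ε₁ α + 1 + 1) • d (some (.gh α)) (d (some (.ghS α)) f) := fun α =>
    pair2 _ _ _ rfl (e1 _).symm _ _ (e1 _).symm (e1 _).symm
  have q4 : ∀ α : κ₁, d (some (.agh α)) (fullQ p ε₀ ε₁ d (extMat EC) f (some (.agh α))) +
      d (some (.aghS α)) (fullQ p ε₀ ε₁ d (extMat EC) f (some (.aghS α))) =
      (2 : ℂ) • sgn (ε₁ α + 1 + 1) • d (some (.agh α)) (d (some (.aghS α)) f) := fun α =>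
    pair2 _ _ _ rfl (e1 _).symm _ _ (e1 _).symm (e1 _).symm
  simp only [q1, q2, q3, q4]
  abel

/-- Partial derivatives at a fixed value of `ħ`. -/
def fullD (Ω : Opens (Body (fullParity p ε₀ ε₁))) :
    HVar ι κ₀ κ₁ → SmAlg (fullParity p ε₀ ε₁) Ω →ₗ[ℂ] SmAlg (fullParity p ε₀ ε₁) Ω
  | none => 0
  | some v => SmAlg.pd (crd _ v)

variable {Ω : Opens (Body (fullParity p ε₀ ε₁))} {E : ι → ι → SFun p} {ρ : SFun p}

/-- The odd Laplacian on even functions. -/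
lemma lap2_fn {EC : ι → ι → SmAlg (fullParity p ε₀ ε₁) Ω}
    {ρC ρC' f : SmAlg (fullParity p ε₀ ε₁) Ω} (hf : f ∈ SmAlg.par _ Ω 0)
    (hEC : ∀ a b, ∀ z ∈ Ω, (EC a b).fn z = toFull p ε₀ ε₁ (E a b) z)
    (hEm : ∀ a b, EC a b ∈ SmAlg.par _ Ω (p a + p b + 1))
    (hρC : ∀ z ∈ Ω, ρC.fn z = toFull p ε₀ ε₁ ρ z) (hρm : ρC ∈ SmAlg.par _ Ω 0)
    (hρ : ρC' * ρC = 1) (hρ' : ρC * ρC' = 1)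
    (hdρ : ∀ v, (∀ a, v ≠ .ext (.gam a)) → SmAlg.pd (crd _ v) ρC = 0)
    {z : Body (fullParity p ε₀ ε₁)} (hz : z ∈ Ω) :
    (lap2 p ε₀ ε₁ (fullD Ω) (extMat EC) ρC ρC' f).fn z =
      (2 : ℂ) • oddLaplacian p ε₀ ε₁ E ρ f.fn z := by
  have hP := SmAlg.superAlg (q := fullParity p ε₀ ε₁) (Ω := Ω)
  have hD := SmAlg.partials_crd Ω
  let D := fun v => SmAlg.pd (Ω := Ω) (crd (fullParity p ε₀ ε₁) v)
  have hdf : ∀ v, D v f ∈ SmAlg.par _ Ω (fullParity p ε₀ ε₁ v) := fun v => by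
    simpa using (hD.der v).mem hf
  have pair : ∀ (v w : FullVar ι κ₀ κ₁) (k : ZMod 2), fullParity p ε₀ ε₁ v = k →
      fullParity p ε₀ ε₁ w = k + 1 → sgn k • lD v (lD w f.fn) z =
        (sgn (k + 1) • D v (D w f)).fn z := by
    intro v w k hv hw
    have h1 : ∀ y ∈ Ω, lD w f.fn y = (sgn (k + 1) • D w f).fn y := fun y hy => by
      rw [SmAlg.lD_fn hf hy (fun _ _ => rfl), hw, zero_add, mul_one]
    rw [SmAlg.lD_fn (Submodule.smul_mem _ _ (hdf w)) hz h1, ← SmAlg.fn_smul hz, map_smul,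
      sgn_smul_smul, sgn_smul_smul, hv, hw]
    have : ∀ k : ZMod 2, k + k * (k + 1 + 1) + (k + 1) = k + 1 := by decide
    rw [this]
  have gam : ∀ a b, (sgn (p a) / 2) • (Ring.inverse (toFull p ε₀ ε₁ ρ z) *
      lD (.ext (.gam a)) (fun y => toFull p ε₀ ε₁ ρ y * toFull p ε₀ ε₁ (E a b) y *
        lD (.ext (.gam b)) f.fn y) z) =
      ((2 : ℂ)⁻¹ • (ρC' * D (.ext (.gam a)) (ρC * (sgn (p b) • (EC a b * D (.ext (.gam b)) f))))).fn z := by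
    intro a b
    have h1 : ∀ y ∈ Ω, toFull p ε₀ ε₁ ρ y * toFull p ε₀ ε₁ (E a b) y *
        lD (.ext (.gam b)) f.fn y = (ρC * (sgn (p b) • (EC a b * D (.ext (.gam b)) f))).fn y := by
      intro y hy
      rw [SmAlg.lD_fn hf hy (fun _ _ => rfl), ← hρC y hy, ← hEC a b y hy, ← SmAlg.fn_mul hy,
        ← SmAlg.fn_mul hy, zero_add, mul_one, mul_smul_comm, mul_smul_comm, mul_assoc]
      rfl
    have h2 : ρC * (sgn (p b) • (EC a b * D (.ext (.gam b)) f)) ∈ SmAlg.par _ Ω (p a + 1) := by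
      have := hP.mul_mem hρm (Submodule.smul_mem _ (sgn (p b))
        (hP.mul_mem (hEm a b) (hdf (.ext (.gam b)))))
      have e : ∀ a b : ZMod 2, 0 + (a + b + 1 + b) = a + 1 := by decide
      rwa [show fullParity p ε₀ ε₁ (.ext (.gam b)) = p b from rfl, e] at this
    have h3 : Ring.inverse (toFull p ε₀ ε₁ ρ z) = ρC'.fn z := by
      have e1 : ρC'.fn z * toFull p ε₀ ε₁ ρ z = 1 := by
        rw [← hρC z hz, ← SmAlg.fn_mul hz, hρ, SmAlg.fn_one hz]
      have e2 : toFull p ε₀ ε₁ ρ z * ρC'.fn z = 1 := by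
        rw [← hρC z hz, ← SmAlg.fn_mul hz, hρ', SmAlg.fn_one hz]
      have hu : IsUnit (toFull p ε₀ ε₁ ρ z) := ⟨⟨_, _, e2, e1⟩, rfl⟩
      rw [← one_mul (Ring.inverse _), ← e1, mul_assoc, Ring.mul_inverse_cancel _ hu, mul_one]
    rw [SmAlg.lD_fn h2 hz h1, h3, SmAlg.fn_smul hz, SmAlg.fn_smul hz, SmAlg.fn_mul hz,
      mul_smul_comm, smul_smul]
    congr 1
    have : ∀ a : ZMod 2, a * (a + 1 + 1) = a := by decide
    change sgn (p a) / 2 * sgn (p a * (p a + 1 + 1)) = _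
    rw [this, div_mul_eq_mul_div, sgn_mul_self, one_div]
  rw [lap2_eq hP hD rfl hf hEm hρm hρ hdρ, SmAlg.fn_smul hz]
  congr 1
  simp only [SmAlg.fn_add hz, SmAlg.fn_sum hz]
  unfold oddLaplacian
  have e1 : ∀ k : ZMod 2, k = k + 1 + 1 := by decide
  congr 1; congr 1; congr 1; congr 1
  · exact Finset.sum_congr rfl fun a _ => Finset.sum_congr rfl fun b _ => (gam a b).symm
  · exact Finset.sum_congr rfl fun α _ => (pair (.ext (.pi α)) (.ext (.piS α)) (ε₁ α) rfl rfl).symm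
  · exact Finset.sum_congr rfl fun α _ => (pair (.lam α) (.lamS α) (ε₀ α) rfl rfl).symm
  · exact Finset.sum_congr rfl fun α _ => (pair (.gh α) (.ghS α) (ε₁ α + 1) rfl (e1 _)).symm
  · exact Finset.sum_congr rfl fun α _ => (pair (.agh α) (.aghS α) (ε₁ α + 1) rfl (e1 _)).symm

end laplacian

lemma extend_comp_apply {α β γ R : Type*} [Zero R] {g : β → γ} (hg : Function.Injective g)
    (e : α → β) (he : Function.Injective e) (v : α → R) (i : β) :
    Function.extend (g ∘ e) v 0 (g i) = Function.extend e v 0 i := by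
  by_cases h : ∃ a, e a = i
  · obtain ⟨a, rfl⟩ := h
    rw [he.extend_apply, show g (e a) = (g ∘ e) a from rfl, (hg.comp he).extend_apply]
  · rw [Function.extend_apply' _ _ _ h, Function.extend_apply']
    · rfl
    · rintro ⟨a, ha⟩
      exact h ⟨a, hg ha⟩

/-! ### The algebras of functions of Γ, of Γ_ext, and of all variables with ħ -/

section model

variable {ι κ₀ κ₁ : Type*} [Fintype ι] [Fintype κ₀] [Fintype κ₁]
  {p : ι → ZMod 2} {ε₀ : κ₀ → ZMod 2} {ε₁ : κ₁ → ZMod 2}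

lemma gam_injective : Function.Injective (ExtVar.gam : ι → ExtVar ι κ₁) := fun _ _ h => by
  injection h

lemma ext_injective : Function.Injective (FullVar.ext : ExtVar ι κ₁ → FullVar ι κ₀ κ₁) :=
  fun _ _ h => by injection h

/-- The original variables among all variables. -/
def gamFull (a : ι) : FullVar ι κ₀ κ₁ := .ext (.gam a)

/-- Projection of the body of all variables. -/
def projFull (p : ι → ZMod 2) (ε₀ : κ₀ → ZMod 2) (ε₁ : κ₁ → ZMod 2) :
    Body (fullParity p ε₀ ε₁) →L[ℝ] Body p := projL gamFull fun _ => rfl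

/-- Projection of the body of the extended variables. -/
def projExt (p : ι → ZMod 2) (ε₁ : κ₁ → ZMod 2) : Body (extParity p ε₁) →L[ℝ] Body p :=
  projL ExtVar.gam fun _ => rfl

/-- The slice map as a continuous linear map. -/
def sliceL (p : ι → ZMod 2) (ε₀ : κ₀ → ZMod 2) (ε₁ : κ₁ → ZMod 2) :
    Body (extParity p ε₁) →L[ℝ] Body (fullParity p ε₀ ε₁) := inclL FullVar.ext fun _ => rfl

lemma projFull_slice (u : Body (extParity p ε₁)) :
    projFull p ε₀ ε₁ (sliceL p ε₀ ε₁ u) = projExt p ε₁ u := by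
  refine funext fun i => ?_
  have h : Function.Injective (evenMap (p := extParity p ε₁) (q := fullParity p ε₀ ε₁) FullVar.ext
    fun _ => rfl) := evenMap_injective (fun _ => rfl) ext_injective
  exact h.extend_apply u 0 (evenMap ExtVar.gam (fun _ => rfl) i)

variable {U₀ : Opens (Body p)} {Ω : Opens (Body (extParity p ε₁))}
  {W : Opens (ℝ × Body (fullParity p ε₀ ε₁))}

/-- Functions of `Γ` as functions of the extended variables. -/
def toA (hA : ∀ u ∈ Ω, projExt p ε₁ u + 0 ∈ U₀) : SmAlg p U₀ →ₐ[ℂ] SmAlg (extParity p ε₁) Ω :=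
  SmAlg.pullHom (projExt p ε₁) 0 Ω hA
    (Function.ExtendByZero.linearMap ℂ (oddMap ExtVar.gam fun _ => rfl))

/-- Functions of `Γ` as functions of all variables and `ħ`. -/
def toB (hB : ∀ z ∈ W, (projFull p ε₀ ε₁).comp (ContinuousLinearMap.snd ℝ ℝ _) z + 0 ∈ U₀) :
    SmAlg p U₀ →ₐ[ℂ] SmAlg (fullParity p ε₀ ε₁) W :=
  SmAlg.pullHom ((projFull p ε₀ ε₁).comp (ContinuousLinearMap.snd ℝ ℝ _)) 0 W hB
    (Function.ExtendByZero.linearMap ℂ (oddMap gamFull fun _ => rfl))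

/-- Restriction to the slice at `ħ = 0`. -/
def toSlice (hS : ∀ u ∈ Ω, (ContinuousLinearMap.inr ℝ ℝ _).comp (sliceL p ε₀ ε₁) u + 0 ∈ W) :
    SmAlg (fullParity p ε₀ ε₁) W →ₐ[ℂ] SmAlg (extParity p ε₁) Ω :=
  SmAlg.pullHom ((ContinuousLinearMap.inr ℝ ℝ _).comp (sliceL p ε₀ ε₁)) 0 Ω hS
    (LinearMap.funLeft ℂ ℂ (oddMap FullVar.ext fun _ => rfl))

variable {hA : ∀ u ∈ Ω, projExt p ε₁ u + 0 ∈ U₀}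
  {hB : ∀ z ∈ W, (projFull p ε₀ ε₁).comp (ContinuousLinearMap.snd ℝ ℝ _) z + 0 ∈ U₀}
  {hS : ∀ u ∈ Ω, (ContinuousLinearMap.inr ℝ ℝ _).comp (sliceL p ε₀ ε₁) u + 0 ∈ W}

lemma toSlice_toB (f : SmAlg p U₀) : toSlice hS (toB hB f) = toA hA f := SmAlg.ext fun z hz => by
  rw [toSlice, toB, toA, SmAlg.fn_pullHom _ hz, SmAlg.fn_pullHom _ (hS z hz),
    SmAlg.fn_pullHom _ hz]
  have h1 : (projFull p ε₀ ε₁).comp (ContinuousLinearMap.snd ℝ ℝ _)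
      ((ContinuousLinearMap.inr ℝ ℝ _).comp (sliceL p ε₀ ε₁) z + 0) + 0 = projExt p ε₁ z + 0 := by
    rw [add_zero]
    simp only [ContinuousLinearMap.comp_apply, ContinuousLinearMap.inr_apply,
      ContinuousLinearMap.coe_snd', add_zero]
    exact projFull_slice z
  rw [h1, ← AlgHom.comp_apply, ExteriorAlgebra.map_comp_map]
  congr 2
  refine LinearMap.ext fun v => funext fun i => ?_
  have h : Function.Injective (oddMap (p := extParity p ε₁) (q := fullParity p ε₀ ε₁) FullVar.ext
    fun _ => rfl) := oddMap_injective (fun _ => rfl) ext_injective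
  exact extend_comp_apply h (oddMap (p := p) ExtVar.gam fun _ => rfl)
    (oddMap_injective (fun _ => rfl) gam_injective) v i

/-- Partial derivatives, `ħ` included. -/
def hbarD (W : Opens (ℝ × Body (fullParity p ε₀ ε₁))) :
    HVar ι κ₀ κ₁ → SmAlg (fullParity p ε₀ ε₁) W →ₗ[ℂ] SmAlg (fullParity p ε₀ ε₁) W
  | none => SmAlg.pd (.inl (1, 0))
  | some v => SmAlg.pd (SmAlg.paramDir (crd _ v))

lemma hbarD_partials : IsPartials (SmAlg.par _ W) (hParity p ε₀ ε₁) (hbarD W) := by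
  let τ : HVar ι κ₀ κ₁ → (ℝ × Body (fullParity p ε₀ ε₁)) ⊕ OddIdx (fullParity p ε₀ ε₁) := fun v =>
    match v with
    | none => .inl (1, 0)
    | some v => SmAlg.paramDir (crd _ v)
  have h := SmAlg.partials (Ω := W) τ
  have h1 : (fun k => SmAlg.pdPar (τ k)) = hParity p ε₀ ε₁ := by
    ext1 v
    rcases v with _ | v
    · rfl
    · rw [hParity, ← pdPar_crd (q := fullParity p ε₀ ε₁) v]
      change SmAlg.pdPar (SmAlg.paramDir (crd _ v)) = _
      cases crd (fullParity p ε₀ ε₁) v <;> rfl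
  have h2 : (fun k => SmAlg.pd (Ω := W) (τ k)) = hbarD W := by
    ext1 v; rcases v with _ | v <;> rfl
  rwa [h1, h2] at h

lemma contDiff_hbar {V : Type*} [NormedAddCommGroup V] [NormedSpace ℝ V] :
    ContDiff ℝ ∞ fun z : ℝ × V => (z.1 : ℂ) := Complex.ofRealCLM.contDiff.comp contDiff_fst

lemma fderiv_hbar {V : Type*} [NormedAddCommGroup V] [NormedSpace ℝ V] (z w : ℝ × V) :
    fderiv ℝ (fun z : ℝ × V => (z.1 : ℂ)) z w = w.1 := by
  have h : HasFDerivAt (fun z : ℝ × V => (z.1 : ℂ))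
      (Complex.ofRealCLM.comp (ContinuousLinearMap.fst ℝ ℝ V)) z :=
    (Complex.ofRealCLM.comp (ContinuousLinearMap.fst ℝ ℝ V)).hasFDerivAt
  rw [h.fderiv]
  rfl

/-- The coordinates, `ħ` included. -/
def hbarX (W : Opens (ℝ × Body (fullParity p ε₀ ε₁))) : HVar ι κ₀ κ₁ → SmAlg (fullParity p ε₀ ε₁) W
  | none => SmAlg.scal (fun z => (z.1 : ℂ)) contDiff_hbar.contDiffOn
  | some v => SmAlg.pullHom (Ω := ⊤) ((ContinuousLinearMap.id ℝ _).comp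
      (ContinuousLinearMap.snd ℝ ℝ _)) 0 W (fun _ _ => Opens.mem_top _) LinearMap.id (SmAlg.coord _ v)

lemma hbarX_mem (v : HVar ι κ₀ κ₁) : hbarX W v ∈ SmAlg.par _ W (hParity p ε₀ ε₁ v) := by
  rcases v with _ | v
  · exact SmAlg.scal_mem contDiff_hbar.contDiffOn
  · exact SmAlg.pullHom_mem (SmAlg.coord_mem _ _)

lemma fn_hbarX_none {z} (hz : z ∈ W) : (hbarX W none).fn z = algebraMap ℂ _ (z.1 : ℂ) :=
  SmAlg.fn_scal contDiff_hbar.contDiffOn hz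

lemma fn_hbarX_some (v : FullVar ι κ₀ κ₁) {z} (hz : z ∈ W) :
    (hbarX W (some v)).fn z = coordFn v z.2 := by
  rw [hbarX, SmAlg.fn_pullHom _ hz, ExteriorAlgebra.map_id, AlgHom.id_apply, add_zero, SmAlg.coord,
    SmAlg.fn_mk]
  · rfl
  · exact Opens.mem_top _

lemma hbarD_hbarX (u v : HVar ι κ₀ κ₁) :
    hbarD W u (hbarX W v) = open Classical in if u = v then 1 else 0 := by
  classical
  rcases u with _ | u <;> rcases v with _ | v
  · rw [if_pos rfl]
    refine SmAlg.ext fun z hz => ?_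
    rw [SmAlg.fn_one hz]
    refine (SmAlg.dirD_scal contDiff_hbar.contDiffOn _ hz).trans ?_
    rw [fderiv_hbar]
    simp
  · rw [if_neg (by simp)]
    refine SmAlg.pd_pullHom_zero (w' := .inl (1, 0)) ?_ _
    change ((ContinuousLinearMap.id ℝ _).comp (ContinuousLinearMap.snd ℝ ℝ _)) (1, 0) = 0
    simp
  · rw [if_neg (by simp)]
    change SmAlg.pd (SmAlg.paramDir (crd _ u)) (hbarX W none) = 0
    cases crd (fullParity p ε₀ ε₁) u with
    | inl w =>
      refine SmAlg.ext fun z hz => ?_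
      rw [SmAlg.fn_zero hz]
      refine (SmAlg.dirD_scal contDiff_hbar.contDiffOn _ hz).trans ?_
      rw [fderiv_hbar]
      simp
    | inr j => exact SmAlg.oddD_scal contDiff_hbar.contDiffOn _
  · have h1 := SmAlg.pd_pullHom (Ω := (⊤ : Opens (Body (fullParity p ε₀ ε₁)))) (Ω' := W)
      (c := 0) (hm := fun _ _ => Opens.mem_top _)
      (SmAlg.pullRel_snd (SmAlg.pullRel_id (crd (fullParity p ε₀ ε₁) u))) (SmAlg.coord _ v)
    refine h1.trans ?_
    rw [SmAlg.pd_coord]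
    simp only [Option.some.injEq]
    split
    · rw [map_one]
    · rw [map_zero]

end model

/-! ### The action as a smooth superfunction; specialization to fixed ħ -/

section fulltheory

variable {ι κ₀ κ₁ : Type*} [Fintype ι] [Fintype κ₀] [Fintype κ₁]
  {p : ι → ZMod 2} {ε₀ : κ₀ → ZMod 2} {ε₁ : κ₁ → ZMod 2}
  {U₀ : Opens (Body p)} {Ω : Opens (Body (extParity p ε₁))}
  {W : Opens (ℝ × Body (fullParity p ε₀ ε₁))}
  {hA : ∀ u ∈ Ω, projExt p ε₁ u + 0 ∈ U₀}
  {hB : ∀ z ∈ W, (projFull p ε₀ ε₁).comp (ContinuousLinearMap.snd ℝ ℝ _) z + 0 ∈ U₀}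
  {hS : ∀ u ∈ Ω, (ContinuousLinearMap.inr ℝ ℝ _).comp (sliceL p ε₀ ε₁) u + 0 ∈ W}

/-- The action as an element of the algebra of smooth superfunctions. -/
def smAction {X : ℝ → SFun (fullParity p ε₀ ε₁)} 
    (hX : SmoothOn (fun z : ℝ × Body (fullParity p ε₀ ε₁) => X z.1 z.2) W) :
    SmAlg (fullParity p ε₀ ε₁) W := SmAlg.mk _ hX

variable {X : ℝ → SFun (fullParity p ε₀ ε₁)}
  {hX : SmoothOn (fun z : ℝ × Body (fullParity p ε₀ ε₁) => X z.1 z.2) W}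

lemma fn_smAction {z} (hz : z ∈ W) : (smAction hX).fn z = X z.1 z.2 := SmAlg.fn_mk _ hz

lemma smAction_slice {t : ℝ} {x : Body (fullParity p ε₀ ε₁)} (hz : (t, x) ∈ W) :
    (fun y => (smAction hX).fn (t, y)) =ᶠ[𝓝 x] X t := by
  have h1 : ∀ᶠ y in 𝓝 x, (t, y) ∈ W :=
    (Continuous.prodMk_right t).continuousAt.eventually (W.isOpen.mem_nhds hz)
  filter_upwards [h1] with y hy
  exact fn_smAction hy

/-- The hypothesis has coordinates on the left of left derivatives, the algebra has them on the
right of right derivatives. For an even action the sign from the reordering cancels the one relating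
the derivatives. -/
lemma smAction_planck (hXe : ∀ z ∈ W, HasParity 0 (X z.1 z.2)) (hpl : PlanckNumberOne p ε₀ ε₁ X W) :
    vf (hbarD W) (fun v => hPlanck v • hbarX W v) (smAction hX) = smAction hX := by
  refine SmAlg.ext fun z hz => ?_
  rw [vf_apply, Fintype.sum_option, SmAlg.fn_add hz, SmAlg.fn_sum hz, fn_smAction hz, ← hpl z hz,
    add_comm]
  congr 1
  · refine Finset.sum_congr rfl fun v _ => ?_
    have h1 : (hbarD W (some v) (smAction hX)).fn z = rD v (X z.1) z.2 := by
      rw [hbarD]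
      refine (SmAlg.fn_paramDir (t := z.1) (x := z.2) _ hz v).trans ?_
      exact SmAlg.rD_congr (smAction_slice hz) v
    have h2 : (hbarD W (some v) (smAction hX)) ∈ SmAlg.par _ W (0 + fullParity p ε₀ ε₁ v) :=
      (hbarD_partials.der (some v)).mem (fun z hz => by rw [fn_smAction hz]; exact hXe z hz)
    have h3 := gpar_comm (h2 z hz) (SmAlg.coordFn_mem v z.2)
    rw [h1] at h3
    rw [SmAlg.fn_mul hz, SmAlg.fn_smul hz, fn_hbarX_some v hz, h1, SmAlg.lD_eq (hXe z hz),
      mul_smul_comm, mul_smul_comm, h3, hPlanck]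
    congr 1
    refine sgn_smul_congr ?_ rfl
    have : ∀ a : ZMod 2, (0 + a) * a = a * (0 + 1) := by decide
    exact this _
  · have h1 : (hbarD W none (smAction hX)).fn z = gderiv (fun t => X t z.2) z.1 1 := by
      refine (SmAlg.fn_dirD _ _ hz).trans ?_
      have h2 : (fun t => X t z.2) =ᶠ[𝓝 z.1] fun t => (smAction hX).fn (t, z.2) := by
        filter_upwards [(Continuous.prodMk_left z.2).continuousAt.eventually
          (W.isOpen.mem_nhds hz)] with t ht
        exact (fn_smAction ht).symm
      rw [gderiv_congr h2, gderiv_comp (m := fun t => (t, z.2)) (m' := ContinuousLinearMap.inl ℝ ℝ _)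
        ((smAction hX).gdiffAt hz) (hasFDerivAt_prodMk_left z.1 z.2)]
      rfl
    rw [SmAlg.fn_mul hz, SmAlg.fn_smul hz, fn_hbarX_none hz, h1, hPlanck, one_smul,
      ← Algebra.commutes, ← Algebra.smul_def]

lemma fullQ_some_mem {C : Type*} [Ring C] [Algebra ℂ C] {P : ZMod 2 → Submodule ℂ C}
    {d : HVar ι κ₀ κ₁ → C →ₗ[ℂ] C} {E : ExtVar ι κ₁ → ExtVar ι κ₁ → C} {f : C} (hP : IsSuperAlg P)
    (hE : ∀ i j, E i j ∈ P (extParity p ε₁ i + extParity p ε₁ j + 1))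
    (hf : ∀ v, d (some v) f ∈ P (fullParity p ε₀ ε₁ v)) (v : FullVar ι κ₀ κ₁) :
    fullQ p ε₀ ε₁ d E f (some v) ∈ P (fullParity p ε₀ ε₁ v + 1) := by
  rcases v with i | a | a | α | α | α | α
  · refine Submodule.sum_mem _ fun j _ => Submodule.smul_mem _ _ ?_
    refine mem_parity_congr (hP.mul_mem (hE i j) (hf _)) ?_
    simp only [fullParity]
    have : ∀ a b : ZMod 2, a + b + 1 + b = a + 1 := by decide
    exact this _ _
  all_goals
    refine Submodule.smul_mem _ _ (mem_parity_congr (hf _) ?_)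
    simp only [fullParity, parity_add_two]

/-- The points of `W` at a given value of `ħ`. -/
def opensAt (W : Opens (ℝ × Body (fullParity p ε₀ ε₁))) (t : ℝ) :
    Opens (Body (fullParity p ε₀ ε₁)) :=
  ⟨{x | (t, x) ∈ W}, W.isOpen.preimage (Continuous.prodMk_right t)⟩

lemma opensAt_mem (t : ℝ) : ∀ x ∈ opensAt W t,
    ContinuousLinearMap.inr ℝ ℝ (Body (fullParity p ε₀ ε₁)) x + (t, 0) ∈ W := fun x hx => by
  have h : ContinuousLinearMap.inr ℝ ℝ (Body (fullParity p ε₀ ε₁)) x + (t, 0) = (t, x) := by simp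
  rw [h]
  exact hx

/-- Specialization to a given value of `ħ`. -/
def atHbar (W : Opens (ℝ × Body (fullParity p ε₀ ε₁))) (t : ℝ) :
    SmAlg (fullParity p ε₀ ε₁) W →ₐ[ℂ] SmAlg (fullParity p ε₀ ε₁) (opensAt W t) :=
  SmAlg.pullHom (ContinuousLinearMap.inr ℝ ℝ _) (t, 0) (opensAt W t) (opensAt_mem t) LinearMap.id

lemma fn_atHbar {t : ℝ} (f : SmAlg (fullParity p ε₀ ε₁) W) {x : Body (fullParity p ε₀ ε₁)}
    (hx : x ∈ opensAt W t) : (atHbar W t f).fn x = f.fn (t, x) := by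
  rw [atHbar, SmAlg.fn_pullHom _ hx, ExteriorAlgebra.map_id, AlgHom.id_apply]
  congr 1
  simp

lemma atHbar_hbarD (t : ℝ) (v : FullVar ι κ₀ κ₁) (f : SmAlg (fullParity p ε₀ ε₁) W) :
    atHbar W t (hbarD W (some v) f) = fullD _ (some v) (atHbar W t f) :=
  (SmAlg.pd_pullHom (SmAlg.pullRel_inr _) f).symm

variable {EB : ExtVar ι κ₁ → ExtVar ι κ₁ → SmAlg (fullParity p ε₀ ε₁) W}
  {ρ ρ' f g : SmAlg (fullParity p ε₀ ε₁) W}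

lemma atHbar_fullQ (t : ℝ) (v : HVar ι κ₀ κ₁) :
    atHbar W t (fullQ p ε₀ ε₁ (hbarD W) EB f v) =
      fullQ p ε₀ ε₁ (fullD _) (fun i j => atHbar W t (EB i j)) (atHbar W t f) v := by
  rcases v with _ | (i | _ | _ | _ | _ | _ | _) <;>
    simp only [fullQ, map_zero, map_smul, map_sum, map_mul, atHbar_hbarD]

lemma atHbar_vf (t : ℝ) : atHbar W t (vf (hbarD W) (fullQ p ε₀ ε₁ (hbarD W) EB f) g) =
    vf (fullD _) (fullQ p ε₀ ε₁ (fullD _) (fun i j => atHbar W t (EB i j)) (atHbar W t f))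
      (atHbar W t g) := by
  rw [vf_apply, vf_apply, Fintype.sum_option, Fintype.sum_option]
  simp only [map_add, map_sum, map_mul, atHbar_hbarD, atHbar_fullQ]
  simp [fullQ]

lemma atHbar_lap2 (t : ℝ) : atHbar W t (lap2 p ε₀ ε₁ (hbarD W) EB ρ ρ' f) =
    lap2 p ε₀ ε₁ (fullD _) (fun i j => atHbar W t (EB i j)) (atHbar W t ρ) (atHbar W t ρ')
      (atHbar W t f) := by
  rw [lap2, lap2, map_add, map_sum, map_mul, atHbar_vf]
  simp only [atHbar_hbarD, atHbar_fullQ]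

/-- A point with ħ = 0 is a limit, inside the open set W, of points with the same coordinates and ħ
≠ 0; continuity in ħ concludes. -/
lemma SmAlg.eq_of_hbar_ne_zero {W : Opens (ℝ × Body (fullParity p ε₀ ε₁))}
    {f g : SmAlg (fullParity p ε₀ ε₁) W} (h : ∀ z ∈ W, z.1 ≠ 0 → f.fn z = g.fn z) : f = g := by
  refine SmAlg.ext fun z hz => ?_
  by_cases h0 : z.1 = 0
  · refine gr_ext fun φ => ?_
    obtain ⟨t, x⟩ := z
    have hc : ContinuousAt (fun s : ℝ => φ (f.fn (s, x)) - φ (g.fn (s, x))) t := by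
      have h1 := ((f.smooth φ).sub (g.smooth φ)).continuousOn.continuousAt (W.isOpen.mem_nhds hz)
      exact ContinuousAt.comp (f := fun s : ℝ => (s, x))
        (g := fun z => φ (f.fn z) - φ (g.fn z)) h1 (Continuous.prodMk_left x).continuousAt
    have h2 : ∀ᶠ s in 𝓝[≠] t, φ (f.fn (s, x)) - φ (g.fn (s, x)) = 0 := by
      have h3 : ∀ᶠ s in 𝓝 t, (s, x) ∈ W :=
        (Continuous.prodMk_left x).continuousAt.eventually (W.isOpen.mem_nhds hz)
      filter_upwards [h3.filter_mono nhdsWithin_le_nhds, self_mem_nhdsWithin] with s hs hs'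
      rw [h _ hs (by simp only at h0; rw [← h0]; exact hs'), sub_self]
    have h4 := tendsto_nhds_unique (hc.tendsto.mono_left nhdsWithin_le_nhds)
      (tendsto_const_nhds.congr' (h2.mono fun _ h => h.symm))
    exact sub_eq_zero.1 h4
  · exact h z hz h0

end fulltheory

/-! ### A gauge-fixing action satisfies the algebraic axioms -/

section fulltheory

variable {ι κ₀ κ₁ : Type*} [Fintype ι] [Fintype κ₀] [Fintype κ₁]
  {p : ι → ZMod 2} {ε₀ : κ₀ → ZMod 2} {ε₁ : κ₁ → ZMod 2}
  {U₀ : Opens (Body p)} {Ω : Opens (Body (extParity p ε₁))}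
  {W : Opens (ℝ × Body (fullParity p ε₀ ε₁))}
  {hA : ∀ u ∈ Ω, projExt p ε₁ u + 0 ∈ U₀}
  {hB : ∀ z ∈ W, (projFull p ε₀ ε₁).comp (ContinuousLinearMap.snd ℝ ℝ _) z + 0 ∈ U₀}
  {hS : ∀ u ∈ Ω, (ContinuousLinearMap.inr ℝ ℝ _).comp (sliceL p ε₀ ε₁) u + 0 ∈ W}
  {X : ℝ → SFun (fullParity p ε₀ ε₁)}
  {hX : SmoothOn (fun z : ℝ × Body (fullParity p ε₀ ε₁) => X z.1 z.2) W}
  {E : ι → ι → SFun p} {ρ : SFun p}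

lemma oddLaplacian_congr {f g : SFun (fullParity p ε₀ ε₁)} {x : Body (fullParity p ε₀ ε₁)}
    (h : f =ᶠ[𝓝 x] g) : oddLaplacian p ε₀ ε₁ E ρ f x = oddLaplacian p ε₀ ε₁ E ρ g x := by
  have h1 : ∀ v, ∀ᶠ y in 𝓝 x, lD v f y = lD v g y := fun v => by
    filter_upwards [eventually_eventually_nhds.2 h] with y hy
    exact SmAlg.lD_congr hy v
  have h2 : ∀ v w, lD v (lD w f) x = lD v (lD w g) x := fun v w => SmAlg.lD_congr (h1 w) v
  have h3 : ∀ a b, lD (.ext (.gam a)) (fun y => toFull p ε₀ ε₁ ρ y * toFull p ε₀ ε₁ (E a b) y *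
        lD (.ext (.gam b)) f y) x = lD (.ext (.gam a)) (fun y => toFull p ε₀ ε₁ ρ y *
        toFull p ε₀ ε₁ (E a b) y * lD (.ext (.gam b)) g y) x := fun a b =>
    SmAlg.lD_congr (by filter_upwards [h1 (.ext (.gam b))] with y hy; rw [hy]) _
  simp only [oddLaplacian, h2, h3]

lemma fn_toB (f : SmAlg p U₀) {z : ℝ × Body (fullParity p ε₀ ε₁)} (hz : z ∈ W) :
    (toB hB f).fn z = toFull p ε₀ ε₁ f.fn z.2 := by
  rw [toB, SmAlg.fn_pullHom _ hz, add_zero]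
  rfl

lemma toFull_congr {f g : SFun p} {x : Body (fullParity p ε₀ ε₁)}
    (h : f (projFull p ε₀ ε₁ x) = g (projFull p ε₀ ε₁ x)) :
    toFull p ε₀ ε₁ f x = toFull p ε₀ ε₁ g x := by
  unfold toFull pull
  congr 1

lemma fn_toB_mk {g : SFun p} (hg : SmoothOn g U₀) {z : ℝ × Body (fullParity p ε₀ ε₁)} (hz : z ∈ W) :
    (toB hB (SmAlg.mk g hg)).fn z = toFull p ε₀ ε₁ g z.2 := by
  rw [fn_toB _ hz]
  refine toFull_congr (SmAlg.fn_mk _ ?_)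
  simpa using hB z hz

lemma hbarD_toB_zero (v : FullVar ι κ₀ κ₁) (hv : ∀ a, v ≠ .ext (.gam a)) (f : SmAlg p U₀) :
    hbarD W (some v) (toB hB f) = 0 := by
  have h := SmAlg.pullZero_proj (p := p) (q := fullParity p ε₀ ε₁) (e := gamFull) (fun _ => rfl)
    (j := v) fun a h => hv a h.symm
  exact SmAlg.pd_pullHom_zero (hm := hB) (SmAlg.pullZero_snd h) f

lemma hbarD_none_toB (f : SmAlg p U₀) : hbarD W none (toB hB f) = 0 :=
  SmAlg.pd_pullHom_zero (w' := .inl (1, 0)) (by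
    change ((projFull p ε₀ ε₁).comp (ContinuousLinearMap.snd ℝ ℝ _)) (1, 0) = 0
    simp) f

/-- The quantum master equation in terms of the vector field `(·, X)`. -/
lemma smAction_master (hE : IsAntisymplectic E U₀) (hρ : IsDensity ρ U₀)
    (hXe : ∀ z ∈ W, HasParity 0 (X z.1 z.2)) (hm : QuantumMasterEquation p ε₀ ε₁ E ρ X W)
    {ρ' : SmAlg p U₀} (h1 : ρ' * SmAlg.mk ρ hρ.smooth = 1) (h2 : SmAlg.mk ρ hρ.smooth * ρ' = 1) :
    vf (hbarD W) (fullQ p ε₀ ε₁ (hbarD W) (extMat fun a b => toB hB (smMat hE a b))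
      (smAction hX)) (smAction hX) = Complex.I • (hbarX W none *
        lap2 p ε₀ ε₁ (hbarD W) (extMat fun a b => toB hB (smMat hE a b))
          (toB hB (SmAlg.mk ρ hρ.smooth)) (toB hB ρ') (smAction hX)) := by
  -- The exponential exists only for ħ ≠ 0, but the resulting identity has no negative powers of ħ
  -- and so extends to ħ = 0.
  refine SmAlg.eq_of_hbar_ne_zero fun z hz h0 => ?_
  obtain ⟨t, x⟩ := z
  simp only at h0
  have hx : x ∈ opensAt W t := hz
  rw [← fn_atHbar _ hx, ← fn_atHbar _ hx, atHbar_vf, map_smul, map_mul, atHbar_lap2]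
  have hEt : (fun i j => atHbar W t (extMat (κ₁ := κ₁) (fun a b => toB hB (smMat hE a b)) i j)) =
      extMat (fun a b => atHbar W t (toB hB (smMat hE a b))) := by
    ext1 i; ext1 j
    exact map_extMat (atHbar W t).toRingHom _ i j
  rw [hEt]
  set XC := atHbar W t (smAction hX) with hXC
  set EC := fun a b => atHbar W t (toB hB (smMat hE a b)) with hEC
  set c : ℂ := Complex.I / (t : ℂ) with hc
  have ht : (t : ℂ) ≠ 0 := Complex.ofReal_ne_zero.2 h0
  have hc0 : c ≠ 0 := div_ne_zero Complex.I_ne_zero ht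
  have hP := SmAlg.superAlg (q := fullParity p ε₀ ε₁) (Ω := opensAt W t)
  have hD := SmAlg.partials_crd (opensAt W t)
  have hXCm : XC ∈ SmAlg.par _ (opensAt W t) 0 := fun y hy => by
    rw [hXC, fn_atHbar _ hy, fn_smAction hy]; exact hXe _ hy
  have hcX : c • XC ∈ SmAlg.par _ (opensAt W t) 0 := Submodule.smul_mem _ _ hXCm
  have hECm : ∀ a b, EC a b ∈ SmAlg.par _ (opensAt W t) (p a + p b + 1) := fun a b =>
    SmAlg.pullHom_mem (SmAlg.pullHom_mem ((smMat_poisson hE).mem a b))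
  have hρm : atHbar W t (toB hB (SmAlg.mk ρ hρ.smooth)) ∈ SmAlg.par _ (opensAt W t) 0 :=
    SmAlg.pullHom_mem (SmAlg.pullHom_mem fun y hy => by
      rw [SmAlg.fn_mk _ hy]; exact hρ.parity y hy)
  have hlap : lap2 p ε₀ ε₁ (fullD _) (extMat EC) (atHbar W t (toB hB (SmAlg.mk ρ hρ.smooth)))
      (atHbar W t (toB hB ρ')) (SmAlg.exp (c • XC)) = 0 := by
    refine SmAlg.ext fun y hy => ?_
    rw [lap2_fn (E := E) (ρ := ρ) (SmAlg.exp_mem hcX) (fun a b w hw => ?_) hECm (fun w hw => ?_) hρm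
      ?_ ?_ (fun v hv => ?_) hy, SmAlg.fn_zero hy]
    · have h3 := hm (t, y) hy h0
      have h4 : (SmAlg.exp (c • XC)).fn =ᶠ[𝓝 y]
          fun w => sexp ((Complex.I / (t : ℂ)) • X t w) := by
        filter_upwards [(opensAt W t).isOpen.mem_nhds hy] with w hw
        have hw' : (t, w) ∈ W := hw
        rw [SmAlg.fn_exp _ hw, SmAlg.fn_smul hw, hXC, fn_atHbar _ hw, fn_smAction hw']
      rw [oddLaplacian_congr h4, h3, smul_zero]
    · rw [← map_mul, ← map_mul, h1, map_one, map_one]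
    · rw [← map_mul, ← map_mul, h2, map_one, map_one]
    · rw [hEC, fn_atHbar _ hw, smMat, fn_toB_mk _ hw]
    · rw [fn_atHbar _ hw, fn_toB_mk _ hw]
    · have := atHbar_hbarD t v (toB hB (SmAlg.mk ρ hρ.smooth))
      rw [hbarD_toB_zero v hv, map_zero] at this
      exact this.symm
  have key := master_of_lap2 (E := extMat EC) hP (fun v => hD.der v) rfl hc0 (SmAlg.exp_mem hcX)
    (SmAlg.isUnit_exp _) (fun v => by
      rcases v with _ | v
      · simp [fullD]
      · exact SmAlg.pd_exp hcX _)
    (fullQ_some_mem hP (extMat_mem hP hECm) fun v => by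
      have := (hD.der v).mem hXCm
      rw [zero_add] at this
      exact this) hlap
  rw [key, SmAlg.fn_smul hx, SmAlg.fn_smul hx, SmAlg.fn_mul hx, fn_atHbar _ hx, fn_hbarX_none hz,
    ← Algebra.smul_def, smul_smul]
  congr 1
  -- With c = i/ħ the coefficient -c⁻¹ equals iħ.
  rw [hc, inv_div, ← neg_div, neg_div, div_eq_mul_inv, Complex.inv_I]
  ring

lemma toSlice_hbarX (v : HVar ι κ₀ κ₁) (hv : IsExtra v) : toSlice hS (hbarX W v) = 0 := by
  refine SmAlg.ext fun u hu => ?_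
  rw [toSlice, SmAlg.fn_pullHom _ hu, SmAlg.fn_zero hu]
  rcases v with _ | v
  · rw [fn_hbarX_none (hS u hu)]
    simp
  · rw [fn_hbarX_some _ (hS u hu)]
    have hv' : ∀ i, FullVar.ext i ≠ v := by
      rintro i rfl; exact hv
    unfold coordFn
    split
    · next h =>
      have : ((ContinuousLinearMap.inr ℝ ℝ _).comp (sliceL p ε₀ ε₁) u + 0).2 ⟨v, h⟩ = 0 := by
        rw [add_zero]
        exact Function.extend_apply' _ _ _ (by
          rintro ⟨i, hi⟩; exact hv' i.1 (congrArg Subtype.val hi))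
      rw [this]
      simp
    · next h =>
      rw [ExteriorAlgebra.map_apply_ι]
      refine (congrArg _ (funext fun i => ?_)).trans (map_zero (ExteriorAlgebra.ι ℂ))
      refine (LinearMap.funLeft_apply _ _ _ _ _).trans ?_
      exact dif_neg fun hi => hv' i.1 (congrArg Subtype.val hi)

/-- A gauge-fixing action defines a full theory. -/
theorem isFullTheory [DecidableEq κ₀] [DecidableEq κ₁] (hE : IsAntisymplectic E U₀) (hρ : IsDensity ρ U₀)
    (hXe : ∀ z ∈ W, HasParity 0 (X z.1 z.2)) (hpl : PlanckNumberOne p ε₀ ε₁ X W)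
    (hm : QuantumMasterEquation p ε₀ ε₁ E ρ X W)
    {ρ' : SmAlg p U₀} (hρ' : ρ' ∈ SmAlg.par p U₀ 0)
    (h1 : ρ' * SmAlg.mk ρ hρ.smooth = 1) (h2 : SmAlg.mk ρ hρ.smooth * ρ' = 1) :
    IsFullTheory (SmAlg.par (extParity p ε₁) Ω) (SmAlg.par (fullParity p ε₀ ε₁) W) p ε₀ ε₁
      (fun k => SmAlg.pd (crd _ k)) (hbarD W) (hbarX W) (toSlice hS)
      (extMat fun a b => toA hA (smMat hE a b)) (extMat fun a b => toB hB (smMat hE a b))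
      (toB hB (SmAlg.mk ρ hρ.smooth)) (toB hB ρ') (smAction hX) where
  superA := SmAlg.superAlg
  superB := SmAlg.superAlg
  partA := SmAlg.partials_crd Ω
  partB := hbarD_partials
  x_mem := hbarX_mem
  d_x u v := by rw [hbarD_hbarX]; congr
  s_x := toSlice_hbarX
  s_d i b := (SmAlg.pd_pullHom (SmAlg.pullRel_incl _ ext_injective i) b).symm
  s_mem hb := SmAlg.pullHom_mem hb
  poisson := by
    have hP := smMat_poisson hE
    have hd : ∀ k f, SmAlg.pd (crd (extParity p ε₁) (.gam k)) (toA hA f) =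
        toA hA (SmAlg.pd (crd p k) f) := fun k f =>
      SmAlg.pd_pullHom (SmAlg.pullRel_proj _ gam_injective k) f
    refine extMat_poisson SmAlg.superAlg (SmAlg.partials_crd Ω)
      (fun a b => SmAlg.pullHom_mem (hP.mem a b)) (fun a b => ?_) (fun α a b => ⟨?_, ?_⟩)
      fun a b c => ?_
    · rw [hP.skew a b, map_neg, map_smul]
    · exact SmAlg.pd_pullHom_zero (SmAlg.pullZero_proj _ (by simp)) _
    · exact SmAlg.pd_pullHom_zero (SmAlg.pullZero_proj _ (by simp)) _
    · have := congrArg (toA hA) (hP.jac a b c)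
      simp only [map_add, map_smul, map_sum, map_mul, map_zero] at this
      simp only [hd]
      exact this
  EB_mem := extMat_mem SmAlg.superAlg fun a b => SmAlg.pullHom_mem ((smMat_poisson hE).mem a b)
  EB_skew := extMat_skew fun a b => by rw [(smMat_poisson hE).skew a b, map_neg, map_smul]
  s_EB i j := by
    refine (map_extMat (toSlice hS).toRingHom _ i j).trans ?_
    congr 1
    ext1 a; ext1 b
    exact toSlice_toB _
  d_EB u i j hu := by
    have h0 : ∀ f : SmAlg p U₀, hbarD W u (toB hB f) = 0 := fun f => by
      rcases u with _ | u
      · exact hbarD_none_toB f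
      · exact hbarD_toB_zero u (by rintro a rfl; exact hu) f
    have h1 := (hbarD_partials.der u).map_one (SmAlg.superAlg (Ω := W))
    rcases i with a | α | α <;> rcases j with b | β | β <;> simp only [extMat, map_zero] <;>
      first
      | exact h0 _
      | split <;> simp [h1]
  ρ_mem := SmAlg.pullHom_mem fun y hy => by rw [SmAlg.fn_mk _ hy]; exact hρ.parity y hy
  ρ'_mem := SmAlg.pullHom_mem hρ'
  d_ρ u hu := by
    rcases u with _ | u
    · exact hbarD_none_toB _
    · exact hbarD_toB_zero u (by rintro a rfl; exact hu) _
  X_mem z hz := by rw [fn_smAction hz]; exact hXe z hz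
  planck := smAction_planck hXe hpl
  master := smAction_master hE hρ hXe hm h1 h2

end fulltheory

lemma body_map {I J : Type*} {p : I → ZMod 2} {q : J → ZMod 2}
    (r : (OddIdx p → ℂ) →ₗ[ℂ] (OddIdx q → ℂ)) (a : Gr p) :
    body (ExteriorAlgebra.map r a : Gr q) = body a := by
  have h : (ExteriorAlgebra.algebraMapInv (R := ℂ) (M := OddIdx q → ℂ)).comp
      (ExteriorAlgebra.map r) = ExteriorAlgebra.algebraMapInv := by
    ext; simp [ExteriorAlgebra.algebraMapInv]
  exact DFunLike.congr_fun h a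

lemma body_odd {I : Type*} [Fintype I] {p : I → ZMod 2} {k : ZMod 2} {a : Gr p} (ha : HasParity k a)
    (hk : k ≠ 0) : body a = 0 := by
  rw [zmod2_ne hk] at ha
  exact body_nilpotent (odd_mem_gfilt ha)

/-! ### Identification of the algebraic quantities with the data of the theorem -/

section identification

variable {ι κ₀ κ₁ : Type*} [Fintype ι] [Fintype κ₀] [Fintype κ₁]
  {p : ι → ZMod 2} {ε₀ : κ₀ → ZMod 2} {ε₁ : κ₁ → ZMod 2}
  {U₀ : Opens (Body p)} {Ω : Opens (Body (extParity p ε₁))}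
  {W : Opens (ℝ × Body (fullParity p ε₀ ε₁))}
  {hA : ∀ u ∈ Ω, projExt p ε₁ u + 0 ∈ U₀}
  {hS : ∀ u ∈ Ω, (ContinuousLinearMap.inr ℝ ℝ _).comp (sliceL p ε₀ ε₁) u + 0 ∈ W}
  {X : ℝ → SFun (fullParity p ε₀ ε₁)}
  {hX : SmoothOn (fun z : ℝ × Body (fullParity p ε₀ ε₁) => X z.1 z.2) W}
  {E : ι → ι → SFun p} {ρ : SFun p} {u : Body (extParity p ε₁)}

include hS in
lemma slice_mem_of (hu : u ∈ Ω) : ((0 : ℝ), slice p ε₀ ε₁ u) ∈ W := by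
  have := hS u hu
  rw [add_zero] at this
  exact this

lemma fn_toSlice (f : SmAlg (fullParity p ε₀ ε₁) W) (hu : u ∈ Ω) :
    (toSlice hS f).fn u = onSlice p ε₀ ε₁ (fun x => f.fn (0, x)) u := by
  rw [toSlice, SmAlg.fn_pullHom _ hu, add_zero]
  rfl

lemma onSlice_congr {f g : SFun (fullParity p ε₀ ε₁)}
    (h : f (slice p ε₀ ε₁ u) = g (slice p ε₀ ε₁ u)) :
    onSlice p ε₀ ε₁ f u = onSlice p ε₀ ε₁ g u :=
  congrArg (ExteriorAlgebra.map _) h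

lemma body_onSlice (f : SFun (fullParity p ε₀ ε₁)) :
    body (onSlice p ε₀ ε₁ f u) = body (f (slice p ε₀ ε₁ u)) := body_map _ _

lemma fn_hbarD_smAction (v : FullVar ι κ₀ κ₁) {t : ℝ} {x : Body (fullParity p ε₀ ε₁)}
    (hz : (t, x) ∈ W) : (hbarD W (some v) (smAction hX)).fn (t, x) = rD v (X t) x :=
  (SmAlg.fn_paramDir _ hz v).trans (SmAlg.rD_congr (smAction_slice hz) v)

lemma fn_hbarD_hbarD (v w : FullVar ι κ₀ κ₁) {t : ℝ} {x : Body (fullParity p ε₀ ε₁)}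
    (hz : (t, x) ∈ W) :
    (hbarD W (some v) (hbarD W (some w) (smAction hX))).fn (t, x) = rD v (rD w (X t)) x := by
  refine (SmAlg.fn_paramDir _ hz v).trans (SmAlg.rD_congr ?_ v)
  filter_upwards [(Continuous.prodMk_right t).continuousAt.eventually (W.isOpen.mem_nhds hz)]
    with y hy
  exact fn_hbarD_smAction w hy

lemma fn_toSlice_hbarD (v : FullVar ι κ₀ κ₁) (hu : u ∈ Ω) :
    (toSlice hS (hbarD W (some v) (smAction hX))).fn u = onSlice p ε₀ ε₁ (rD v (X 0)) u := by
  rw [fn_toSlice _ hu]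
  exact onSlice_congr (fn_hbarD_smAction v (slice_mem_of (hS := hS) hu))

include hX in
lemma rD_action_mem (hXe : ∀ z ∈ W, HasParity 0 (X z.1 z.2)) (v : FullVar ι κ₀ κ₁) {t : ℝ}
    {x : Body (fullParity p ε₀ ε₁)} (hz : (t, x) ∈ W) :
    HasParity (fullParity p ε₀ ε₁ v) (rD v (X t) x) := by
  have hs : SmoothOn (X t) (opensAt W t) := fun φ =>
    ContDiffOn.comp (g := fun z => φ (X z.1 z.2)) (f := fun y => (t, y)) (hX φ)
      (contDiff_prodMk_right t).contDiffOn fun y hy => hy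
  have h := (SmAlg.partials_crd (opensAt W t)).der v |>.mem (x := SmAlg.mk _ hs) (i := 0)
    (fun y hy => by rw [SmAlg.fn_mk _ hy]; exact hXe (t, y) hy) x hz
  rw [SmAlg.fn_pd_crd _ _ (show x ∈ opensAt W t from hz), zero_add,
    SmAlg.rD_congr (SmAlg.fn_mk_nhds hs (show x ∈ opensAt W t from hz))] at h
  exact h

lemma fn_cG (a : κ₀) (hu : u ∈ Ω) : (cG (hbarD W) (toSlice hS) (smAction hX) a).fn u =
    constraintG p ε₀ ε₁ X a u := fn_toSlice_hbarD _ hu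

lemma fn_cG₁ (a : κ₁) (hu : u ∈ Ω) : (cG₁ (hbarD W) (toSlice hS) (smAction hX) a).fn u =
    constraintG₁ p ε₀ ε₁ X a u := by
  rw [cG₁, SmAlg.fn_neg hu, fn_toSlice_hbarD _ hu]
  exact (map_neg _ _).symm

lemma lD_rD_eq (hXe : ∀ z ∈ W, HasParity 0 (X z.1 z.2)) (v w : FullVar ι κ₀ κ₁) (hu : u ∈ Ω) :
    onSlice p ε₀ ε₁ (lD v (rD w (X 0))) u =
      (sgn (fullParity p ε₀ ε₁ v * (fullParity p ε₀ ε₁ w + 1)) •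
        toSlice hS (hbarD W (some v) (hbarD W (some w) (smAction hX)))).fn u := by
  have hz := slice_mem_of (hS := hS) hu
  rw [SmAlg.fn_smul hu, fn_toSlice _ hu]
  refine Eq.trans ?_ (map_smul (ExteriorAlgebra.map _) _ _)
  refine congrArg (ExteriorAlgebra.map _) ?_
  exact (SmAlg.lD_eq (rD_action_mem (hX := hX) hXe w hz) v).trans
    (congrArg _ (fn_hbarD_hbarD (hX := hX) v w hz).symm)

lemma fn_cΔ (hXe : ∀ z ∈ W, HasParity 0 (X z.1 z.2)) (α β : κ₁) (hu : u ∈ Ω) :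
    (cΔ ε₁ (hbarD W) (toSlice hS) (smAction hX) α β).fn u = fpMatrix p ε₀ ε₁ X u α β := by
  rw [fpMatrix, Matrix.of_apply, lD_rD_eq (hS := hS) (hX := hX) hXe _ _ hu,
    hbarD_partials.comm (some (.agh α)) (some (.gh β)), map_smul, sgn_smul_smul]
  simp only [cΔ, Matrix.of_apply]
  congr 1
  refine sgn_smul_congr ?_ rfl
  simp only [hParity, fullParity]
  have : ∀ a b : ZMod 2, a + 1 = (a + 1) * (b + 1 + 1) + (a + 1) * (b + 1) := by decide
  exact this _ _

lemma fn_oneLoop (hu : u ∈ Ω) :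
    ((1 / Complex.I) • toSlice hS (hbarD W none (smAction hX))).fn u = oneLoop p ε₀ ε₁ X u := by
  have hz := slice_mem_of (hS := hS) hu
  rw [SmAlg.fn_smul hu, fn_toSlice _ hu]
  refine (map_smul (ExteriorAlgebra.map _) _ _).symm.trans ?_
  refine congrArg (ExteriorAlgebra.map _) (congrArg _ ?_)
  refine (SmAlg.fn_dirD _ _ hz).trans ?_
  have h2 : (fun t => X t (slice p ε₀ ε₁ u)) =ᶠ[𝓝 0]
      fun t => (smAction hX).fn (t, slice p ε₀ ε₁ u) := by
    filter_upwards [(Continuous.prodMk_left (slice p ε₀ ε₁ u)).continuousAt.eventually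
      (W.isOpen.mem_nhds hz)] with t ht
    exact (fn_smAction ht).symm
  exact ((gderiv_congr h2 1).trans (gderiv_comp (m := fun t => (t, slice p ε₀ ε₁ u))
    (m' := ContinuousLinearMap.inl ℝ ℝ _) ((smAction hX).gdiffAt hz)
    (hasFDerivAt_prodMk_left 0 (slice p ε₀ ε₁ u)) 1)).symm

lemma fn_toA {g : SFun p} (hg : SmoothOn g U₀) (hu : u ∈ Ω) :
    (toA hA (SmAlg.mk g hg)).fn u = toExt p ε₁ g u := by
  rw [toA, SmAlg.fn_pullHom _ hu, SmAlg.fn_mk _ (hA u hu), add_zero]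
  rfl

lemma fn_extMat (hE : IsAntisymplectic E U₀) (i j : ExtVar ι κ₁) (hu : u ∈ Ω) :
    (extMat (fun a b => toA hA (smMat hE a b)) i j).fn u = Eext p ε₁ E i j u := by
  rcases i with a | α | α <;> rcases j with b | β | β <;> simp only [extMat, Eext, SmAlg.fn_zero hu]
  · exact fn_toA _ hu
  all_goals first
    | rfl
    | split
      · simp [SmAlg.fn_one hu, SmAlg.fn_neg hu]
      · simp [SmAlg.fn_zero hu]

/-- The sign in `ham` is the one converting the right derivatives of g into the left derivatives of
the antibracket. -/
lemma fn_bracket (hE : IsAntisymplectic E U₀) {k : ZMod 2} {f g : SmAlg (extParity p ε₁) Ω}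
    (hg : g ∈ SmAlg.par _ Ω k) {f' g' : SFun (extParity p ε₁)} (hf' : ∀ v ∈ Ω, f.fn v = f' v)
    (hg' : ∀ v ∈ Ω, g.fn v = g' v) (hu : u ∈ Ω) :
    (vf (fun i => SmAlg.pd (crd _ i)) (ham (extParity p ε₁) (fun i => SmAlg.pd (crd _ i))
      (extMat fun a b => toA hA (smMat hE a b)) (k + 1) g) f).fn u =
      antibracket (Eext p ε₁ E) f' g' u := by
  have hn : ∀ {f : SmAlg (extParity p ε₁) Ω} {f' : SFun (extParity p ε₁)},
      (∀ v ∈ Ω, f.fn v = f' v) → f.fn =ᶠ[𝓝 u] f' := fun h => by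
    filter_upwards [Ω.isOpen.mem_nhds hu] with v hv
    exact h v hv
  rw [vf_apply, SmAlg.fn_sum hu, antibracket]
  refine Finset.sum_congr rfl fun i _ => ?_
  rw [SmAlg.fn_mul hu, ham, SmAlg.fn_sum hu, Finset.mul_sum]
  refine Finset.sum_congr rfl fun j _ => ?_
  have h1 : HasParity k (g' u) := by rw [← hg' u hu]; exact hg u hu
  rw [SmAlg.fn_smul hu, SmAlg.fn_mul hu, fn_extMat hE _ _ hu, SmAlg.fn_pd_crd _ _ hu,
    SmAlg.fn_pd_crd _ _ hu, SmAlg.rD_congr (hn hf'), SmAlg.rD_congr (hn hg'), SmAlg.lD_eq h1,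
    mul_smul_comm, mul_smul_comm, mul_assoc]

end identification

/-! ### Linear algebra of the matrices on the constraint surface -/

section linalg

/-- A square block of a matrix of large rank is invertible if the other blocks vanish. -/
lemma isUnit_block_of_rank {a b c : Type*} [Fintype a] [Fintype b] [Fintype c] [DecidableEq c]
    {H : Matrix (a ⊕ b ⊕ c ⊕ c) (a ⊕ b ⊕ c ⊕ c) ℂ} (hab : Fintype.card a = 2 * Fintype.card b)
    (hr : H.rank = 2 * (Fintype.card b + Fintype.card c))
    (h1 : ∀ i j, H (.inl i) (.inl j) = 0) (h2 : ∀ i γ, H (.inl i) (.inr (.inr (.inl γ))) = 0)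
    (h3 : ∀ i γ, H (.inr (.inl i)) (.inr (.inr (.inl γ))) = 0)
    (h4 : ∀ γ j, H (.inr (.inr (.inl γ))) (.inl j) = 0)
    (h5 : ∀ γ δ, H (.inr (.inr (.inl γ))) (.inr (.inr (.inl δ))) = 0)
    (h6 : ∀ γ j, H (.inr (.inr (.inr γ))) (.inl j) = 0) :
    IsUnit (Matrix.of fun γ δ => H (.inr (.inr (.inr γ))) (.inr (.inr (.inl δ)))) := by
  classical
  set Δ : Matrix c c ℂ := Matrix.of fun γ δ => H (.inr (.inr (.inr γ))) (.inr (.inr (.inl δ)))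
  let A : Matrix b a ℂ := Matrix.of fun i j => H (.inr (.inl i)) (.inl j)
  -- Dimension count. Put |a| = 2|b|. The kernel of L embeds into the kernel of H through the first
  -- and third slots, and ker H has dimension 3|b| + 2|c| - 2(|b| + |c|) = |b|. So L has rank at
  -- least 2|b| + |c| - |b| = |b| + |c|, which is the dimension of its target; being onto, it has Δ
  -- onto.
  let L : ((a → ℂ) × (c → ℂ)) →ₗ[ℂ] ((b → ℂ) × (c → ℂ)) := A.mulVecLin.prodMap Δ.mulVecLin
  let Ψ : ((a → ℂ) × (c → ℂ)) →ₗ[ℂ] (a ⊕ b ⊕ c ⊕ c → ℂ) :=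
    { toFun := fun v => Sum.elim v.1 (Sum.elim 0 (Sum.elim v.2 0))
      map_add' := fun v w => by ext (i | i | i | i) <;> simp
      map_smul' := fun r v => by ext (i | i | i | i) <;> simp }
  have hΨ : Function.Injective Ψ := fun v w h => by
    refine Prod.ext (funext fun i => congrFun h (.inl i))
      (funext fun i => congrFun h (.inr (.inr (.inl i))))
  have hH : ∀ v, L v = 0 → H.mulVec (Ψ v) = 0 := by
    intro v hv
    have e1 := congrArg Prod.fst hv
    have e2 := congrArg Prod.snd hv
    ext (i | i | i | i)
    · simp [Matrix.mulVec, dotProduct, Fintype.sum_sum_type, Ψ, h1, h2]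
    · have := congrFun e1 i
      simpa [Matrix.mulVec, dotProduct, Fintype.sum_sum_type, Ψ, h3, L, A] using this
    · simp [Matrix.mulVec, dotProduct, Fintype.sum_sum_type, Ψ, h4, h5]
    · have := congrFun e2 i
      simpa [Matrix.mulVec, dotProduct, Fintype.sum_sum_type, Ψ, h6, L, Δ] using this
  let f : LinearMap.ker L →ₗ[ℂ] LinearMap.ker H.mulVecLin :=
    (Ψ.comp (LinearMap.ker L).subtype).codRestrict _ fun v => hH v.1 v.2
  have hf : Function.Injective f := fun v w h => Subtype.ext (hΨ (congrArg Subtype.val h))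
  have k1 := LinearMap.finrank_le_finrank_of_injective hf
  have k2 := LinearMap.finrank_range_add_finrank_ker H.mulVecLin
  have k3 := LinearMap.finrank_range_add_finrank_ker L
  rw [Matrix.rank] at hr
  rw [hr] at k2
  simp only [Module.finrank_prod, Module.finrank_fintype_fun_eq_card, Fintype.card_sum] at k2 k3
  have hs : LinearMap.range L = ⊤ := by
    refine Submodule.eq_top_of_finrank_eq (le_antisymm (Submodule.finrank_le _) ?_)
    simp only [Module.finrank_prod, Module.finrank_fintype_fun_eq_card]
    omega
  rw [← Matrix.mulVec_surjective_iff_isUnit]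
  intro y
  obtain ⟨v, hv⟩ := LinearMap.range_eq_top.1 hs (0, y)
  exact ⟨v.2, congrArg Prod.snd hv⟩

/-- On vectors (0, v) the whole matrix acts through this block alone, so injectivity is inherited.
-/
lemma isUnit_block_of_zero {b : Type*} [Fintype b] [DecidableEq b] {M : Matrix (b ⊕ b) (b ⊕ b) ℂ}
    (hM : IsUnit M) (h0 : ∀ i j, M (.inr i) (.inr j) = 0) :
    IsUnit (Matrix.of fun i j => M (.inl i) (.inr j)) := by
  rw [← Matrix.mulVec_injective_iff_isUnit] at hM ⊢
  intro v w h
  have := @hM (Sum.elim 0 v) (Sum.elim 0 w) (by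
    ext (i | i)
    · simpa [Matrix.mulVec, dotProduct, Fintype.sum_sum_type] using congrFun h i
    · simp [Matrix.mulVec, dotProduct, Fintype.sum_sum_type, h0])
  exact funext fun i => congrFun this (.inr i)

lemma extMat_isUnit {ι κ₁ : Type*} [Fintype ι] [Fintype κ₁] [DecidableEq ι] [DecidableEq κ₁]
    {e : ι → ι → ℂ} (he : IsUnit (Matrix.of e)) :
    IsUnit (Matrix.of (extMat (κ₁ := κ₁) e) : Matrix (ExtVar ι κ₁) (ExtVar ι κ₁) ℂ) := by
  rw [← Matrix.mulVec_injective_iff_isUnit] at he ⊢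
  intro v w h
  have h1 := @he (fun i => v (.gam i)) (fun i => w (.gam i)) (by
    ext i
    simpa [Matrix.mulVec, dotProduct, sum_extVar, extMat] using congrFun h (.gam i))
  ext (i | α | α)
  · exact congrFun h1 i
  · simpa [Matrix.mulVec, dotProduct, sum_extVar, extMat] using congrFun h (.piS α)
  · simpa [Matrix.mulVec, dotProduct, sum_extVar, extMat] using congrFun h (.pi α)

end linalg

/-! ### Invertibility of the ghost and bracket matrices on the constraint surface -/

section onshell

variable {ι κ₀ κ₁ : Type*} [Fintype ι] [Fintype κ₀] [Fintype κ₁] [DecidableEq κ₀] [DecidableEq κ₁]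
  {p : ι → ZMod 2} {ε₀ : κ₀ → ZMod 2} {ε₁ : κ₁ → ZMod 2}
  {U₀ : Opens (Body p)} {Ω : Opens (Body (extParity p ε₁))}
  {W : Opens (ℝ × Body (fullParity p ε₀ ε₁))}
  {hS : ∀ u ∈ Ω, (ContinuousLinearMap.inr ℝ ℝ _).comp (sliceL p ε₀ ε₁) u + 0 ∈ W}
  {X : ℝ → SFun (fullParity p ε₀ ε₁)}
  {hX : SmoothOn (fun z : ℝ × Body (fullParity p ε₀ ε₁) => X z.1 z.2) W}
  {E : ι → ι → SFun p} {ρ : SFun p} {u : Body (extParity p ε₁)}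
  {dA : ExtVar ι κ₁ → SmAlg (extParity p ε₁) Ω →ₗ[ℂ] SmAlg (extParity p ε₁) Ω}
  {EA : ExtVar ι κ₁ → ExtVar ι κ₁ → SmAlg (extParity p ε₁) Ω}
  {EB : ExtVar ι κ₁ → ExtVar ι κ₁ → SmAlg (fullParity p ε₀ ε₁) W}
  {ρB ρB' : SmAlg (fullParity p ε₀ ε₁) W}

/-- The fields, grouped. -/
def fieldEquiv : ExtVar ι κ₁ ⊕ κ₀ ⊕ κ₁ ⊕ κ₁ ≃ {v : FullVar ι κ₀ κ₁ // isField v = true} where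
  toFun := Sum.elim (fun i => ⟨.ext i, rfl⟩) (Sum.elim (fun i => ⟨.lam i, rfl⟩)
    (Sum.elim (fun i => ⟨.gh i, rfl⟩) fun i => ⟨.agh i, rfl⟩))
  invFun := fun v => match v with
    | ⟨.ext i, _⟩ => .inl i
    | ⟨.lam i, _⟩ => .inr (.inl i)
    | ⟨.gh i, _⟩ => .inr (.inr (.inl i))
    | ⟨.agh i, _⟩ => .inr (.inr (.inr i))
  left_inv := by rintro (i | i | i | i) <;> rfl
  right_inv := by rintro ⟨i | i | i | i | i | i | i, h⟩ <;> first | rfl | cases h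

/-- The ghost matrix is invertible at stationary configurations. -/
lemma ghost_isUnit (h : IsFullTheory (SmAlg.par (extParity p ε₁) Ω)
      (SmAlg.par (fullParity p ε₀ ε₁) W) p ε₀ ε₁ dA (hbarD W) (hbarX W) (toSlice hS) EA EB ρB ρB'
      (smAction hX))
    (hXe : ∀ z ∈ W, HasParity 0 (X z.1 z.2)) (hcard : Fintype.card (ExtVar ι κ₁) = 2 * Fintype.card κ₀)
    (hu : u ∈ Ω) (hr : IsStationaryConf p ε₀ ε₁ X u →
      (fieldHessian p ε₀ ε₁ X u).rank = 2 * (Fintype.card κ₀ + Fintype.card κ₁))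
    (h0 : ∀ α, body (constraintG p ε₀ ε₁ X α u) = 0)
    (h1 : ∀ α, body (constraintG₁ p ε₀ ε₁ X α u) = 0) :
    IsUnit (Matrix.of fun α β => body (fpMatrix p ε₀ ε₁ X u α β)) := by
  have hz := slice_mem_of (hS := hS) hu
  have hpl := h.hasPlanck_X
  have d1 : ∀ v, (1 : ℂ) ≠ planckNumber v → body (rD v (X 0) (slice p ε₀ ε₁ u)) = 0 := fun v hv => by
    rw [← body_onSlice, ← fn_toSlice_hbarD (hS := hS) (hX := hX) v hu, h.kill hpl (some v) hv,
      SmAlg.fn_zero hu]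
    exact map_zero _
  -- The only coordinate directions in which a first derivative of the classical action may survive
  -- are λ and c̄*, where it is a constraint up to sign; so the constraint surface consists of
  -- stationary configurations.
  have hst : IsStationaryConf p ε₀ ε₁ X u := by
    intro v
    rw [SmAlg.lD_eq (hXe _ hz), body_smul]
    have : body (rD v (X 0) (slice p ε₀ ε₁ u)) = 0 := by
      rcases v with i | a | a | α | α | α | α
      case lam => rw [← body_onSlice]; exact h0 a
      case aghS =>
        have := h1 α
        rw [constraintG₁, body_onSlice] at this
        exact neg_eq_zero.1 ((map_neg ExteriorAlgebra.algebraMapInv _).symm.trans this)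
      all_goals
        refine d1 _ ?_
        simp only [planckNumber]
        norm_num
    rw [this, mul_zero]
  -- A second derivative survives only if the two Planck numbers add up to 1. Among Γ_ext, λ, c, c̄
  -- (numbers 0, 1, 2, -1) these are the pairs Γ_ext with λ and c with c̄.
  have hH : ∀ v w : {v : FullVar ι κ₀ κ₁ // isField v = true},
      (1 : ℂ) - planckNumber w.1 ≠ planckNumber v.1 → fieldHessian p ε₀ ε₁ X u v w = 0 := by
    intro v w hvw
    rw [fieldHessian, Matrix.of_apply, ← body_onSlice, lD_rD_eq (hS := hS) (hX := hX) hXe _ _ hu,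
      h.kill (h.hasPlanck_d hpl (some w.1)) (some v.1) hvw, smul_zero, SmAlg.fn_zero hu]
    exact map_zero _
  have key := isUnit_block_of_rank
    (H := (fieldHessian p ε₀ ε₁ X u).submatrix fieldEquiv fieldEquiv) hcard
    (by rw [Matrix.rank_submatrix]; exact hr hst)
    (fun i j => hH _ _ (by simp [fieldEquiv, planckNumber]))
    (fun i j => hH _ _ (by simp [fieldEquiv, planckNumber]; norm_num))
    (fun i j => hH _ _ (by simp [fieldEquiv, planckNumber]))
    (fun i j => hH _ _ (by simp [fieldEquiv, planckNumber]))
    (fun i j => hH _ _ (by simp [fieldEquiv, planckNumber]; norm_num))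
    (fun i j => hH _ _ (by simp [fieldEquiv, planckNumber]; norm_num))
  convert key using 1
  ext α β
  exact body_onSlice _

/-- If the direction has the parity of g, the sign between left and right derivatives is 1;
otherwise the derivative is odd and has zero body. -/
lemma body_lD {g : SmAlg (extParity p ε₁) Ω} {g' : SFun (extParity p ε₁)} {j : ExtVar ι κ₁}
    (hg : g ∈ SmAlg.par _ Ω (extParity p ε₁ j)) (hg' : ∀ v ∈ Ω, g.fn v = g' v) (hu : u ∈ Ω)
    (i : ExtVar ι κ₁) : body (lD i g' u) = body (rD i g' u) := by
  have hn : g.fn =ᶠ[𝓝 u] g' := by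
    filter_upwards [Ω.isOpen.mem_nhds hu] with v hv
    exact hg' v hv
  have h1 : HasParity (extParity p ε₁ j) (g' u) := by rw [← hg' u hu]; exact hg u hu
  rw [SmAlg.lD_eq h1, body_smul]
  by_cases hij : extParity p ε₁ i = extParity p ε₁ j
  · have : ∀ a : ZMod 2, a * (a + 1) = 0 := by decide
    rw [hij, this, sgn_zero, one_mul]
  · have h2 := ((SmAlg.partials_crd Ω).der i).mem hg u hu
    rw [SmAlg.fn_pd_crd _ _ hu, SmAlg.rD_congr hn] at h2
    have h3 : extParity p ε₁ j + extParity p ε₁ i ≠ 0 := by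
      have : ∀ a b : ZMod 2, a ≠ b → b + a ≠ 0 := by decide
      exact this _ _ hij
    rw [body_odd h2 h3, mul_zero]

lemma body_Eext (i j : ExtVar ι κ₁) : body (Eext p ε₁ E i j u) =
    extMat (fun a b => body (E a b (bodyOfExt p ε₁ u))) i j := by
  rcases i with a | α | α <;> rcases j with b | β | β <;> simp only [extMat, Eext]
  · exact body_map _ _
  all_goals first
    | exact map_zero _
    | split
      · simp [body]
      · exact map_zero _

/-- The bracket of half of the coordinates with the other, isotropic, half is non-degenerate. -/
lemma bracket_isUnit [DecidableEq ι] (hE : IsUnit (Matrix.of fun a b => E a b (bodyOfExt p ε₁ u)))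
    {f : κ₀ ⊕ κ₀ → SmAlg (extParity p ε₁) Ω} {f' : κ₀ ⊕ κ₀ → SFun (extParity p ε₁)}
    {σ : κ₀ ⊕ κ₀ ≃ ExtVar ι κ₁} (hf : ∀ a, f a ∈ SmAlg.par _ Ω (extParity p ε₁ (σ a)))
    (hf' : ∀ a, ∀ v ∈ Ω, (f a).fn v = f' a v) (hu : u ∈ Ω) (hJ : IsUnit (jacobian σ f' u))
    (h0 : ∀ a b, body (antibracket (Eext p ε₁ E) (f' (.inr a)) (f' (.inr b)) u) = 0) :
    IsUnit (Matrix.of fun a b =>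
      body (antibracket (Eext p ε₁ E) (f' (.inl a)) (f' (.inr b)) u)) := by
  classical
  let φ : Gr (extParity p ε₁) →+* ℂ :=
    (ExteriorAlgebra.algebraMapInv (R := ℂ) (M := OddIdx (extParity p ε₁) → ℂ)).toRingHom
  let φ₀ : Gr p →+* ℂ := (ExteriorAlgebra.algebraMapInv (R := ℂ) (M := OddIdx p → ℂ)).toRingHom
  let J : Matrix (ExtVar ι κ₁) (ExtVar ι κ₁) ℂ := φ.mapMatrix (jacobian σ f' u)
  have hJ1 : IsUnit J := by
    have := hJ.map φ.mapMatrix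
    convert this
  have hE1 : IsUnit (Matrix.of (extMat (κ₁ := κ₁) fun a b => body (E a b (bodyOfExt p ε₁ u))) :
      Matrix (ExtVar ι κ₁) (ExtVar ι κ₁) ℂ) := by
    refine extMat_isUnit ?_
    exact hE.map φ₀.mapMatrix
  -- On bodies, J E Jᵀ is the matrix of all brackets of the new coordinates. It is invertible with J
  -- and E, and its lower right block is the one assumed to vanish.
  have hN : IsUnit (J * Matrix.of (extMat (κ₁ := κ₁) fun a b => body (E a b (bodyOfExt p ε₁ u))) *
      J.transpose) := by
    rw [Matrix.isUnit_iff_isUnit_det] at hJ1 hE1 ⊢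
    rw [Matrix.det_mul, Matrix.det_mul, Matrix.det_transpose]
    exact (hJ1.mul hE1).mul hJ1
  have hM : IsUnit ((J * Matrix.of (extMat (κ₁ := κ₁) fun a b => body (E a b (bodyOfExt p ε₁ u))) *
      J.transpose).submatrix σ σ) := by
    rw [Matrix.isUnit_iff_isUnit_det] at hN ⊢
    rwa [Matrix.det_submatrix_equiv_self]
  have hent : ∀ a b, ((J * Matrix.of (extMat (κ₁ := κ₁) fun a b =>
      body (E a b (bodyOfExt p ε₁ u))) * J.transpose).submatrix σ σ) a b =
      body (antibracket (Eext p ε₁ E) (f' a) (f' b) u) := by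
    intro a b
    rw [antibracket]
    simp only [body_sum, body_mul, Matrix.submatrix_apply, Matrix.mul_apply, Finset.sum_mul]
    rw [Finset.sum_comm]
    refine Finset.sum_congr rfl fun i _ => Finset.sum_congr rfl fun j _ => ?_
    rw [body_lD (hf b) (hf' b) hu, body_Eext]
    simp [J, jacobian, φ, body]
  have := isUnit_block_of_zero hM fun a b => by rw [hent]; exact h0 a b
  simpa only [hent] using this

/-- The constraints commute on the constraint surface. -/
lemma body_bracket_constraints {hA : ∀ u ∈ Ω, projExt p ε₁ u + 0 ∈ U₀}
    (hE : IsAntisymplectic E U₀) (h : IsFullTheory (SmAlg.par (extParity p ε₁) Ω)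
      (SmAlg.par (fullParity p ε₀ ε₁) W) p ε₀ ε₁ (fun k => SmAlg.pd (crd _ k)) (hbarD W) (hbarX W)
      (toSlice hS) (extMat fun a b => toA hA (smMat hE a b)) EB ρB ρB' (smAction hX))
    (hu : u ∈ Ω) (h0 : ∀ α, body (constraintG p ε₀ ε₁ X α u) = 0)
    (h1 : ∀ α, body (constraintG₁ p ε₀ ε₁ X α u) = 0) (a b : κ₀) :
    body (antibracket (Eext p ε₁ E) (constraintG p ε₀ ε₁ X a) (constraintG p ε₀ ε₁ X b) u) = 0 := by
  rw [← fn_bracket (k := ε₀ b) (hA := hA) hE (h.cG_mem b) (fun v hv => fn_cG a hv)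
    (fun v hv => fn_cG b hv) hu]
  have h2 := congrArg (SmAlg.bodyAt u hu) (h.constraint_algebra b a)
  rw [map_smul, map_add, map_sum, map_sum, Finset.sum_eq_zero, Finset.sum_eq_zero, add_zero,
    smul_eq_zero] at h2
  · have h3 := h2.resolve_left (sgn_ne_zero _)
    rwa [SmAlg.bodyAt_apply] at h3
  · intro α _
    rw [map_mul, SmAlg.bodyAt_apply, fn_cG₁ _ hu, h1, zero_mul]
  · intro α _
    rw [map_mul, SmAlg.bodyAt_apply, fn_cG _ hu, h0, zero_mul]

end onshell

/-! ### Smooth dependence of an integral on parameters -/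

section parametric

open MeasureTheory intervalIntegral

universe u

variable {E F : Type u} [NormedAddCommGroup E] [NormedSpace ℝ E] [ProperSpace E]
  [NormedAddCommGroup F] [NormedSpace ℝ F] [CompleteSpace F]

/-- Differentiation under the integral; the dominating constant is the bound of the derivative on
the compact product of a small closed ball with [0, 1]. -/
lemma hasFDerivAt_parametric {O : Set (E × ℝ)} (hO : IsOpen O) {s : Set E} (hs : IsOpen s)
    (hsO : ∀ x ∈ s, ∀ t ∈ Set.Icc (0 : ℝ) 1, (x, t) ∈ O) {f : E × ℝ → F}
    (hf : ContDiffOn ℝ ∞ f O) {x₀ : E} (hx : x₀ ∈ s) :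
    HasFDerivAt (fun x => ∫ t in (0 : ℝ)..1, f (x, t))
      (∫ t in (0 : ℝ)..1, (fderiv ℝ f (x₀, t)).comp (ContinuousLinearMap.inl ℝ E ℝ)) x₀ := by
  have hf' : ContinuousOn (fun z => (fderiv ℝ f z).comp (ContinuousLinearMap.inl ℝ E ℝ)) O :=
    ((hf.fderiv_of_isOpen (m := ∞) hO (by simp)).clm_comp contDiffOn_const).continuousOn
  obtain ⟨r, hr, hrs⟩ := Metric.isOpen_iff.1 hs x₀ hx
  have hsub : Metric.closedBall x₀ (r / 2) ×ˢ Set.Icc (0 : ℝ) 1 ⊆ O := by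
    rintro ⟨x, t⟩ ⟨h1, h2⟩
    exact hsO x (hrs (Metric.closedBall_subset_ball (by linarith) h1)) t h2
  have hc : IsCompact (Metric.closedBall x₀ (r / 2) ×ˢ Set.Icc (0 : ℝ) 1) :=
    (isCompact_closedBall x₀ _).prod isCompact_Icc
  obtain ⟨C, hC⟩ := hc.exists_bound_of_continuousOn (hf'.mono hsub)
  have hI : Set.uIoc (0 : ℝ) 1 ⊆ Set.Icc 0 1 := by
    rw [Set.uIoc_of_le zero_le_one]; exact Set.Ioc_subset_Icc_self
  have hcont : ∀ {G : Type u} [NormedAddCommGroup G] {g : E × ℝ → G}, ContinuousOn g O → ∀ x ∈ s,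
      ContinuousOn (fun t => g (x, t)) (Set.Icc (0 : ℝ) 1) := fun hg x hx =>
    hg.comp (Continuous.prodMk_right x).continuousOn fun t ht => hsO x hx t ht
  refine hasFDerivAt_integral_of_dominated_of_fderiv_le (μ := volume)
    (F := fun x t => f (x, t)) (F' := fun x t => (fderiv ℝ f (x, t)).comp (ContinuousLinearMap.inl ℝ E ℝ))
    (bound := fun _ => C) (s := Metric.closedBall x₀ (r / 2))
    (Metric.closedBall_mem_nhds x₀ (by linarith)) ?_ ?_ ?_ ?_ ?_ ?_
  · filter_upwards [hs.mem_nhds hx] with x hx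
    exact ((hcont hf.continuousOn x hx).mono hI).aestronglyMeasurable measurableSet_uIoc
  · refine ContinuousOn.intervalIntegrable ?_
    rw [Set.uIcc_of_le zero_le_one]
    exact hcont hf.continuousOn x₀ hx
  · exact ((hcont hf' x₀ hx).mono hI).aestronglyMeasurable measurableSet_uIoc
  · exact Filter.Eventually.of_forall fun t ht x hx => hC (x, t) ⟨hx, hI ht⟩
  · exact intervalIntegrable_const
  · refine Filter.Eventually.of_forall fun t ht x hx => ?_
    have h1 : HasFDerivAt f (fderiv ℝ f (x, t)) (x, t) :=
      ((hf.contDiffAt (hO.mem_nhds (hsub ⟨hx, hI ht⟩))).differentiableAt (by simp)).hasFDerivAt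
    exact h1.comp x (hasFDerivAt_prodMk_left x t)

/-- Induction on the order of differentiability, with F replaced by the space of continuous linear
maps from E to F; for this E and F share a universe. -/
lemma contDiffOn_parametric {O : Set (E × ℝ)} (hO : IsOpen O) {s : Set E} (hs : IsOpen s)
    (hsO : ∀ x ∈ s, ∀ t ∈ Set.Icc (0 : ℝ) 1, (x, t) ∈ O) {f : E × ℝ → F}
    (hf : ContDiffOn ℝ ∞ f O) : ContDiffOn ℝ ∞ (fun x => ∫ t in (0 : ℝ)..1, f (x, t)) s := by
  refine contDiffOn_infty.2 fun n => ?_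
  induction n generalizing F with
  | zero =>
    exact contDiffOn_zero.2 fun x hx =>
      (hasFDerivAt_parametric hO hs hsO hf hx).continuousAt.continuousWithinAt
  | succ n ih =>
    rw [Nat.cast_succ, contDiffOn_succ_iff_fderiv_of_isOpen hs]
    refine ⟨fun x hx => (hasFDerivAt_parametric hO hs hsO hf hx).differentiableAt.differentiableWithinAt,
      fun h => absurd h (by simp), ?_⟩
    have h1 : ContDiffOn ℝ ∞ (fun z => (fderiv ℝ f z).comp (ContinuousLinearMap.inl ℝ E ℝ)) O :=
      (hf.fderiv_of_isOpen (m := ∞) hO (by simp)).clm_comp contDiffOn_const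
    exact (ih h1).congr fun x hx => (hasFDerivAt_parametric hO hs hsO hf hx).fderiv

end parametric

/-! ### Hadamard's lemma for a coordinate subspace -/

section hadamard

variable {n : Type*} [Fintype n] {g : n → Prop} [DecidablePred g]

/-- Putting some of the coordinates to zero. -/
def killL (g : n → Prop) [DecidablePred g] : (n → ℝ) →L[ℝ] (n → ℝ) :=
  ContinuousLinearMap.pi fun i => if g i then 0 else ContinuousLinearMap.proj i

lemma killL_apply (y : n → ℝ) (i : n) : killL g y i = if g i then 0 else y i := by
  rw [killL, ContinuousLinearMap.pi_apply]
  split <;> rfl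

lemma killL_killL (y : n → ℝ) : killL g (killL g y) = killL g y := by
  ext i; simp only [killL_apply]; split <;> rfl

lemma norm_killL_le (y : n → ℝ) : ‖killL g y‖ ≤ ‖y‖ := by
  refine (pi_norm_le_iff_of_nonneg (norm_nonneg _)).2 fun i => ?_
  rw [killL_apply]
  split
  · simp
  · exact norm_le_pi_norm y i

/-- Hadamard's lemma. -/
lemma hadamard {O : Set (n → ℝ)} (hO : IsOpen O)
    (hst : ∀ y ∈ O, ∀ t ∈ Set.Icc (0 : ℝ) 1, killL g y + t • (y - killL g y) ∈ O)
    {φ : (n → ℝ) → ℂ} (hφ : ContDiffOn ℝ ∞ φ O) :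
    ∃ k : n → (n → ℝ) → ℂ, (∀ i, ContDiffOn ℝ ∞ (k i) O) ∧
      ∀ y ∈ O, φ y - φ (killL g y) = ∑ i, if g i then (y i : ℂ) * k i y else 0 := by
  classical
  let m : (n → ℝ) × ℝ → (n → ℝ) := fun z => killL g z.1 + z.2 • (z.1 - killL g z.1)
  have hm : ContDiff ℝ ∞ m := by
    refine ((killL g).contDiff.comp contDiff_fst).add (contDiff_snd.smul ?_)
    exact contDiff_fst.sub ((killL g).contDiff.comp contDiff_fst)
  have hO' : IsOpen (m ⁻¹' O) := hO.preimage hm.continuous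
  have hf : ContDiffOn ℝ ∞ (fun z => fderiv ℝ φ (m z)) (m ⁻¹' O) :=
    (hφ.fderiv_of_isOpen (m := ∞) hO (by simp)).comp hm.contDiffOn fun z hz => hz
  -- The mean of the derivative along the segment from `killL g y` to y. Applied to the difference
  -- of the end points it gives the increment of φ, and the coefficients are its values on the basis
  -- vectors.
  let I : (n → ℝ) → ((n → ℝ) →L[ℝ] ℂ) := fun y => ∫ t in (0 : ℝ)..1, fderiv ℝ φ (m (y, t))
  have hI : ContDiffOn ℝ ∞ I O := contDiffOn_parametric hO' hO (fun y hy t ht => hst y hy t ht) hf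
  refine ⟨fun i y => I y (Pi.single i 1), fun i => hI.clm_apply contDiffOn_const, fun y hy => ?_⟩
  have hcont : ContinuousOn (fun t => fderiv ℝ φ (m (y, t))) (Set.uIcc (0 : ℝ) 1) := by
    rw [Set.uIcc_of_le zero_le_one]
    exact hf.continuousOn.comp (Continuous.prodMk_right y).continuousOn fun t ht => hst y hy t ht
  have hd : ∀ t ∈ Set.uIcc (0 : ℝ) 1, HasDerivAt (fun t => φ (m (y, t)))
      (fderiv ℝ φ (m (y, t)) (y - killL g y)) t := by
    intro t ht
    rw [Set.uIcc_of_le zero_le_one] at ht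
    have h1 : HasFDerivAt φ (fderiv ℝ φ (m (y, t))) (m (y, t)) :=
      ((hφ.contDiffAt (hO.mem_nhds (hst y hy t ht))).differentiableAt (by simp)).hasFDerivAt
    have h2 : HasDerivAt (fun t : ℝ => m (y, t)) (y - killL g y) t := by
      have := ((hasDerivAt_id t).smul_const (y - killL g y)).const_add (killL g y)
      simpa [m] using this
    exact h1.comp_hasDerivAt t h2
  have h3 := intervalIntegral.integral_eq_sub_of_hasDerivAt hd
    ((hcont.clm_apply continuousOn_const).intervalIntegrable (μ := MeasureTheory.volume))
  have h4 : φ y - φ (killL g y) = I y (y - killL g y) := by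
    have e1 : m (y, 1) = y := by simp [m]
    have e0 : m (y, 0) = killL g y := by simp [m]
    rw [e1, e0] at h3
    rw [← h3]
    exact (ContinuousLinearMap.intervalIntegral_apply
      (hcont.intervalIntegrable (μ := MeasureTheory.volume)) _).symm
  rw [h4, ← Finset.univ_sum_single (y - killL g y), map_sum]
  refine Finset.sum_congr rfl fun i _ => ?_
  rw [Pi.sub_apply, killL_apply]
  split
  · rw [sub_zero, ← mul_one (y i), ← smul_eq_mul, Pi.single_smul', map_smul, smul_eq_mul, mul_one]
    simp
  · rw [sub_self, Pi.single_zero, map_zero]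

end hadamard

/-! ### Smooth inverses of injective local diffeomorphisms -/

section inverse

variable {E : Type*} [NormedAddCommGroup E] [NormedSpace ℝ E] [CompleteSpace E]

/-- An injective local diffeomorphism has a smooth inverse on its open image. -/
lemma exists_smooth_inverse {y : E → E} {U : Set E} (hU : IsOpen U) (hy : ContDiffOn ℝ ∞ y U)
    (hi : Set.InjOn y U) (hd : ∀ u ∈ U, ∃ e : E ≃L[ℝ] E, (e : E →L[ℝ] E) = fderiv ℝ y u) :
    ∃ x : E → E, IsOpen (y '' U) ∧ ContDiffOn ℝ ∞ x (y '' U) ∧ ∀ u ∈ U, x (y u) = u := by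
  have hx : ∀ u ∈ U, Function.invFunOn y U (y u) = u := fun u hu =>
    hi.leftInvOn_invFunOn hu
  have hyat : ∀ u ∈ U, ContDiffAt ℝ ∞ y u := fun u hu => hy.contDiffAt (hU.mem_nhds hu)
  have hinf : (∞ : WithTop ℕ∞) ≠ 0 := by simp
  refine ⟨Function.invFunOn y U, ?_, ?_, hx⟩
  · rw [isOpen_iff_mem_nhds]
    rintro _ ⟨u, hu, rfl⟩
    obtain ⟨e, he⟩ := hd u hu
    have h1 : HasStrictFDerivAt y (e : E →L[ℝ] E) u := by
      rw [he]; exact (hyat u hu).hasStrictFDerivAt hinf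
    rw [← h1.map_nhds_eq_of_equiv]
    exact Filter.image_mem_map (hU.mem_nhds hu)
  · rintro _ ⟨u, hu, rfl⟩
    obtain ⟨e, he⟩ := hd u hu
    have h0 : HasFDerivAt y (e : E →L[ℝ] E) u := by
      rw [he]; exact ((hyat u hu).differentiableAt hinf).hasFDerivAt
    have h1 : HasStrictFDerivAt y (e : E →L[ℝ] E) u := by
      rw [he]; exact (hyat u hu).hasStrictFDerivAt hinf
    have h2 : ContDiffAt ℝ ∞ (h1.localInverse y e u) (y u) := (hyat u hu).to_localInverse h0 hinf
    -- By injectivity on U the set-theoretic inverse coincides near y u with the one from the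
    -- inverse function theorem, and so is smooth.
    have h3 : Function.invFunOn y U =ᶠ[𝓝 (y u)] h1.localInverse y e u := by
      have h4 : ∀ᶠ z in 𝓝 (y u), h1.localInverse y e u z ∈ U := by
        refine h2.continuousAt.eventually ?_
        rw [h1.localInverse_apply_image]
        exact hU.mem_nhds hu
      filter_upwards [h1.eventually_right_inverse, h4] with z hz hz'
      conv_lhs => rw [← hz]
      exact hx _ hz'
    exact (h2.congr_of_eventuallyEq h3).contDiffWithinAt

end inverse

/-! ### A neighbourhood of the constraint surface with a retraction -/

section neighbourhood

variable {n : Type*} [Fintype n] {g : n → Prop} [DecidablePred g]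

/-- Straightening of a nowhere vanishing function that is constant along the surface where some of
the coordinates `y` vanish. -/
theorem exists_neighbourhood {U : Set (n → ℝ)} (hU : IsOpen U) {y : (n → ℝ) → n → ℝ}
    (hy : ContDiffOn ℝ ∞ y U) (hi : Set.InjOn y U)
    (hd : ∀ u ∈ U, ∃ e : (n → ℝ) ≃L[ℝ] (n → ℝ), (e : (n → ℝ) →L[ℝ] (n → ℝ)) = fderiv ℝ y u)
    {S : Set (n → ℝ)} (hSU : S ⊆ U) (hS : ∀ s ∈ S, killL g (y s) = y s)
    {f : (n → ℝ) → ℂ} (hf : ContDiffOn ℝ ∞ f U) (hf0 : ∀ u ∈ U, f u ≠ 0)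
    (ht : ∀ u ∈ U, killL g (y u) = y u → ∀ v, killL g (fderiv ℝ y u v) = fderiv ℝ y u v →
      fderiv ℝ f u v = 0) :
    ∃ (V : Set (n → ℝ)) (r : (n → ℝ) → n → ℝ), IsOpen V ∧ S ⊆ V ∧ V ⊆ U ∧
      (∀ u ∈ V, r u ∈ V ∧ r (r u) = r u) ∧ (∀ u ∈ V, ∀ᶠ v in 𝓝 u, f (r v) = f (r u)) ∧
      (IsPreconnected S → ∃ c₀, ∀ u ∈ V, f (r u) = c₀) ∧
      (∀ u ∈ V, ‖f u - f (r u)‖ < ‖f (r u)‖) ∧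
      ∀ φ : (n → ℝ) → ℂ, ContDiffOn ℝ ∞ φ V → ∃ k : n → (n → ℝ) → ℂ,
        (∀ i, ContDiffOn ℝ ∞ (k i) V) ∧
        ∀ u ∈ V, φ u - φ (r u) = ∑ i, if g i then (y u i : ℂ) * k i u else 0 := by
  obtain ⟨x, hO, hx, hxy⟩ := exists_smooth_inverse hU hy hi hd
  have hfx : ContDiffOn ℝ ∞ (fun z => f (x z)) (y '' U) := hf.comp hx (by
    rintro _ ⟨u, hu, rfl⟩; rw [hxy u hu]; exact hu)
  -- The second condition on the radius keeps the quotient of f by its value at s within distance 1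
  -- of 1, so that a principal logarithm can be taken later.
  have hball : ∀ s ∈ S, ∃ ρ > 0, Metric.ball (y s) ρ ⊆ y '' U ∧
      ∀ z ∈ Metric.ball (y s) ρ, ‖f (x z) - f s‖ < ‖f s‖ := by
    intro s hs
    have hmem : y s ∈ y '' U := ⟨s, hSU hs, rfl⟩
    have hc : ContinuousAt (fun z => f (x z)) (y s) := hfx.continuousOn.continuousAt (hO.mem_nhds hmem)
    have h1 : ∀ᶠ z in 𝓝 (y s), ‖f (x z) - f s‖ < ‖f s‖ := by
      have h2 : ContinuousAt (fun z => ‖f (x z) - f s‖) (y s) := (hc.sub continuousAt_const).norm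
      refine h2.eventually_lt continuousAt_const ?_
      rw [hxy s (hSU hs), sub_self, norm_zero]
      exact norm_pos_iff.2 (hf0 s (hSU hs))
    obtain ⟨ρ, hρ, h⟩ := Metric.eventually_nhds_iff_ball.1 (h1.and (hO.eventually_mem hmem))
    exact ⟨ρ, hρ, fun z hz => (h z hz).2, fun z hz => (h z hz).1⟩
  choose! R hR hRO hRf using hball
  let O : Set (n → ℝ) := ⋃ s ∈ S, Metric.ball (y s) (R s)
  have hOo : IsOpen O := isOpen_biUnion fun s _ => Metric.isOpen_ball
  have hOU : O ⊆ y '' U := Set.iUnion₂_subset hRO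
  -- The centre is fixed by `killL g`, which does not increase the supremum norm; convexity then
  -- keeps the segments needed for Hadamard's lemma inside the ball.
  have hkill : ∀ s ∈ S, ∀ z ∈ Metric.ball (y s) (R s), killL g z ∈ Metric.ball (y s) (R s) := by
    intro s hs z hz
    rw [mem_ball_iff_norm] at hz ⊢
    rw [← hS s hs, ← map_sub]
    refine (norm_killL_le _).trans_lt ?_
    exact hz
  have hst : ∀ z ∈ O, ∀ t ∈ Set.Icc (0 : ℝ) 1, killL g z + t • (z - killL g z) ∈ O := by
    intro z hz t ht
    obtain ⟨s, hs, hz⟩ := Set.mem_iUnion₂.1 hz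
    refine Set.mem_iUnion₂.2 ⟨s, hs, ?_⟩
    exact (convex_ball (y s) (R s)).add_smul_sub_mem (hkill s hs z hz) hz ht
  -- By `ht` the function f ∘ x ∘ killL has zero derivative on the convex ball, hence is constant
  -- there, with the value at the centre.
  have hconst : ∀ s ∈ S, ∀ z ∈ Metric.ball (y s) (R s), f (x (killL g z)) = f s := by
    intro s hs z hz
    have hmem : y s ∈ Metric.ball (y s) (R s) := Metric.mem_ball_self (hR s hs)
    have hder : ∀ w ∈ Metric.ball (y s) (R s),
        HasFDerivAt (fun z => f (x (killL g z))) (0 : (n → ℝ) →L[ℝ] ℂ) w := by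
      intro w hw
      obtain ⟨u, hu, huw⟩ := hRO s hs (hkill s hs w hw)
      have h1 : HasFDerivAt (fun z => f (x z)) (fderiv ℝ (fun z => f (x z)) (killL g w)) (killL g w) :=
        ((hfx.contDiffAt (hO.mem_nhds (hRO s hs (hkill s hs w hw)))).differentiableAt
          (by simp)).hasFDerivAt
      have h2 := h1.comp w (killL g).hasFDerivAt
      have h3 : (fderiv ℝ (fun z => f (x z)) (killL g w)).comp (killL g) = 0 := by
        obtain ⟨e, he⟩ := hd u hu
        have h4 : HasFDerivAt y (e : (n → ℝ) →L[ℝ] (n → ℝ)) u := by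
          rw [he]; exact ((hy.contDiffAt (hU.mem_nhds hu)).differentiableAt (by simp)).hasFDerivAt
        have h5 : fderiv ℝ f u = (fderiv ℝ (fun z => f (x z)) (killL g w)).comp
            (e : (n → ℝ) →L[ℝ] (n → ℝ)) := by
          have h6 : f =ᶠ[𝓝 u] fun v => f (x (y v)) := by
            filter_upwards [hU.mem_nhds hu] with v hv
            rw [hxy v hv]
          rw [h6.fderiv_eq]
          rw [← huw] at h1 ⊢
          exact (h1.comp u h4).fderiv
        ext v
        have h7 := ht u hu (by rw [huw, killL_killL]) (e.symm (killL g v)) (by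
          rw [← he]; simp [killL_killL])
        rw [h5] at h7
        simpa using h7
      rw [h3] at h2
      exact h2
    have h1 := (convex_ball (y s) (R s)).is_const_of_fderivWithin_eq_zero (𝕜 := ℝ)
      (fun w hw => (hder w hw).differentiableAt.differentiableWithinAt)
      (fun w hw => by
        rw [fderivWithin_of_isOpen Metric.isOpen_ball hw]; exact (hder w hw).fderiv) hz hmem
    rw [h1, hS s hs, hxy s (hSU hs)]
  have hV : IsOpen (U ∩ y ⁻¹' O) := hy.continuousOn.isOpen_inter_preimage hU hOo
  have hyx : ∀ z ∈ y '' U, x z ∈ U ∧ y (x z) = z := by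
    rintro _ ⟨u, hu, rfl⟩
    rw [hxy u hu]
    exact ⟨hu, rfl⟩
  have hkO : ∀ z ∈ O, killL g z ∈ O := fun z hz => by
    simpa using hst z hz 0 ⟨le_rfl, zero_le_one⟩
  have hloc : ∀ u ∈ U ∩ y ⁻¹' O, ∃ s ∈ S, y u ∈ Metric.ball (y s) (R s) ∧
      f (x (killL g (y u))) = f s := by
    rintro u ⟨hu, hz⟩
    obtain ⟨s, hs, hz⟩ := Set.mem_iUnion₂.1 hz
    exact ⟨s, hs, hz, hconst s hs _ hz⟩
  have hSV : S ⊆ U ∩ y ⁻¹' O := fun s hs =>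
    ⟨hSU hs, Set.mem_iUnion₂.2 ⟨s, hs, Metric.mem_ball_self (hR s hs)⟩⟩
  have hcst : ∀ u ∈ U ∩ y ⁻¹' O, ∀ᶠ v in 𝓝 u, f (x (killL g (y v))) = f (x (killL g (y u))) := by
    intro u hu
    obtain ⟨s, hs, hz, h⟩ := hloc u hu
    have h1 : ∀ᶠ v in 𝓝 u, y v ∈ Metric.ball (y s) (R s) :=
      (hy.continuousOn.continuousAt (hU.mem_nhds hu.1)).eventually (Metric.isOpen_ball.mem_nhds hz)
    filter_upwards [h1] with v hv
    rw [h, hconst s hs _ hv]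
  refine ⟨U ∩ y ⁻¹' O, fun u => x (killL g (y u)), hV, hSV, Set.inter_subset_left,
    fun u hu => ⟨⟨?_, ?_⟩, ?_⟩, hcst, fun hp => ?_, fun u hu => ?_, fun φ hφ => ?_⟩
  · exact (hyx _ (hOU (hkO _ hu.2))).1
  · rw [Set.mem_preimage, (hyx _ (hOU (hkO _ hu.2))).2]
    exact hkO _ hu.2
  · change x (killL g (y (x (killL g (y u))))) = x (killL g (y u))
    rw [(hyx _ (hOU (hkO _ hu.2))).2, killL_killL]
  · by_cases hne : S.Nonempty
    · obtain ⟨s₀, hs₀⟩ := hne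
      refine ⟨f s₀, fun u hu => ?_⟩
      obtain ⟨s, hs, hz, h⟩ := hloc u hu
      rw [h]
      by_contra hcon
      have hfs : ∀ s ∈ S, f (x (killL g (y s))) = f s := fun s hs => by
        rw [hS s hs, hxy s (hSU hs)]
      -- Local constancy makes every level condition open; two different values on S would then
      -- split a preconnected set.
      have hA : ∀ P : ℂ → Prop, IsOpen {v | v ∈ U ∩ y ⁻¹' O ∧ P (f (x (killL g (y v))))} := by
        intro P
        rw [isOpen_iff_mem_nhds]
        rintro v ⟨hv, hP⟩
        filter_upwards [hV.mem_nhds hv, hcst v hv] with w hw hw'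
        exact ⟨hw, by rw [hw']; exact hP⟩
      obtain ⟨v, hv, h1, h2⟩ := hp _ _ (hA (· = f s₀)) (hA (· ≠ f s₀))
        (fun v hv => by
          by_cases h : f (x (killL g (y v))) = f s₀
          · exact Or.inl ⟨hSV hv, h⟩
          · exact Or.inr ⟨hSV hv, h⟩)
        ⟨s₀, hs₀, hSV hs₀, hfs s₀ hs₀⟩ ⟨s, hs, hSV hs, by rw [hfs s hs]; exact hcon⟩
      exact h2.2 h1.2
    · refine ⟨0, fun u hu => ?_⟩
      obtain ⟨s, hs, -⟩ := hloc u hu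
      exact absurd ⟨s, hs⟩ hne
  · obtain ⟨s, hs, hz, h⟩ := hloc u hu
    rw [h]
    have := hRf s hs _ hz
    rwa [hxy u hu.1] at this
  · have hφx : ContDiffOn ℝ ∞ (fun z => φ (x z)) O := hφ.comp (hx.mono hOU) fun z hz =>
      ⟨(hyx z (hOU hz)).1, by rw [Set.mem_preimage, (hyx z (hOU hz)).2]; exact hz⟩
    obtain ⟨k, hk, hk'⟩ := hadamard hOo hst hφx
    refine ⟨fun i u => k i (y u), fun i => (hk i).comp (hy.mono Set.inter_subset_left)
      fun u hu => hu.2, fun u hu => ?_⟩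
    have := hk' (y u) hu.2
    rwa [hxy u hu.1] at this

end neighbourhood

/-! ### Logarithms of even superfunctions and descent in the odd variables -/

namespace SmAlg

section log

variable {J : Type*} [Fintype J] {q : J → ZMod 2} {V : Type*} [NormedAddCommGroup V]
  [NormedSpace ℝ V] {Ω : Opens V}

lemma exp_add {f g : SmAlg q Ω} (hf : f ∈ par q Ω 0) : exp (f + g) = exp f * exp g :=
  ext fun z hz => by
    rw [fn_mul hz, fn_exp _ hz, fn_exp _ hz, fn_exp _ hz, fn_add hz]
    refine sexp_add ?_
    have := superAlg.even_comm hf g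
    change f.fn z * g.fn z = g.fn z * f.fn z
    rw [← fn_mul hz, ← fn_mul hz, this]

lemma exp_zero : exp (0 : SmAlg q Ω) = 1 := ext fun z hz => by
  have := sexp_algebraMap (p := q) 0
  rw [map_zero, Complex.exp_zero, map_one] at this
  rw [fn_exp _ hz, fn_zero hz, fn_one hz, this]

lemma exp_mul_exp_neg {f : SmAlg q Ω} (hf : f ∈ par q Ω 0) : exp f * exp (-f) = 1 := by
  rw [← exp_add hf, add_neg_cancel, exp_zero]

/-- What remains of the exponential series starts with the square of m, whose degree exceeds k
because m has positive degree. -/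
lemma exp_sub_mem {k : ℕ} (hk : 1 ≤ k) {m : SmAlg q Ω} (hm : m ∈ filt q Ω k) :
    exp m - 1 - m ∈ filt q Ω (k + 1) := by
  have h1 : m ∈ filt q Ω 1 := filt_anti hk hm
  have hb : ∀ z ∈ Ω, body (m.fn z) = 0 := mem_filt_one.1 h1
  have hb0 : bodyPart m = 0 := ext fun z hz => by
    rw [bodyPart, fn_scal _ hz, hb z hz, map_zero, fn_zero hz]
  have hs : (scal _ m.smooth_body.cexp : SmAlg q Ω) = 1 := ext fun z hz => by
    rw [fn_scal _ hz, hb z hz, Complex.exp_zero, map_one, fn_one hz]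
  have hp : ∀ j, m ^ (j + 2) ∈ filt q Ω (k + 1) := fun j => by
    induction j with
    | zero => rw [pow_two]; exact filt_mul hm h1
    | succ j ih => rw [pow_succ]; exact filt_mul_right ih m
  rw [exp_eq, hs, one_mul, hb0, sub_zero, Finset.sum_range_succ']
  simp only [Nat.factorial_zero, Nat.cast_one, inv_one, pow_zero, one_smul, add_sub_cancel_right]
  rcases hN : Fintype.card (OddIdx q) with _ | N
  · have : m = 0 := filt_card (by rw [hN]; exact h1)
    rw [this]
    simp
  · rw [Finset.sum_range_succ']
    simp only [zero_add, Nat.factorial_one, Nat.cast_one, inv_one, pow_one, one_smul,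
      add_sub_cancel_right]
    exact Submodule.sum_mem _ fun j _ => Submodule.smul_mem _ _ (hp j)

/-- Logarithm of an even superfunction with a given branch of the logarithm of its body. -/
theorem exists_log {f : SmAlg q Ω} (hf : f ∈ par q Ω 0) {l : V → ℂ} (hl : ContDiffOn ℝ ∞ l Ω)
    (hlf : ∀ z ∈ Ω, Complex.exp (l z) = body (f.fn z)) :
    ∃ h ∈ par q Ω 0, exp h = f ∧ ∀ z ∈ Ω, body (h.fn z) = l z := by
  -- Successive correction: adding m = e^{-h}(f - e^h) to h raises the degree of the error by one
  -- without changing the body. The process stops once the degree exceeds the number of odd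
  -- generators.
  have key : ∀ k, ∃ h ∈ par q Ω 0, f - exp h ∈ filt q Ω (k + 1) ∧ ∀ z ∈ Ω, body (h.fn z) = l z := by
    intro k
    induction k with
    | zero =>
      refine ⟨scal l hl, scal_mem hl, mem_filt_one.2 fun z hz => ?_, fun z hz => ?_⟩
      · rw [fn_sub hz, body_sub, fn_exp _ hz, fn_scal _ hz, sexp_algebraMap, body_algebraMap,
          hlf z hz, sub_self]
      · rw [fn_scal _ hz, body_algebraMap]
    | succ k ih =>
      obtain ⟨h, hh, hr, hb⟩ := ih
      set m := exp (-h) * (f - exp h) with hmdef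
      have hm : m ∈ filt q Ω (k + 1) := filt_mul_left hr _
      have hm0 : m ∈ par q Ω 0 := by
        simpa using superAlg.mul_mem (exp_mem (neg_mem hh)) (sub_mem hf (exp_mem hh))
      refine ⟨h + m, add_mem hh hm0, ?_, fun z hz => ?_⟩
      · have h1 : exp h * m = f - exp h := by
          rw [hmdef, ← mul_assoc, exp_mul_exp_neg hh, one_mul]
        have h2 : f - exp (h + m) = -(exp h * (exp m - 1 - m)) := by
          rw [exp_add hh, mul_sub, mul_sub, h1, mul_one]
          abel
        rw [h2]
        exact neg_mem (filt_mul_left (exp_sub_mem (by omega) hm) _)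
      · rw [fn_add hz, body_add, hb z hz, mem_filt_one.1 (filt_anti (by omega) hm) z hz, add_zero]
  obtain ⟨h, hh, hr, hb⟩ := key (Fintype.card (OddIdx q))
  exact ⟨h, hh, (sub_eq_zero.1 (filt_card hr)).symm, hb⟩

end log

section descent

variable {J : Type*} [Fintype J] [DecidableEq J] {q : J → ZMod 2} {Ω : Opens (Body q)}

open Classical in
/-- The components of the Euler vector field in the odd directions. -/
def oddEuler (Ω : Opens (Body q)) (j : J) : SmAlg q Ω := if q j = 0 then 0 else coord Ω j

lemma fn_vf_oddEuler (f : SmAlg q Ω) {z : Body q} (hz : z ∈ Ω) :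
    (vf (fun k => pd (crd q k)) (oddEuler Ω) f).fn z = gEuler (f.fn z) := by
  rw [vf_apply, fn_sum hz, gEuler]
  refine (Fintype.sum_of_injective (Subtype.val : OddIdx q → J) Subtype.val_injective _ _
    (fun j hj => ?_) fun j => ?_).symm
  · have : q j = 0 := by_contra fun h => hj ⟨⟨j, h⟩, rfl⟩
    rw [oddEuler, if_pos this, mul_zero, fn_zero hz]
  · rw [fn_mul hz, oddEuler, if_neg j.2, coord, fn_mk _ hz]
    congr 1
    · unfold crd
      rw [dif_neg j.2]
      exact (fn_oddD _ _ hz).symm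
    · unfold coordFn
      rw [dif_neg j.2]
      congr!

lemma vf_oddEuler_sub_mem {k : ℕ} {f : SmAlg q Ω} (hf : f ∈ filt q Ω k) :
    vf (fun k => pd (crd q k)) (oddEuler Ω) f - (k : ℂ) • f ∈ filt q Ω (k + 1) := fun z hz => by
  rw [fn_sub hz, fn_smul hz, fn_vf_oddEuler _ hz]
  exact gEuler_sub_mem (hf z hz)

lemma pd_crd_even_mem_filt {k : ℕ} {f : SmAlg q Ω} (hf : f ∈ filt q Ω k) {j : J} (hj : q j = 0) :
    pd (crd q j) f ∈ filt q Ω k := by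
  unfold crd
  rw [dif_pos hj]
  exact dirD_mem_filt hf _

variable {κ : Type*} [Fintype κ] [DecidableEq κ] {f : J → SmAlg q Ω} {K' : Matrix J J (SmAlg q Ω)}
  {σ : κ ⊕ κ ≃ J} {G : κ → SmAlg q Ω}

/-- On degree k + 1 the odd Euler field is multiplication by k + 1 up to higher degree. Expanded in
the new coordinates, its F-terms lie in the ideal by `hF`. For even G b the coefficient is of degree
at least 1 while the derivative of m keeps degree k + 1. For odd G b the coefficient is G b plus
terms of degree 2 while the derivative loses at most one degree. Dividing by k + 1 gives the claim.
-/
lemma descent_step (hf : IsCoords (par q Ω) q (fun k => pd (crd q k)) f K')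
    (hG : ∀ b, f (σ (.inr b)) = G b) {k : ℕ} {m : SmAlg q Ω} (hm : m ∈ filt q Ω (k + 1))
    (hF : ∀ b, newD (fun k => pd (crd q k)) K' (σ (.inl b)) m ∈ gIdeal G) :
    m ∈ gIdeal G ⊔ filt q Ω (k + 2) := by
  have hd := partials_crd Ω
  have hGm : ∀ b, G b ∈ par q Ω (q (σ (.inr b))) := fun b => by rw [← hG]; exact hf.mem _
  have hK := hf.sm_inv superAlg hd
  have hE : vf (fun k => pd (crd q k)) (oddEuler Ω) m ∈ gIdeal G ⊔ filt q Ω (k + 2) := by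
    rw [hf.vf_expand, ← σ.sum_comp, Fintype.sum_sum_type]
    refine add_mem (Submodule.sum_mem _ fun b _ => Submodule.mem_sup_left
      (gIdeal_mul_right (hF b) _)) (Submodule.sum_mem _ fun b _ => ?_)
    rw [hG]
    by_cases hb : q (σ (.inr b)) = 0
    · refine Submodule.mem_sup_right ?_
      refine filt_mul (k := k + 1) (l := 1) ?_ ?_
      · rw [newD, vf_apply]
        refine Submodule.sum_mem _ fun j _ => ?_
        by_cases hj : q j = 0
        · exact filt_mul_right (pd_crd_even_mem_filt hm hj) _
        · refine filt_mul (pd_mem_filt hm _) (odd_mem_filt ?_)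
          have := hK j (σ (.inr b))
          rwa [hb, zmod2_ne hj, add_zero, add_zero] at this
      · have := vf_oddEuler_sub_mem (filt_zero (G b))
        simpa using this
    · have h1 : G b ∈ filt q Ω 1 := odd_mem_filt (by rw [← zmod2_ne hb]; exact hGm b)
      have h2 := vf_oddEuler_sub_mem h1
      rw [Nat.cast_one, one_smul] at h2
      rw [← sub_add_cancel (vf (fun k => pd (crd q k)) (oddEuler Ω) (G b)) (G b), mul_add]
      refine add_mem (Submodule.mem_sup_right ?_)
        (Submodule.mem_sup_left (gIdeal_mul_left superAlg hGm (gIdeal_gen b) _))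
      refine filt_mul (k := k) (l := 2) ?_ h2
      rw [newD, vf_apply]
      exact Submodule.sum_mem _ fun j _ => filt_mul_right (pd_mem_filt hm _) _
  have h1 := vf_oddEuler_sub_mem hm
  have h2 : ((k + 1 : ℕ) : ℂ) • m ∈ gIdeal G ⊔ filt q Ω (k + 2) := by
    have := sub_mem hE (Submodule.mem_sup_right (S := gIdeal G) h1)
    rwa [sub_sub_cancel] at this
  have h3 := Submodule.smul_mem _ (((k + 1 : ℕ) : ℂ)⁻¹) h2
  rwa [smul_smul, inv_mul_cancel₀ (by exact_mod_cast Nat.succ_ne_zero k), one_smul] at h3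

/-- A function whose derivatives along the surface `G = 0` lie in the ideal of the surface, and
which lies in the ideal modulo odd variables, lies in the ideal. -/
theorem mem_gIdeal_of_newD (hf : IsCoords (par q Ω) q (fun k => pd (crd q k)) f K')
    (hG : ∀ b, f (σ (.inr b)) = G b) {h : SmAlg q Ω} (hh : h ∈ gIdeal G ⊔ filt q Ω 1)
    (hF : ∀ b, newD (fun k => pd (crd q k)) K' (σ (.inl b)) h ∈ gIdeal G) : h ∈ gIdeal G := by
  have hd := partials_crd Ω
  have hGm : ∀ b, G b ∈ par q Ω (q (σ (.inr b))) := fun b => by rw [← hG]; exact hf.mem _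
  -- The F-derivatives preserve the ideal because they annihilate the G b, so the remainder
  -- satisfies the same hypothesis at each stage; beyond the number of odd generators it is zero.
  have key : ∀ k, h ∈ gIdeal G ⊔ filt q Ω (k + 1) := by
    intro k
    induction k with
    | zero => exact hh
    | succ k ih =>
      obtain ⟨i, hi, m, hm, rfl⟩ := Submodule.mem_sup.1 ih
      refine add_mem (Submodule.mem_sup_left hi) (descent_step (σ := σ) hf hG hm fun b => ?_)
      have h1 : newD (fun k => pd (crd q k)) K' (σ (.inl b)) i ∈ gIdeal G :=
        gIdeal_der superAlg hGm (hf.newD_der superAlg hd _) (fun a => by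
          rw [← hG, hf.newD_apply, if_neg (by simp)]; exact zero_mem _) hi
      have h2 := sub_mem (hF b) h1
      rwa [map_add, add_sub_cancel_left] at h2
  obtain ⟨i, hi, m, hm, hs⟩ := Submodule.mem_sup.1 (key (Fintype.card (OddIdx q)))
  rw [← hs, filt_card hm, add_zero]
  exact hi

end descent

end SmAlg

/-! ### Superdeterminants under ring homomorphisms -/

section sdet

lemma map_ring_inverse {R S : Type*} [Ring R] [Ring S] (φ : R →+* S) {x : R} (hx : IsUnit x) :
    φ (Ring.inverse x) = Ring.inverse (φ x) := by
  obtain ⟨u, rfl⟩ := hx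
  rw [Ring.inverse_unit, show φ u = (Units.map (φ : R →* S) u : Sˣ) from rfl, Ring.inverse_unit]
  rfl

open Classical in
-- Both unit hypotheses are there because `Ring.inverse` is compatible with homomorphisms on units
-- only.
lemma sdet_map {R S n : Type*} [Ring R] [Ring S] [Fintype n] (φ : R →+* S) (p : n → ZMod 2)
    {M : Matrix n n R}
    (hD : IsUnit (M.submatrix Subtype.val Subtype.val : Matrix (OddIdx p) (OddIdx p) R))
    (hn : IsUnit (ndet (M.submatrix Subtype.val Subtype.val : Matrix (OddIdx p) (OddIdx p) R))) :
    φ (sdet p M) = sdet p (M.map φ) := by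
  have h := map_ring_inverse φ.mapMatrix hD
  simp only [sdet]
  rw [map_mul, map_ring_inverse φ hn, ← ndet_map_ringHom, ← ndet_map_ringHom]
  congr 2
  refine (map_sub φ.mapMatrix _ _).trans (congrArg₂ (· - ·) rfl ?_)
  refine (Matrix.map_mul (f := φ)).trans (congrArg₂ (· * ·) ?_ rfl)
  exact (Matrix.map_mul (f := φ)).trans (congrArg₂ (· * ·) rfl h)

lemma isUnit_body_det {I n : Type*} {p : I → ZMod 2} [Fintype n] [DecidableEq n]
    {M : Matrix n n (Gr p)} (hM : IsUnit M) : (Matrix.of fun i j => body (M i j)).det ≠ 0 := by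
  have := hM.map (ExteriorAlgebra.algebraMapInv (R := ℂ)
    (M := OddIdx p → ℂ)).toRingHom.mapMatrix
  exact ((Matrix.isUnit_iff_isUnit_det _).1 this).ne_zero

end sdet

namespace SmAlg

variable {J : Type*} [Fintype J] {q : J → ZMod 2} {V : Type*} [NormedAddCommGroup V]
  [NormedSpace ℝ V] {Ω : Opens V} {n : Type*} [Fintype n] [DecidableEq n]

lemma map_ev {M : Matrix n n (SmAlg q Ω)} {z : V} (hz : z ∈ Ω) :
    M.map (ev z hz) = Matrix.of fun i j => (M i j).fn z := by
  ext1 i j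
  simp [ev_apply hz]

lemma fn_sdet {ε : n → ZMod 2} {M M' : Matrix n n (SmAlg q Ω)}
    (hM : SdetRegular (par q Ω) ε M M') {z : V} (hz : z ∈ Ω) :
    (sdet ε M).fn z = sdet ε (Matrix.of fun i j => (M i j).fn z) := by
  classical
  have h := hM.odd
  rw [← map_ev, ← ev_apply hz]
  refine sdet_map (ev z hz).toRingHom ε (by convert h) (isUnit_of_body fun w hw => ?_)
  rw [← bodyAt_apply hw]
  have h1 := ndet_map (RingHom.id ℂ) ((M.submatrix Subtype.val Subtype.val :
    Matrix (OddIdx ε) (OddIdx ε) (SmAlg q Ω)).map (bodyAt w hw))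
  have h2 := ndet_map_ringHom (bodyAt w hw).toRingHom (M.submatrix Subtype.val Subtype.val :
    Matrix (OddIdx ε) (OddIdx ε) (SmAlg q Ω))
  refine ne_of_eq_of_ne (h2.symm.trans h1) ?_
  rw [bodyAt_map_det hw]
  exact body_det_ne_zero (by convert h) hw

lemma isUnit_map_ev {M : Matrix n n (SmAlg q Ω)} (hM : IsUnit M) {z : V} (hz : z ∈ Ω) :
    IsUnit (Matrix.of fun i j => (M i j).fn z) := by
  rw [← map_ev hz]
  exact hM.map (ev z hz).toRingHom.mapMatrix

lemma vf_exp {K : Type*} [Fintype K] {τ : K → V ⊕ OddIdx q} (Q : K → SmAlg q Ω) {f : SmAlg q Ω}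
    (hf : f ∈ par q Ω 0) :
    vf (fun k => pd (τ k)) Q (exp f) = exp f * vf (fun k => pd (τ k)) Q f := by
  simp only [vf_apply, pd_exp hf, Finset.mul_sum, mul_assoc]

end SmAlg

/-! ### The radicand times exp 2𝓗 as a smooth superfunction -/

section radicand

variable {ι κ₀ κ₁ : Type*} [Fintype ι] [Fintype κ₀] [Fintype κ₁] [DecidableEq ι]
  [DecidableEq κ₀] [DecidableEq κ₁] {p : ι → ZMod 2} {ε₀ : κ₀ → ZMod 2} {ε₁ : κ₁ → ZMod 2}
  {U₀ : Opens (Body p)} {Ω : Opens (Body (extParity p ε₁))}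
  {W : Opens (ℝ × Body (fullParity p ε₀ ε₁))}
  {hA : ∀ u ∈ Ω, projExt p ε₁ u + 0 ∈ U₀}
  {hB : ∀ z ∈ W, (projFull p ε₀ ε₁).comp (ContinuousLinearMap.snd ℝ ℝ _) z + 0 ∈ U₀}
  {hS : ∀ u ∈ Ω, (ContinuousLinearMap.inr ℝ ℝ _).comp (sliceL p ε₀ ε₁) u + 0 ∈ W}
  {X : ℝ → SFun (fullParity p ε₀ ε₁)}
  {hX : SmoothOn (fun z : ℝ × Body (fullParity p ε₀ ε₁) => X z.1 z.2) W}
  {E : ι → ι → SFun p} {ρ : SFun p} {ρ' : SmAlg p U₀}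
  {F : κ₀ → SFun (extParity p ε₁)} {σ : κ₀ ⊕ κ₀ ≃ ExtVar ι κ₁}

/-- The new coordinates as elements of the algebra of superfunctions. -/
def coordsAlg (hs : ∀ a, SmoothOn (newCoords p ε₀ ε₁ X F a) Ω) (σ : κ₀ ⊕ κ₀ ≃ ExtVar ι κ₁)
    (i : ExtVar ι κ₁) : SmAlg (extParity p ε₁) Ω := SmAlg.mk _ (hs (σ.symm i))

variable (hs : ∀ a, SmoothOn (newCoords p ε₀ ε₁ X F a) Ω)

lemma fn_coordsAlg (i : ExtVar ι κ₁) {u : Body (extParity p ε₁)} (hu : u ∈ Ω) :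
    (coordsAlg hs σ i).fn u = newCoords p ε₀ ε₁ X F (σ.symm i) u := SmAlg.fn_mk _ hu

lemma fn_jacobian (i j : ExtVar ι κ₁) {u : Body (extParity p ε₁)} (hu : u ∈ Ω) :
    (SmAlg.pd (crd (extParity p ε₁) j) (coordsAlg hs σ i)).fn u =
      jacobian σ (newCoords p ε₀ ε₁ X F) u i j := by
  rw [SmAlg.fn_pd_crd _ _ hu]
  exact SmAlg.rD_congr (SmAlg.fn_mk_nhds _ hu) j

/-- Where the brackets and the ghost matrix are invertible, the radicand times `exp 2𝓗` is an
invertible superfunction whose derivatives along the constraint surface vanish there. -/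
theorem exists_radicand (hE : IsAntisymplectic E U₀) (hρ : IsDensity ρ U₀)
    (h : IsFullTheory (SmAlg.par (extParity p ε₁) Ω) (SmAlg.par (fullParity p ε₀ ε₁) W) p ε₀ ε₁
      (fun k => SmAlg.pd (crd _ k)) (hbarD W) (hbarX W) (toSlice hS)
      (extMat fun a b => toA hA (smMat hE a b)) (extMat fun a b => toB hB (smMat hE a b))
      (toB hB (SmAlg.mk ρ hρ.smooth)) (toB hB ρ') (smAction hX))
    (hρρ : SmAlg.mk ρ hρ.smooth * ρ' = 1) (hXe : ∀ z ∈ W, HasParity 0 (X z.1 z.2))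
    (hσF : ∀ α, extParity p ε₁ (σ (.inl α)) = ε₀ α + 1)
    (hσG : ∀ α, extParity p ε₁ (σ (.inr α)) = ε₀ α)
    (hpar : ∀ a, ∀ u ∈ Ω, HasParity (extParity p ε₁ (σ a)) (newCoords p ε₀ ε₁ X F a u))
    (hJ : ∀ u ∈ Ω, (Matrix.of fun i j => body (jacobian σ (newCoords p ε₀ ε₁ X F) u i j)).det ≠ 0)
    (hBr : ∀ u ∈ Ω, (Matrix.of fun i j => body (bracketMatrix p ε₀ ε₁ E X F u i j)).det ≠ 0)
    (hΔ : ∀ u ∈ Ω, (Matrix.of fun i j => body (fpMatrix p ε₀ ε₁ X u i j)).det ≠ 0) :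
    (∀ u ∈ Ω, IsUnit (bracketMatrix p ε₀ ε₁ E X F u) ∧ IsUnit (fpMatrix p ε₀ ε₁ X u)) ∧
    ∃ K' R, IsCoords (SmAlg.par (extParity p ε₁) Ω) (extParity p ε₁)
        (fun k => SmAlg.pd (crd _ k)) (coordsAlg hs σ) K' ∧
      (R ∈ SmAlg.par (extParity p ε₁) Ω 0 ∧ IsUnit R) ∧
      (∀ u ∈ Ω, R.fn u = radicand p ε₀ ε₁ E ρ X F σ u * sexp ((2 : ℂ) • oneLoop p ε₀ ε₁ X u)) ∧
      ∀ b, newD (fun k => SmAlg.pd (crd (extParity p ε₁) k)) K' (σ (.inl b)) R ∈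
        gIdeal (cG (hbarD W) (toSlice hS) (smAction hX)) := by
  set f := coordsAlg hs σ with hf
  set dA : ExtVar ι κ₁ → SmAlg (extParity p ε₁) Ω →ₗ[ℂ] SmAlg (extParity p ε₁) Ω :=
    fun k => SmAlg.pd (crd _ k) with hdA
  set EA : ExtVar ι κ₁ → ExtVar ι κ₁ → SmAlg (extParity p ε₁) Ω :=
    extMat fun a b => toA hA (smMat hE a b) with hEA
  set G := cG (hbarD W) (toSlice hS) (smAction hX) with hG
  have hP : IsSuperAlg (SmAlg.par (extParity p ε₁) Ω) := SmAlg.superAlg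
  have hfm : ∀ i, f i ∈ SmAlg.par (extParity p ε₁) Ω (extParity p ε₁ i) := fun i u hu => by
    rw [hf, fn_coordsAlg hs i hu]
    have := hpar (σ.symm i) u hu
    rwa [σ.apply_symm_apply] at this
  have hfG : ∀ b, f (σ (.inr b)) = G b := fun b => SmAlg.ext fun u hu => by
    rw [hf, fn_coordsAlg hs _ hu, σ.symm_apply_apply, fn_cG b hu]
    rfl
  obtain ⟨K', hK⟩ := SmAlg.sdetRegular (M := Matrix.of fun i j => dA j (f i))
    (ε := extParity p ε₁) (fun i j => by simpa using ((SmAlg.partials_crd Ω).der j).mem (hfm i))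
    fun u hu => by
      simp only [Matrix.of_apply, hdA, hf, fn_jacobian hs _ _ hu]
      exact hJ u hu
  have hc : IsCoords (SmAlg.par (extParity p ε₁) Ω) (extParity p ε₁) dA f K' :=
    ⟨hfm, hK.mul_inv, hK.inv_mul⟩
  have hbr : ∀ b c, ∀ u ∈ Ω, (hamG (extParity p ε₁) dA EA ε₀ G c (f (σ (.inl b)))).fn u =
      bracketMatrix p ε₀ ε₁ E X F u b c := fun b c u hu => by
    refine fn_bracket (hA := hA) hE (h.cG_mem c) (fun v hv => ?_) (fun v hv => fn_cG c hv) hu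
    rw [hf, fn_coordsAlg hs _ hv, σ.symm_apply_apply]
    rfl
  obtain ⟨B', hB'⟩ := SmAlg.sdetRegular
    (M := Matrix.of fun b c => hamG (extParity p ε₁) dA EA ε₀ G c (f (σ (.inl b))))
    (ε := ε₀) (fun b c => by
      have h1 := (hamG_der (ε := ε₀) hP h.partA h.poisson h.cG_mem c).mem (hfm (σ (.inl b)))
      refine mem_parity_congr h1 ?_
      rw [hσF]
      generalize ε₀ b = x
      generalize ε₀ c = y
      revert x y
      decide)
    fun u hu => by
      simp only [Matrix.of_apply, hbr _ _ u hu]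
      exact hBr u hu
  obtain ⟨Δ', hΔ'⟩ := SmAlg.sdetRegular (M := cΔ ε₁ (hbarD W) (toSlice hS) (smAction hX))
    (ε := ε₁) h.cΔ_sm fun u hu => by
      simp only [fn_cΔ (hS := hS) (hX := hX) hXe _ _ hu]
      exact hΔ u hu
  have hBof : ∀ u ∈ Ω, (Matrix.of fun b c => ((Matrix.of fun b c =>
      hamG (extParity p ε₁) dA EA ε₀ G c (f (σ (.inl b)))) b c).fn u) =
      bracketMatrix p ε₀ ε₁ E X F u := fun u hu => by
    ext1 b c
    exact hbr b c u hu
  have hΔof : ∀ u ∈ Ω, (Matrix.of fun b c =>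
      (cΔ ε₁ (hbarD W) (toSlice hS) (smAction hX) b c).fn u) = fpMatrix p ε₀ ε₁ X u :=
    fun u hu => by
    ext1 b c
    exact fn_cΔ hXe b c hu
  have hJof : ∀ u ∈ Ω, (Matrix.of fun i j => ((Matrix.of fun i j => dA j (f i)) i j).fn u) =
      jacobian σ (newCoords p ε₀ ε₁ X F) u := fun u hu => by
    ext1 i j
    exact fn_jacobian hs i j hu
  have hsρ : toSlice hS (toB hB (SmAlg.mk ρ hρ.smooth)) * toSlice hS (toB hB ρ') = 1 := by
    rw [← map_mul, ← map_mul, hρρ, map_one, map_one]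
  have hH : (2 : ℂ) • ((1 / Complex.I) • toSlice hS (hbarD W none (smAction hX))) ∈
      SmAlg.par (extParity p ε₁) Ω 0 := by
    refine Submodule.smul_mem _ _ (Submodule.smul_mem _ _ (h.s_mem ?_))
    exact mem_parity_congr ((h.partB.der none).mem h.X_mem) (zero_add _)
  -- The zero derivation is used only to obtain evenness and invertibility of the products from the
  -- rules for `HasLogDer`.
  have hD0 : IsRDer (SmAlg.par (extParity p ε₁) Ω) 0
      (0 : SmAlg (extParity p ε₁) Ω →ₗ[ℂ] SmAlg (extParity p ε₁) Ω) :=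
    ⟨fun _ => zero_mem _, fun _ _ => by simp⟩
  have lC := ((HasLogDer.mk (D := 0) (l := 0)
    ⟨⟨_, _, hsρ, (hP.even_comm (h.s_mem h.ρ'_mem) _).trans hsρ⟩, rfl⟩
    (h.s_mem h.ρ_mem) (by simp)).mul hP hD0
    ((hΔ'.hasLogDer hP hD0).mul hP hD0 (hΔ'.hasLogDer hP hD0)))
  rw [← pow_two] at lC
  have lR := (((hK.hasLogDer hP hD0).mul hP hD0 (hB'.hasLogDer hP hD0)).mul hP hD0
    (lC.inverse hP hD0)).mul hP hD0
    (HasLogDer.mk (D := 0) (l := 0) (SmAlg.isUnit_exp _) (SmAlg.exp_mem hH) (by simp))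
  refine ⟨fun u hu => ⟨?_, ?_⟩, K', _, hc, ?_, ?_, fun b => h.radicand_newD hc (fun _ => rfl) hfG
    hB'.mul_inv hΔ'.mul_inv (h.radicand_hamG (e := SmAlg.exp ((2 : ℂ) •
      ((1 / Complex.I) • toSlice hS (hbarD W none (smAction hX))))) hc hσF hσG (fun _ => rfl) hfG
      hK hB' hΔ' ?_ ?_ (SmAlg.isUnit_exp _) fun a => ?_) b⟩
  · rw [← hBof u hu]
    exact SmAlg.isUnit_map_ev ⟨⟨_, _, hB'.mul_inv, hB'.inv_mul⟩, rfl⟩ hu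
  · rw [← hΔof u hu]
    exact SmAlg.isUnit_map_ev ⟨⟨_, _, hΔ'.mul_inv, hΔ'.inv_mul⟩, rfl⟩ hu
  · exact ⟨lR.even, lR.unit⟩
  · intro u hu
    rw [SmAlg.fn_mul hu, SmAlg.fn_mul hu, SmAlg.fn_mul hu, SmAlg.fn_exp _ hu, SmAlg.fn_smul hu,
      fn_oneLoop hu, SmAlg.fn_sdet hK hu, SmAlg.fn_sdet hB' hu, hJof u hu, hBof u hu,
      ← SmAlg.ev_apply hu (Ring.inverse _)]
    refine congrArg₂ (· * ·) (congrArg₂ (· * ·) rfl ?_) rfl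
    refine (map_ring_inverse (SmAlg.ev u hu).toRingHom lC.unit).trans (congrArg Ring.inverse ?_)
    refine (SmAlg.ev_apply hu _).trans ?_
    rw [SmAlg.fn_mul hu, SmAlg.fn_pow hu, SmAlg.fn_sdet hΔ' hu, hΔof u hu]
    refine congrArg₂ (· * ·) ?_ rfl
    exact (congrArg (fun a : SmAlg (extParity p ε₁) Ω => a.fn u) (toSlice_toB (hA := hA) _)).trans (fn_toA _ hu)
  · exact hsρ
  · exact SmAlg.exp_mem hH
  · rw [hamG, SmAlg.vf_exp _ hH, map_smul]

end radicand

/-! ### From derivatives in the ideal to a logarithm near the surface -/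

namespace SmAlg

variable {J : Type*} [Fintype J] [DecidableEq J] {q : J → ZMod 2} {Ω : Opens (Body q)}

open Classical in
/-- The components of a constant even vector field. -/
def constVec (Ω : Opens (Body q)) (v : Body q) (j : J) : SmAlg q Ω :=
  if h : q j = 0 then algebraMap ℂ _ ((v ⟨j, h⟩ : ℝ) : ℂ) else 0

/-- Expresses directional derivatives of bodies through vector fields, so that the chain rule in
supercoordinates becomes available for them. -/
lemma bodyAt_vf_constVec (v : Body q) (f : SmAlg q Ω) {u : Body q} (hu : u ∈ Ω) :
    bodyAt u hu (vf (fun k => pd (crd q k)) (constVec Ω v) f) =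
      fderiv ℝ (fun w => body (f.fn w)) u v := by
  have hv : v = ∑ j : EvenIdx q, v j • Pi.single j (1 : ℝ) := by
    ext i
    simp [Finset.sum_apply, Pi.single_apply]
  conv_rhs => rw [hv, map_sum]
  rw [vf_apply, map_sum]
  refine (Fintype.sum_of_injective (Subtype.val : EvenIdx q → J) Subtype.val_injective _ _
    (fun j hj => ?_) fun j => ?_).symm
  · have : ¬ q j = 0 := fun h => hj ⟨⟨j, h⟩, rfl⟩
    rw [constVec, dif_neg this, mul_zero, map_zero]
  · rw [map_smul, map_mul, constVec, dif_pos j.2, AlgHom.commutes, bodyAt_apply, fn_pd_crd _ _ hu,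
      rD, dif_pos j.2, body_eq]
    have := gderiv_dual (f.gdiffAt hu) (Pi.single j 1)
      (ExteriorAlgebra.algebraMapInv (R := ℂ) (M := OddIdx q → ℂ)).toLinearMap
    rw [AlgHom.toLinearMap_apply] at this
    refine (Complex.real_smul (x := v j)).trans ((mul_comm _ _).trans ?_)
    refine congrArg₂ (· * ·) ?_ rfl
    exact this.symm.trans (congrArg (fun w => ExteriorAlgebra.algebraMapInv (gderiv f.fn u w)) (by congr!))

variable {κ : Type*} [Fintype κ] [DecidableEq κ] {f : J → SmAlg q Ω} {K' : Matrix J J (SmAlg q Ω)}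
  {σ : κ ⊕ κ ≃ J} {G : κ → SmAlg q Ω}

lemma bodyAt_gIdeal {x : SmAlg q Ω} (hx : x ∈ gIdeal G) {u : Body q} (hu : u ∈ Ω)
    (h0 : ∀ b, body ((G b).fn u) = 0) : bodyAt u hu x = 0 := by
  obtain ⟨k, rfl⟩ := hx
  rw [map_sum]
  exact Finset.sum_eq_zero fun b _ => by rw [map_mul, bodyAt_apply, h0, zero_mul]

/-- On shell, a function with derivatives in the ideal is stationary along the surface. -/
lemma fderiv_body_eq_zero (hf : IsCoords (par q Ω) q (fun k => pd (crd q k)) f K')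
    (hG : ∀ b, f (σ (.inr b)) = G b) {R : SmAlg q Ω}
    (hR : ∀ b, newD (fun k => pd (crd q k)) K' (σ (.inl b)) R ∈ gIdeal G) {u v : Body q}
    (hu : u ∈ Ω) (h0 : ∀ b, body ((G b).fn u) = 0)
    (hv : ∀ b, fderiv ℝ (fun w => body ((G b).fn w)) u v = 0) :
    fderiv ℝ (fun w => body (R.fn w)) u v = 0 := by
  rw [← bodyAt_vf_constVec v R hu, hf.vf_expand, map_sum, ← σ.sum_comp, Fintype.sum_sum_type]
  simp only [map_mul, hG, bodyAt_vf_constVec, hv, mul_zero, Finset.sum_const_zero, add_zero]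
  exact Finset.sum_eq_zero fun b _ => by rw [bodyAt_gIdeal (hR b) hu h0, zero_mul]

/-- The inverse Jacobian recovers a vector field from its action on the new coordinates; taking
bodies, v is recovered from the derivatives of their bodies. -/
lemma eq_zero_of_fderiv_coords (hf : IsCoords (par q Ω) q (fun k => pd (crd q k)) f K')
    {u v : Body q} (hu : u ∈ Ω) (hv : ∀ i, fderiv ℝ (fun w => body ((f i).fn w)) u v = 0) :
    v = 0 := by
  have h1 : constVec Ω v = K'.mulVec fun i => vf (fun k => pd (crd q k)) (constVec Ω v) (f i) := by
    have : (fun i => vf (fun k => pd (crd q k)) (constVec Ω v) (f i)) =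
        (Matrix.of fun i j => pd (crd q j) (f i)).mulVec (constVec Ω v) := by
      ext1 i
      rw [vf_apply]
      rfl
    rw [this, Matrix.mulVec_mulVec, hf.inv_mul, Matrix.one_mulVec]
  ext i
  have h2 := congrArg (bodyAt u hu) (congrFun h1 i.1)
  rw [Matrix.mulVec, dotProduct, map_sum, constVec, dif_pos i.2, AlgHom.commutes] at h2
  simp only [map_mul, bodyAt_vf_constVec, hv, mul_zero, Finset.sum_const_zero] at h2
  exact Complex.ofReal_eq_zero.1 h2

/-- A nowhere vanishing body with derivatives in the ideal has, near the surface, a logarithm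
which is locally constant modulo the coordinates vanishing on the surface. -/
theorem exists_log_near_surface (hf : IsCoords (par q Ω) q (fun k => pd (crd q k)) f K')
    (hG : ∀ b, f (σ (.inr b)) = G b) (hre : ∀ i, ∀ u ∈ Ω, (body ((f i).fn u)).im = 0)
    (hinj : Set.InjOn (fun u i => body ((f i).fn u)) Ω) {R : SmAlg q Ω}
    (hR0 : ∀ u ∈ Ω, body (R.fn u) ≠ 0)
    (hR : ∀ b, newD (fun k => pd (crd q k)) K' (σ (.inl b)) R ∈ gIdeal G)
    {g : EvenIdx q → Prop} [DecidablePred g] (hg : ∀ i, g i ↔ ∃ b, σ (.inr b) = i.1)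
    {S : Set (Body q)} (hS : S ⊆ Ω) (hSG : ∀ s ∈ S, ∀ b, body ((G b).fn s) = 0) :
    ∃ (V : Opens (Body q)) (c l : Body q → ℂ) (k : EvenIdx q → Body q → ℂ), S ⊆ V ∧ V ≤ Ω ∧
      (∀ u ∈ V, ∀ᶠ v in 𝓝 u, c v = c u) ∧ (IsPreconnected S → ∃ c₀, ∀ u ∈ V, c u = c₀) ∧
      ContDiffOn ℝ ∞ c V ∧ ContDiffOn ℝ ∞ l V ∧ (∀ i, ContDiffOn ℝ ∞ (k i) V) ∧
      (∀ u ∈ V, Complex.exp (l u) = body (R.fn u)) ∧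
      ∀ u ∈ V, l u - c u = ∑ i, if g i then body ((f i.1).fn u) * k i u else 0 := by
  set y : Body q → Body q := fun u i => (body ((f i.1).fn u)).re with hy
  have hys : ContDiffOn ℝ ∞ y Ω := contDiffOn_pi.2 fun i =>
    Complex.reCLM.contDiff.comp_contDiffOn (f i.1).smooth_body
  have hyc : ∀ u ∈ Ω, ∀ i, (y u i : ℂ) = body ((f i.1).fn u) := fun u hu i =>
    Complex.ext (by simp [hy]) (by simp [hre i.1 u hu])
  have hodd : ∀ i : J, ¬ q i = 0 → ∀ u ∈ Ω, body ((f i).fn u) = 0 := fun i hi u hu =>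
    body_odd (hf.mem i u hu) hi
  have hdy : ∀ u ∈ Ω, ∀ v i, ((fderiv ℝ y u v i : ℝ) : ℂ) =
      fderiv ℝ (fun w => body ((f i.1).fn w)) u v := by
    intro u hu v i
    have hd : DifferentiableAt ℝ y u :=
      (hys.contDiffAt (Ω.isOpen.mem_nhds hu)).differentiableAt (by simp)
    have h1 : (fun w => body ((f i.1).fn w)) =ᶠ[𝓝 u]
        (Complex.ofRealCLM.comp (ContinuousLinearMap.proj i)) ∘ y := by
      filter_upwards [Ω.isOpen.mem_nhds hu] with w hw
      exact (hyc w hw i).symm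
    rw [h1.fderiv_eq, ((ContinuousLinearMap.hasFDerivAt _).comp u hd.hasFDerivAt).fderiv]
    rfl
  have hfd : ∀ u ∈ Ω, ∀ i : J, ¬ q i = 0 → ∀ v,
      fderiv ℝ (fun w => body ((f i).fn w)) u v = 0 := by
    intro u hu i hi v
    have h1 : (fun w => body ((f i).fn w)) =ᶠ[𝓝 u] fun _ => 0 := by
      filter_upwards [Ω.isOpen.mem_nhds hu] with w hw
      exact hodd i hi w hw
    rw [h1.fderiv_eq]
    simp
  have hkill : ∀ w : Body q, killL g w = w ↔ ∀ i, g i → w i = 0 := fun w => by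
    rw [funext_iff]
    refine forall_congr' fun i => ?_
    rw [killL_apply]
    split <;> simp_all [eq_comm]
  have hGy : ∀ u ∈ Ω, killL g (y u) = y u → ∀ b, body ((G b).fn u) = 0 := by
    intro u hu h b
    rw [← hG]
    by_cases hb : q (σ (.inr b)) = 0
    · rw [← hyc u hu ⟨_, hb⟩, (hkill _).1 h ⟨_, hb⟩ ((hg _).2 ⟨b, rfl⟩), Complex.ofReal_zero]
    · exact hodd _ hb u hu
  have hyi : Set.InjOn y Ω := fun u hu w hw h => hinj hu hw (funext fun i => by
    show body ((f i).fn u) = body ((f i).fn w)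
    by_cases hi : q i = 0
    · rw [← hyc u hu ⟨i, hi⟩, ← hyc w hw ⟨i, hi⟩, h]
    · rw [hodd i hi u hu, hodd i hi w hw])
  -- The odd coordinates have zero body and contribute no derivative, so the even ones alone give an
  -- injective, hence bijective, endomorphism.
  have hye : ∀ u ∈ Ω, ∃ e : Body q ≃L[ℝ] Body q, (e : Body q →L[ℝ] Body q) = fderiv ℝ y u := by
    intro u hu
    have hi : Function.Injective (fderiv ℝ y u) := by
      rw [injective_iff_map_eq_zero]
      intro v hv
      refine eq_zero_of_fderiv_coords hf hu fun i => ?_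
      by_cases hi : q i = 0
      · rw [← hdy u hu v ⟨i, hi⟩, hv]
        simp
      · exact hfd u hu i hi v
    refine ⟨(LinearEquiv.ofInjectiveEndo (fderiv ℝ y u).toLinearMap hi).toContinuousLinearEquiv, ?_⟩
    ext v : 1
    rfl
  have hyS : ∀ s ∈ S, killL g (y s) = y s := by
    intro s hs
    rw [hkill]
    intro i hi
    obtain ⟨b, hb⟩ := (hg i).1 hi
    have h1 := hSG s hs b
    rw [← hG, hb] at h1
    simp [hy, h1]
  have hRS : ∀ u ∈ Ω, killL g (y u) = y u → ∀ v, killL g (fderiv ℝ y u v) = fderiv ℝ y u v →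
      fderiv ℝ (fun w => body (R.fn w)) u v = 0 := by
    intro u hu h v hv
    refine fderiv_body_eq_zero hf hG hR hu (hGy u hu h) fun b => ?_
    rw [← hG]
    by_cases hb : q (σ (.inr b)) = 0
    · rw [← hdy u hu v ⟨_, hb⟩, (hkill _).1 hv ⟨_, hb⟩ ((hg _).2 ⟨b, rfl⟩), Complex.ofReal_zero]
    · exact hfd u hu _ hb v
  obtain ⟨V, r, hVo, hSV, hVΩ, hr, hloc, hcon, hlt, hhad⟩ :=
    exists_neighbourhood (g := g) Ω.isOpen hys hyi hye hS hyS R.smooth_body hR0 hRS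
  have hc0 : ∀ u ∈ V, body (R.fn (r u)) ≠ 0 := fun u hu => hR0 _ (hVΩ (hr u hu).1)
  have hdiv : ∀ u ∈ V, body (R.fn u) / body (R.fn (r u)) ∈ Complex.slitPlane := by
    intro u hu
    have h1 : body (R.fn u) / body (R.fn (r u)) =
        1 + (body (R.fn u) - body (R.fn (r u))) / body (R.fn (r u)) := by
      have := hc0 u hu
      field_simp
      ring
    rw [h1]
    refine Complex.mem_slitPlane_of_norm_lt_one ?_
    rw [norm_div, div_lt_one (norm_pos_iff.2 (hc0 u hu))]
    exact hlt u hu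
  have hlc : ∀ {φ : ℂ → ℂ}, ContDiffOn ℝ ∞ (fun u => φ (body (R.fn (r u)))) V := fun {φ} u hu =>
    (contDiffAt_const (c := φ (body (R.fn (r u))))).congr_of_eventuallyEq
      ((hloc u hu).mono fun v hv => by simp only [hv]) |>.contDiffWithinAt
  have hls : ContDiffOn ℝ ∞ (fun u => Complex.log (body (R.fn u) / body (R.fn (r u)))) V :=
    fun u hu => by
    have h1 : ContDiffOn ℝ ∞ (fun u => body (R.fn u) / body (R.fn (r u))) V := by
      simp only [div_eq_mul_inv]
      exact (R.smooth_body.mono hVΩ).mul (hlc (φ := fun x => x⁻¹))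
    exact (((Complex.contDiffAt_log (n := ∞) (hdiv u hu)).restrict_scalars ℝ).comp u
      (h1.contDiffAt (hVo.mem_nhds hu))).contDiffWithinAt
  -- The quotient stays in the slit plane, and R ∘ r is locally constant, so this logarithm is
  -- smooth whichever values R takes on the surface. At r u the first summand is log 1 = 0, hence
  -- Hadamard's lemma yields l - c.
  obtain ⟨k, hk, hsum⟩ := hhad (fun u => Complex.log (body (R.fn u) / body (R.fn (r u))) +
    Complex.log (body (R.fn (r u)))) (hls.add (hlc (φ := Complex.log)))
  refine ⟨⟨V, hVo⟩, fun u => Complex.log (body (R.fn (r u))), _, k, hSV, hVΩ,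
    fun u hu => (hloc u hu).mono fun v hv => by simp only [hv], fun h => ?_, hlc (φ := Complex.log),
    hls.add (hlc (φ := Complex.log)), hk, fun u hu => ?_, fun u hu => ?_⟩
  · obtain ⟨c₀, h⟩ := hcon h
    exact ⟨Complex.log c₀, fun u hu => congrArg _ (h u hu)⟩
  · rw [Complex.exp_add, Complex.exp_log (Complex.slitPlane_ne_zero (hdiv u hu)),
      Complex.exp_log (hc0 u hu), div_mul_cancel₀ _ (hc0 u hu)]
  · have h1 := hsum u hu
    simp only [(hr u hu).2, div_self (hc0 u hu), Complex.log_one, zero_add] at h1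
    rw [h1]
    refine Finset.sum_congr rfl fun i _ => ?_
    rw [hyc u (hVΩ hu)]

/-- Assembling a logarithm that is locally constant modulo the ideal of the surface. -/
theorem exists_log_sub_mem (hf : IsCoords (par q Ω) q (fun k => pd (crd q k)) f K')
    (hG : ∀ b, f (σ (.inr b)) = G b) {R : SmAlg q Ω} (hRm : R ∈ par q Ω 0)
    (hR : ∀ b, newD (fun k => pd (crd q k)) K' (σ (.inl b)) R ∈ gIdeal G)
    {g : EvenIdx q → Prop} [DecidablePred g] (hg : ∀ i, g i ↔ ∃ b, σ (.inr b) = i.1)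
    {c l : Body q → ℂ} {k : EvenIdx q → Body q → ℂ} (hc : ContDiffOn ℝ ∞ c Ω)
    (hl : ContDiffOn ℝ ∞ l Ω) (hk : ∀ i, ContDiffOn ℝ ∞ (k i) Ω)
    (hloc : ∀ u ∈ Ω, ∀ᶠ v in 𝓝 u, c v = c u)
    (hlR : ∀ u ∈ Ω, Complex.exp (l u) = body (R.fn u))
    (hlc : ∀ u ∈ Ω, l u - c u = ∑ i, if g i then body ((f i.1).fn u) * k i u else 0) :
    ∃ h ∈ par q Ω 0, exp h = R ∧ h - scal c hc ∈ gIdeal G := by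
  obtain ⟨h, hh, rfl, hb⟩ := exists_log hRm hl hlR
  refine ⟨h, hh, rfl, mem_gIdeal_of_newD (σ := σ) hf hG ?_ fun b => ?_⟩
  -- Lifting the body identity `hlc` to an element of the ideal shows membership up to terms of
  -- positive degree, the starting point of the descent.
  · set m : SmAlg q Ω := ∑ i, if g i then f i.1 * scal (k i) (hk i) else 0 with hm
    have h1 : m ∈ gIdeal G := Submodule.sum_mem _ fun i _ => by
      split
      · next hi =>
        obtain ⟨b, hb⟩ := (hg i).1 hi
        rw [← hb, hG]
        exact gIdeal_gen_mul b _
      · exact zero_mem _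
    rw [← add_sub_cancel m (h - scal c hc)]
    refine add_mem (Submodule.mem_sup_left h1) (Submodule.mem_sup_right (mem_filt_one.2 fun u hu => ?_))
    rw [fn_sub hu, fn_sub hu, body_sub, body_sub, fn_scal _ hu, body_algebraMap, hb u hu, hlc u hu,
      hm, fn_sum hu, body_sum, sub_eq_zero]
    refine Finset.sum_congr rfl fun i _ => ?_
    split
    · rw [fn_mul hu, body_mul, fn_scal _ hu, body_algebraMap]
    · rw [fn_zero hu]
      exact (map_zero _).symm
  · have hcz : ∀ w, pd w (scal c hc : SmAlg q Ω) = 0 := fun w => by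
      rcases w with w | w
      · refine ext fun u hu => (dirD_scal hc w hu).trans ?_
        rw [Filter.EventuallyEq.fderiv_eq (hloc u hu), fn_zero hu]
        simp
      · exact oddD_scal hc w
    have h1 : newD (fun k => pd (crd q k)) K' (σ (.inl b)) (scal c hc) = 0 := by
      rw [newD, vf_apply]
      exact Finset.sum_eq_zero fun j _ => by rw [hcz, zero_mul]
    -- The logarithmic derivative of R is e^{-h} ∂R and lies in the ideal with ∂R; the locally
    -- constant c contributes nothing.
    have h2 : newD (fun k => pd (crd q k)) K' (σ (.inl b)) h =
        exp (-h) * newD (fun k => pd (crd q k)) K' (σ (.inl b)) (exp h) := by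
      have h3 : exp (-h) * exp h = 1 := by
        rw [superAlg.even_comm (exp_mem (neg_mem hh)), exp_mul_exp_neg hh]
      rw [newD, vf_exp _ hh, ← mul_assoc, h3, one_mul]
    rw [map_sub, h1, sub_zero, h2]
    exact gIdeal_mul_left superAlg (fun b => by rw [← hG]; exact hf.mem _) (hR b) _

end SmAlg

/-! ### Conjugacy of 𝓕 and the constraints on the constraint surface -/

section regular

variable {ι κ₀ κ₁ : Type*} [Fintype ι] [Fintype κ₀] [Fintype κ₁] [DecidableEq ι]
  [DecidableEq κ₀] [DecidableEq κ₁] {p : ι → ZMod 2} {ε₀ : κ₀ → ZMod 2} {ε₁ : κ₁ → ZMod 2}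
  {U₀ : Opens (Body p)} {Ω : Opens (Body (extParity p ε₁))}
  {W : Opens (ℝ × Body (fullParity p ε₀ ε₁))}
  {hA : ∀ u ∈ Ω, projExt p ε₁ u + 0 ∈ U₀}
  {hS : ∀ u ∈ Ω, (ContinuousLinearMap.inr ℝ ℝ _).comp (sliceL p ε₀ ε₁) u + 0 ∈ W}
  {X : ℝ → SFun (fullParity p ε₀ ε₁)}
  {hX : SmoothOn (fun z : ℝ × Body (fullParity p ε₀ ε₁) => X z.1 z.2) W}
  {E : ι → ι → SFun p} {EB : ExtVar ι κ₁ → ExtVar ι κ₁ → SmAlg (fullParity p ε₀ ε₁) W}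
  {ρB ρB' : SmAlg (fullParity p ε₀ ε₁) W}
  {F : κ₀ → SFun (extParity p ε₁)} {σ : κ₀ ⊕ κ₀ ≃ ExtVar ι κ₁}

/-- On the constraint surface the functions `𝓕` are conjugate to the constraints. -/
lemma bracket_isUnit_of_onShell (hE : IsAntisymplectic E U₀)
    (h : IsFullTheory (SmAlg.par (extParity p ε₁) Ω) (SmAlg.par (fullParity p ε₀ ε₁) W) p ε₀ ε₁
      (fun k => SmAlg.pd (crd _ k)) (hbarD W) (hbarX W) (toSlice hS)
      (extMat fun a b => toA hA (smMat hE a b)) EB ρB ρB' (smAction hX))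
    {u : Body (extParity p ε₁)} (hEu : IsUnit (Matrix.of fun a b => E a b (bodyOfExt p ε₁ u)))
    {f : κ₀ ⊕ κ₀ → SmAlg (extParity p ε₁) Ω}
    (hf : ∀ a, f a ∈ SmAlg.par _ Ω (extParity p ε₁ (σ a)))
    (hf' : ∀ a, ∀ v ∈ Ω, (f a).fn v = newCoords p ε₀ ε₁ X F a v) (hu : u ∈ Ω)
    (hJ : IsUnit (jacobian σ (newCoords p ε₀ ε₁ X F) u))
    (h0 : ∀ α, body (constraintG p ε₀ ε₁ X α u) = 0)
    (h1 : ∀ α, body (constraintG₁ p ε₀ ε₁ X α u) = 0) :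
    IsUnit (Matrix.of fun a b => body (bracketMatrix p ε₀ ε₁ E X F u a b)) :=
  bracket_isUnit (f' := newCoords p ε₀ ε₁ X F) hEu hf hf' hu hJ
    (body_bracket_constraints hE h hu h0 h1)

end regular

end

/-! ### The theorem -/

open TopologicalSpace (Opens)

theorem mainTheorem3 {ι κ₀ κ₁ : Type*} [Fintype ι] [Fintype κ₀] [Fintype κ₁]
    [DecidableEq κ₀] [DecidableEq κ₁]
    (p : ι → ZMod 2) (ε₀ : κ₀ → ZMod 2) (ε₁ : κ₁ → ZMod 2)
    (U₀ : Set (Body p)) (hU₀ : IsOpen U₀)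
    (E : ι → ι → SFun p) (hE : IsAntisymplectic E U₀)
    (ρ : SFun p) (hρ : IsDensity ρ U₀)
    (U : Set (Body (extParity p ε₁))) (hU : IsOpen U) (hUU₀ : ∀ u ∈ U, bodyOfExt p ε₁ u ∈ U₀)
    (X : ℝ → SFun (fullParity p ε₀ ε₁)) (W : Set (ℝ × Body (fullParity p ε₀ ε₁)))
    (hX : IsGaugeFixingAction p ε₀ ε₁ E ρ X W U)
    (F : κ₀ → SFun (extParity p ε₁)) (σ : κ₀ ⊕ κ₀ ≃ ExtVar ι κ₁)
    (hσF : ∀ α, extParity p ε₁ (σ (Sum.inl α)) = ε₀ α + 1)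
    (hσG : ∀ α, extParity p ε₁ (σ (Sum.inr α)) = ε₀ α)
    (hF : IsCoordSystem σ (newCoords p ε₀ ε₁ X F) U) :
    ∃ V : Set (Body (extParity p ε₁)), IsOpen V ∧ V ⊆ U ∧ onShell p ε₀ ε₁ X U ⊆ V ∧
      (∀ u ∈ V, IsUnit (bracketMatrix p ε₀ ε₁ E X F u) ∧ IsUnit (fpMatrix p ε₀ ε₁ X u)) ∧
      ∃ (c : Body (extParity p ε₁) → ℂ) (ℓ : SFun (extParity p ε₁))
        (K : κ₀ → SFun (extParity p ε₁)),
        (∀ u ∈ V, ∀ᶠ v in 𝓝 u, c v = c u) ∧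
        (IsPreconnected (onShell p ε₀ ε₁ X U) → ∃ c₀ : ℂ, ∀ u ∈ V, c u = c₀) ∧
        SmoothOn ℓ V ∧ (∀ u ∈ V, HasParity 0 (ℓ u)) ∧ (∀ α, SmoothOn (K α) V) ∧
        (∀ u ∈ V, sexp ((2 : ℂ) • ℓ u) = radicand p ε₀ ε₁ E ρ X F σ u) ∧
        ∀ u ∈ V, oneLoop p ε₀ ε₁ X u =
          algebraMap ℂ (Gr (extParity p ε₁)) (c u) - ℓ u
            + ∑ α, constraintG p ε₀ ε₁ X α u * K α u := by
  classical
  let U₁ : Opens (Body p) := ⟨U₀, hU₀⟩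
  -- W is cut down to the points lying over U₀, where E and ρ are controlled; the slice over U stays
  -- inside.
  let W₁ : Opens (ℝ × Body (fullParity p ε₀ ε₁)) :=
    ⟨W ∩ (fun z => projFull p ε₀ ε₁ z.2) ⁻¹' U₀,
      hX.isOpen.inter (hU₀.preimage ((projFull p ε₀ ε₁).continuous.comp continuous_snd))⟩
  have hE₁ : IsAntisymplectic E U₁ := hE
  have hρ₁ : IsDensity ρ U₁ := hρ
  have hB : ∀ z ∈ W₁, (projFull p ε₀ ε₁).comp (ContinuousLinearMap.snd ℝ ℝ _) z + 0 ∈ U₁ :=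
    fun z hz => by rw [add_zero]; exact hz.2
  have hWW : (W₁ : Set (ℝ × Body (fullParity p ε₀ ε₁))) ⊆ W := Set.inter_subset_left
  have hXs : SmoothOn (fun z : ℝ × Body (fullParity p ε₀ ε₁) => X z.1 z.2) W₁ :=
    hX.smooth.mono hWW
  have hXe : ∀ z ∈ W₁, HasParity 0 (X z.1 z.2) := fun z hz => hX.even z (hWW hz)
  have hpl : PlanckNumberOne p ε₀ ε₁ X W₁ := fun z hz => hX.planck z (hWW hz)
  have hm : QuantumMasterEquation p ε₀ ε₁ E ρ X W₁ := fun z hz => hX.master z (hWW hz)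
  have hρe : SmAlg.mk ρ hρ₁.smooth ∈ SmAlg.par p U₁ 0 := fun y hy => by
    rw [SmAlg.fn_mk _ hy]; exact hρ.parity y hy
  obtain ⟨ρ', hρ', hρρ, hρρ'⟩ := SmAlg.superAlg.even_inv hρe (SmAlg.isUnit_of_body fun y hy => by
    rw [SmAlg.fn_mk _ hy]; exact hρ.ne_zero y hy)
  have hS : ∀ Ω : Opens (Body (extParity p ε₁)), (Ω : Set _) ⊆ U → ∀ u ∈ Ω,
      (ContinuousLinearMap.inr ℝ ℝ _).comp (sliceL p ε₀ ε₁) u + 0 ∈ W₁ := fun Ω hΩ u hu => by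
    rw [add_zero]
    refine ⟨hX.slice_mem u (hΩ hu), ?_⟩
    show projFull p ε₀ ε₁ (sliceL p ε₀ ε₁ u) ∈ U₀
    rw [projFull_slice]
    exact hUU₀ u (hΩ hu)
  have hA : ∀ Ω : Opens (Body (extParity p ε₁)), (Ω : Set _) ⊆ U → ∀ u ∈ Ω,
      projExt p ε₁ u + 0 ∈ U₁ := fun Ω hΩ u hu => by
    rw [add_zero]
    exact hUU₀ u (hΩ hu)
  have full := fun (Ω : Opens (Body (extParity p ε₁))) (hΩ : (Ω : Set _) ⊆ U) =>
    isFullTheory (hA := hA Ω hΩ) (hB := hB) (hS := hS Ω hΩ) (hX := hXs) hE₁ hρ₁ hXe hpl hm hρ'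
      hρρ' hρρ
  have hJ : ∀ u ∈ U,
      (Matrix.of fun i j => body (jacobian σ (newCoords p ε₀ ε₁ X F) u i j)).det ≠ 0 :=
    fun u hu => isUnit_body_det (by convert hF.jacobian_isUnit u hu)
  -- the open set where both matrices are invertible
  let Ω : Opens (Body (extParity p ε₁)) := ⟨U, hU⟩
  have hfull := full Ω subset_rfl
  have hcoord : ∀ a, ∀ v ∈ Ω, (coordsAlg (Ω := Ω) hF.smooth σ (σ a)).fn v =
      newCoords p ε₀ ε₁ X F a v := fun a v hv => by
    rw [fn_coordsAlg _ _ hv, σ.symm_apply_apply]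
  have hcoordm : ∀ a, coordsAlg (Ω := Ω) hF.smooth σ (σ a) ∈
      SmAlg.par (extParity p ε₁) Ω (extParity p ε₁ (σ a)) := fun a u hu => by
    rw [hcoord a u hu]; exact hF.parity a u hu
  have hfp : ContinuousOn (fun u => (Matrix.of fun i j => body (fpMatrix p ε₀ ε₁ X u i j)).det) U := by
    refine (Continuous.matrix_det continuous_id).comp_continuousOn
      (continuousOn_pi.2 fun i => continuousOn_pi.2 fun j => ?_)
    refine (SmAlg.smooth_body (Ω := Ω)
      (cΔ ε₁ (hbarD W₁) (toSlice (hS Ω subset_rfl)) (smAction hXs) i j)).continuousOn.congr fun u hu => ?_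
    exact congrArg body (fn_cΔ hXe i j hu).symm
  have hbr : ContinuousOn
      (fun u => (Matrix.of fun i j => body (bracketMatrix p ε₀ ε₁ E X F u i j)).det) U := by
    refine (Continuous.matrix_det continuous_id).comp_continuousOn
      (continuousOn_pi.2 fun i => continuousOn_pi.2 fun j => ?_)
    refine (SmAlg.smooth_body (Ω := Ω) (hamG (extParity p ε₁) (fun k => SmAlg.pd (crd _ k))
      (extMat fun a b => toA (hA Ω subset_rfl) (smMat hE₁ a b)) ε₀
      (cG (hbarD W₁) (toSlice (hS Ω subset_rfl)) (smAction hXs)) j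
      (coordsAlg (Ω := Ω) hF.smooth σ (σ (.inl i))))).continuousOn.congr fun u hu => ?_
    refine congrArg body ?_
    exact (fn_bracket (hA := hA Ω subset_rfl) hE₁ (hfull.cG_mem j) (hcoord (.inl i))
      (fun v hv => fn_cG j hv) hu).symm
  -- The open locus where the bodies of the bracket matrix and of the ghost matrix are invertible;
  -- `hon` shows that it contains the constraint surface.
  let V₁ : Opens (Body (extParity p ε₁)) :=
    ⟨{u ∈ U | (Matrix.of fun i j => body (bracketMatrix p ε₀ ε₁ E X F u i j)).det ≠ 0 ∧
      (Matrix.of fun i j => body (fpMatrix p ε₀ ε₁ X u i j)).det ≠ 0}, by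
      have h1 := hbr.isOpen_inter_preimage hU isOpen_compl_singleton (t := {0}ᶜ)
      have h2 := hfp.isOpen_inter_preimage hU isOpen_compl_singleton (t := {0}ᶜ)
      convert h1.inter h2 using 1
      ext u
      simp only [Set.mem_ofPred_eq, Set.mem_inter_iff, Set.mem_preimage, Set.mem_compl_iff,
        Set.mem_singleton_iff]
      tauto⟩
  have hV₁U : (V₁ : Set (Body (extParity p ε₁))) ⊆ U := fun u hu => hu.1
  have hcard : Fintype.card (ExtVar ι κ₁) = 2 * Fintype.card κ₀ := by
    rw [← Fintype.card_congr σ, Fintype.card_sum, two_mul]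
  have hon : onShell p ε₀ ε₁ X U ⊆ V₁ := fun u hu => by
    refine ⟨hu.1, isUnit_iff_ne_zero.1 ((Matrix.isUnit_iff_isUnit_det _).1 ?_),
      isUnit_iff_ne_zero.1 ((Matrix.isUnit_iff_isUnit_det _).1 ?_)⟩
    · refine bracket_isUnit_of_onShell (σ := σ) (hA := hA Ω subset_rfl) hE₁ hfull ?_ hcoordm hcoord
        hu.1 ?_ hu.2.1 hu.2.2
      · convert hE.nondegenerate _ (hUU₀ u hu.1)
      · convert hF.jacobian_isUnit u hu.1
    · exact ghost_isUnit hfull hXe hcard hu.1 (hX.rank u hu.1) hu.2.1 hu.2.2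
  -- Used twice: on V₁ to find the final neighbourhood V, and on V itself, because membership in the
  -- ideal needs coefficients smooth on V.
  have main := fun (V : Opens (Body (extParity p ε₁))) (hV : V ≤ V₁) =>
    exists_radicand (σ := σ) (F := F) (Ω := V)
      (fun a => (hF.smooth a).mono fun u hu => hV₁U (hV hu)) hE₁ hρ₁
      (full V fun u hu => hV₁U (hV hu)) hρρ hXe hσF hσG
      (fun a u hu => hF.parity a u (hV₁U (hV hu)))
      (fun u hu => hJ u (hV₁U (hV hu))) (fun u hu => (show u ∈ V₁ from hV hu).2.1) fun u hu =>
        (show u ∈ V₁ from hV hu).2.2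
  have hcG : ∀ (V : Opens (Body (extParity p ε₁))) (hV : (V : Set _) ⊆ U) b,
      coordsAlg (Ω := V) (fun a => (hF.smooth a).mono hV) σ (σ (.inr b)) =
        cG (hbarD W₁) (toSlice (hS V hV)) (smAction hXs) b :=
    fun V hV b => SmAlg.ext fun u hu => by
      rw [fn_coordsAlg _ _ hu, σ.symm_apply_apply, fn_cG b hu]
      rfl
  obtain ⟨-, K₁, R₁, hc₁, hR₁, hRfn₁, hRG₁⟩ := main V₁ le_rfl
  obtain ⟨V, c, l, k, hSV, hVV₁, hloc, hcon, hcs, hls, hks, hexp, hlc⟩ :=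
    SmAlg.exists_log_near_surface (σ := σ) hc₁ (hcG V₁ hV₁U) (fun i u hu => by
        rw [fn_coordsAlg _ _ hu]; exact hF.real _ u (hV₁U hu))
      (fun u hu w hw h => hF.injOn (hV₁U hu) (hV₁U hw) (funext fun a => by
        have := congrFun h (σ a)
        simp only [fn_coordsAlg _ _ hu, fn_coordsAlg _ _ hw, σ.symm_apply_apply] at this
        exact this))
      (fun u hu => by
        have := hR₁.2.map (SmAlg.bodyAt u hu)
        rw [SmAlg.bodyAt_apply] at this
        exact this.ne_zero) hRG₁
      (g := fun i => ∃ b, σ (.inr b) = i.1) (fun i => Iff.rfl) hon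
      fun s hs b => by rw [fn_cG b (hon hs)]; exact hs.2.1 b
  have hVU : (V : Set (Body (extParity p ε₁))) ⊆ U := fun u hu => hV₁U (hVV₁ hu)
  obtain ⟨hunit, K', R, hc, hR, hRfn, hRG⟩ := main V hVV₁
  have hRR : ∀ u ∈ V, R.fn u = R₁.fn u := fun u hu => by rw [hRfn u hu, hRfn₁ u (hVV₁ hu)]
  obtain ⟨h, hh, hhR, k', hk'⟩ := SmAlg.exists_log_sub_mem (σ := σ) hc (hcG V hVU) hR.1 hRG
    (g := fun i => ∃ b, σ (.inr b) = i.1) (fun i => Iff.rfl) hcs hls hks hloc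
    (fun u hu => by rw [hexp u hu, hRR u hu]) fun u hu => by
      rw [hlc u hu]
      refine Finset.sum_congr rfl fun i _ => ?_
      rw [fn_coordsAlg _ _ hu, fn_coordsAlg _ _ (hVV₁ hu)]
  set H : SmAlg (extParity p ε₁) V := (1 / Complex.I) •
    toSlice (hS V hVU) (hbarD W₁ none (smAction hXs)) with hH
  have hHfn : ∀ u ∈ V, H.fn u = oneLoop p ε₀ ε₁ X u := fun u hu => fn_oneLoop hu
  have hHm : H ∈ SmAlg.par (extParity p ε₁) V 0 := Submodule.smul_mem _ _ ((full V hVU).s_mem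
    (mem_parity_congr (((full V hVU).partB.der none).mem (full V hVU).X_mem) (zero_add _)))
  have hlm : (1 / 2 : ℂ) • h - H ∈ SmAlg.par (extParity p ε₁) V 0 :=
    sub_mem (Submodule.smul_mem _ _ hh) hHm
  -- With exp h = R and h - c = Σ G k', put ℓ = h/2 - 𝓗. Then exp 2ℓ = R e^{-2𝓗} is the radicand,
  -- and 𝓗 = h/2 - ℓ = c/2 - ℓ + Σ G k'/2.
  refine ⟨V, V.isOpen, hVU, hSV, hunit, fun u => (1 / 2 : ℂ) * c u, ((1 / 2 : ℂ) • h - H).fn,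
    fun α => ((1 / 2 : ℂ) • k' α).fn, fun u hu => (hloc u hu).mono fun v hv => by simp only [hv],
    fun hp => ?_, SmAlg.smooth _, hlm, fun α => SmAlg.smooth _, fun u hu => ?_, fun u hu => ?_⟩
  · obtain ⟨c₀, h₀⟩ := hcon hp
    exact ⟨1 / 2 * c₀, fun u hu => congrArg (1 / 2 * ·) (h₀ u hu)⟩
  · have h1 : (2 : ℂ) • ((1 / 2 : ℂ) • h - H) = h + -((2 : ℂ) • H) := by
      rw [smul_sub, smul_smul, sub_eq_add_neg]
      norm_num
    rw [← SmAlg.fn_smul hu, h1, ← SmAlg.fn_exp _ hu, SmAlg.exp_add hh, hhR, SmAlg.fn_mul hu,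
      hRfn u hu, ← hHfn u hu, ← SmAlg.fn_smul hu, ← SmAlg.fn_exp _ hu, mul_assoc,
      ← SmAlg.fn_mul hu, SmAlg.exp_mul_exp_neg (Submodule.smul_mem _ _ hHm), SmAlg.fn_one hu,
      mul_one]
  · have h1 := congrArg (fun f : SmAlg (extParity p ε₁) V => f.fn u) hk'
    simp only [SmAlg.fn_sub hu, SmAlg.fn_sum hu, SmAlg.fn_mul hu, SmAlg.fn_scal _ hu,
      fn_cG _ hu] at h1
    simp only [SmAlg.fn_sub hu, SmAlg.fn_smul hu, hHfn u hu, mul_smul_comm, ← Finset.smul_sum, ← h1,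
      map_mul]
    rw [smul_sub, Algebra.smul_def (1 / 2 : ℂ) (algebraMap ℂ _ (c u))]
    abel
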